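/- Let $\mathcal H(1,1)$ denote the moduli space of pairs $(M,\omega)$, where $M$ is a compact connected Riemann surface of genus $2$ and $\omega$ is a holomorphic $1$-form on $M$ with exactly two zeros, both simple, with its usual topology (given by local period coordinates). A torus cover is a holomorphic map $\pi\colon M\to\mathbb C/\Lambda$, with $\Lambda\subset\mathbb C$ a lattice, such that $\omega=\pi^*dz$. It is primitive if it does not factor through any other torus cover, that is, if whenever $\pi=q\circ\pi_1$ with a torus cover $\pi_1\colon M\to\mathbb C/\Lambda_1$ and an unbranched cover $q\colon\mathbb C/\Lambda_1\to\mathbb C/\Lambda$, the map $q$ has degree one. For $d\ge 2$ let $\mathcal P_d(1,1)\subset\mathcal H(1,1)$ be the set of those $(M,\omega)$ of area $1$ which admit a primitive torus cover of degree $d$. Then $\mathcal P_d(1,1)$ is non-empty and connected. The same holds for the corresponding space of triples $(M,\omega,z_1)$, with $(M,\omega)\in\mathcal P_d(1,1)$ and $z_1$ one of the two zeros of $\omega$ (that is, for primitive covers with labelled zeros $z_1,z_2$). -/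

import Mathlib

namespace TranslationSurface

/-- The signed area of the triangle `a b c`. -/
noncomputable def signedArea (a b c : ℂ) : ℝ :=
  ((starRingEnd ℂ) (b - a) * (c - a)).im / 2

/-- `n` oriented triangles in the plane together with a pairing of their sides.
The side `(i, k)` runs from `vert i k` to `vert i (k + 1)`. -/
structure GluedTriangles (n : ℕ) where
  /-- the side to which a given side is glued -/
  glue : Fin n × Fin 3 → Fin n × Fin 3
  /-- the vertices of the triangles -/
  vert : Fin n → Fin 3 → ℂ

namespace GluedTriangles

variable {n : ℕ}

/-- The topology in which the pairing is discrete and the vertices vary in the plane. -/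
noncomputable instance : TopologicalSpace (GluedTriangles n) :=
  TopologicalSpace.induced
    (fun S => ((S.glue, S.vert) : (Fin n × Fin 3 → Fin n × Fin 3) × (Fin n → Fin 3 → ℂ)))
    inferInstance

/-- The `i`-th (closed, filled) triangle. -/
def triangle (S : GluedTriangles n) (i : Fin n) : Set ℂ :=
  convexHull ℝ (Set.range (S.vert i))

/-- The disjoint union of the closed triangles. -/
def Points (S : GluedTriangles n) : Type :=
  {p : Fin n × ℂ // p.2 ∈ S.triangle p.1}

noncomputable instance (S : GluedTriangles n) : TopologicalSpace S.Points :=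
  inferInstanceAs (TopologicalSpace {p : Fin n × ℂ // p.2 ∈ S.triangle p.1})

/-- The planar coordinate of a point of one of the triangles. -/
def Points.coord {S : GluedTriangles n} (p : S.Points) : ℂ := p.1.2

/-- The point at parameter `t` of the side `e`, traversed in its direction. -/
noncomputable def sidePoint (S : GluedTriangles n) (e : Fin n × Fin 3) (t : ℝ) : ℂ :=
  (1 - t) * S.vert e.1 e.2 + t * S.vert e.1 (e.2 + 1)

/-- The elementary identifications: the side `e` is glued to the side `glue e`, with the direction
reversed. -/
def Glued (S : GluedTriangles n) (p q : S.Points) : Prop :=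
  ∃ e : Fin n × Fin 3, ∃ t ∈ Set.Icc (0 : ℝ) 1,
    p.1 = (e.1, S.sidePoint e t) ∧
    q.1 = ((S.glue e).1, S.sidePoint (S.glue e) (1 - t))

/-- The surface obtained from the triangles by gluing their sides (`Quot` is the quotient by the
equivalence relation generated by the elementary identifications, with the quotient topology). -/
def Surface (S : GluedTriangles n) : Type := Quot S.Glued

noncomputable instance (S : GluedTriangles n) : TopologicalSpace S.Surface :=
  inferInstanceAs (TopologicalSpace (Quot S.Glued))

/-- The projection of the disjoint union of the triangles to the surface. -/
def proj (S : GluedTriangles n) (p : S.Points) : S.Surface := Quot.mk _ p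

/-- The point of the surface given by the corner `c.2` of the triangle `c.1`. -/
def corner (S : GluedTriangles n) (c : Fin n × Fin 3) : S.Surface :=
  S.proj ⟨(c.1, S.vert c.1 c.2), subset_convexHull ℝ _ (Set.mem_range_self c.2)⟩

/-- The vertices of the surface. -/
def vertices (S : GluedTriangles n) : Set S.Surface := Set.range S.corner

open Classical in
/-- The total angle of the surface at a vertex: the sum of the angles of the triangles at the
corners that are identified with that vertex. -/
noncomputable def totalAngle (S : GluedTriangles n) (z : S.Surface) : ℝ :=
  ∑ c : Fin n × Fin 3,
    if S.corner c = z then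
      EuclideanGeometry.angle (S.vert c.1 (c.2 + 1)) (S.vert c.1 c.2) (S.vert c.1 (c.2 + 2))
    else 0

/-- The area of the surface. -/
noncomputable def area (S : GluedTriangles n) : ℝ :=
  ∑ i, signedArea (S.vert i 0) (S.vert i 1) (S.vert i 2)

/-- The triangles are nondegenerate and positively oriented, and their sides are glued in pairs by
translations, so that `dz` descends to an Abelian differential `ω` on the glued surface, which is
connected; there are exactly two vertices, and each of them has total angle `4π`, that is, each is
a simple zero of `ω`. -/
structure IsH11 (S : GluedTriangles n) : Prop where
  signedArea_pos : ∀ i, 0 < signedArea (S.vert i 0) (S.vert i 1) (S.vert i 2)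
  glue_glue : ∀ e, S.glue (S.glue e) = e
  parallel : ∀ e, S.vert (S.glue e).1 ((S.glue e).2 + 1) - S.vert (S.glue e).1 (S.glue e).2 =
    -(S.vert e.1 (e.2 + 1) - S.vert e.1 e.2)
  connected : ConnectedSpace S.Surface
  two_vertices : S.vertices.ncard = 2
  simple_zero : ∀ z ∈ S.vertices, S.totalAngle z = 4 * Real.pi

/-- `φ` satisfies `dφ = ω` on the open set `U`: read in the triangles, `φ` is locally the sum of the
planar coordinate and a constant. -/
def IsPrimitiveFunction (S : GluedTriangles n) (U : Set S.Surface) (φ : S.Surface → ℂ) : Prop :=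
  ∀ p : S.Points, S.proj p ∈ U →
    ∀ᶠ q in nhds p, φ (S.proj q) - q.coord = φ (S.proj p) - p.coord

/-- The homeomorphism `f` satisfies `f^* ω' = ω`, that is, it is an isomorphism
`(M, ω) → (M', ω')`: local primitives of `ω'` correspond under `f` to local primitives of `ω`. -/
def IsTranslationIso {m : ℕ} (S : GluedTriangles n) (S' : GluedTriangles m)
    (f : S.Surface ≃ₜ S'.Surface) : Prop :=
  ∀ (U : Set S'.Surface) (φ : S'.Surface → ℂ), IsOpen U →
    (S'.IsPrimitiveFunction U φ ↔ S.IsPrimitiveFunction (f ⁻¹' U) (φ ∘ f))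

theorem IsTranslationIso.refl (S : GluedTriangles n) :
    S.IsTranslationIso S (Homeomorph.refl _) := fun _ _ _ => Iff.rfl

theorem IsTranslationIso.symm {m : ℕ} {S : GluedTriangles n} {S' : GluedTriangles m}
    {f : S.Surface ≃ₜ S'.Surface} (h : S.IsTranslationIso S' f) :
    S'.IsTranslationIso S f.symm := by
  intro U φ hU
  have := h (f.symm ⁻¹' U) (φ ∘ f.symm) (hU.preimage f.symm.continuous)
  have e1 : f ⁻¹' (f.symm ⁻¹' U) = U := by ext x; simp
  have e2 : (φ ∘ f.symm) ∘ f = φ := by ext x; simp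
  rw [e1, e2] at this
  exact this.symm

theorem IsTranslationIso.trans {m k : ℕ} {S : GluedTriangles n} {S' : GluedTriangles m}
    {S'' : GluedTriangles k} {f : S.Surface ≃ₜ S'.Surface} {g : S'.Surface ≃ₜ S''.Surface}
    (h : S.IsTranslationIso S' f) (h' : S'.IsTranslationIso S'' g) :
    S.IsTranslationIso S'' (f.trans g) := by
  intro U φ hU
  exact (h' U φ hU).trans (h (g ⁻¹' U) (φ ∘ g) (hU.preimage g.continuous))

end GluedTriangles

open GluedTriangles

/-- A plane lattice: a discrete subgroup of `ℂ` of rank two. -/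
structure IsLattice (L : Submodule ℤ ℂ) : Prop where
  discrete : DiscreteTopology L
  span_top : Submodule.span ℝ (L : Set ℂ) = ⊤

/-- `π` is a holomorphic map from the surface to the torus `ℂ / L` such that `ω` is the pullback of
the standard differential `dz`: in each triangle, `π` is a translation modulo `L`. -/
def IsTorusCover {n : ℕ} (S : GluedTriangles n) (L : Submodule ℤ ℂ) (π : S.Surface → ℂ ⧸ L) :
    Prop :=
  IsLattice L ∧
    ∃ c : Fin n → ℂ, ∀ p : S.Points, π (S.proj p) = Submodule.Quotient.mk (p.coord + c p.1.1)

/-- `π` has degree `d`: every point of the torus that is not the image of a zero of `ω` has exactly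
`d` preimages. -/
def HasDegree {n : ℕ} {S : GluedTriangles n} {L : Submodule ℤ ℂ} (π : S.Surface → ℂ ⧸ L)
    (d : ℕ) : Prop :=
  ∀ y : ℂ ⧸ L, y ∉ π '' S.vertices → (π ⁻¹' {y}).Finite ∧ (π ⁻¹' {y}).ncard = d

/-- `π` is primitive: whenever `π = q ∘ π₁` with a torus cover `π₁` and an unbranched cover `q`
between tori, `q` has degree one. -/
def IsPrimitiveCover {n : ℕ} (S : GluedTriangles n) (L : Submodule ℤ ℂ) (π : S.Surface → ℂ ⧸ L) :
    Prop :=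
  IsTorusCover S L π ∧
    ∀ (L₁ : Submodule ℤ ℂ) (π₁ : S.Surface → ℂ ⧸ L₁) (q : ℂ ⧸ L₁ → ℂ ⧸ L),
      IsTorusCover S L₁ π₁ → IsCoveringMap q → π = q ∘ π₁ → Function.Injective q

/-- The surface has area one and is a primitive torus cover of degree `d`. -/
def IsPrimitiveTorusCover {n : ℕ} (S : GluedTriangles n) (d : ℕ) : Prop :=
  S.area = 1 ∧
    ∃ (L : Submodule ℤ ℂ) (π : S.Surface → ℂ ⧸ L), IsPrimitiveCover S L π ∧ HasDegree π d

/-- The surfaces of the stratum `H(1,1)` with a triangulation whose vertices are the two zeros.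
There are eight triangles because the angles add up to `4π + 4π`. -/
def TriangulatedH11 : Type := {S : GluedTriangles 8 // S.IsH11}

noncomputable instance : TopologicalSpace TriangulatedH11 :=
  inferInstanceAs (TopologicalSpace {S : GluedTriangles 8 // S.IsH11})

/-- Two triangulated surfaces are equivalent if the pairs `(M, ω)` are isomorphic. -/
instance isoSetoid : Setoid TriangulatedH11 where
  r S S' := ∃ f : S.1.Surface ≃ₜ S'.1.Surface, S.1.IsTranslationIso S'.1 f
  iseqv :=
    { refl := fun S => ⟨_, IsTranslationIso.refl S.1⟩
      symm := fun ⟨_, h⟩ => ⟨_, h.symm⟩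
      trans := fun ⟨_, h⟩ ⟨_, h'⟩ => ⟨_, h.trans h'⟩ }

/-- The stratum `H(1,1)`: the isomorphism classes of pairs `(M, ω)`, where `ω` has two simple
zeros. Since the sides of a triangulation are local period coordinates, the topology of the stratum
is the quotient topology. -/
def H11 : Type := Quotient isoSetoid

noncomputable instance : TopologicalSpace H11 := inferInstanceAs (TopologicalSpace (Quotient isoSetoid))

/-- The space of primitive torus covers of degree `d` and area one in `H(1,1)`. -/
def primitiveCovers (d : ℕ) : Set H11 :=
  {x | ∃ S : TriangulatedH11, IsPrimitiveTorusCover S.1 d ∧ Quotient.mk isoSetoid S = x}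

/-- Triangulated surfaces in `H(1,1)` with a first zero `z₁`, the one at a chosen corner; the
other zero is `z₂`. -/
def LabelledTriangulatedH11 : Type := TriangulatedH11 × (Fin 8 × Fin 3)

noncomputable instance : TopologicalSpace LabelledTriangulatedH11 :=
  inferInstanceAs (TopologicalSpace (TriangulatedH11 × (Fin 8 × Fin 3)))

/-- Equivalence by isomorphisms that respect the labels of the zeros. -/
instance labelledIsoSetoid : Setoid LabelledTriangulatedH11 where
  r S S' := ∃ f : S.1.1.Surface ≃ₜ S'.1.1.Surface, S.1.1.IsTranslationIso S'.1.1 f ∧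
    f (S.1.1.corner S.2) = S'.1.1.corner S'.2
  iseqv :=
    { refl := fun S => ⟨_, IsTranslationIso.refl S.1.1, rfl⟩
      symm := fun ⟨f, h, e⟩ => ⟨_, h.symm, (f.symm_apply_eq).2 e.symm⟩
      trans := fun ⟨_, h, e⟩ ⟨g, h', e'⟩ => ⟨_, h.trans h', (congrArg g e).trans e'⟩ }

/-- The stratum `H(1,1)` with labelled zeros `z₁`, `z₂`. -/
def LabelledH11 : Type := Quotient labelledIsoSetoid

noncomputable instance : TopologicalSpace LabelledH11 :=
  inferInstanceAs (TopologicalSpace (Quotient labelledIsoSetoid))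

/-- The space of primitive torus covers of degree `d` and area one with labelled zeros. -/
def labelledPrimitiveCovers (d : ℕ) : Set LabelledH11 :=
  {x | ∃ S : LabelledTriangulatedH11, IsPrimitiveTorusCover S.1.1 d ∧
    Quotient.mk labelledIsoSetoid S = x}

end TranslationSurface

/-! The normal forms are the surfaces that split into two tori: `ℂ / ⟨a, w⟩` and `ℂ / ⟨b, z⟩` are
slit along a common segment `c` and glued crosswise (`model`, with `w = c + e` and `z = c + f`).
Every primitive cover is joined to such a surface inside the space, and all of these are joined to
each other.

Reduction to split surfaces (`exists_linked_params`). Moving one zero changes relative periods only,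
so that the area, the torus covers and their lattices persist. Let `v₁, v₂` be a basis of the
lattice `L` of the cover. After a small displacement by `t v₂` the two zeros lie at different
heights over `v₁`, modulo the heights of `L`; hence every horizontal segment between zeros is a
loop. Flipping the highest sides lowers the triangulation, and since the heights lie in a discrete
set this ends with a horizontal side in every triangle (`exists_horizontal`). A zero of angle `4π`
carries two horizontal loops. Lengths, vertices and connectedness leave one possibility: three
horizontal cylinders, two of them with a single loop at the bottom and at the top, and a long one
with two loops at each end (`IsRowed.exists_rowPerm`). Cut suitably, the long cylinder becomes the
parallelograms with sides `a, c` and `b, c` of a split surface (`exists_model_of_rowPermGlue`).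

Joining the split surfaces. For fixed periods `(a, w, b, z)` the possible slits form a convex set.
Changes of diagonals give isomorphisms that change the basis of each torus, so that only the two
lattices matter (`Deformable.of_isBaseChange`, by the Euclidean algorithm). Another isomorphism
replaces `(a, w, b, z)` by `(a, w + b, b, z + a)` (`Deformable.twist`). A split surface is a
primitive cover of degree `d` and area one if the two lattices generate a lattice of covolume `1 /
d` and the areas add up to one (`IsGood`). The pairing `cross` between the two lattices has a Smith
normal form. One twist makes its first entry equal to `1 / d`, since a prime that divided the new
pairing would divide all pairings of periods (`IsGood.exists_unimodular`). A second twist shrinks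
the first torus to area `1 / d`; then the periods are `(u₁, u₂, u₂, -(d - 1) u₁)`
(`IsGood.exists_normal_form`), and these form one connected family because the oriented bases of
given covolume do (`linked_normalPeriods`).

Labels are carried along as a corner of the triangulation. The half-turn of a split surface
exchanges the zeros and replaces the parameters by their negatives, so that the chosen zero can be
taken to be the first one. The unlabelled space is the image of the labelled one.

Isomorphisms are produced combinatorially: a change of diagonal is a `Recut`, and its effect on
gluings and side vectors is followed in integral tables by decision. -/

open Set Filter Topology

/-! ### Determinants, and triangles in the plane. -/

namespace TranslationSurface

/-- The determinant of two plane vectors. -/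
def cross (z w : ℂ) : ℝ := z.re * w.im - z.im * w.re

theorem cross_add_left (x y z : ℂ) : cross (x + y) z = cross x z + cross y z := by
  simp [cross]; ring
theorem cross_add_right (x y z : ℂ) : cross x (y + z) = cross x y + cross x z := by
  simp [cross]; ring
theorem cross_sub_left (x y z : ℂ) : cross (x - y) z = cross x z - cross y z := by
  simp [cross]; ring
theorem cross_sub_right (x y z : ℂ) : cross x (y - z) = cross x y - cross x z := by
  simp [cross]; ring
theorem cross_neg_left (x y : ℂ) : cross (-x) y = -cross x y := by simp [cross]; ring
theorem cross_neg_right (x y : ℂ) : cross x (-y) = -cross x y := by simp [cross]; ring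
theorem cross_self (x : ℂ) : cross x x = 0 := by simp [cross]; ring
theorem cross_comm (x y : ℂ) : cross x y = -cross y x := by simp [cross]; ring
theorem cross_zero_left (x : ℂ) : cross 0 x = 0 := by simp [cross]
theorem cross_zero_right (x : ℂ) : cross x 0 = 0 := by simp [cross]
theorem cross_smul_left (t : ℝ) (x y : ℂ) : cross (t * x) y = t * cross x y := by
  simp [cross]; ring
theorem cross_smul_right (t : ℝ) (x y : ℂ) : cross x (t * y) = t * cross x y := by
  simp [cross]; ring

theorem continuous_cross : Continuous fun p : ℂ × ℂ => cross p.1 p.2 := by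
  unfold cross; fun_prop

theorem Continuous.cross {X : Type*} [TopologicalSpace X] {f g : X → ℂ} (hf : Continuous f)
    (hg : Continuous g) : Continuous fun x => cross (f x) (g x) :=
  continuous_cross.comp (hf.prodMk hg)

theorem signedArea_eq (a b c : ℂ) : signedArea a b c = cross (b - a) (c - a) / 2 := by
  simp [signedArea, TranslationSurface.cross]; ring

/-- Two vectors with nonzero determinant span the plane. -/
theorem eq_of_cross_ne_zero {u v : ℂ} (h : cross u v ≠ 0) (z : ℂ) :
    z = ((cross z v / cross u v : ℝ) : ℂ) * u + ((cross u z / cross u v : ℝ) : ℂ) * v := by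
  apply Complex.ext
  · simp only [Complex.add_re, Complex.re_ofReal_mul]
    field_simp
    simp [TranslationSurface.cross]; ring
  · simp only [Complex.add_im, Complex.im_ofReal_mul]
    field_simp
    simp [TranslationSurface.cross]; ring

theorem eq_and_eq_of_cross {u v : ℂ} (h : cross u v ≠ 0) {s t s' t' : ℝ}
    (he : (s : ℂ) * u + t * v = s' * u + t' * v) : s = s' ∧ t = t' := by
  have h1 := congrArg (fun z => cross z v) he
  have h2 := congrArg (fun z => cross u z) he
  simp only [cross_add_left, cross_add_right, cross_smul_left, cross_smul_right, cross_self,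
    mul_zero, add_zero, zero_add] at h1 h2
  exact ⟨mul_right_cancel₀ h h1, mul_right_cancel₀ h h2⟩

namespace GluedTriangles

variable {n : ℕ}

/-- The vector along a side. -/
def side (S : GluedTriangles n) (e : Fin n × Fin 3) : ℂ :=
  S.vert e.1 (e.2 + 1) - S.vert e.1 e.2

/-- Positively oriented triangles glued in pairs by translations. -/
structure Admissible (S : GluedTriangles n) : Prop where
  signedArea_pos : ∀ i, 0 < signedArea (S.vert i 0) (S.vert i 1) (S.vert i 2)
  glue_glue : ∀ e, S.glue (S.glue e) = e
  side_glue : ∀ e, S.side (S.glue e) = -S.side e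

theorem IsH11.admissible {S : GluedTriangles n} (h : S.IsH11) : S.Admissible :=
  ⟨h.signedArea_pos, h.glue_glue, h.parallel⟩

@[simp] theorem fin3_add_one_add_one (k : Fin 3) : k + 1 + 1 = k + 2 := by revert k; decide
@[simp] theorem fin3_add_one_add_two (k : Fin 3) : k + 1 + 2 = k := by revert k; decide
@[simp] theorem fin3_add_two_add_one (k : Fin 3) : k + 2 + 1 = k := by revert k; decide
@[simp] theorem fin3_add_two_add_two (k : Fin 3) : k + 2 + 2 = k + 1 := by revert k; decide

theorem side_add_side_add_side (S : GluedTriangles n) (i : Fin n) (k : Fin 3) :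
    S.side (i, k) + S.side (i, k + 1) + S.side (i, k + 2) = 0 := by
  simp only [side, fin3_add_one_add_one, fin3_add_two_add_one]; ring

theorem cross_side_side (S : GluedTriangles n) (i : Fin n) (k : Fin 3) :
    cross (S.side (i, k)) (S.side (i, k + 1)) =
      2 * signedArea (S.vert i 0) (S.vert i 1) (S.vert i 2) := by
  rw [signedArea_eq]
  fin_cases k <;> simp [side, TranslationSurface.cross] <;> ring

theorem Admissible.cross_pos {S : GluedTriangles n} (h : S.Admissible) (i : Fin n) (k : Fin 3) :
    0 < cross (S.side (i, k)) (S.side (i, k + 1)) := by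
  rw [cross_side_side]; have := h.signedArea_pos i; linarith

theorem Admissible.cross_pos' {S : GluedTriangles n} (h : S.Admissible) (i : Fin n) (k : Fin 3) :
    0 < cross (S.side (i, k)) (S.vert i (k + 2) - S.vert i k) := by
  have h1 := h.cross_pos i k
  have : S.vert i (k + 2) - S.vert i k = S.side (i, k) + S.side (i, k + 1) := by
    simp only [side, fin3_add_one_add_one]; ring
  rw [this, cross_add_right, cross_self]; linarith

theorem Admissible.side_ne_zero {S : GluedTriangles n} (h : S.Admissible) (e : Fin n × Fin 3) :
    S.side e ≠ 0 := by
  intro h0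
  have := h.cross_pos e.1 e.2
  rw [h0, cross_zero_left] at this
  exact lt_irrefl _ this

theorem fin3_cases (k j : Fin 3) : j = k ∨ j = k + 1 ∨ j = k + 2 := by
  revert k j; decide

/-- The barycentric coordinates start at an arbitrary corner `k`, so that later arguments need to
treat one side of a triangle only. -/
theorem mem_triangle_iff_weights (S : GluedTriangles n) (i : Fin n) (k : Fin 3) (p : ℂ) :
    p ∈ S.triangle i ↔ ∃ x y z : ℝ, 0 ≤ x ∧ 0 ≤ y ∧ 0 ≤ z ∧ x + y + z = 1 ∧
      p = x * S.vert i k + y * S.vert i (k + 1) + z * S.vert i (k + 2) := by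
  have hr : Set.range (S.vert i) = {S.vert i k, S.vert i (k + 1), S.vert i (k + 2)} := by
    ext q
    constructor
    · rintro ⟨j, rfl⟩
      rcases fin3_cases k j with rfl | rfl | rfl <;> simp
    · rintro (rfl | rfl | rfl) <;> exact Set.mem_range_self _
  rw [triangle, hr, convexHull_insert (by simp), convexHull_pair]
  simp only [convexJoin, Set.mem_singleton_iff, Set.iUnion_iUnion_eq_left, Set.mem_iUnion]
  constructor
  · rintro ⟨q, ⟨a, b, ha, hb, hab, rfl⟩, c, d, hc, hd, hcd, rfl⟩
    refine ⟨c, d * a, d * b, hc, by positivity, by positivity, ?_, ?_⟩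
    · rw [add_assoc, ← mul_add, hab, mul_one, hcd]
    · simp only [Complex.real_smul]; push_cast; ring
  · rintro ⟨x, y, z, hx, hy, hz, h, rfl⟩
    -- If the last two weights vanish they cannot be normalised; any point of the opposite side then
    -- serves, here the corner `k + 1` with weight zero.
    rcases eq_or_lt_of_le (add_nonneg hy hz) with h0 | h0
    · have hy0 : y = 0 := by linarith
      have hz0 : z = 0 := by linarith
      subst hy0 hz0
      exact ⟨S.vert i (k + 1), left_mem_segment ℝ _ _, 1, 0, by norm_num, le_rfl, by norm_num,
        by simp [show x = 1 by linarith]⟩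
    · refine ⟨_, ⟨y / (y + z), z / (y + z), by positivity, by positivity, by field_simp, rfl⟩,
        x, y + z, hx, h0.le, by linarith, ?_⟩
      have : (y + z : ℂ) ≠ 0 := by exact_mod_cast h0.ne'
      simp only [Complex.real_smul]; push_cast; field_simp; ring

/-- An affine functional that is nonnegative at the vertices is nonnegative on the triangle. -/
theorem cross_nonneg_of_mem {S : GluedTriangles n} {i : Fin n} {p : ℂ} (hp : p ∈ S.triangle i)
    (k : Fin 3) {u q : ℂ} (h0 : 0 ≤ cross u (S.vert i k - q))
    (h1 : 0 ≤ cross u (S.vert i (k + 1) - q)) (h2 : 0 ≤ cross u (S.vert i (k + 2) - q)) :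
    0 ≤ cross u (p - q) := by
  obtain ⟨x, y, z, hx, hy, hz, h, rfl⟩ := (S.mem_triangle_iff_weights i k p).1 hp
  have : (x * S.vert i k + y * S.vert i (k + 1) + z * S.vert i (k + 2) - q : ℂ) =
      x * (S.vert i k - q) + y * (S.vert i (k + 1) - q) + z * (S.vert i (k + 2) - q) := by
    have h' : (x + y + z : ℂ) = 1 := by exact_mod_cast h
    linear_combination q * h'
  rw [this, cross_add_right, cross_add_right, cross_smul_right, cross_smul_right, cross_smul_right]
  positivity

theorem vert_mem_triangle (S : GluedTriangles n) (i : Fin n) (k : Fin 3) :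
    S.vert i k ∈ S.triangle i := subset_convexHull ℝ _ (Set.mem_range_self k)

theorem Admissible.mem_triangle_iff {S : GluedTriangles n} (h : S.Admissible) (i : Fin n)
    (k : Fin 3) (p : ℂ) :
    p ∈ S.triangle i ↔ 0 ≤ cross (S.side (i, k)) (p - S.vert i k) ∧
      0 ≤ cross (S.side (i, k + 1)) (p - S.vert i (k + 1)) ∧
      0 ≤ cross (S.side (i, k + 2)) (p - S.vert i (k + 2)) := by
  have key : ∀ k : Fin 3, p ∈ S.triangle i → 0 ≤ cross (S.side (i, k)) (p - S.vert i k) := by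
    intro k hp
    refine cross_nonneg_of_mem hp k ?_ ?_ (h.cross_pos' i k).le
    · simp [cross_zero_right]
    · exact (cross_self _).ge
  refine ⟨fun hp => ⟨key _ hp, key _ hp, key _ hp⟩, ?_⟩
  rintro ⟨h0, h1, h2⟩
  rw [S.mem_triangle_iff_weights i k]
  have hD := h.cross_pos i k
  simp only [side, fin3_add_one_add_one, fin3_add_two_add_one] at h0 h1 h2 hD ⊢
  set A := S.vert i k
  set B := S.vert i (k + 1)
  set C := S.vert i (k + 2)
  set D := cross (B - A) (C - B) with hDdef
  -- The barycentric weights are the areas of the three triangles spanned by `p` and a side, divided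
  -- by the total area.
  refine ⟨cross (C - B) (p - B) / D, cross (A - C) (p - C) / D, cross (B - A) (p - A) / D,
    div_nonneg h1 hD.le, div_nonneg h2 hD.le, div_nonneg h0 hD.le, ?_, ?_⟩
  · field_simp; rw [hDdef]; simp [TranslationSurface.cross]; ring
  · apply Complex.ext
    · simp only [Complex.add_re, Complex.re_ofReal_mul]
      field_simp; rw [hDdef]; simp [TranslationSurface.cross]; ring
    · simp only [Complex.add_im, Complex.im_ofReal_mul]
      field_simp; rw [hDdef]; simp [TranslationSurface.cross]; ring

theorem sidePoint_eq (S : GluedTriangles n) (e : Fin n × Fin 3) (t : ℝ) :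
    S.sidePoint e t = S.vert e.1 e.2 + t * S.side e := by
  simp only [sidePoint, side]; ring

theorem sidePoint_zero (S : GluedTriangles n) (e : Fin n × Fin 3) :
    S.sidePoint e 0 = S.vert e.1 e.2 := by simp [sidePoint_eq]

theorem sidePoint_one (S : GluedTriangles n) (e : Fin n × Fin 3) :
    S.sidePoint e 1 = S.vert e.1 (e.2 + 1) := by simp [sidePoint]

theorem sidePoint_mem (S : GluedTriangles n) (e : Fin n × Fin 3) {t : ℝ} (ht : t ∈ Icc (0 : ℝ) 1) :
    S.sidePoint e t ∈ S.triangle e.1 := by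
  rw [S.mem_triangle_iff_weights e.1 e.2]
  exact ⟨1 - t, t, 0, by linarith [ht.2], ht.1, le_rfl, by ring, by simp [sidePoint]⟩

/-- A point of a triangle on the line through a side lies on the side. -/
theorem Admissible.exists_sidePoint {S : GluedTriangles n} (h : S.Admissible) {e : Fin n × Fin 3}
    {p : ℂ} (hp : p ∈ S.triangle e.1) (h0 : cross (S.side e) (p - S.vert e.1 e.2) = 0) :
    ∃ t ∈ Icc (0 : ℝ) 1, p = S.sidePoint e t := by
  obtain ⟨x, y, z, hx, hy, hz, hs, rfl⟩ := (S.mem_triangle_iff_weights e.1 e.2 p).1 hp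
  have hc := h.cross_pos' e.1 e.2
  have h' : (x + y + z : ℂ) = 1 := by exact_mod_cast hs
  have : (x * S.vert e.1 e.2 + y * S.vert e.1 (e.2 + 1) + z * S.vert e.1 (e.2 + 2) -
      S.vert e.1 e.2 : ℂ) = y * S.side e + z * (S.vert e.1 (e.2 + 2) - S.vert e.1 e.2) := by
    simp only [side]
    linear_combination (S.vert e.1 e.2) * h'
  rw [this, cross_add_right, cross_smul_right, cross_self, cross_smul_right, mul_zero,
    zero_add] at h0
  have hz0 : z = 0 := by
    rcases mul_eq_zero.1 h0 with h1 | h1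
    · exact h1
    · exact absurd h1 hc.ne'
  subst hz0
  refine ⟨y, ⟨hy, by linarith⟩, ?_⟩
  simp only [sidePoint]
  have : (x : ℂ) = 1 - y := by push_cast at h'; linear_combination h'
  rw [this]; simp

end GluedTriangles
end TranslationSurface

/-! ### Points of the glued surface: which are identified, and connectedness. -/

namespace TranslationSurface
namespace GluedTriangles

variable {n : ℕ}

/-- The point of the triangle `c.1` at its corner `c.2`. -/
def cornerPt (S : GluedTriangles n) (c : Fin n × Fin 3) : S.Points :=
  ⟨(c.1, S.vert c.1 c.2), S.vert_mem_triangle c.1 c.2⟩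

theorem proj_cornerPt (S : GluedTriangles n) (c : Fin n × Fin 3) :
    S.proj (S.cornerPt c) = S.corner c := rfl

/-- The point at parameter `t` of a side. -/
noncomputable def sidePt (S : GluedTriangles n) (e : Fin n × Fin 3) (t : Icc (0 : ℝ) 1) : S.Points :=
  ⟨(e.1, S.sidePoint e t), S.sidePoint_mem e t.2⟩

theorem proj_eq_of_glued {S : GluedTriangles n} {p q : S.Points} (h : S.Glued p q) :
    S.proj p = S.proj q := Quot.sound h

theorem proj_surjective (S : GluedTriangles n) : Function.Surjective S.proj := Quot.mk_surjective

theorem continuous_proj (S : GluedTriangles n) : Continuous S.proj := continuous_quot_mk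

theorem isQuotientMap_proj (S : GluedTriangles n) : IsQuotientMap S.proj := isQuotientMap_quot_mk

theorem Glued.symm {S : GluedTriangles n} (h : S.Admissible) {p q : S.Points} (hg : S.Glued p q) :
    S.Glued q p := by
  obtain ⟨e, t, ht, hp, hq⟩ := hg
  refine ⟨S.glue e, 1 - t, ⟨by linarith [ht.2], by linarith [ht.1]⟩, hq, ?_⟩
  rw [h.glue_glue, hp]; simp

theorem corner_glue (S : GluedTriangles n) (e : Fin n × Fin 3) :
    S.corner e = S.corner ((S.glue e).1, (S.glue e).2 + 1) := by
  apply proj_eq_of_glued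
  refine ⟨e, 0, by simp, ?_, ?_⟩
  · simp [sidePoint_zero]
  · simp [sidePoint_one]

/-- The height over one side is linear along the two others and vanishes only at the common corner.
Hence the interior of a side meets no other side. -/
theorem cross_sidePoint_add_one (S : GluedTriangles n) (i : Fin n) (k : Fin 3) (t : ℝ) :
    cross (S.side (i, k)) (S.sidePoint (i, k + 1) t - S.vert i k) =
      t * cross (S.side (i, k)) (S.side (i, k + 1)) := by
  have : S.sidePoint (i, k + 1) t - S.vert i k = S.side (i, k) + t * S.side (i, k + 1) := by
    simp only [sidePoint_eq, side]; ring
  rw [this, cross_add_right, cross_self, cross_smul_right, zero_add]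

theorem cross_sidePoint_add_two (S : GluedTriangles n) (i : Fin n) (k : Fin 3) (t : ℝ) :
    cross (S.side (i, k)) (S.sidePoint (i, k + 2) t - S.vert i k) =
      (1 - t) * cross (S.side (i, k)) (S.vert i (k + 2) - S.vert i k) := by
  have : S.sidePoint (i, k + 2) t - S.vert i k =
      ((1 - t : ℝ) : ℂ) * (S.vert i (k + 2) - S.vert i k) := by
    simp only [sidePoint_eq, side, fin3_add_two_add_one]; push_cast; ring
  rw [this, cross_smul_right]

namespace Admissible

variable {S : GluedTriangles n} (h : S.Admissible)
include h

theorem vert_injective (i : Fin n) : Function.Injective (S.vert i) := by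
  intro k k' hk
  rcases fin3_cases k k' with rfl | rfl | rfl
  · rfl
  · exact absurd (by simp [side, hk]) (h.side_ne_zero (i, k))
  · exact absurd (by simp [side, hk]) (h.side_ne_zero (i, k + 2))

theorem cornerPt_injective : Function.Injective S.cornerPt := by
  rintro ⟨i, k⟩ ⟨j, l⟩ hc
  have h1 := congrArg (fun p : S.Points => p.1) hc
  simp only [cornerPt, Prod.mk.injEq] at h1
  obtain ⟨rfl, h2⟩ := h1
  rw [h.vert_injective i h2]

theorem sidePoint_injective (e : Fin n × Fin 3) : Function.Injective (S.sidePoint e) := by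
  intro t t' ht
  simp only [sidePoint_eq, add_right_inj, mul_eq_mul_right_iff, h.side_ne_zero e, or_false] at ht
  exact_mod_cast ht

/-- The interior of a side is disjoint from the other sides. -/
theorem sidePoint_eq_iff {i : Fin n} {k k' : Fin 3} {t t' : ℝ} (ht : t ∈ Ioo (0 : ℝ) 1)
    (heq : S.sidePoint (i, k) t = S.sidePoint (i, k') t') : k' = k ∧ t' = t := by
  have h0 : cross (S.side (i, k)) (S.sidePoint (i, k) t - S.vert i k) = 0 := by
    rw [sidePoint_eq, add_sub_cancel_left, cross_smul_right, cross_self, mul_zero]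
  rcases fin3_cases k k' with rfl | rfl | rfl
  · exact ⟨rfl, (h.sidePoint_injective _ heq).symm⟩
  · exfalso
    rw [heq, S.cross_sidePoint_add_one] at h0
    have ht' : t' = 0 := (mul_eq_zero.1 h0).resolve_right (h.cross_pos i k).ne'
    subst ht'
    rw [sidePoint_zero] at heq
    have := h.sidePoint_injective (i, k) (heq.trans (S.sidePoint_one (i, k)).symm)
    linarith [ht.2]
  · exfalso
    rw [heq, S.cross_sidePoint_add_two] at h0
    have ht' : 1 - t' = 0 := (mul_eq_zero.1 h0).resolve_right (h.cross_pos' i k).ne'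
    have ht' : t' = 1 := by linarith
    subst ht'
    rw [sidePoint_one] at heq
    simp only [fin3_add_two_add_one] at heq
    have := h.sidePoint_injective (i, k) (heq.trans (S.sidePoint_zero (i, k)).symm)
    linarith [ht.1]

theorem sidePoint_ne_vert {i : Fin n} {k : Fin 3} {t : ℝ} (ht : t ∈ Ioo (0 : ℝ) 1) (k' : Fin 3) :
    S.sidePoint (i, k) t ≠ S.vert i k' := by
  intro heq
  have := h.sidePoint_eq_iff ht (heq.trans (S.sidePoint_zero (i, k')).symm)
  linarith [ht.1, this.2]

/-- Gluing exchanges the parameters `t` and `1 - t`, so corners are identified with corners and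
other points with other points. -/
theorem glued_cases {p q : S.Points} (hg : S.Glued p q) :
    (∃ c, p = S.cornerPt c ∧ q = S.cornerPt ((S.glue c).1, (S.glue c).2 + 1)) ∨
    (∃ c, p = S.cornerPt (c.1, c.2 + 1) ∧ q = S.cornerPt (S.glue c)) ∨
    ((∀ c, p ≠ S.cornerPt c) ∧ (∀ c, q ≠ S.cornerPt c)) := by
  obtain ⟨e, t, ht, hp, hq⟩ := hg
  rcases eq_or_lt_of_le ht.1 with h0 | h0
  · left
    subst h0
    exact ⟨e, Subtype.ext (by simp [hp, cornerPt, sidePoint_zero]),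
      Subtype.ext (by simp [hq, cornerPt, sidePoint_one])⟩
  rcases eq_or_lt_of_le ht.2 with h1 | h1
  · right; left
    subst h1
    exact ⟨e, Subtype.ext (by simp [hp, cornerPt, sidePoint_one]),
      Subtype.ext (by simp [hq, cornerPt, sidePoint_zero])⟩
  right; right
  constructor
  · rintro ⟨j, l⟩ rfl
    simp only [cornerPt, Prod.mk.injEq] at hp
    obtain ⟨rfl, h2⟩ := hp
    exact h.sidePoint_ne_vert (k := e.2) ⟨h0, h1⟩ l h2.symm
  · rintro ⟨j, l⟩ rfl
    simp only [cornerPt, Prod.mk.injEq] at hq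
    obtain ⟨h3, h2⟩ := hq
    subst h3
    exact h.sidePoint_ne_vert (k := (S.glue e).2) (t := 1 - t) ⟨by linarith, by linarith⟩ l h2.symm

/-- A function of the corners that is compatible with the gluing is a function of the vertices of
the surface. -/
theorem eq_of_corner_eq {α : Type*} (κ : Fin n × Fin 3 → α)
    (hκ : ∀ e, κ e = κ ((S.glue e).1, (S.glue e).2 + 1)) {c c' : Fin n × Fin 3}
    (hc : S.corner c = S.corner c') : κ c = κ c' := by
  classical
  -- Extended by `none` away from the corners, the function respects the elementary identifications
  -- and descends to the quotient; the generated equivalence relation need not be described.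
  let g : S.Points → Option α := fun p =>
    if hp : ∃ c, p = S.cornerPt c then some (κ hp.choose) else none
  have hg : ∀ c, g (S.cornerPt c) = some (κ c) := by
    intro c
    have hp : ∃ c', S.cornerPt c = S.cornerPt c' := ⟨c, rfl⟩
    simp only [g, dif_pos hp]
    rw [← h.cornerPt_injective hp.choose_spec]
  have hwd : ∀ p q, S.Glued p q → g p = g q := by
    intro p q hpq
    rcases h.glued_cases hpq with ⟨c, rfl, rfl⟩ | ⟨c, rfl, rfl⟩ | ⟨h1, h2⟩
    · rw [hg, hg, hκ]
    · rw [hg, hg, hκ (S.glue c), h.glue_glue]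
    · simp only [g]
      rw [dif_neg (by simpa using h1), dif_neg (by simpa using h2)]
  have := congrArg (Quot.lift g hwd) hc
  change g (S.cornerPt c) = g (S.cornerPt c') at this
  rw [hg, hg] at this
  exact Option.some.inj this

/-- Two distinct points of the triangles that are not corners are identified only if they are
glued. -/
theorem eq_or_glued_of_proj_eq {p q : S.Points} (hpq : S.proj p = S.proj q)
    (hp : ∀ c, p ≠ S.cornerPt c) : q = p ∨ S.Glued p q := by
  classical
  -- A point that is no corner is sent to its presumed class, a corner to the empty set. Once this
  -- is invariant under gluing, it descends to the quotient and shows that the presumed classes are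
  -- the true ones.
  let cls : S.Points → Set S.Points := fun p =>
    if ∃ c, p = S.cornerPt c then ∅ else {q | q = p ∨ S.Glued p q}
  -- A point inside a side lies on no other side, so that gluing twice leads back to the start.
  have huniq : ∀ {p q s : S.Points}, (∀ c, q ≠ S.cornerPt c) → S.Glued p q → S.Glued q s →
      s = p := by
    rintro p q s hnc hpq ⟨e', t', ht', hq', hs⟩
    obtain ⟨e, t, ht, hp, hq⟩ := hpq
    rw [hq, Prod.mk.injEq] at hq'
    obtain ⟨h1, h2⟩ := hq'
    have htt : 1 - t ∈ Ioo (0 : ℝ) 1 := by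
      rcases h.glued_cases (⟨e, t, ht, hp, hq⟩ : S.Glued p q) with ⟨c, h3, h4⟩ | ⟨c, h3, h4⟩ | h3
      · exact absurd h4 (hnc _)
      · exact absurd h4 (hnc _)
      · refine ⟨?_, ?_⟩
        · rcases eq_or_lt_of_le ht.2 with h5 | h5
          · subst h5
            exact absurd (Subtype.ext (by simp [hq, cornerPt, sidePoint_zero])) (hnc (S.glue e))
          · linarith
        · rcases eq_or_lt_of_le ht.1 with h5 | h5
          · subst h5
            exact absurd (Subtype.ext (by simp [hq, cornerPt, sidePoint_one]))
              (hnc ((S.glue e).1, (S.glue e).2 + 1))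
          · linarith
    obtain ⟨i', k'⟩ := e'
    simp only at h1
    subst h1
    obtain ⟨h5, h6⟩ := h.sidePoint_eq_iff (k := (S.glue e).2) htt h2
    subst h5
    apply Subtype.ext
    rw [hs, hp, h6]
    simp [h.glue_glue]
  have hwd : ∀ p q, S.Glued p q → cls p = cls q := by
    intro p q hpq
    rcases h.glued_cases hpq with ⟨c, rfl, rfl⟩ | ⟨c, rfl, rfl⟩ | ⟨h1, h2⟩
    · simp only [cls]; rw [if_pos ⟨_, rfl⟩, if_pos ⟨_, rfl⟩]
    · simp only [cls]; rw [if_pos ⟨_, rfl⟩, if_pos ⟨_, rfl⟩]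
    · simp only [cls]
      rw [if_neg (by simpa using h1), if_neg (by simpa using h2)]
      ext s
      constructor
      · rintro (rfl | hs)
        · exact Or.inr (hpq.symm h)
        · exact Or.inl (huniq h1 (hpq.symm h) hs)
      · rintro (rfl | hs)
        · exact Or.inr hpq
        · exact Or.inl (huniq h2 hpq hs)
  have := congrArg (Quot.lift cls hwd) hpq
  change cls p = cls q at this
  have hq : q ∈ cls p := by
    rw [this]
    by_cases hqc : ∃ c, q = S.cornerPt c
    · simp only [cls] at this
      rw [if_neg (by simpa using hp), if_pos hqc] at this
      have hpp : p ∈ {q | q = p ∨ S.Glued p q} := Or.inl rfl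
      rw [this] at hpp
      exact absurd hpp (Set.notMem_empty _)
    · simp only [cls]
      rw [if_neg hqc]; exact Or.inl rfl
  simp only [cls] at hq
  rw [if_neg (by simpa using hp)] at hq
  exact hq

end Admissible

theorem continuous_index (S : GluedTriangles n) : Continuous fun p : S.Points => p.1.1 :=
  continuous_fst.comp continuous_subtype_val

theorem continuous_coord (S : GluedTriangles n) : Continuous fun p : S.Points => p.coord :=
  continuous_snd.comp continuous_subtype_val

/-- If the surface is connected, a set of triangles that is closed under adjacency and not empty
consists of all triangles. -/
theorem forall_mem_of_connected (S : GluedTriangles n) [ConnectedSpace S.Surface] (P : Set (Fin n))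
    (hP : ∀ e, e.1 ∈ P ↔ (S.glue e).1 ∈ P) {i : Fin n} (hi : i ∈ P) (j : Fin n) : j ∈ P := by
  let g : S.Surface → Prop := Quot.lift (fun p : S.Points => p.1.1 ∈ P) (by
    rintro p q ⟨e, t, ht, hp, hq⟩
    simp only [hp, hq]
    exact propext (hP e))
  have hcl : IsClopen {x | g x} := by
    have hop : ∀ Q : Set (Fin n), IsOpen {p : S.Points | p.1.1 ∈ Q} := fun Q =>
      (isOpen_discrete Q).preimage S.continuous_index
    constructor
    · rw [← isOpen_compl_iff, ← (isQuotientMap_proj S).isOpen_preimage]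
      exact hop Pᶜ
    · rw [← (isQuotientMap_proj S).isOpen_preimage]
      exact hop P
  have huniv := hcl.eq_univ ⟨S.corner (i, 0), hi⟩
  have : S.corner (j, 0) ∈ {x | g x} := by rw [huniv]; trivial
  exact this

theorem isPreconnected_image_triangle (S : GluedTriangles n) (i : Fin n) :
    IsPreconnected (S.proj '' {p | p.1.1 = i}) := by
  apply IsPreconnected.image _ _ S.continuous_proj.continuousOn
  have : {p : S.Points | p.1.1 = i} =
      Set.range (fun z : S.triangle i => (⟨(i, z.1), z.2⟩ : S.Points)) := by
    ext p
    constructor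
    · rintro rfl
      exact ⟨⟨p.1.2, p.2⟩, rfl⟩
    · rintro ⟨z, rfl⟩; rfl
  rw [this]
  have : PreconnectedSpace (S.triangle i) :=
    isPreconnected_iff_preconnectedSpace.1 (convex_convexHull ℝ _).isPreconnected
  exact isPreconnected_range
    (Continuous.subtype_mk (continuous_const.prodMk continuous_subtype_val) _)

/-- The surface is connected if the adjacency graph of the triangles is. -/
theorem connectedSpace_of_forall (S : GluedTriangles n) (i₀ : Fin n)
    (H : ∀ P : Set (Fin n), i₀ ∈ P → (∀ e, e.1 ∈ P → (S.glue e).1 ∈ P) → ∀ j, j ∈ P) :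
    ConnectedSpace S.Surface := by
  let x₀ := S.corner (i₀, 0)
  have key : ∀ j, ∀ p : S.Points, p.1.1 = j → S.proj p ∈ connectedComponent x₀ := by
    apply H {j | ∀ p : S.Points, p.1.1 = j → S.proj p ∈ connectedComponent x₀}
    · intro p hp
      exact (S.isPreconnected_image_triangle i₀).subset_connectedComponent
        ⟨S.cornerPt (i₀, 0), rfl, rfl⟩ ⟨p, hp, rfl⟩
    · intro e he p hp
      have h1 : S.corner ((S.glue e).1, (S.glue e).2 + 1) ∈ connectedComponent x₀ := by
        rw [← corner_glue]; exact he _ rfl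
      rw [connectedComponent_eq h1]
      exact (S.isPreconnected_image_triangle (S.glue e).1).subset_connectedComponent
        ⟨S.cornerPt ((S.glue e).1, (S.glue e).2 + 1), rfl, rfl⟩ ⟨p, hp, rfl⟩
  refine connectedSpace_iff_connectedComponent.2 ⟨x₀, ?_⟩
  ext x
  obtain ⟨p, rfl⟩ := S.proj_surjective x
  simp [key _ p rfl]

end GluedTriangles
end TranslationSurface

/-! ### Isomorphisms given by cutting a surface into other triangles. -/

namespace TranslationSurface
namespace GluedTriangles

variable {n m k : ℕ}

theorem isCompact_triangle (S : GluedTriangles n) (i : Fin n) : IsCompact (S.triangle i) :=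
  (Set.finite_range _).isCompact_convexHull ℝ

instance compactSpace_points (S : GluedTriangles n) : CompactSpace S.Points := by
  have : IsCompact {p : Fin n × ℂ | p.2 ∈ S.triangle p.1} := by
    have h : {p : Fin n × ℂ | p.2 ∈ S.triangle p.1} = ⋃ i, ({i} : Set (Fin n)) ×ˢ S.triangle i := by
      ext ⟨i, p⟩; simp
    rw [h]
    exact isCompact_iUnion fun i => isCompact_singleton.prod (S.isCompact_triangle i)
  exact isCompact_iff_compactSpace.1 this

/-- Translation constants `c` of the triangles that are compatible with the gluing modulo `L`. -/
def Compatible (S : GluedTriangles n) (L : Submodule ℤ ℂ) (c : Fin n → ℂ) : Prop :=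
  ∀ e, (S.vert (S.glue e).1 ((S.glue e).2 + 1) + c (S.glue e).1) - (S.vert e.1 e.2 + c e.1) ∈ L

theorem compatible_of_proj {S : GluedTriangles n} {L : Submodule ℤ ℂ} {π : S.Surface → ℂ ⧸ L}
    {c : Fin n → ℂ} (h : ∀ p : S.Points, π (S.proj p) = Submodule.Quotient.mk (p.coord + c p.1.1)) :
    S.Compatible L c := by
  intro e
  have h1 := h (S.cornerPt e)
  have h2 := h (S.cornerPt ((S.glue e).1, (S.glue e).2 + 1))
  rw [proj_cornerPt] at h1 h2
  rw [S.corner_glue e, h2, Submodule.Quotient.eq] at h1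
  exact h1

/-- Compatibility is demanded at one end of each side only. Sides are glued by translations, so the
discrepancy is the same all along the side. -/
theorem Compatible.mk_eq {S : GluedTriangles n} (hS : S.Admissible) {L : Submodule ℤ ℂ}
    {c : Fin n → ℂ} (h : S.Compatible L c) {p q : S.Points} (hpq : S.Glued p q) :
    (Submodule.Quotient.mk (p.coord + c p.1.1) : ℂ ⧸ L) =
      Submodule.Quotient.mk (q.coord + c q.1.1) := by
  obtain ⟨e, t, ht, hp, hq⟩ := hpq
  rw [eq_comm, Submodule.Quotient.eq]
  have h1 := h e
  have hs := hS.side_glue e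
  simp only [Points.coord, hp, hq, sidePoint_eq]
  convert h1 using 1
  simp only [side] at hs ⊢
  push_cast
  linear_combination (-(t : ℂ)) * hs

/-- The torus cover given by compatible translation constants. -/
noncomputable def torusMap {S : GluedTriangles n} (hS : S.Admissible) {L : Submodule ℤ ℂ}
    {c : Fin n → ℂ} (h : S.Compatible L c) : S.Surface → ℂ ⧸ L :=
  Quot.lift (fun p => Submodule.Quotient.mk (p.coord + c p.1.1)) fun _ _ hpq => h.mk_eq hS hpq

theorem isTorusCover_torusMap {S : GluedTriangles n} (hS : S.Admissible) {L : Submodule ℤ ℂ}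
    (hL : IsLattice L) {c : Fin n → ℂ} (h : S.Compatible L c) :
    IsTorusCover S L (torusMap hS h) := ⟨hL, c, fun _ => rfl⟩

/-- Points of two surfaces correspond if they lie in overlapping triangles and differ by the
translation `τ`. -/
def Match (S : GluedTriangles n) (S' : GluedTriangles m) (A : Fin n → Fin m → Prop)
    (τ : Fin n → Fin m → ℂ) (p : S.Points) (p' : S'.Points) : Prop :=
  A p.1.1 p'.1.1 ∧ p'.coord = p.coord + τ p.1.1 p'.1.1

/-- The triangles of `S` are covered by translates of the triangles of `S'`, compatibly with the
gluings. -/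
structure Recut (S : GluedTriangles n) (S' : GluedTriangles m) (A : Fin n → Fin m → Prop)
    (τ : Fin n → Fin m → ℂ) : Prop where
  total : ∀ p : S.Points, ∃ p' : S'.Points, Match S S' A τ p p'
  proj_eq : ∀ (p q : S.Points) (p' q' : S'.Points), p = q ∨ S.Glued p q → Match S S' A τ p p' →
    Match S S' A τ q q' → S'.proj p' = S'.proj q'
  corner : ∀ c, ∃ c', Match S S' A τ (S.cornerPt c) (S'.cornerPt c')
  pull : ∀ (L : Submodule ℤ ℂ) (c' : Fin m → ℂ), S'.Compatible L c' →
    ∃ c : Fin n → ℂ, ∀ i i', A i i' → τ i i' + c' i' - c i ∈ L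

/-- A point on a cut matches several points, so no choice of a matching point is continuous. That
the relation is closed, together with compactness of the triangles, replaces continuity of a choice.
-/
theorem isClosed_match (S : GluedTriangles n) (S' : GluedTriangles m) (A : Fin n → Fin m → Prop)
    (τ : Fin n → Fin m → ℂ) :
    IsClosed {x : S.Points × S'.Points | Match S S' A τ x.1 x.2} := by
  have hi : Continuous fun x : S.Points × S'.Points => (x.1.1.1, x.2.1.1) :=
    (S.continuous_index.comp continuous_fst).prodMk (S'.continuous_index.comp continuous_snd)
  apply IsClosed.inter
  · exact (isClosed_discrete {y : Fin n × Fin m | A y.1 y.2}).preimage hi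
  · apply isClosed_eq
    · exact S'.continuous_coord.comp continuous_snd
    · exact (S.continuous_coord.comp continuous_fst).add
        ((continuous_of_discreteTopology (f := fun y : Fin n × Fin m => τ y.1 y.2)).comp hi)

namespace Recut

variable {S : GluedTriangles n} {S' : GluedTriangles m} {A : Fin n → Fin m → Prop}
  {τ : Fin n → Fin m → ℂ} (h : Recut S S' A τ)

/-- The map of surfaces given by a recutting. -/
noncomputable def map : S.Surface → S'.Surface :=
  Quot.lift (fun p => S'.proj (h.total p).choose) fun p q hpq =>
    h.proj_eq p q _ _ (Or.inr hpq) (h.total p).choose_spec (h.total q).choose_spec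

theorem map_proj {p : S.Points} {p' : S'.Points} (hp : Match S S' A τ p p') :
    h.map (S.proj p) = S'.proj p' :=
  h.proj_eq p p _ _ (Or.inl rfl) (h.total p).choose_spec hp

/-- The preimage of a closed set is the projection, along a compact space, of a closed set of
matching pairs. -/
theorem continuous_map : Continuous h.map := by
  rw [continuous_iff_isClosed]
  intro C hC
  rw [← (isQuotientMap_proj S).isClosed_preimage]
  have : S.proj ⁻¹' (h.map ⁻¹' C) =
      Prod.fst '' ({x : S.Points × S'.Points | Match S S' A τ x.1 x.2} ∩
        {x | S'.proj x.2 ∈ C}) := by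
    ext p
    constructor
    · intro hp
      obtain ⟨p', hp'⟩ := h.total p
      refine ⟨(p, p'), ⟨hp', ?_⟩, rfl⟩
      simpa [h.map_proj hp'] using hp
    · rintro ⟨⟨p, p'⟩, ⟨hp', hC'⟩, rfl⟩
      simpa [h.map_proj hp'] using hC'
  rw [this]
  exact isClosedMap_fst_of_compactSpace _ ((isClosed_match S S' A τ).inter
    (hC.preimage (S'.continuous_proj.comp continuous_snd)))

theorem isPrimitiveFunction_comp {U : Set S'.Surface} {φ : S'.Surface → ℂ}
    (hφ : S'.IsPrimitiveFunction U φ) : S.IsPrimitiveFunction (h.map ⁻¹' U) (φ ∘ h.map) := by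
  intro p hp
  -- The identity is proved for all points `q'` that match `q` at once. Near a `p'` that matches `p`
  -- it holds because `φ` is a local primitive, near any other `p'` nothing matches, and compactness
  -- gives one neighbourhood of `p`.
  have key : ∀ᶠ q in 𝓝 p, ∀ q' ∈ (univ : Set S'.Points), Match S S' A τ q q' →
      φ (S'.proj q') - q.coord = φ (h.map (S.proj p)) - p.coord := by
    apply isCompact_univ.eventually_forall_of_forall_eventually
    intro p' _
    by_cases hm : Match S S' A τ p p'
    · have hU : S'.proj p' ∈ U := by rw [← h.map_proj hm]; exact hp
      have h1 : ∀ᶠ z : S.Points × S'.Points in 𝓝 (p, p'),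
          φ (S'.proj z.2) - z.2.coord = φ (S'.proj p') - p'.coord :=
        (hφ p' hU).prod_inr_nhds p
      have h2 : ∀ᶠ z : S.Points × S'.Points in 𝓝 (p, p'), z.1.1.1 = p.1.1 :=
        (IsOpen.preimage (S.continuous_index.comp continuous_fst)
          (isOpen_discrete {p.1.1})).mem_nhds rfl
      have h3 : ∀ᶠ z : S.Points × S'.Points in 𝓝 (p, p'), z.2.1.1 = p'.1.1 :=
        (IsOpen.preimage (S'.continuous_index.comp continuous_snd)
          (isOpen_discrete {p'.1.1})).mem_nhds rfl
      filter_upwards [h1, h2, h3] with z hz1 hz2 hz3 hz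
      have e1 := hz.2
      have e2 := hm.2
      rw [hz2, hz3] at e1
      rw [h.map_proj hm]
      linear_combination hz1 + e1 - e2
    · have : ∀ᶠ z : S.Points × S'.Points in 𝓝 (p, p'), ¬ Match S S' A τ z.1 z.2 :=
        (isClosed_match S S' A τ).isOpen_compl.mem_nhds hm
      filter_upwards [this] with z hz hz'
      exact absurd hz' hz
  filter_upwards [key] with q hq
  obtain ⟨q', hq'⟩ := h.total q
  simp only [Function.comp, h.map_proj hq']
  exact hq q' (mem_univ _) hq'

theorem isTorusCover_comp {L : Submodule ℤ ℂ} {π : S'.Surface → ℂ ⧸ L}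
    (hπ : IsTorusCover S' L π) : IsTorusCover S L (π ∘ h.map) := by
  obtain ⟨hL, c', hc'⟩ := hπ
  obtain ⟨c, hc⟩ := h.pull L c' (compatible_of_proj hc')
  refine ⟨hL, c, fun p => ?_⟩
  obtain ⟨p', hp'⟩ := h.total p
  simp only [Function.comp, h.map_proj hp', hc', Submodule.Quotient.eq, hp'.2]
  convert hc _ _ hp'.1 using 1
  ring

theorem map_corner_mem (c : Fin n × Fin 3) : h.map (S.corner c) ∈ S'.vertices := by
  obtain ⟨c', hc'⟩ := h.corner c
  rw [← proj_cornerPt, h.map_proj hc']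
  exact ⟨c', rfl⟩

theorem map_map (h' : Recut S' S (fun i' i => A i i') (fun i' i => -τ i i')) (x : S.Surface) :
    h'.map (h.map x) = x := by
  obtain ⟨p, rfl⟩ := S.proj_surjective x
  obtain ⟨p', hp'⟩ := h.total p
  rw [h.map_proj hp']
  apply h'.map_proj
  exact ⟨hp'.1, by rw [hp'.2]; ring⟩

end Recut

/-- The surfaces `S` and `S'`, each with a chosen corner, are isomorphic; the isomorphism respects
vertices, the chosen corners, torus covers and the area. -/
def Equivalent (S : GluedTriangles n) (c : Fin n × Fin 3) (S' : GluedTriangles m)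
    (c' : Fin m × Fin 3) : Prop :=
  ∃ f : S.Surface ≃ₜ S'.Surface, S.IsTranslationIso S' f ∧ f (S.corner c) = S'.corner c' ∧
    (∀ x, f x ∈ S'.vertices ↔ x ∈ S.vertices) ∧
    (∀ L (π : S.Surface → ℂ ⧸ L), IsTorusCover S L π → IsTorusCover S' L (π ∘ f.symm)) ∧
    (∀ L (π : S'.Surface → ℂ ⧸ L), IsTorusCover S' L π → IsTorusCover S L (π ∘ f)) ∧
    S.area = S'.area

theorem Equivalent.refl (S : GluedTriangles n) (c : Fin n × Fin 3) : Equivalent S c S c :=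
  ⟨Homeomorph.refl _, IsTranslationIso.refl S, rfl, fun _ => Iff.rfl, fun _ _ h => h,
    fun _ _ h => h, rfl⟩

theorem Equivalent.symm {S : GluedTriangles n} {c : Fin n × Fin 3} {S' : GluedTriangles m}
    {c' : Fin m × Fin 3} (h : Equivalent S c S' c') : Equivalent S' c' S c := by
  obtain ⟨f, h1, h2, h3, h4, h5, h6⟩ := h
  refine ⟨f.symm, h1.symm, by simp [← h2], fun x => ?_, h5, h4, h6.symm⟩
  rw [← h3]; simp

theorem Equivalent.trans {S : GluedTriangles n} {c : Fin n × Fin 3} {S' : GluedTriangles m}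
    {c' : Fin m × Fin 3} {S'' : GluedTriangles k} {c'' : Fin k × Fin 3}
    (h : Equivalent S c S' c') (h' : Equivalent S' c' S'' c'') : Equivalent S c S'' c'' := by
  obtain ⟨f, h1, h2, h3, h4, h5, h6⟩ := h
  obtain ⟨g, g1, g2, g3, g4, g5, g6⟩ := h'
  exact ⟨f.trans g, h1.trans g1, by simp [h2, g2], fun x => (g3 _).trans (h3 x),
    fun L π hπ => g4 L _ (h4 L π hπ), fun L π hπ => h5 L _ (g5 L π hπ), h6.trans g6⟩

theorem Recut.equivalent {S : GluedTriangles n} {S' : GluedTriangles m} {A : Fin n → Fin m → Prop}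
    {τ : Fin n → Fin m → ℂ} (h : Recut S S' A τ)
    (h' : Recut S' S (fun i' i => A i i') (fun i' i => -τ i i'))
    {c : Fin n × Fin 3} {c' : Fin m × Fin 3} (hc : Match S S' A τ (S.cornerPt c) (S'.cornerPt c'))
    (harea : S.area = S'.area) : Equivalent S c S' c' := by
  have hinv : ∀ x, h.map (h'.map x) = x := by
    intro x
    obtain ⟨p, rfl⟩ := S'.proj_surjective x
    obtain ⟨p', hp'⟩ := h'.total p
    rw [h'.map_proj hp']
    apply h.map_proj
    exact ⟨hp'.1, by rw [hp'.2]; ring⟩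
  let f : S.Surface ≃ₜ S'.Surface :=
    { toFun := h.map
      invFun := h'.map
      left_inv := h.map_map h'
      right_inv := hinv
      continuous_toFun := h.continuous_map
      continuous_invFun := h'.continuous_map }
  refine ⟨f, ?_, h.map_proj hc, ?_, fun L π hπ => h'.isTorusCover_comp hπ,
    fun L π hπ => h.isTorusCover_comp hπ, harea⟩
  · intro U φ _
    refine ⟨fun hφ => h.isPrimitiveFunction_comp hφ, fun hφ => ?_⟩
    have := h'.isPrimitiveFunction_comp hφ
    have e1 : h'.map ⁻¹' (f ⁻¹' U) = U := by ext x; simp [f, hinv]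
    have e2 : (φ ∘ f) ∘ h'.map = φ := by ext x; simp [f, hinv]
    rwa [e1, e2] at this
  · intro x
    constructor
    · rintro ⟨d, hd⟩
      have : x = h'.map (S'.corner d) := by
        rw [hd]; exact (h.map_map h' x).symm
      rw [this]
      exact h'.map_corner_mem d
    · rintro ⟨d, rfl⟩
      exact h.map_corner_mem d

/-- Isomorphic surfaces have the same primitive torus covers. -/
theorem Equivalent.isPrimitiveTorusCover {S : GluedTriangles n} {c : Fin n × Fin 3}
    {S' : GluedTriangles m} {c' : Fin m × Fin 3} (h : Equivalent S c S' c') {d : ℕ}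
    (hS : IsPrimitiveTorusCover S d) : IsPrimitiveTorusCover S' d := by
  obtain ⟨f, h1, h2, h3, h4, h5, h6⟩ := h
  obtain ⟨ha, L, π, ⟨hπ, hp⟩, hd⟩ := hS
  refine ⟨h6 ▸ ha, L, π ∘ f.symm, ⟨h4 L π hπ, ?_⟩, ?_⟩
  · intro L₁ π₁ q hπ₁ hq he
    apply hp L₁ (π₁ ∘ f) q (h5 _ _ hπ₁) hq
    ext x
    have := congrFun he (f x)
    simpa using this
  · intro y hy
    have hy' : y ∉ π '' S.vertices := by
      rintro ⟨x, hx, rfl⟩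
      exact hy ⟨f x, (h3 x).2 hx, by simp⟩
    have hpre : (π ∘ f.symm) ⁻¹' {y} = f '' (π ⁻¹' {y}) := by
      rw [Homeomorph.image_eq_preimage_symm]; rfl
    obtain ⟨hf, hn⟩ := hd y hy'
    rw [hpre]
    exact ⟨hf.image f, by rw [Set.ncard_image_of_injective _ f.injective, hn]⟩

end GluedTriangles
end TranslationSurface

/-! ### Renumbering triangles, and the combinatorics of a change of diagonal. -/

namespace TranslationSurface
namespace GluedTriangles

variable {n : ℕ}

theorem Points.ext' {S : GluedTriangles n} {p q : S.Points} (h1 : p.1.1 = q.1.1)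
    (h2 : p.coord = q.coord) : p = q := Subtype.ext (Prod.ext h1 h2)

section relabel

variable {S S' : GluedTriangles n} {σ : Fin n × Fin 3 ≃ Fin n × Fin 3}

/-- The bijection of sides permutes the triangles and rotates each of them. -/
def IsRelabelling (σ : Fin n × Fin 3 ≃ Fin n × Fin 3) : Prop :=
  ∀ e, σ (e.1, e.2 + 1) = ((σ e).1, (σ e).2 + 1)

theorem IsRelabelling.apply_add (hσ : IsRelabelling σ) (i : Fin n) (k j : Fin 3) :
    σ (i, k + j) = ((σ (i, k)).1, (σ (i, k)).2 + j) := by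
  have h0 : j = 0 ∨ j = 1 ∨ j = 2 := by revert j; decide
  rcases h0 with rfl | rfl | rfl
  · simp
  · exact hσ (i, k)
  · have h1 := hσ (i, k)
    have h2 := hσ (i, k + 1)
    simp only [fin3_add_one_add_one] at h1 h2
    rw [h2, h1]
    simp

theorem IsRelabelling.fst_eq (hσ : IsRelabelling σ) (i : Fin n) (k k' : Fin 3) :
    (σ (i, k)).1 = (σ (i, k')).1 := by
  have := hσ.apply_add i k' (k - k')
  rw [add_sub_cancel] at this
  rw [this]

theorem IsRelabelling.symm (hσ : IsRelabelling σ) : IsRelabelling σ.symm := by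
  intro e
  rw [Equiv.symm_apply_eq]
  have := hσ (σ.symm e)
  simp only [Equiv.apply_symm_apply] at this
  exact this.symm

theorem recut_of_relabelling (hσ : IsRelabelling σ) (hglue : ∀ e, S'.glue (σ e) = σ (S.glue e))
    (T : Fin n → Fin n → ℂ)
    (hT : ∀ e, S'.vert (σ e).1 (σ e).2 = S.vert e.1 e.2 + T e.1 (σ e).1) :
    Recut S S' (fun i i' => ∃ k k', σ (i, k) = (i', k')) T := by
  have hA : ∀ i i', (∃ k k', σ (i, k) = (i', k')) → ∀ k, (σ (i, k)).1 = i' := by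
    rintro i i' ⟨k, k', h⟩ l
    rw [hσ.fst_eq i l k, h]
  have hmem : ∀ (i : Fin n) (p : ℂ), p ∈ S.triangle i →
      p + T i (σ (i, 0)).1 ∈ S'.triangle (σ (i, 0)).1 := by
    intro i p hp
    obtain ⟨x, y, z, hx, hy, hz, hs, rfl⟩ := (S.mem_triangle_iff_weights i 0 p).1 hp
    rw [S'.mem_triangle_iff_weights _ (σ (i, 0)).2]
    refine ⟨x, y, z, hx, hy, hz, hs, ?_⟩
    have h0 := hT (i, 0)
    have h1 := hT (i, 0 + 1)
    have h2 := hT (i, 0 + 2)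
    rw [hσ.apply_add] at h1 h2
    simp only at h0 h1 h2
    rw [h0, h1, h2]
    have h' : (x + y + z : ℂ) = 1 := by exact_mod_cast hs
    linear_combination (-T i (σ (i, 0)).1) * h'
  have hside : ∀ e t, S'.sidePoint (σ e) t = S.sidePoint e t + T e.1 (σ e).1 := by
    intro e t
    have h1 := hT (e.1, e.2 + 1)
    rw [hσ] at h1
    simp only at h1
    simp only [sidePoint, hT e, h1]
    ring
  have huniq : ∀ (p : S.Points) (p' q' : S'.Points),
      Match S S' (fun i i' => ∃ k k', σ (i, k) = (i', k')) T p p' →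
      Match S S' (fun i i' => ∃ k k', σ (i, k) = (i', k')) T p q' → p' = q' := by
    intro p p' q' hp hq
    have h1 : p'.1.1 = q'.1.1 := (hA _ _ hp.1 0).symm.trans (hA _ _ hq.1 0)
    refine Points.ext' h1 ?_
    rw [hp.2, hq.2, h1]
  refine ⟨?_, ?_, ?_, ?_⟩
  · rintro ⟨⟨i, p⟩, hp⟩
    exact ⟨⟨((σ (i, 0)).1, p + T i (σ (i, 0)).1), hmem i p hp⟩, ⟨0, (σ (i, 0)).2, rfl⟩, rfl⟩
  · rintro p q p' q' (rfl | ⟨e, t, ht, hp, hq⟩) hp' hq'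
    · rw [huniq p p' q' hp' hq']
    · apply proj_eq_of_glued
      refine ⟨σ e, t, ht, ?_, ?_⟩
      · have h1 : p'.1.1 = (σ e).1 := by
          rw [← hA _ _ hp'.1 e.2, hp]
        refine Prod.ext h1 ?_
        have := hp'.2
        rw [h1] at this
        simp only [Points.coord, hp] at this
        simp only [this, hside]
      · have h1 : q'.1.1 = (σ (S.glue e)).1 := by
          rw [← hA _ _ hq'.1 (S.glue e).2, hq]
        refine Prod.ext (by rw [h1, hglue]) ?_
        have := hq'.2
        rw [h1] at this
        simp only [Points.coord, hq] at this
        simp only [this, hglue, hside]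
  · intro c
    refine ⟨σ c, ⟨c.2, (σ c).2, rfl⟩, ?_⟩
    exact hT c
  · intro L c' _
    refine ⟨fun i => T i (σ (i, 0)).1 + c' (σ (i, 0)).1, fun i i' h => ?_⟩
    simp only [hA i i' h 0, sub_self]
    exact L.zero_mem

/-- Two surfaces whose side vectors and gluings correspond are isomorphic. -/
theorem equivalent_of_relabelling (hσ : IsRelabelling σ)
    (hglue : ∀ e, S'.glue (σ e) = σ (S.glue e)) (hside : ∀ e, S'.side (σ e) = S.side e)
    (c : Fin n × Fin 3) : Equivalent S c S' (σ c) := by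
  let T : Fin n → Fin n → ℂ := fun i _ => S'.vert (σ (i, 0)).1 (σ (i, 0)).2 - S.vert i 0
  have hT : ∀ e, S'.vert (σ e).1 (σ e).2 = S.vert e.1 e.2 + T e.1 (σ e).1 := by
    rintro ⟨i, k⟩
    have h0 : k = 0 ∨ k = 0 + 1 ∨ k = 0 + 2 := fin3_cases 0 k
    rcases h0 with rfl | rfl | rfl
    · simp [T]
    · have h1 := hside (i, 0)
      rw [hσ.apply_add]
      simp only [side, T] at h1 ⊢
      linear_combination h1
    · have h1 := hside (i, 0)
      have h2 := hside (i, 0 + 1)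
      rw [hσ.apply_add] at h2 ⊢
      simp only [side, T, fin3_add_one_add_one] at h1 h2 ⊢
      linear_combination h1 + h2
  have hT' : ∀ e, S.vert (σ.symm e).1 (σ.symm e).2 =
      S'.vert e.1 e.2 + (fun i' i => -T i i') e.1 (σ.symm e).1 := by
    intro e
    have := hT (σ.symm e)
    simp only [Equiv.apply_symm_apply] at this ⊢
    rw [this]; ring
  have hglue' : ∀ e, S.glue (σ.symm e) = σ.symm (S'.glue e) := by
    intro e
    rw [Equiv.eq_symm_apply, ← hglue, Equiv.apply_symm_apply]
  have h1 := recut_of_relabelling hσ hglue T hT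
  have h2 := recut_of_relabelling hσ.symm hglue' (fun i' i => -T i i') hT'
  have hA : (fun i i' => ∃ k k', σ.symm (i, k) = (i', k')) =
      fun i' i => (fun i i' => ∃ k k', σ (i, k) = (i', k')) i i' := by
    funext i' i
    apply propext
    constructor
    · rintro ⟨k, k', h⟩
      exact ⟨k', k, by rw [← h, Equiv.apply_symm_apply]⟩
    · rintro ⟨k, k', h⟩
      exact ⟨k', k, by rw [← h, Equiv.symm_apply_apply]⟩
  rw [hA] at h2
  refine h1.equivalent h2 ⟨⟨c.2, (σ c).2, rfl⟩, hT c⟩ ?_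
  have hsum : ∀ i, signedArea (S.vert i 0) (S.vert i 1) (S.vert i 2) =
      signedArea (S'.vert (σ (i, 0)).1 0) (S'.vert (σ (i, 0)).1 1) (S'.vert (σ (i, 0)).1 2) := by
    intro i
    have e1 := S.cross_side_side i 0
    have e2 := S'.cross_side_side (σ (i, 0)).1 (σ (i, 0)).2
    have e3 := hside (i, 0 + 1)
    rw [hσ.apply_add] at e3
    rw [e3, hside (i, 0), e1] at e2
    linarith
  simp only [area, hsum]
  refine Fintype.sum_equiv
    { toFun := fun i => (σ (i, 0)).1
      invFun := fun i => (σ.symm (i, 0)).1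
      left_inv := fun i => ?_
      right_inv := fun i => ?_ } _ _ fun i => rfl
  · have := hσ.symm.fst_eq (σ (i, 0)).1 0 (σ (i, 0)).2
    simpa using this
  · have := hσ.fst_eq (σ.symm (i, 0)).1 0 (σ.symm (i, 0)).2
    simpa using this

theorem Admissible.of_relabelling (hS : S.Admissible) (hσ : IsRelabelling σ)
    (hglue : ∀ e, S'.glue (σ e) = σ (S.glue e)) (hside : ∀ e, S'.side (σ e) = S.side e) :
    S'.Admissible := by
  refine ⟨fun i => ?_, fun e => ?_, fun e => ?_⟩
  · obtain ⟨⟨j, k⟩, hj⟩ := σ.surjective (i, 0)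
    have e2 := S'.cross_side_side i 0
    have e3 := hσ (j, k)
    rw [hj] at e3
    simp only at e3
    have := hS.cross_pos j k
    rw [← e3, ← hj, hside, hside] at e2
    linarith
  · obtain ⟨e, rfl⟩ := σ.surjective e
    rw [hglue, hglue, hS.glue_glue]
  · obtain ⟨e, rfl⟩ := σ.surjective e
    rw [hglue, hside, hside, hS.side_glue]

end relabel

section flip

/-- The point `z` lies in the positively oriented triangle `A B C`. -/
def InTriangle (A B C z : ℂ) : Prop :=
  0 ≤ cross (B - A) (z - A) ∧ 0 ≤ cross (C - B) (z - B) ∧ 0 ≤ cross (A - C) (z - C)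

theorem Admissible.mem_triangle_iff_inTriangle {S : GluedTriangles n} (h : S.Admissible)
    (i : Fin n) (k : Fin 3) (z x : ℂ) :
    z - x ∈ S.triangle i ↔
      InTriangle (x + S.vert i k) (x + S.vert i (k + 1)) (x + S.vert i (k + 2)) z := by
  rw [h.mem_triangle_iff i k]
  simp only [side, InTriangle, fin3_add_one_add_one, fin3_add_two_add_one]
  have e : ∀ a b c : ℂ, cross (a - b) (z - x - c) = cross (x + a - (x + b)) (z - (x + c)) := by
    intro a b c; congr 1 <;> ring
  simp only [e]

/-- `P Q` and `R T` are the diagonals of a convex quadrilateral, and a point of the half `P Q R`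
lies on one of the sides of `R T`. The inequalities for the new outer sides `P T` and `T Q` are
positive combinations of known ones, by `key` and `key2`. -/
theorem inTriangle_flip {P Q R T z : ℂ} (hD : 0 < cross (Q - P) (R - P))
    (hPQT : 0 < cross (T - P) (Q - P)) (hTR : 0 < cross (T - P) (R - P))
    (hTQ : 0 < cross (Q - T) (R - T)) (hz : InTriangle P Q R z) :
    InTriangle T R P z ∨ InTriangle R T Q z := by
  obtain ⟨h1, h2, h3⟩ := hz
  have key : cross (Q - P) (R - P) * cross (T - P) (z - P) =
      cross (P - R) (z - R) * cross (T - P) (Q - P) + cross (Q - P) (z - P) * cross (T - P) (R - P) := by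
    simp [TranslationSurface.cross]; ring
  have key2 : cross (Q - P) (R - P) * cross (Q - T) (z - T) =
      cross (Q - P) (z - P) * cross (Q - T) (R - T) +
        cross (R - Q) (z - Q) * cross (T - P) (Q - P) := by
    simp [TranslationSurface.cross]; ring
  have a1 : 0 ≤ cross (T - P) (z - P) := by
    by_contra hlt
    push Not at hlt
    nlinarith [mul_nonneg h3 hPQT.le, mul_nonneg h1 hTR.le]
  have a2 : 0 ≤ cross (Q - T) (z - T) := by
    by_contra hlt
    push Not at hlt
    nlinarith [mul_nonneg h1 hTQ.le, mul_nonneg h2 hPQT.le]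
  have e : cross (T - R) (z - R) = -cross (R - T) (z - T) := by
    simp [TranslationSurface.cross]; ring
  rcases le_total 0 (cross (R - T) (z - T)) with h | h
  · exact Or.inl ⟨h, h3, a1⟩
  · exact Or.inr ⟨by linarith, a2, h2⟩

variable {i j i' j' : Fin n} {k l k' l' : Fin 3}

/-- The correspondence of the outer sides of a quadrilateral under a change of its diagonal. -/
def flipSide (i j : Fin n) (k l : Fin 3) (i' j' : Fin n) (k' l' : Fin 3) (e : Fin n × Fin 3) :
    Fin n × Fin 3 :=
  if e = (i, k + 1) then (j', l' + 2) else if e = (i, k + 2) then (i', k' + 1)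
  else if e = (j, l + 1) then (i', k' + 2) else if e = (j, l + 2) then (j', l' + 1) else e

theorem flipSide_one : flipSide i j k l i' j' k' l' (i, k + 1) = (j', l' + 2) := by simp [flipSide]

theorem flipSide_two : flipSide i j k l i' j' k' l' (i, k + 2) = (i', k' + 1) := by simp [flipSide]

theorem flipSide_three (h : i ≠ j) : flipSide i j k l i' j' k' l' (j, l + 1) = (i', k' + 2) := by
  simp [flipSide, h.symm]

theorem flipSide_four (h : i ≠ j) : flipSide i j k l i' j' k' l' (j, l + 2) = (j', l' + 1) := by
  simp [flipSide, h.symm]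

theorem flipSide_of_ne {e : Fin n × Fin 3} (h1 : e.1 ≠ i) (h2 : e.1 ≠ j) :
    flipSide i j k l i' j' k' l' e = e := by
  obtain ⟨a, b⟩ := e
  simp only at h1 h2
  simp [flipSide, h1, h2]

theorem flipSide_diag (h : i ≠ j) : flipSide i j k l i' j' k' l' (i, k) = (i, k) := by
  simp [flipSide, h]

theorem flipSide_diag' (h : i ≠ j) : flipSide i j k l i' j' k' l' (j, l) = (j, l) := by
  simp [flipSide, h.symm]

/-- Case distinction for a side: it is one of the six sides of two given triangles, or another. -/
theorem side_cases (i j : Fin n) (k l : Fin 3) (e : Fin n × Fin 3) :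
    e = (i, k) ∨ e = (i, k + 1) ∨ e = (i, k + 2) ∨ e = (j, l) ∨ e = (j, l + 1) ∨ e = (j, l + 2) ∨
      (e.1 ≠ i ∧ e.1 ≠ j) := by
  obtain ⟨a, b⟩ := e
  by_cases h1 : a = i
  · subst h1
    rcases fin3_cases k b with rfl | rfl | rfl <;> simp
  by_cases h2 : a = j
  · subst h2
    rcases fin3_cases l b with rfl | rfl | rfl <;> simp
  simp [h1, h2]

theorem flipSide_flipSide (hij : i ≠ j) (hs : (i' = i ∧ j' = j) ∨ (i' = j ∧ j' = i))
    {e : Fin n × Fin 3} (h1 : e ≠ (i, k)) (h2 : e ≠ (j, l)) :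
    flipSide i' j' k' l' j i l k (flipSide i j k l i' j' k' l' e) = e := by
  have hij' : i' ≠ j' := by rcases hs with ⟨rfl, rfl⟩ | ⟨rfl, rfl⟩; exacts [hij, hij.symm]
  rcases side_cases i j k l e with rfl | rfl | rfl | rfl | rfl | rfl | ⟨h3, h4⟩
  · exact absurd rfl h1
  · rw [flipSide_one, flipSide_four hij']
  · rw [flipSide_two, flipSide_one]
  · exact absurd rfl h2
  · rw [flipSide_three hij, flipSide_two]
  · rw [flipSide_four hij, flipSide_three hij']
  · rw [flipSide_of_ne h3 h4, flipSide_of_ne]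
    · rcases hs with ⟨rfl, rfl⟩ | ⟨rfl, rfl⟩ <;> assumption
    · rcases hs with ⟨rfl, rfl⟩ | ⟨rfl, rfl⟩ <;> assumption

/-- The surfaces differ by a change of the diagonal in a quadrilateral that consists of two
triangles; `x` and `x'` are translations that move the triangles into place. -/
structure FlipRel (S S' : GluedTriangles n) (i j : Fin n) (k l : Fin 3) (i' j' : Fin n)
    (k' l' : Fin 3) (x x' : Fin n → ℂ) : Prop where
  ne : i ≠ j
  same : (i' = i ∧ j' = j) ∨ (i' = j ∧ j' = i)
  glue_diag : S.glue (i, k) = (j, l)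
  glue_diag' : S'.glue (i', k') = (j', l')
  eqP : x j + S.vert j (l + 1) = x i + S.vert i k
  eqQ : x j + S.vert j l = x i + S.vert i (k + 1)
  eq1 : x' i' + S'.vert i' k' = x j + S.vert j (l + 2)
  eq2 : x' i' + S'.vert i' (k' + 1) = x i + S.vert i (k + 2)
  eq3 : x' i' + S'.vert i' (k' + 2) = x i + S.vert i k
  eq4 : x' j' + S'.vert j' l' = x i + S.vert i (k + 2)
  eq5 : x' j' + S'.vert j' (l' + 1) = x j + S.vert j (l + 2)
  eq6 : x' j' + S'.vert j' (l' + 2) = x i + S.vert i (k + 1)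
  other : ∀ a, a ≠ i → a ≠ j → ∀ b, x' a + S'.vert a b = x a + S.vert a b
  glue_outer : ∀ e, e ≠ (i, k) → e ≠ (j, l) →
    S'.glue (flipSide i j k l i' j' k' l' e) = flipSide i j k l i' j' k' l' (S.glue e)

end flip
end GluedTriangles
end TranslationSurface

/-! ### A change of diagonal does not change the surface. -/

namespace TranslationSurface
namespace GluedTriangles

variable {n : ℕ} {i j i' j' : Fin n} {k l k' l' : Fin 3}

theorem fin3_add_one_ne (k : Fin 3) : k + 1 ≠ k := by revert k; decide
theorem fin3_add_two_ne (k : Fin 3) : k + 2 ≠ k := by revert k; decide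

theorem flipSide_swap (hij : i ≠ j) {e : Fin n × Fin 3} (h1 : e ≠ (i, k)) (h2 : e ≠ (j, l)) :
    flipSide j i l k j' i' l' k' e = flipSide i j k l i' j' k' l' e := by
  rcases side_cases i j k l e with rfl | rfl | rfl | rfl | rfl | rfl | ⟨h3, h4⟩
  · exact absurd rfl h1
  · rw [flipSide_one, flipSide_three hij.symm]
  · rw [flipSide_two, flipSide_four hij.symm]
  · exact absurd rfl h2
  · rw [flipSide_one, flipSide_three hij]
  · rw [flipSide_two, flipSide_four hij]
  · rw [flipSide_of_ne h3 h4, flipSide_of_ne h4 h3]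

theorem flipSide_ne (hij : i ≠ j) (hs : (i' = i ∧ j' = j) ∨ (i' = j ∧ j' = i))
    {e : Fin n × Fin 3} (h1 : e ≠ (i, k)) (h2 : e ≠ (j, l)) :
    flipSide i j k l i' j' k' l' e ≠ (i', k') ∧ flipSide i j k l i' j' k' l' e ≠ (j', l') := by
  have hij' : i' ≠ j' := by rcases hs with ⟨rfl, rfl⟩ | ⟨rfl, rfl⟩; exacts [hij, hij.symm]
  have a1 := fin3_add_one_ne
  have a2 := fin3_add_two_ne
  rcases side_cases i j k l e with rfl | rfl | rfl | rfl | rfl | rfl | ⟨h3, h4⟩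
  · exact absurd rfl h1
  · rw [flipSide_one]; simp [hij'.symm]
  · rw [flipSide_two]; simp [hij']
  · exact absurd rfl h2
  · rw [flipSide_three hij]; simp [hij']
  · rw [flipSide_four hij]; simp [hij'.symm]
  · rw [flipSide_of_ne h3 h4]
    constructor
    · rintro rfl
      rcases hs with ⟨rfl, rfl⟩ | ⟨rfl, rfl⟩ <;> contradiction
    · rintro rfl
      rcases hs with ⟨rfl, rfl⟩ | ⟨rfl, rfl⟩ <;> contradiction

namespace FlipRel

variable {S S' : GluedTriangles n} {x x' : Fin n → ℂ}

theorem ne' (h : FlipRel S S' i j k l i' j' k' l' x x') : i' ≠ j' := by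
  rcases h.same with ⟨rfl, rfl⟩ | ⟨rfl, rfl⟩
  exacts [h.ne, h.ne.symm]

theorem glue_ne (h : FlipRel S S' i j k l i' j' k' l' x x') (hS : S.Admissible)
    {e : Fin n × Fin 3} (h1 : e ≠ (i, k)) (h2 : e ≠ (j, l)) :
    S.glue e ≠ (i, k) ∧ S.glue e ≠ (j, l) := by
  constructor
  · intro h3; apply h2; rw [← hS.glue_glue e, h3, h.glue_diag]
  · intro h4; apply h1; rw [← hS.glue_glue e, h4, ← h.glue_diag, hS.glue_glue]

/-- Exchange of the two triangles. -/
theorem swap (h : FlipRel S S' i j k l i' j' k' l' x x') (hS : S.Admissible)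
    (hS' : S'.Admissible) : FlipRel S S' j i l k j' i' l' k' x x' := by
  refine ⟨h.ne.symm, ?_, ?_, ?_, h.eqQ.symm, h.eqP.symm, h.eq4, h.eq5, h.eq6.trans h.eqQ.symm, h.eq1,
    h.eq2, h.eq3.trans h.eqP.symm, fun a h1 h2 => h.other a h2 h1, ?_⟩
  · rcases h.same with ⟨rfl, rfl⟩ | ⟨rfl, rfl⟩ <;> simp
  · rw [← h.glue_diag, hS.glue_glue]
  · rw [← h.glue_diag', hS'.glue_glue]
  · intro e h1 h2
    obtain ⟨h3, h4⟩ := h.glue_ne hS h2 h1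
    rw [flipSide_swap h.ne h2 h1, flipSide_swap h.ne h3 h4, h.glue_outer e h2 h1]

/-- Changing the diagonal back. -/
theorem symm (h : FlipRel S S' i j k l i' j' k' l' x x') (hS : S.Admissible) :
    FlipRel S' S i' j' k' l' j i l k x' x := by
  have hs' : (j = i' ∧ i = j') ∨ (j = j' ∧ i = i') := by
    rcases h.same with ⟨rfl, rfl⟩ | ⟨rfl, rfl⟩ <;> simp
  refine ⟨h.ne', hs', h.glue_diag', ?_, ?_, ?_, ?_, ?_, ?_, ?_, ?_, ?_, ?_, ?_⟩
  · rw [← h.glue_diag, hS.glue_glue]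
  · rw [h.eq5, h.eq1]
  · rw [h.eq4, h.eq2]
  · rw [h.eq6, h.eqQ]
  · rw [h.eq3, h.eqP]
  · rw [h.eq1]
  · rw [h.eq3]
  · rw [h.eq6]
  · rw [h.eq2]
  · intro a h1 h2 b
    rw [h.other]
    · rcases h.same with ⟨rfl, rfl⟩ | ⟨rfl, rfl⟩ <;> assumption
    · rcases h.same with ⟨rfl, rfl⟩ | ⟨rfl, rfl⟩ <;> assumption
  · intro e h1 h2
    have hinv := flipSide_flipSide (k := k') (l := l') (k' := l) (l' := k) h.ne' hs' h1 h2
    obtain ⟨hd2, hd1⟩ := flipSide_ne (k := k') (l := l') (k' := l) (l' := k) h.ne' hs' h1 h2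
    rw [flipSide_swap h.ne hd1 hd2] at hinv
    have h3 := h.glue_outer _ hd1 hd2
    rw [hinv] at h3
    obtain ⟨h4, h5⟩ := h.glue_ne hS hd1 hd2
    rw [h3, flipSide_flipSide h.ne h.same h4 h5]

/-- The triangles of the quadrilateral correspond to each other, and so does every other triangle
to itself. -/
def Rel (i j : Fin n) (a a' : Fin n) : Prop :=
  (a = a' ∧ a ≠ i ∧ a ≠ j) ∨ ((a = i ∨ a = j) ∧ (a' = i ∨ a' = j))

variable (h : FlipRel S S' i j k l i' j' k' l' x x') (hS : S.Admissible) (hS' : S'.Admissible)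
include h

theorem eq_or (a : Fin n) : (a = i ∨ a = j) ↔ (a = i' ∨ a = j') := by
  rcases h.same with ⟨rfl, rfl⟩ | ⟨rfl, rfl⟩
  · rfl
  · exact or_comm

include hS hS'

theorem exists_mem {a : Fin n} {p : ℂ} (hp : p ∈ S.triangle a) (ha : a = i ∨ a = j) :
    ∃ a', (a' = i ∨ a' = j) ∧ p + x a - x' a' ∈ S'.triangle a' := by
  wlog hai : a = i generalizing i j k l i' j' k' l'
  · obtain ⟨a', h1, h2⟩ := this (h.swap hS hS') ha.symm (ha.resolve_left hai)
    exact ⟨a', h1.symm, h2⟩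
  subst hai
  have hi' : i' = a ∨ i' = j := by rcases h.same with ⟨rfl, rfl⟩ | ⟨rfl, rfl⟩ <;> simp
  have hj' : j' = a ∨ j' = j := by rcases h.same with ⟨rfl, rfl⟩ | ⟨rfl, rfl⟩ <;> simp
  have e : p = p + x a - x a := by ring
  rw [e, hS.mem_triangle_iff_inTriangle a k] at hp
  have key := inTriangle_flip (T := x j + S.vert j (l + 2)) ?_ ?_ ?_ ?_ hp
  · rcases key with key | key
    · refine ⟨i', hi', ?_⟩
      rw [hS'.mem_triangle_iff_inTriangle i' k', h.eq1, h.eq2, h.eq3]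
      exact key
    · refine ⟨j', hj', ?_⟩
      rw [hS'.mem_triangle_iff_inTriangle j' l', h.eq4, h.eq5, h.eq6]
      exact key
  · have := hS.cross_pos' a k
    simpa [side] using this
  · have := hS.cross_pos j l
    have := hS.cross_pos j (l + 1)
    rw [← h.eqP, ← h.eqQ]
    simp only [side, fin3_add_one_add_one, fin3_add_two_add_one] at this
    have e : cross (x j + S.vert j (l + 2) - (x j + S.vert j (l + 1)))
        (x j + S.vert j l - (x j + S.vert j (l + 1))) =
        cross (S.vert j (l + 2) - S.vert j (l + 1)) (S.vert j l - S.vert j (l + 2)) := by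
      simp [TranslationSurface.cross]; ring
    rw [e]
    exact this
  · rw [← h.eq1, ← h.eq2, ← h.eq3]
    have := hS'.cross_pos' i' (k' + 2)
    simp only [side, fin3_add_two_add_one, fin3_add_two_add_two] at this
    simpa using this
  · rw [← h.eq4, ← h.eq5, ← h.eq6]
    have := hS'.cross_pos' j' (l' + 1)
    simp only [side, fin3_add_one_add_one, fin3_add_one_add_two] at this
    simpa using this

/-- The translations `x'` place the two triangles on opposite sides of their common diagonal. Two
points at the same place are therefore equal, or they are the two copies of a point of the diagonal,
which are glued. -/
theorem proj_eq_of_dev_eq {p' q' : S'.Points} (hp : p'.1.1 = i ∨ p'.1.1 = j)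
    (hq : q'.1.1 = i ∨ q'.1.1 = j) (hd : p'.coord + x' p'.1.1 = q'.coord + x' q'.1.1) :
    S'.proj p' = S'.proj q' := by
  by_cases hpq : p'.1.1 = q'.1.1
  · rw [Points.ext' hpq (by rw [hpq] at hd; exact add_right_cancel hd)]
  rw [h.eq_or] at hp hq
  wlog hpi : p'.1.1 = i' generalizing p' q'
  · refine (this hq hp hd.symm (Ne.symm hpq) ?_).symm
    rcases hp with hp | hp
    · exact absurd hp hpi
    · rcases hq with hq | hq
      · exact hq
      · exact absurd (hp.trans hq.symm) hpq
  have hqj : q'.1.1 = j' := by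
    rcases hq with hq | hq
    · exact absurd (hpi.trans hq.symm) hpq
    · exact hq
  obtain ⟨⟨a, p⟩, hp'⟩ := p'
  obtain ⟨⟨b, q⟩, hq'⟩ := q'
  simp only [Points.coord] at hpi hqj hd hp' hq'
  subst hpi hqj
  have h1 := ((hS'.mem_triangle_iff a k' p).1 hp').1
  have h2 := ((hS'.mem_triangle_iff b l' q).1 hq').1
  have hs := hS'.side_glue (a, k')
  rw [h.glue_diag'] at hs
  have hv : S'.vert b (l' + 1) = S'.vert a k' + x' a - x' b := by
    have h3 := h.eq5; have h4 := h.eq1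
    linear_combination h3 - h4
  have hv2 : q - S'.vert b l' = p - S'.vert a k' + S'.side (b, l') := by
    simp only [side] at hs ⊢
    linear_combination -hd - hv
  rw [hv2, hs, cross_neg_left, cross_add_right, cross_neg_right, cross_self] at h2
  obtain ⟨t, ht, hpt⟩ := hS'.exists_sidePoint (e := (a, k')) hp' (by
    change cross (S'.side (a, k')) (p - S'.vert a k') = 0
    linarith)
  refine proj_eq_of_glued ⟨(a, k'), t, ht, Prod.ext rfl hpt, ?_⟩
  rw [h.glue_diag']
  simp only [sidePoint_eq, Prod.mk.injEq, true_and] at hpt ⊢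
  push_cast
  linear_combination hv2 + hpt + (t : ℂ) * hs

omit hS hS' in
theorem rel_flipSide {e : Fin n × Fin 3} (h1 : e ≠ (i, k)) (h2 : e ≠ (j, l)) :
    Rel i j e.1 (flipSide i j k l i' j' k' l' e).1 ∧
    (∀ t : ℝ, S'.sidePoint (flipSide i j k l i' j' k' l' e) t =
      S.sidePoint e t + (x e.1 - x' (flipSide i j k l i' j' k' l' e).1)) := by
  have hi' : i' = i ∨ i' = j := by rcases h.same with ⟨rfl, rfl⟩ | ⟨rfl, rfl⟩ <;> simp
  have hj' : j' = i ∨ j' = j := by rcases h.same with ⟨rfl, rfl⟩ | ⟨rfl, rfl⟩ <;> simp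
  have key : ∀ (e' : Fin n × Fin 3), x' e'.1 + S'.vert e'.1 e'.2 = x e.1 + S.vert e.1 e.2 →
      x' e'.1 + S'.vert e'.1 (e'.2 + 1) = x e.1 + S.vert e.1 (e.2 + 1) →
      ∀ t : ℝ, S'.sidePoint e' t = S.sidePoint e t + (x e.1 - x' e'.1) := by
    intro e' h1 h2 t
    simp only [sidePoint]
    linear_combination (1 - (t : ℂ)) * h1 + (t : ℂ) * h2
  rcases side_cases i j k l e with rfl | rfl | rfl | rfl | rfl | rfl | ⟨h3, h4⟩
  · exact absurd rfl h1
  · rw [flipSide_one]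
    refine ⟨Or.inr ⟨Or.inl rfl, hj'⟩, key _ ?_ ?_⟩
    · exact h.eq6
    · simpa using h.eq4
  · rw [flipSide_two]
    refine ⟨Or.inr ⟨Or.inl rfl, hi'⟩, key _ ?_ ?_⟩
    · exact h.eq2
    · simpa using h.eq3
  · exact absurd rfl h2
  · rw [flipSide_three h.ne]
    refine ⟨Or.inr ⟨Or.inr rfl, hi'⟩, key _ ?_ ?_⟩
    · exact h.eq3.trans h.eqP.symm
    · simpa using h.eq1
  · rw [flipSide_four h.ne]
    refine ⟨Or.inr ⟨Or.inr rfl, hj'⟩, key _ ?_ ?_⟩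
    · exact h.eq5
    · simpa using h.eq6.trans h.eqQ.symm
  · rw [flipSide_of_ne h3 h4]
    exact ⟨Or.inl ⟨rfl, h3, h4⟩, key _ (h.other _ h3 h4 _) (h.other _ h3 h4 _)⟩

theorem proj_eq_of_match {p : S.Points} {p' q' : S'.Points}
    (hp : Match S S' (Rel i j) (fun a a' => x a - x' a') p p')
    (hq : Match S S' (Rel i j) (fun a a' => x a - x' a') p q') : S'.proj p' = S'.proj q' := by
  have hd : p'.coord + x' p'.1.1 = q'.coord + x' q'.1.1 := by rw [hp.2, hq.2]; ring
  rcases hp.1 with ⟨h1, h2, h3⟩ | ⟨h1, h2⟩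
  · rcases hq.1 with ⟨h4, _⟩ | ⟨h4, _⟩
    · have : p'.1.1 = q'.1.1 := h1.symm.trans h4
      rw [Points.ext' this (by rw [this] at hd; exact add_right_cancel hd)]
    · exact absurd h4 (by simp [h2, h3])
  · rcases hq.1 with ⟨h4, h5, h6⟩ | ⟨h4, h5⟩
    · exact absurd h1 (by simp [h5, h6])
    · exact h.proj_eq_of_dev_eq hS hS' h2 h5 hd

omit hS hS' in
theorem exists_match_corner (c : Fin n × Fin 3) : ∃ c',
    Match S S' (Rel i j) (fun a a' => x a - x' a') (S.cornerPt c) (S'.cornerPt c') := by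
  have hi' : i' = i ∨ i' = j := by rcases h.same with ⟨rfl, rfl⟩ | ⟨rfl, rfl⟩ <;> simp
  have hj' : j' = i ∨ j' = j := by rcases h.same with ⟨rfl, rfl⟩ | ⟨rfl, rfl⟩ <;> simp
  have key : ∀ c', Rel i j c.1 c'.1 → x' c'.1 + S'.vert c'.1 c'.2 = x c.1 + S.vert c.1 c.2 →
      Match S S' (Rel i j) (fun a a' => x a - x' a') (S.cornerPt c) (S'.cornerPt c') := by
    intro c' h1 h2
    refine ⟨h1, ?_⟩
    simp only [Points.coord, cornerPt]
    linear_combination h2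
  rcases side_cases i j k l c with rfl | rfl | rfl | rfl | rfl | rfl | ⟨h3, h4⟩
  · exact ⟨(i', k' + 2), key _ (Or.inr ⟨Or.inl rfl, hi'⟩) h.eq3⟩
  · exact ⟨(j', l' + 2), key _ (Or.inr ⟨Or.inl rfl, hj'⟩) h.eq6⟩
  · exact ⟨(i', k' + 1), key _ (Or.inr ⟨Or.inl rfl, hi'⟩) h.eq2⟩
  · exact ⟨(j', l' + 2), key _ (Or.inr ⟨Or.inr rfl, hj'⟩) (h.eq6.trans h.eqQ.symm)⟩
  · exact ⟨(i', k' + 2), key _ (Or.inr ⟨Or.inr rfl, hi'⟩) (h.eq3.trans h.eqP.symm)⟩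
  · exact ⟨(i', k'), key _ (Or.inr ⟨Or.inr rfl, hi'⟩) h.eq1⟩
  · exact ⟨c, key _ (Or.inl ⟨rfl, h3, h4⟩) (h.other _ h3 h4 _)⟩

theorem recut : Recut S S' (Rel i j) (fun a a' => x a - x' a') := by
  refine ⟨?_, ?_, h.exists_match_corner, ?_⟩
  · rintro ⟨⟨a, p⟩, hp⟩
    by_cases ha : a = i ∨ a = j
    · obtain ⟨a', h1, h2⟩ := h.exists_mem hS hS' hp ha
      exact ⟨⟨(a', _), h2⟩, Or.inr ⟨ha, h1⟩, by simp only [Points.coord]; ring⟩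
    · push Not at ha
      refine ⟨⟨(a, p + (x a - x' a)), ?_⟩, Or.inl ⟨rfl, ha.1, ha.2⟩, rfl⟩
      obtain ⟨u, v, w, hu, hv, hw, hs, rfl⟩ := (S.mem_triangle_iff_weights a 0 p).1 hp
      rw [S'.mem_triangle_iff_weights _ 0]
      refine ⟨u, v, w, hu, hv, hw, hs, ?_⟩
      have h0 := h.other a ha.1 ha.2
      have h' : (u + v + w : ℂ) = 1 := by exact_mod_cast hs
      linear_combination (-(x a - x' a)) * h' - (u : ℂ) * h0 0 - (v : ℂ) * h0 (0 + 1) -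
        (w : ℂ) * h0 (0 + 2)
  · rintro p q p' q' (rfl | ⟨e, t, ht, hp, hq⟩) hp' hq'
    · exact h.proj_eq_of_match hS hS' hp' hq'
    -- Points glued along the old diagonal have the same place in the quadrilateral. For an outer
    -- side the gluing is transported by `flipSide`.
    by_cases hdiag : e = (i, k) ∨ e = (j, l)
    · have hi : (e.1 = i ∨ e.1 = j) ∧ ((S.glue e).1 = i ∨ (S.glue e).1 = j) ∧
          x (S.glue e).1 + S.vert (S.glue e).1 ((S.glue e).2 + 1) = x e.1 + S.vert e.1 e.2 := by
        rcases hdiag with rfl | rfl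
        · rw [h.glue_diag]; exact ⟨Or.inl rfl, Or.inr rfl, h.eqP⟩
        · have hji : S.glue (j, l) = (i, k) := by rw [← h.glue_diag, hS.glue_glue]
          rw [hji]; exact ⟨Or.inr rfl, Or.inl rfl, h.eqQ.symm⟩
      obtain ⟨h1, h2, h3⟩ := hi
      have hs := hS.side_glue e
      refine h.proj_eq_of_dev_eq hS hS' ?_ ?_ ?_
      · rcases hp'.1 with ⟨_, h5, h6⟩ | ⟨_, h5⟩
        · rw [hp] at h5 h6
          exact absurd h1 (by simp [h5, h6])
        · exact h5
      · rcases hq'.1 with ⟨_, h5, h6⟩ | ⟨_, h5⟩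
        · rw [hq] at h5 h6
          exact absurd h2 (by simp [h5, h6])
        · exact h5
      · rw [hp'.2, hq'.2]
        simp only [Points.coord, hp, hq, sidePoint_eq]
        simp only [side] at hs ⊢
        push_cast
        linear_combination -h3 + (t : ℂ) * hs
    · push Not at hdiag
      obtain ⟨h1, h2⟩ := hdiag
      obtain ⟨h3, h4⟩ := h.glue_ne hS h1 h2
      obtain ⟨r1, s1⟩ := h.rel_flipSide h1 h2
      obtain ⟨r2, s2⟩ := h.rel_flipSide h3 h4
      have ht' : 1 - t ∈ Icc (0 : ℝ) 1 := ⟨by linarith [ht.2], by linarith [ht.1]⟩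
      have m1 : Match S S' (Rel i j) (fun a a' => x a - x' a') p
          (S'.sidePt (flipSide i j k l i' j' k' l' e) ⟨t, ht⟩) := by
        refine ⟨by rw [hp]; exact r1, ?_⟩
        simp only [Points.coord, hp, sidePt, s1]
      have m2 : Match S S' (Rel i j) (fun a a' => x a - x' a') q
          (S'.sidePt (flipSide i j k l i' j' k' l' (S.glue e)) ⟨1 - t, ht'⟩) := by
        refine ⟨by rw [hq]; exact r2, ?_⟩
        simp only [Points.coord, hq, sidePt, s2]
      rw [h.proj_eq_of_match hS hS' hp' m1, h.proj_eq_of_match hS hS' hq' m2]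
      refine proj_eq_of_glued ⟨_, t, ht, rfl, ?_⟩
      rw [h.glue_outer e h1 h2]
      rfl
  · intro L c' hc'
    -- Both triangles of the quadrilateral may take their constant from `i'`: compatibility along
    -- the new diagonal says that `j'` gives the same one modulo `L`.
    refine ⟨fun a => if a = i ∨ a = j then x a - x' i' + c' i' else x a - x' a + c' a, ?_⟩
    rintro a a' (⟨rfl, h1, h2⟩ | ⟨h1, h2⟩)
    · simp [h1, h2]
    · simp only [if_pos h1]
      rw [h.eq_or] at h2
      rcases h2 with rfl | rfl
      · simp
      · have h3 := hc' (i', k')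
        rw [h.glue_diag'] at h3
        convert h3 using 1
        have h4 := h.eq5; have h5 := h.eq1
        simp only
        linear_combination h5 - h4

end FlipRel
end GluedTriangles
end TranslationSurface

/-! ### Additivity of angles, and changes of diagonals inside the stratum. -/

namespace TranslationSurface

theorem angle_eq_arg {u v : ℂ} (h : 0 < cross u v) :
    InnerProductGeometry.angle u v = (v / u).arg ∧ 0 < (v / u).arg ∧ (v / u).arg < Real.pi := by
  have hu : u ≠ 0 := by rintro rfl; simp [cross_zero_left] at h
  have hv : v ≠ 0 := by rintro rfl; simp [cross_zero_right] at h
  have him : 0 < (v / u).im := by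
    rw [Complex.div_im]
    have : v.im * u.re / Complex.normSq u - v.re * u.im / Complex.normSq u =
        cross u v / Complex.normSq u := by simp [cross]; ring
    rw [this]
    exact div_pos h (Complex.normSq_pos.2 hu)
  have h0 : 0 < (v / u).arg := by
    rcases (Complex.arg_nonneg_iff.2 him.le).lt_or_eq with h1 | h1
    · exact h1
    · exact absurd (Complex.arg_eq_zero_iff.1 h1.symm).2 him.ne'
  have h1 : (v / u).arg < Real.pi := by
    rcases (Complex.arg_le_pi (v / u)).lt_or_eq with h1 | h1
    · exact h1
    · exact absurd (Complex.arg_eq_pi_iff.1 h1).2 him.ne'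
  refine ⟨?_, h0, h1⟩
  rw [InnerProductGeometry.angle_comm, Complex.angle_eq_abs_arg hv hu, abs_of_pos h0]

/-- Arguments add modulo `2π`. All three angles lie strictly between `0` and `π`, which excludes a
nonzero multiple of `2π`. -/
theorem angle_add_angle {u v w : ℂ} (h1 : 0 < cross u v) (h2 : 0 < cross v w)
    (h3 : 0 < cross u w) : InnerProductGeometry.angle u v + InnerProductGeometry.angle v w =
      InnerProductGeometry.angle u w := by
  have hu : u ≠ 0 := by rintro rfl; simp [cross_zero_left] at h1
  have hv : v ≠ 0 := by rintro rfl; simp [cross_zero_right] at h1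
  have hw : w ≠ 0 := by rintro rfl; simp [cross_zero_right] at h3
  obtain ⟨e1, a1, b1⟩ := angle_eq_arg h1
  obtain ⟨e2, a2, b2⟩ := angle_eq_arg h2
  obtain ⟨e3, a3, b3⟩ := angle_eq_arg h3
  rw [e1, e2, e3]
  have hm : (w / u : ℂ) = (v / u) * (w / v) := by field_simp
  have hang : (((w / u).arg : ℝ) : Real.Angle) = (((v / u).arg + (w / v).arg : ℝ) : Real.Angle) := by
    rw [hm, Complex.arg_mul_coe_angle (div_ne_zero hv hu) (div_ne_zero hw hv)]; simp
  rw [Real.Angle.angle_eq_iff_two_pi_dvd_sub] at hang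
  obtain ⟨N, hN⟩ := hang
  have hpi := Real.pi_pos
  have hN0 : N = 0 := by
    have c1 : (-1 : ℝ) < N := by nlinarith
    have c2 : (N : ℝ) < 1 := by nlinarith
    have c1' : (-1 : ℤ) < N := by exact_mod_cast c1
    have c2' : N < 1 := by exact_mod_cast c2
    omega
  rw [hN0] at hN
  simp at hN
  linarith

theorem sum_eq_of_pair {ι : Type*} [Fintype ι] [DecidableEq ι] {i j : ι} (hij : i ≠ j)
    (f g : ι → ℝ) (h : ∀ a, a ≠ i → a ≠ j → f a = g a) (hs : f i + f j = g i + g j) :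
    ∑ a, f a = ∑ a, g a := by
  have hj : j ∈ Finset.univ.erase i := by simp [hij.symm]
  rw [← Finset.add_sum_erase _ f (Finset.mem_univ i), ← Finset.add_sum_erase _ g (Finset.mem_univ i),
    ← Finset.add_sum_erase _ f hj, ← Finset.add_sum_erase _ g hj, ← add_assoc, ← add_assoc, hs]
  congr 1
  refine Finset.sum_congr rfl fun a ha => ?_
  simp only [Finset.mem_erase, Finset.mem_univ, and_true] at ha
  exact h a ha.2 ha.1

theorem sum_fin_three (f : Fin 3 → ℝ) (k : Fin 3) : ∑ b, f b = f k + f (k + 1) + f (k + 2) := by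
  rw [Fin.sum_univ_three]
  fin_cases k
  · rfl
  · change _ = f 1 + f 2 + f 0; ring
  · change _ = f 2 + f 0 + f 1; ring

namespace GluedTriangles

variable {n : ℕ} {S : GluedTriangles n} {i j : Fin n} {k l : Fin 3}

/-- The gluing after the change of the diagonal `(i, k)`. -/
def flipGlue (g : Fin n × Fin 3 → Fin n × Fin 3) (i : Fin n) (k : Fin 3) (e : Fin n × Fin 3) :
    Fin n × Fin 3 :=
  flipSide i (g (i, k)).1 k (g (i, k)).2 i (g (i, k)).1 k (g (i, k)).2
    (g (flipSide i (g (i, k)).1 k (g (i, k)).2 (g (i, k)).1 i (g (i, k)).2 k e))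

/-- The side vectors after the change of the diagonal `(i, k)`. -/
def flipVec {G : Type*} [AddCommGroup G] (g : Fin n × Fin 3 → Fin n × Fin 3)
    (v : Fin n × Fin 3 → G) (i : Fin n) (k : Fin 3) (e : Fin n × Fin 3) : G :=
  if e = (i, k) then -(v (i, k + 2) + v ((g (i, k)).1, (g (i, k)).2 + 1))
  else if e = g (i, k) then v (i, k + 2) + v ((g (i, k)).1, (g (i, k)).2 + 1)
  else v (flipSide i (g (i, k)).1 k (g (i, k)).2 (g (i, k)).1 i (g (i, k)).2 k e)

/-- The change of the diagonal `(i, k)` in the quadrilateral formed by two adjacent triangles. -/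
noncomputable def flip (S : GluedTriangles n) (i : Fin n) (k : Fin 3) : GluedTriangles n where
  glue := flipGlue S.glue i k
  vert a b :=
    if a = i then
      if b = k then S.vert (S.glue (i, k)).1 ((S.glue (i, k)).2 + 2) +
        (S.vert i k - S.vert (S.glue (i, k)).1 ((S.glue (i, k)).2 + 1))
      else if b = k + 1 then S.vert i (k + 2) else S.vert i k
    else if a = (S.glue (i, k)).1 then
      if b = (S.glue (i, k)).2 then S.vert i (k + 2)
      else if b = (S.glue (i, k)).2 + 1 then
        S.vert (S.glue (i, k)).1 ((S.glue (i, k)).2 + 2) +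
          (S.vert i k - S.vert (S.glue (i, k)).1 ((S.glue (i, k)).2 + 1))
      else S.vert i (k + 1)
    else S.vert a b

/-- The two triangles with the new diagonal are positively oriented. -/
def CanFlip (S : GluedTriangles n) (i : Fin n) (k : Fin 3) : Prop :=
  0 < cross (S.side (i, k + 2)) (S.side ((S.glue (i, k)).1, (S.glue (i, k)).2 + 1)) ∧
  0 < cross (S.side ((S.glue (i, k)).1, (S.glue (i, k)).2 + 2)) (S.side (i, k + 1))

namespace Admissible

/-- Glued sides are opposite vectors, but no side is its own opposite, and two different sides of a
nondegenerate triangle are not parallel. -/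
theorem glue_fst_ne (hS : S.Admissible) (e : Fin n × Fin 3) : (S.glue e).1 ≠ e.1 := by
  obtain ⟨i, k⟩ := e
  intro h
  have hs := hS.side_glue (i, k)
  rcases hg : S.glue (i, k) with ⟨j, l⟩
  rw [hg] at h hs
  simp only at h
  subst h
  have h1 := hS.cross_pos j k
  have h2 := hS.cross_pos j (k + 2)
  rw [fin3_add_two_add_one] at h2
  have hne := hS.side_ne_zero (j, k)
  rcases fin3_cases k l with rfl | rfl | rfl
  · have : (2 : ℂ) * S.side (j, l) = 0 := by linear_combination hs
    simp [hne] at this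
  · rw [hs, cross_neg_right, cross_self] at h1; simp at h1
  · rw [hs, cross_neg_left, cross_self] at h2; simp at h2

theorem flipRel_flip (hS : S.Admissible) (hg : S.glue (i, k) = (j, l)) :
    FlipRel S (S.flip i k) i j k l i j k l
      (fun a => if a = j then S.vert i k - S.vert j (l + 1) else 0) (fun _ => 0) := by
  have hij : i ≠ j := by
    have := hS.glue_fst_ne (i, k)
    rw [hg] at this
    exact this.symm
  have hs := hS.side_glue (i, k)
  rw [hg] at hs
  simp only [side] at hs
  have a1 := fin3_add_one_ne
  have a2 := fin3_add_two_ne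
  have a3 : ∀ k : Fin 3, k + 2 ≠ k + 1 := by decide
  refine ⟨hij, Or.inl ⟨rfl, rfl⟩, hg, ?_, ?_, ?_, ?_, ?_, ?_, ?_, ?_, ?_, ?_, ?_⟩
  · simp only [flip, flipGlue, hg]
    rw [flipSide_diag hij, hg, flipSide_diag' hij]
  · simp [hij]
  · simp only [if_true, if_neg hij]; linear_combination -hs
  all_goals simp only [flip, hg, if_true, if_neg hij, if_neg hij.symm, if_neg (a1 _), if_neg (a2 _),
    if_neg (a3 _)]
  · ring
  · ring
  · intro a h1 h2 b
    rw [if_neg h1, if_neg h2, if_neg h2]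
  · intro e h1 h2
    simp only [flipGlue, hg]
    rw [flipSide_flipSide hij (Or.inl ⟨rfl, rfl⟩) h1 h2]

end Admissible

theorem FlipRel.side_flipSide {S S' : GluedTriangles n} {i' j' : Fin n} {k' l' : Fin 3}
    {x x' : Fin n → ℂ} (h : FlipRel S S' i j k l i' j' k' l' x x') {e : Fin n × Fin 3}
    (h1 : e ≠ (i, k)) (h2 : e ≠ (j, l)) :
    S'.side (flipSide i j k l i' j' k' l' e) = S.side e := by
  have h3 := (h.rel_flipSide h1 h2).2
  have e0 := h3 0
  have e1 := h3 1
  rw [sidePoint_zero, sidePoint_zero] at e0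
  rw [sidePoint_one, sidePoint_one] at e1
  simp only [side]
  linear_combination e1 - e0

theorem FlipRel.side_diag {S S' : GluedTriangles n} {i' j' : Fin n} {k' l' : Fin 3}
    {x x' : Fin n → ℂ} (h : FlipRel S S' i j k l i' j' k' l' x x') :
    S'.side (i', k') = -(S.side (i, k + 2) + S.side (j, l + 1)) ∧
    S'.side (j', l') = S.side (i, k + 2) + S.side (j, l + 1) := by
  have h1 := h.eq1; have h2 := h.eq2; have h4 := h.eq4; have h5 := h.eq5; have h6 := h.eqP
  simp only [side, fin3_add_two_add_one, fin3_add_one_add_one]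
  constructor
  · linear_combination h2 - h1 - h6
  · linear_combination h5 - h4 + h6

namespace Admissible

theorem side_flip (hS : S.Admissible) (i : Fin n) (k : Fin 3) (e : Fin n × Fin 3) :
    (S.flip i k).side e = flipVec S.glue S.side i k e := by
  rcases hg : S.glue (i, k) with ⟨j, l⟩
  have h := hS.flipRel_flip hg
  simp only [flipVec, hg]
  split_ifs with h1 h2
  · rw [h1]; exact h.side_diag.1
  · rw [h2]; exact h.side_diag.2
  · have hs : (j = i ∧ i = j) ∨ (j = j ∧ i = i) := Or.inr ⟨rfl, rfl⟩
    have hn := flipSide_ne (k' := l) (l' := k) h.ne hs h1 h2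
    rw [← h.side_flipSide hn.2 hn.1]
    have := flipSide_flipSide (k' := l) (l' := k) h.ne hs h1 h2
    rw [flipSide_swap h.ne hn.2 hn.1] at this
    rw [this]

theorem flip (hS : S.Admissible) (hc : CanFlip S i k) : (S.flip i k).Admissible := by
  rcases hg : S.glue (i, k) with ⟨j, l⟩
  have h := hS.flipRel_flip hg
  have hs : (j = i ∧ i = j) ∨ (j = j ∧ i = i) := Or.inr ⟨rfl, rfl⟩
  simp only [CanFlip, hg] at hc
  have hji : S.glue (j, l) = (i, k) := by rw [← hg, hS.glue_glue]
  have g1 : (S.flip i k).glue (i, k) = (j, l) := h.glue_diag'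
  have g2 : (S.flip i k).glue (j, l) = (i, k) := by
    change flipGlue S.glue i k (j, l) = (i, k)
    simp only [flipGlue, hg]
    rw [flipSide_diag' h.ne, hji, flipSide_diag h.ne]
  have hout : ∀ e, e ≠ (i, k) → e ≠ (j, l) →
      ∃ d, d ≠ (i, k) ∧ d ≠ (j, l) ∧ flipSide i j k l i j k l d = e := by
    intro e h1 h2
    have hn := flipSide_ne (k' := l) (l' := k) h.ne hs h1 h2
    refine ⟨_, hn.2, hn.1, ?_⟩
    have := flipSide_flipSide (k' := l) (l' := k) h.ne hs h1 h2
    rw [flipSide_swap h.ne hn.2 hn.1] at this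
    exact this
  have a2 := fin3_add_two_ne
  have a1 := fin3_add_one_ne
  refine ⟨?_, ?_, ?_⟩
  · intro a
    by_cases h1 : a = i
    · subst h1
      have h3 := (S.flip a k).cross_side_side a (k + 1)
      have e1 := h.side_flipSide (e := (a, k + 2)) (by simp [a2]) (by simp [h.ne])
      have e2 := h.side_flipSide (e := (j, l + 1)) (by simp [h.ne.symm]) (by simp [a1])
      rw [flipSide_two] at e1
      rw [flipSide_three h.ne] at e2
      rw [fin3_add_one_add_one, e1, e2] at h3
      linarith [hc.1]
    by_cases h2 : a = j
    · subst h2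
      have h3 := (S.flip i k).cross_side_side a (l + 1)
      have e1 := h.side_flipSide (e := (a, l + 2)) (by simp [h.ne.symm]) (by simp [a2])
      have e2 := h.side_flipSide (e := (i, k + 1)) (by simp [a1]) (by simp [h.ne])
      rw [flipSide_four h.ne] at e1
      rw [flipSide_one] at e2
      rw [fin3_add_one_add_one, e1, e2] at h3
      linarith [hc.2]
    · have h3 := (S.flip i k).cross_side_side a 0
      have e1 := h.side_flipSide (e := (a, 0)) (by simp [h1]) (by simp [h2])
      have e2 := h.side_flipSide (e := (a, 0 + 1)) (by simp [h1]) (by simp [h2])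
      rw [flipSide_of_ne (by simpa using h1) (by simpa using h2)] at e1 e2
      rw [e1, e2] at h3
      linarith [hS.cross_pos a 0]
  · intro e
    by_cases h1 : e = (i, k)
    · rw [h1, g1, g2]
    by_cases h2 : e = (j, l)
    · rw [h2, g2, g1]
    obtain ⟨d, d1, d2, rfl⟩ := hout e h1 h2
    have hd := h.glue_ne hS d1 d2
    rw [h.glue_outer d d1 d2, h.glue_outer _ hd.1 hd.2, hS.glue_glue]
  · intro e
    by_cases h1 : e = (i, k)
    · rw [h1, g1, h.side_diag.1, h.side_diag.2, neg_neg]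
    by_cases h2 : e = (j, l)
    · rw [h2, g2, h.side_diag.1, h.side_diag.2]
    obtain ⟨d, d1, d2, rfl⟩ := hout e h1 h2
    have hd := h.glue_ne hS d1 d2
    rw [h.glue_outer d d1 d2, h.side_flipSide hd.1 hd.2, h.side_flipSide d1 d2, hS.side_glue]

theorem area_flip (hS : S.Admissible) (i : Fin n) (k : Fin 3) : (S.flip i k).area = S.area := by
  rcases hg : S.glue (i, k) with ⟨j, l⟩
  have h := hS.flipRel_flip hg
  have a2 := fin3_add_two_ne
  have a1 := fin3_add_one_ne
  have hs := hS.side_glue (i, k)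
  rw [hg] at hs
  have t1 := S.side_add_side_add_side i k
  have t2 := S.side_add_side_add_side j l
  simp only [area]
  apply sum_eq_of_pair h.ne
  · intro a h1 h2
    have h3 := (S.flip i k).cross_side_side a 0
    have h4 := S.cross_side_side a 0
    have e1 := h.side_flipSide (e := (a, 0)) (by simp [h1]) (by simp [h2])
    have e2 := h.side_flipSide (e := (a, 0 + 1)) (by simp [h1]) (by simp [h2])
    rw [flipSide_of_ne (by simpa using h1) (by simpa using h2)] at e1 e2
    rw [e1, e2] at h3
    linarith
  · have e1 := h.side_flipSide (e := (i, k + 2)) (by simp [a2]) (by simp [h.ne])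
    have e2 := h.side_flipSide (e := (j, l + 1)) (by simp [h.ne.symm]) (by simp [a1])
    have e3 := h.side_flipSide (e := (j, l + 2)) (by simp [h.ne.symm]) (by simp [a2])
    have e4 := h.side_flipSide (e := (i, k + 1)) (by simp [a1]) (by simp [h.ne])
    rw [flipSide_two] at e1
    rw [flipSide_three h.ne] at e2
    rw [flipSide_four h.ne] at e3
    rw [flipSide_one] at e4
    have c1 := (S.flip i k).cross_side_side i (k + 1)
    have c2 := (S.flip i k).cross_side_side j (l + 1)
    have c3 := S.cross_side_side i (k + 1)
    have c4 := S.cross_side_side j (l + 1)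
    rw [fin3_add_one_add_one] at c1 c2 c3 c4
    rw [e1, e2] at c1
    rw [e3, e4] at c2
    have hsum : S.side (j, l + 2) = -(S.side (i, k + 1) + S.side (i, k + 2) + S.side (j, l + 1)) := by
      linear_combination t1 + t2 - hs
    rw [hsum] at c2 c4
    simp only [cross_add_left, cross_neg_left, cross_add_right, cross_neg_right] at c1 c2 c3 c4
    have z1 := cross_self (S.side (i, k + 1))
    have z2 := cross_self (S.side (j, l + 1))
    have z3 := cross_comm (S.side (i, k + 1)) (S.side (i, k + 2))
    have z4 := cross_comm (S.side (i, k + 1)) (S.side (j, l + 1))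
    have z5 := cross_comm (S.side (i, k + 2)) (S.side (j, l + 1))
    linarith

end Admissible

end GluedTriangles
end TranslationSurface

namespace TranslationSurface
namespace GluedTriangles

variable {n : ℕ} {S : GluedTriangles n} {i j : Fin n} {k l : Fin 3}

theorem FlipRel.rel_symm (i j : Fin n) : (fun a' a => FlipRel.Rel i j a a') = FlipRel.Rel i j := by
  funext a' a
  apply propext
  constructor
  · rintro (⟨rfl, h⟩ | ⟨h1, h2⟩)
    exacts [Or.inl ⟨rfl, h⟩, Or.inr ⟨h2, h1⟩]
  · rintro (⟨rfl, h⟩ | ⟨h1, h2⟩)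
    exacts [Or.inl ⟨rfl, h⟩, Or.inr ⟨h2, h1⟩]

theorem FlipRel.recut' {S S' : GluedTriangles n} {x x' : Fin n → ℂ}
    (h : FlipRel S S' i j k l i j k l x x') (hS : S.Admissible) (hS' : S'.Admissible) :
    Recut S' S (fun a' a => FlipRel.Rel i j a a') (fun a' a => -(x a - x' a')) := by
  rw [FlipRel.rel_symm]
  have := (h.symm hS).recut hS' hS
  convert this using 3
  ring

theorem FlipRel.equivalent {S S' : GluedTriangles n} {x x' : Fin n → ℂ}
    (h : FlipRel S S' i j k l i j k l x x') (hS : S.Admissible) (hS' : S'.Admissible)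
    (harea : S.area = S'.area) {c c' : Fin n × Fin 3} (hr : FlipRel.Rel i j c.1 c'.1)
    (hv : x' c'.1 + S'.vert c'.1 c'.2 = x c.1 + S.vert c.1 c.2) : Equivalent S c S' c' := by
  refine (h.recut hS hS').equivalent (h.recut' hS hS') ⟨hr, ?_⟩ harea
  simp only [Points.coord, cornerPt]
  linear_combination hv

theorem Admissible.equivalent_flip (hS : S.Admissible) (hc : CanFlip S i k) (c : Fin n × Fin 3) :
    ∃ c', Equivalent S c (S.flip i k) c' := by
  rcases hg : S.glue (i, k) with ⟨j, l⟩
  have h := hS.flipRel_flip hg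
  obtain ⟨c', hr, hv⟩ := h.exists_match_corner c
  refine ⟨c', h.equivalent hS (hS.flip hc) (hS.area_flip i k).symm hr ?_⟩
  simp only [Points.coord, cornerPt] at hv
  rw [hv, sub_zero, zero_add]
  by_cases hcj : c.1 = j
  · simp only [hcj, if_true]; ring
  · simp only [hcj, if_false]; ring

/-- The angle at a corner. -/
noncomputable def cornerAngle (S : GluedTriangles n) (c : Fin n × Fin 3) : ℝ :=
  InnerProductGeometry.angle (S.side c) (-S.side (c.1, c.2 + 2))

theorem cornerAngle_eq (S : GluedTriangles n) (c : Fin n × Fin 3) :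
    EuclideanGeometry.angle (S.vert c.1 (c.2 + 1)) (S.vert c.1 c.2) (S.vert c.1 (c.2 + 2)) =
      S.cornerAngle c := by
  simp [EuclideanGeometry.angle, cornerAngle, side]

open Classical in
theorem totalAngle_eq (S : GluedTriangles n) (z : S.Surface) :
    S.totalAngle z = ∑ c, if S.corner c = z then S.cornerAngle c else 0 := by
  simp only [totalAngle, cornerAngle_eq]

theorem Admissible.cross_corner (hS : S.Admissible) (c : Fin n × Fin 3) :
    0 < cross (S.side c) (-S.side (c.1, c.2 + 2)) := by
  have := hS.cross_pos' c.1 c.2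
  simpa [side] using this

theorem FlipRel.totalAngle_map {S S' : GluedTriangles n} {x x' : Fin n → ℂ}
    (h : FlipRel S S' i j k l i j k l x x') (hS : S.Admissible) (hS' : S'.Admissible)
    (z : S.Surface) : S'.totalAngle ((h.recut hS hS').map z) = S.totalAngle z := by
  classical
  set F := (h.recut hS hS').map with hF
  have hinj : Function.Injective F :=
    Function.LeftInverse.injective ((h.recut hS hS').map_map (h.recut' hS hS'))
  have key : ∀ c c' : Fin n × Fin 3, FlipRel.Rel i j c.1 c'.1 →
      x' c'.1 + S'.vert c'.1 c'.2 = x c.1 + S.vert c.1 c.2 → F (S.corner c) = S'.corner c' := by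
    intro c c' h1 h2
    rw [← proj_cornerPt, ← proj_cornerPt]
    apply Recut.map_proj
    refine ⟨h1, ?_⟩
    simp only [Points.coord, cornerPt]
    linear_combination h2
  have kii : FlipRel.Rel i j i i := Or.inr ⟨Or.inl rfl, Or.inl rfl⟩
  have kij : FlipRel.Rel i j i j := Or.inr ⟨Or.inl rfl, Or.inr rfl⟩
  have kji : FlipRel.Rel i j j i := Or.inr ⟨Or.inr rfl, Or.inl rfl⟩
  have kjj : FlipRel.Rel i j j j := Or.inr ⟨Or.inr rfl, Or.inr rfl⟩
  have P1 := key (i, k) (i, k + 2) kii h.eq3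
  have Q1 := key (i, k + 1) (j, l + 2) kij h.eq6
  have R1 := key (i, k + 2) (i, k + 1) kii h.eq2
  have R2 := key (i, k + 2) (j, l) kij h.eq4
  have Q2 := key (j, l) (j, l + 2) kjj (h.eq6.trans h.eqQ.symm)
  have P2 := key (j, l + 1) (i, k + 2) kji (h.eq3.trans h.eqP.symm)
  have T1 := key (j, l + 2) (i, k) kji h.eq1
  have T2 := key (j, l + 2) (j, l + 1) kjj h.eq5
  have hPP : S.corner (j, l + 1) = S.corner (i, k) := hinj (P2.trans P1.symm)
  have hQQ : S.corner (j, l) = S.corner (i, k + 1) := hinj (Q2.trans Q1.symm)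
  rw [totalAngle_eq, totalAngle_eq, Fintype.sum_prod_type, Fintype.sum_prod_type]
  apply sum_eq_of_pair h.ne
  · intro a h1 h2
    refine Finset.sum_congr rfl fun b _ => ?_
    rw [← key (a, b) (a, b) (Or.inl ⟨rfl, h1, h2⟩) (h.other a h1 h2 b), hinj.eq_iff]
    have : S'.cornerAngle (a, b) = S.cornerAngle (a, b) := by
      have hs : ∀ b, S'.side (a, b) = S.side (a, b) := by
        intro b
        simp only [side]
        linear_combination h.other a h1 h2 (b + 1) - h.other a h1 h2 b
      simp only [cornerAngle, hs]
    rw [this]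
  · have a2 := fin3_add_two_ne
    have a1 := fin3_add_one_ne
    have e1 := h.side_flipSide (e := (i, k + 2)) (by simp [a2]) (by simp [h.ne])
    have e2 := h.side_flipSide (e := (j, l + 1)) (by simp [h.ne.symm]) (by simp [a1])
    have e3 := h.side_flipSide (e := (j, l + 2)) (by simp [h.ne.symm]) (by simp [a2])
    have e4 := h.side_flipSide (e := (i, k + 1)) (by simp [a1]) (by simp [h.ne])
    rw [flipSide_two] at e1
    rw [flipSide_three h.ne] at e2
    rw [flipSide_four h.ne] at e3
    rw [flipSide_one] at e4
    have hs := hS.side_glue (i, k)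
    rw [h.glue_diag] at hs
    obtain ⟨d1, d2⟩ := h.side_diag
    have c1 := hS.cross_corner (i, k)
    have c2 := hS.cross_corner (i, k + 1)
    have c3 := hS.cross_corner (i, k + 2)
    have c4 := hS.cross_corner (j, l)
    have c5 := hS.cross_corner (j, l + 1)
    have c6 := hS.cross_corner (j, l + 2)
    have b1 := hS'.cross_corner (i, k)
    have b2 := hS'.cross_corner (i, k + 1)
    have b3 := hS'.cross_corner (i, k + 2)
    have b4 := hS'.cross_corner (j, l)
    have b5 := hS'.cross_corner (j, l + 1)
    have b6 := hS'.cross_corner (j, l + 2)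
    rw [sum_fin_three _ k, sum_fin_three _ l, sum_fin_three _ k, sum_fin_three _ l]
    simp only [← P1, ← Q1, ← R2, ← T2]
    rw [← R1, ← T1]
    simp only [hinj.eq_iff, hPP, hQQ]
    have hd : S'.side (i, k) = -S'.side (j, l) := by rw [d1, d2]
    simp only [cornerAngle, fin3_add_one_add_two, fin3_add_two_add_two]
      at c1 c2 c3 c4 c5 c6 b1 b2 b3 b4 b5 b6 ⊢
    rw [hs] at c4 c5
    rw [hd] at b1 b2
    rw [hs, hd]
    rw [e2] at b1 b3
    rw [e1] at b2 b3
    rw [e4] at b4 b6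
    rw [e3] at b5 b6
    rw [e1, e2, e3, e4]
    rw [neg_neg] at c5 b2 ⊢
    rw [neg_neg]
    -- At the ends of the old diagonal two old angles add up to a new one; at the ends of the new
    -- diagonal two new angles add up to an old one.
    have hP := angle_add_angle c5 c1 b3
    have hQ := angle_add_angle c2 c4 b6
    have hR := angle_add_angle b2 b4 c3
    have hT := angle_add_angle b5 b1 c6
    rw [← hP, ← hQ, ← hR, ← hT]
    split_ifs <;> ring

theorem IsH11.flip (hS : S.IsH11) (hc : CanFlip S i k) : (S.flip i k).IsH11 := by
  rcases hg : S.glue (i, k) with ⟨j, l⟩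
  have hA := hS.admissible
  have h := hA.flipRel_flip hg
  have hA' := hA.flip hc
  set F := (h.recut hA hA').map with hF
  have hl := (h.recut hA hA').map_map (h.recut' hA hA')
  have hinj : Function.Injective F := Function.LeftInverse.injective hl
  have hsurj : Function.Surjective F := by
    intro y
    obtain ⟨p', rfl⟩ := (S.flip i k).proj_surjective y
    obtain ⟨p, hp⟩ := (h.recut' hA hA').total p'
    refine ⟨S.proj p, (h.recut hA hA').map_proj ⟨hp.1, ?_⟩⟩
    rw [hp.2]; ring
  have hvert : (S.flip i k).vertices = F '' S.vertices := by
    ext y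
    constructor
    · rintro ⟨c', rfl⟩
      obtain ⟨c, hcc⟩ := (h.recut' hA hA').corner c'
      refine ⟨S.corner c, ⟨c, rfl⟩, (h.recut hA hA').map_proj (p := S.cornerPt c) ⟨hcc.1, ?_⟩⟩
      change ((S.flip i k).cornerPt c').coord = _
      rw [hcc.2]; ring
    · rintro ⟨_, ⟨c, rfl⟩, rfl⟩
      exact (h.recut hA hA').map_corner_mem c
  refine ⟨hA'.signedArea_pos, hA'.glue_glue, hA'.side_glue, ?_, ?_, ?_⟩
  · have := hS.connected
    exact hsurj.connectedSpace (h.recut hA hA').continuous_map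
  · rw [hvert, Set.ncard_image_of_injective _ hinj, hS.two_vertices]
  · rw [hvert]
    rintro _ ⟨z, hz, rfl⟩
    rw [h.totalAngle_map hA hA', hS.simple_zero z hz]

end GluedTriangles
end TranslationSurface

/-! ### Side vectors as integral tables, and the split model surfaces. -/

namespace TranslationSurface
namespace GluedTriangles

/-- The integral linear combination of the numbers `x r` with coefficients `V r`. -/
noncomputable def lin (V : Fin 5 → ℤ) (x : Fin 5 → ℂ) : ℂ := ∑ r, (V r : ℂ) * x r

theorem lin_add (V W : Fin 5 → ℤ) (x : Fin 5 → ℂ) : lin (V + W) x = lin V x + lin W x := by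
  simp [lin, add_mul, Finset.sum_add_distrib]

theorem lin_neg (V : Fin 5 → ℤ) (x : Fin 5 → ℂ) : lin (-V) x = -lin V x := by
  simp [lin]

theorem lin_comp (V : Fin 5 → ℤ) (Y : Fin 5 → Fin 5 → ℤ) (x : Fin 5 → ℂ) :
    lin V (fun r => lin (Y r) x) = lin (fun s => ∑ r, V r * Y r s) x := by
  simp only [lin]
  push_cast
  simp only [Finset.mul_sum, Finset.sum_mul]
  rw [Finset.sum_comm]
  refine Finset.sum_congr rfl fun s _ => Finset.sum_congr rfl fun r _ => by ring

/-- The gluing of `S` is `g`, and its side vectors are the combinations `V` of the numbers `x`. -/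
def HasTable (S : GluedTriangles 8) (g : Fin 8 × Fin 3 → Fin 8 × Fin 3)
    (V : Fin 8 × Fin 3 → Fin 5 → ℤ) (x : Fin 5 → ℂ) : Prop :=
  S.glue = g ∧ ∀ e, S.side e = lin (V e) x

variable {S : GluedTriangles 8} {g : Fin 8 × Fin 3 → Fin 8 × Fin 3}
  {V : Fin 8 × Fin 3 → Fin 5 → ℤ} {x : Fin 5 → ℂ}

/-- The rule for the side vectors is integral and applies to the coefficients as well, so a sequence
of flips becomes a computation with integers that can be decided. -/
theorem HasTable.flip (hS : S.Admissible) (h : HasTable S g V x) (i : Fin 8) (k : Fin 3) :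
    HasTable (S.flip i k) (flipGlue g i k) (flipVec g V i k) x := by
  obtain ⟨rfl, hV⟩ := h
  refine ⟨rfl, fun e => ?_⟩
  rw [hS.side_flip]
  unfold flipVec
  split_ifs <;> simp only [hV, lin_add, lin_neg]

theorem HasTable.canFlip (h : HasTable S g V x) {i : Fin 8} {k : Fin 3}
    (h1 : 0 < cross (lin (V (i, k + 2)) x) (lin (V ((g (i, k)).1, (g (i, k)).2 + 1)) x))
    (h2 : 0 < cross (lin (V ((g (i, k)).1, (g (i, k)).2 + 2)) x) (lin (V (i, k + 1)) x)) :
    S.CanFlip i k := by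
  obtain ⟨rfl, hV⟩ := h
  simp only [CanFlip, hV]
  exact ⟨h1, h2⟩

/-- The gluing of the model surfaces. -/
def modelGlue (e : Fin 8 × Fin 3) : Fin 8 × Fin 3 :=
  (![![(3, 0), (5, 1), (1, 2)], ![(2, 0), (4, 1), (0, 2)], ![(1, 0), (3, 1), (3, 2)],
    ![(0, 0), (2, 1), (2, 2)], ![(7, 0), (1, 1), (5, 2)], ![(6, 0), (0, 1), (4, 2)],
    ![(5, 0), (7, 1), (7, 2)], ![(4, 0), (6, 1), (6, 2)]] : Fin 8 → Fin 3 → Fin 8 × Fin 3) e.1 e.2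

/-- The coefficients of the side vectors of the model surfaces. -/
def modelVec (e : Fin 8 × Fin 3) : Fin 5 → ℤ :=
  (![![![1, 0, 0, 0, 0], ![0, 0, 1, 0, 0], ![-1, 0, -1, 0, 0]],
    ![![-1, 0, 0, 0, 0], ![0, 0, -1, 0, 0], ![1, 0, 1, 0, 0]],
    ![![1, 0, 0, 0, 0], ![0, 0, 0, 1, 0], ![-1, 0, 0, -1, 0]],
    ![![-1, 0, 0, 0, 0], ![0, 0, 0, -1, 0], ![1, 0, 0, 1, 0]],
    ![![0, 1, 0, 0, 0], ![0, 0, 1, 0, 0], ![0, -1, -1, 0, 0]],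
    ![![0, -1, 0, 0, 0], ![0, 0, -1, 0, 0], ![0, 1, 1, 0, 0]],
    ![![0, 1, 0, 0, 0], ![0, 0, 0, 0, 1], ![0, -1, 0, 0, -1]],
    ![![0, -1, 0, 0, 0], ![0, 0, 0, 0, -1], ![0, 1, 0, 0, 1]]] :
    Fin 8 → Fin 3 → Fin 5 → ℤ) e.1 e.2

/-- The surface glued from the parallelograms with sides `(a, c)`, `(a, e)`, `(b, c)`, `(b, f)`:
the tori with periods `(a, c + e)` and `(b, c + f)`, slit along `c` and glued crosswise. -/
noncomputable def model (x : Fin 5 → ℂ) : GluedTriangles 8 where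
  glue := modelGlue
  vert := ![![0, x 0, x 0 + x 2], ![x 0 + x 2, x 2, 0],
    ![x 2, x 2 + x 0, x 2 + x 0 + x 3], ![x 2 + x 0 + x 3, x 2 + x 3, x 2],
    ![0, x 1, x 1 + x 2], ![x 1 + x 2, x 2, 0],
    ![x 2, x 2 + x 1, x 2 + x 1 + x 4], ![x 2 + x 1 + x 4, x 2 + x 4, x 2]]

theorem hasTable_model (x : Fin 5 → ℂ) : HasTable (model x) modelGlue modelVec x := by
  refine ⟨rfl, ?_⟩
  rintro ⟨i, k⟩
  fin_cases i <;> fin_cases k <;>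
    simp [side, model, lin, modelVec, Fin.sum_univ_five] <;> ring

/-- The conditions on the parameters of a model surface. -/
structure ModelDomain (x : Fin 5 → ℂ) : Prop where
  ac : 0 < cross (x 0) (x 2)
  ae : 0 < cross (x 0) (x 3)
  bc : 0 < cross (x 1) (x 2)
  bf : 0 < cross (x 1) (x 4)

theorem modelGlue_modelGlue : ∀ e, modelGlue (modelGlue e) = e := by decide

theorem HasTable.signedArea_pos (h : HasTable S g V x)
    (h0 : ∀ i, 0 < cross (lin (V (i, 0)) x) (lin (V (i, 1)) x)) (i : Fin 8) :
    0 < signedArea (S.vert i 0) (S.vert i 1) (S.vert i 2) := by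
  have h1 := S.cross_side_side i 0
  have h2 := h0 i
  rw [← h.2, ← h.2] at h2
  rw [zero_add] at h1
  linarith

theorem lin_modelVec (x : Fin 5 → ℂ) (i : Fin 8) :
    lin (modelVec (i, 0)) x =
      (![x 0, -x 0, x 0, -x 0, x 1, -x 1, x 1, -x 1] : Fin 8 → ℂ) i ∧
    lin (modelVec (i, 1)) x =
      (![x 2, -x 2, x 3, -x 3, x 2, -x 2, x 4, -x 4] : Fin 8 → ℂ) i := by
  fin_cases i <;> simp [lin, modelVec, Fin.sum_univ_five]

theorem admissible_model {x : Fin 5 → ℂ} (hx : ModelDomain x) : (model x).Admissible := by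
  have ht := hasTable_model x
  refine ⟨ht.signedArea_pos ?_, modelGlue_modelGlue, ?_⟩
  · intro i
    rw [(lin_modelVec x i).1, (lin_modelVec x i).2]
    obtain ⟨h1, h2, h3, h4⟩ := hx
    fin_cases i <;> simpa [cross_neg_left, cross_neg_right]
  · intro e
    rw [ht.2, ht.2, ← lin_neg]
    congr 1
    change modelVec (modelGlue e) = - modelVec e
    revert e; decide

/-- The corners of a model surface at the first zero. -/
def modelColour (e : Fin 8 × Fin 3) : Bool :=
  (![![true, true, false], ![false, false, true], ![false, false, true],
    ![true, true, false], ![true, true, false], ![false, false, true], ![false, false, true],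
    ![true, true, false]] : Fin 8 → Fin 3 → Bool) e.1 e.2

theorem modelColour_glue : ∀ e, modelColour e = modelColour ((modelGlue e).1, (modelGlue e).2 + 1) := by
  decide

end GluedTriangles
end TranslationSurface

/-! ### The model surfaces belong to the stratum. -/

namespace TranslationSurface
namespace GluedTriangles

/-- The corner that follows the corner `c` in the cyclic order around a vertex. -/
def turn {n : ℕ} (S : GluedTriangles n) (c : Fin n × Fin 3) : Fin n × Fin 3 :=
  ((S.glue c).1, (S.glue c).2 + 1)

theorem corner_iterate_turn {n : ℕ} (S : GluedTriangles n) (m : ℕ) (c : Fin n × Fin 3) :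
    S.corner (S.turn^[m] c) = S.corner c := by
  induction m with
  | zero => rfl
  | succ m ih =>
    rw [Function.iterate_succ_apply']
    exact (S.corner_glue _).symm.trans ih

variable {x : Fin 5 → ℂ}

theorem corner_model_eq (x : Fin 5 → ℂ) (c : Fin 8 × Fin 3) :
    (model x).corner c = (model x).corner (if modelColour c then (0, 0) else (1, 0)) := by
  -- There are twelve corners at each of the two vertices, so fewer than twelve turns reach all of
  -- them.
  have h : ∀ c, ∃ m : Fin 12, (fun c : Fin 8 × Fin 3 => ((modelGlue c).1, (modelGlue c).2 + 1))^[m.1]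
      (if modelColour c then (0, 0) else (1, 0)) = c := by decide +kernel
  obtain ⟨m, hm⟩ := h c
  conv_lhs => rw [← hm]
  exact (model x).corner_iterate_turn m.1 _

theorem corner_model_eq_iff (hx : ModelDomain x) {c c' : Fin 8 × Fin 3} :
    (model x).corner c = (model x).corner c' ↔ modelColour c = modelColour c' := by
  constructor
  · exact (admissible_model hx).eq_of_corner_eq modelColour modelColour_glue
  · intro h
    rw [corner_model_eq x c, corner_model_eq x c', h]

theorem Admissible.sum_cornerAngle {n : ℕ} {S : GluedTriangles n} (hS : S.Admissible) (i : Fin n) :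
    S.cornerAngle (i, 0) + S.cornerAngle (i, 1) + S.cornerAngle (i, 2) = Real.pi := by
  rw [← cornerAngle_eq, ← cornerAngle_eq, ← cornerAngle_eq]
  have hinj := hS.vert_injective i
  have h01 : S.vert i 1 ≠ S.vert i 0 := fun h => by simpa using hinj h
  have := EuclideanGeometry.angle_add_angle_add_angle_eq_pi (S.vert i 2) h01
  rw [← this]
  rw [EuclideanGeometry.angle_comm (S.vert i 2) (S.vert i 0), EuclideanGeometry.angle_comm
    (S.vert i 1) (S.vert i 2), EuclideanGeometry.angle_comm (S.vert i 0) (S.vert i 1)]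
  simp only [zero_add, show (1 : Fin 3) + 1 = 2 from rfl, show (1 : Fin 3) + 2 = 0 from rfl,
    show (2 : Fin 3) + 1 = 0 from rfl, show (2 : Fin 3) + 2 = 1 from rfl]
  rw [EuclideanGeometry.angle_comm (S.vert i 1) (S.vert i 0) (S.vert i 2),
    EuclideanGeometry.angle_comm (S.vert i 2) (S.vert i 1) (S.vert i 0)]
  try rw [EuclideanGeometry.angle_comm (S.vert i 0) (S.vert i 2) (S.vert i 1)]
  ring

theorem cornerAngle_model (x : Fin 5 → ℂ) (j : Fin 4) (k : Fin 3) :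
    (model x).cornerAngle (![1, 3, 5, 7] j, k) = (model x).cornerAngle (![0, 2, 4, 6] j, k) := by
  have ht := hasTable_model x
  have h : ∀ (j : Fin 4) (k : Fin 3), modelVec (![1, 3, 5, 7] j, k) = -modelVec (![0, 2, 4, 6] j, k) := by
    decide
  simp only [cornerAngle, ht.2, h, lin_neg]
  rw [InnerProductGeometry.angle_neg_neg]

/-- Each parallelogram consists of a triangle and its half-turn, with the same angles but opposite
colours at corresponding corners. Each zero thus receives the full angle sum `π` of each of the four
pairs. -/
theorem totalAngle_model (hx : ModelDomain x) (c : Fin 8 × Fin 3) :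
    (model x).totalAngle ((model x).corner c) = 4 * Real.pi := by
  classical
  have hA := admissible_model hx
  have p0 := hA.sum_cornerAngle 0
  have p2 := hA.sum_cornerAngle 2
  have p4 := hA.sum_cornerAngle 4
  have p6 := hA.sum_cornerAngle 6
  have q := cornerAngle_model x
  have q0 := q 0
  have q1 := q 1
  have q2 := q 2
  have q3 := q 3
  simp only [Matrix.cons_val] at q0 q1 q2 q3
  simp only [totalAngle_eq, corner_model_eq_iff hx, Fintype.sum_prod_type, Fin.sum_univ_eight,
    Fin.sum_univ_three, q0, q1, q2, q3]
  cases modelColour c <;> simp [modelColour] <;> linarith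

theorem isH11_model (hx : ModelDomain x) : (model x).IsH11 := by
  have hA := admissible_model hx
  refine ⟨hA.signedArea_pos, hA.glue_glue, hA.side_glue, ?_, ?_, ?_⟩
  · refine connectedSpace_of_forall _ 0 fun P h0 hP j => ?_
    have g : ∀ e : Fin 8 × Fin 3, e.1 ∈ P → (modelGlue e).1 ∈ P := hP
    have h1 : (1 : Fin 8) ∈ P := g (0, 2) h0
    have h2 : (2 : Fin 8) ∈ P := g (1, 0) h1
    have h3 : (3 : Fin 8) ∈ P := g (2, 1) h2
    have h4 : (4 : Fin 8) ∈ P := g (1, 1) h1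
    have h5 : (5 : Fin 8) ∈ P := g (4, 2) h4
    have h6 : (6 : Fin 8) ∈ P := g (5, 0) h5
    have h7 : (7 : Fin 8) ∈ P := g (6, 1) h6
    fin_cases j <;> assumption
  · have : (model x).vertices = {(model x).corner (0, 0), (model x).corner (1, 0)} := by
      ext z
      constructor
      · rintro ⟨c, rfl⟩
        have h := corner_model_eq x c
        split_ifs at h
        · exact Or.inl h
        · exact Or.inr h
      · rintro (rfl | rfl) <;> exact mem_range_self _
    rw [this, Set.ncard_pair]
    rw [Ne, corner_model_eq_iff hx]
    decide
  · rintro _ ⟨c, rfl⟩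
    exact totalAngle_model hx c

/-- The bijection of sides that sends the triangle `i` to the triangle `p i`, rotated by `r i`. -/
def relabel (p q : Fin 8 → Fin 8) (r : Fin 8 → Fin 3) (h1 : ∀ i, q (p i) = i)
    (h2 : ∀ i, p (q i) = i) : Fin 8 × Fin 3 ≃ Fin 8 × Fin 3 where
  toFun e := (p e.1, e.2 + r e.1)
  invFun e := (q e.1, e.2 - r (q e.1))
  left_inv e := by simp [h1]
  right_inv e := by simp [h2]

theorem isRelabelling_relabel {p q : Fin 8 → Fin 8} {r : Fin 8 → Fin 3} (h1 : ∀ i, q (p i) = i)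
    (h2 : ∀ i, p (q i) = i) : IsRelabelling (relabel p q r h1 h2) := fun e => by
  simp only [relabel, Equiv.coe_fn_mk, Prod.mk.injEq, true_and]
  abel

theorem HasTable.equivalent_model {S : GluedTriangles 8} {g : Fin 8 × Fin 3 → Fin 8 × Fin 3}
    {V : Fin 8 × Fin 3 → Fin 5 → ℤ} (h : HasTable S g V x) (Y : Fin 5 → Fin 5 → ℤ)
    (σ : Fin 8 × Fin 3 ≃ Fin 8 × Fin 3) (hσ : IsRelabelling σ)
    (hg : ∀ e, modelGlue (σ e) = σ (g e))
    (hV : ∀ e, V e = fun s => ∑ r, modelVec (σ e) r * Y r s) (c : Fin 8 × Fin 3) :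
    Equivalent S c (model fun r => lin (Y r) x) (σ c) := by
  obtain ⟨rfl, hV'⟩ := h
  refine equivalent_of_relabelling hσ hg (fun e => ?_) c
  rw [(hasTable_model _).2, lin_comp, hV', hV]

theorem Equivalent.of_corner_eq {n m : ℕ} {S : GluedTriangles n} {S' : GluedTriangles m}
    {c d : Fin n × Fin 3} {c' d' : Fin m × Fin 3} (h : Equivalent S c S' c')
    (h1 : S.corner c = S.corner d) (h2 : S'.corner c' = S'.corner d') : Equivalent S d S' d' := by
  obtain ⟨f, a, b, r⟩ := h
  exact ⟨f, a, by rw [← h1, b, h2], r⟩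

/-- A change of diagonals does not move the corners of the other triangles. -/
theorem Admissible.equivalent_flip_of_ne {n : ℕ} {S : GluedTriangles n} {i : Fin n} {k : Fin 3}
    (hS : S.Admissible) (hc : CanFlip S i k) {c : Fin n × Fin 3} (h1 : c.1 ≠ i)
    (h2 : c.1 ≠ (S.glue (i, k)).1) : Equivalent S c (S.flip i k) c := by
  rcases hg : S.glue (i, k) with ⟨j, l⟩
  rw [hg] at h2
  have h := hS.flipRel_flip hg
  exact h.equivalent hS (hS.flip hc) (hS.area_flip i k).symm (Or.inl ⟨rfl, h1, h2⟩)
    (h.other c.1 h1 h2 c.2)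

end GluedTriangles
end TranslationSurface

/-! ### Isomorphisms between model surfaces with different parameters. -/

namespace TranslationSurface
namespace GluedTriangles

variable {a b c e f : ℂ}

/-- The surface `S₀` is isomorphic, with the corner `d` fixed, to one with the given side vectors
and gluing. -/
def Reaches (S₀ : GluedTriangles 8) (d : Fin 8 × Fin 3) (g : Fin 8 × Fin 3 → Fin 8 × Fin 3)
    (V : Fin 8 × Fin 3 → Fin 5 → ℤ) (x : Fin 5 → ℂ) : Prop :=
  ∃ S : GluedTriangles 8, S.Admissible ∧ HasTable S g V x ∧ Equivalent S₀ d S d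

theorem reaches_model {x : Fin 5 → ℂ} (hx : ModelDomain x) (d : Fin 8 × Fin 3) :
    Reaches (model x) d modelGlue modelVec x :=
  ⟨_, admissible_model hx, hasTable_model x, Equivalent.refl _ _⟩

/-- The four coefficient vectors are arguments so that the convexity conditions are stated with
literals. The label stays in place because its triangle is not one of the two that are changed. -/
theorem Reaches.flip {S₀ : GluedTriangles 8} {d : Fin 8 × Fin 3}
    {g : Fin 8 × Fin 3 → Fin 8 × Fin 3} {V : Fin 8 × Fin 3 → Fin 5 → ℤ} {x : Fin 5 → ℂ}
    (h : Reaches S₀ d g V x) (i : Fin 8) (k : Fin 3) (A B C D : Fin 5 → ℤ)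
    (hA : V (i, k + 2) = A) (hB : V ((g (i, k)).1, (g (i, k)).2 + 1) = B)
    (hC : V ((g (i, k)).1, (g (i, k)).2 + 2) = C) (hD : V (i, k + 1) = D)
    (hi : d.1 ≠ i ∧ d.1 ≠ (g (i, k)).1)
    (h1 : 0 < cross (lin A x) (lin B x)) (h2 : 0 < cross (lin C x) (lin D x)) :
    Reaches S₀ d (flipGlue g i k) (flipVec g V i k) x := by
  obtain ⟨S, hS, ht, he⟩ := h
  subst hA hB hC hD
  have hc := ht.canFlip h1 h2
  refine ⟨S.flip i k, hS.flip hc, ht.flip hS i k, he.trans (hS.equivalent_flip_of_ne hc hi.1 ?_)⟩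
  rw [ht.1]
  exact hi.2

/-- `Y` expresses the parameters of the target by those of the source, and `p`, `r` say to which
triangle, rotated by how much, each triangle goes. The label need only land at a corner of the right
colour, since corners of equal colour are the same vertex. -/
theorem Reaches.equivalent_model {S₀ : GluedTriangles 8} {d : Fin 8 × Fin 3}
    {g : Fin 8 × Fin 3 → Fin 8 × Fin 3} {V : Fin 8 × Fin 3 → Fin 5 → ℤ} {x : Fin 5 → ℂ}
    (h : Reaches S₀ d g V x) (Y : Fin 5 → Fin 5 → ℤ) (p q : Fin 8 → Fin 8) (r : Fin 8 → Fin 3)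
    (h1 : ∀ i, q (p i) = i) (h2 : ∀ i, p (q i) = i)
    (hg : ∀ e, modelGlue (relabel p q r h1 h2 e) = relabel p q r h1 h2 (g e))
    (hV : ∀ e, V e = fun s => ∑ t, modelVec (relabel p q r h1 h2 e) t * Y t s)
    {y : Fin 5 → ℂ} (hy : ∀ t, y t = lin (Y t) x) {d' : Fin 8 × Fin 3}
    (hd : modelColour (relabel p q r h1 h2 d) = modelColour d') {d₀ : Fin 8 × Fin 3}
    (hd₀ : S₀.corner d = S₀.corner d₀) : Equivalent S₀ d₀ (model y) d' := by
  obtain ⟨S, hS, ht, he⟩ := h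
  have h3 := he.trans (ht.equivalent_model Y _ (isRelabelling_relabel h1 h2) hg hV d)
  rw [← funext hy] at h3
  refine h3.of_corner_eq hd₀ ?_
  rw [corner_model_eq, hd, ← corner_model_eq]

/-- The first zero is also a corner of triangles that a given sequence of flips leaves alone; the
label is moved there before the flips. -/
theorem corner_model_four_zero (x : Fin 5 → ℂ) :
    (model x).corner (4, 0) = (model x).corner (0, 0) := corner_model_eq x (4, 0)

theorem corner_model_three_zero (x : Fin 5 → ℂ) :
    (model x).corner (3, 0) = (model x).corner (0, 0) := corner_model_eq x (3, 0)

theorem modelDomain_iff : ModelDomain ![a, b, c, e, f] ↔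
    0 < cross a c ∧ 0 < cross a e ∧ 0 < cross b c ∧ 0 < cross b f :=
  ⟨fun h => ⟨h.1, h.2, h.3, h.4⟩, fun h => ⟨h.1, h.2.1, h.2.2.1, h.2.2.2⟩⟩

/-- The halves of a model surface are interchanged. -/
theorem equivalent_model_swap (hx : ModelDomain ![a, b, c, e, f]) :
    Equivalent (model ![a, b, c, e, f]) (0, 0) (model ![b, a, c, f, e]) (0, 0) := by
  refine (reaches_model hx (0, 0)).equivalent_model
    ![![0, 1, 0, 0, 0], ![1, 0, 0, 0, 0], ![0, 0, 1, 0, 0], ![0, 0, 0, 0, 1], ![0, 0, 0, 1, 0]]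
    ![4, 5, 6, 7, 0, 1, 2, 3] ![4, 5, 6, 7, 0, 1, 2, 3] ![0, 0, 0, 0, 0, 0, 0, 0]
    (by decide) (by decide) (by decide +kernel) (by decide +kernel) (fun t => ?_) (by decide) rfl
  fin_cases t <;> simp [lin, Fin.sum_univ_five]

/-- The rotation by the angle `π` interchanges the zeros. -/
theorem equivalent_model_rotate (hx : ModelDomain ![a, b, c, e, f]) {d : Fin 8 × Fin 3}
    (hd : modelColour d = false) :
    Equivalent (model ![a, b, c, e, f]) d (model ![-a, -b, -c, -e, -f]) (0, 0) := by
  refine (reaches_model hx (1, 0)).equivalent_model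
    ![![-1, 0, 0, 0, 0], ![0, -1, 0, 0, 0], ![0, 0, -1, 0, 0], ![0, 0, 0, -1, 0], ![0, 0, 0, 0, -1]]
    ![1, 0, 3, 2, 5, 4, 7, 6] ![1, 0, 3, 2, 5, 4, 7, 6] ![0, 0, 0, 0, 0, 0, 0, 0]
    (by decide) (by decide) (by decide +kernel) (by decide +kernel) (fun t => ?_) (by decide) ?_
  · fin_cases t <;> simp [lin, Fin.sum_univ_five]
  · have := corner_model_eq ![a, b, c, e, f] d
    rw [hd] at this
    exact this.symm

/-- The first torus is glued from other parallelograms with the same side `a`. -/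
theorem equivalent_model_shear (hx : ModelDomain ![a, b, c, e, f]) :
    Equivalent (model ![a, b, c, e, f]) (0, 0) (model ![a, b, c, e - a, f]) (0, 0) := by
  have hx' := modelDomain_iff.1 hx
  -- The only flip takes the other diagonal `e - a` of the parallelogram with sides `a` and `e`; cut
  -- along it and reassembled, this is the parallelogram with sides `a` and `e - a`.
  refine ((reaches_model hx (4, 0)).flip 2 2 ![0, 0, 0, 1, 0] ![-1, 0, 0, 0, 0]
    ![0, 0, 0, -1, 0] ![1, 0, 0, 0, 0] (by decide +kernel)
    (by decide +kernel) (by decide +kernel) (by decide +kernel) (by decide +kernel) ?_ ?_).equivalent_model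
    ![![1, 0, 0, 0, 0], ![0, 1, 0, 0, 0], ![0, 0, 1, 0, 0], ![-1, 0, 0, 1, 0], ![0, 0, 0, 0, 1]]
    ![0, 1, 3, 2, 4, 5, 6, 7] ![0, 1, 3, 2, 4, 5, 6, 7] ![0, 0, 2, 2, 0, 0, 0, 0]
    (by decide) (by decide) (by decide +kernel) (by decide +kernel) (fun t => ?_) (by decide)
    (corner_model_four_zero _)
  on_goal -1 => fin_cases t <;> simp [lin, Fin.sum_univ_five] <;> ring
  all_goals
    simp [lin, Fin.sum_univ_five, cross_neg_right, cross_neg_left]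
    linarith [cross_comm a c, cross_comm a e, cross_comm c e, cross_comm a b, cross_comm b c,
      cross_self a, cross_self b, cross_self c, cross_self e]

/-- The first torus is glued from other parallelograms with the same transversal period. -/
theorem equivalent_model_shear' (hx : ModelDomain ![a, b, c, e, f])
    (h1 : 0 < cross (a + c) e) (h2 : 0 < cross (a + e) c) :
    Equivalent (model ![a, b, c, e, f]) (0, 0) (model ![a + c + e, b, c, e, f]) (0, 0) := by
  have hx' := modelDomain_iff.1 hx
  simp only [cross_add_left] at h1 h2
  -- The first two flips replace the two sides `a` by `a + c + e`. The last two give the new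
  -- parallelograms, with sides `a + c + e, c` and `a + c + e, e`, the diagonals of the model. The
  -- hypotheses make all four quadrilaterals convex.
  refine (((((reaches_model hx (4, 0)).flip 0 0 ![-1, 0, -1, 0, 0] ![0, 0, 0, -1, 0]
    ![1, 0, 0, 1, 0] ![0, 0, 1, 0, 0] (by decide +kernel)
    (by decide +kernel) (by decide +kernel) (by decide +kernel) (by decide +kernel) ?_ ?_).flip 1 0 ![1, 0, 1, 0, 0] ![0, 0, 0, 1, 0]
    ![-1, 0, 0, -1, 0] ![0, 0, -1, 0, 0] (by decide +kernel)
    (by decide +kernel) (by decide +kernel) (by decide +kernel) (by decide +kernel) ?_ ?_).flip 2 1 ![1, 0, 1, 1, 0] ![0, 0, 1, 0, 0]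
    ![-1, 0, -1, -1, 0] ![0, 0, -1, 0, 0] (by decide +kernel)
    (by decide +kernel) (by decide +kernel) (by decide +kernel) (by decide +kernel) ?_ ?_).flip 0 1 ![1, 0, 1, 1, 0] ![0, 0, 0, 1, 0]
    ![-1, 0, -1, -1, 0] ![0, 0, 0, -1, 0] (by decide +kernel)
    (by decide +kernel) (by decide +kernel) (by decide +kernel) (by decide +kernel) ?_ ?_).equivalent_model
    ![![1, 0, 1, 1, 0], ![0, 1, 0, 0, 0], ![0, 0, 1, 0, 0], ![0, 0, 0, 1, 0], ![0, 0, 0, 0, 1]]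
    ![2, 3, 0, 1, 4, 5, 6, 7] ![2, 3, 0, 1, 4, 5, 6, 7] ![1, 1, 1, 1, 0, 0, 0, 0]
    (by decide) (by decide) (by decide +kernel) (by decide +kernel) (fun t => ?_) (by decide)
    (corner_model_four_zero _)
  on_goal -1 => fin_cases t <;> simp [lin, Fin.sum_univ_five]
  all_goals
    simp [lin, Fin.sum_univ_five, cross_neg_right, cross_neg_left, cross_add_left]
    linarith [cross_comm a c, cross_comm a e, cross_comm c e, cross_comm a b, cross_comm b c,
      cross_self a, cross_self b, cross_self c, cross_self e]

/-- The two tori are separated along another pair of segments. -/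
theorem equivalent_model_twist (hx : ModelDomain ![a, b, c, e, f])
    (h1 : 0 < cross a (b + c)) (h2 : 0 < cross b (a + c)) :
    Equivalent (model ![a, b, c, e, f]) (0, 0) (model ![a, b, c + a + b, e, f]) (0, 0) := by
  have hx' := modelDomain_iff.1 hx
  simp only [cross_add_right] at h1 h2
  -- The first two flips replace the two sides `c` by `a + b + c`; the last two restore the
  -- diagonals of the model in the parallelograms that have the new slit as a side.
  refine (((((reaches_model hx (3, 0)).flip 0 1 ![1, 0, 0, 0, 0] ![0, 1, 1, 0, 0]
    ![0, -1, 0, 0, 0] ![-1, 0, -1, 0, 0] (by decide +kernel)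
    (by decide +kernel) (by decide +kernel) (by decide +kernel) (by decide +kernel) ?_ ?_).flip 1 1 ![-1, 0, 0, 0, 0] ![0, -1, -1, 0, 0]
    ![0, 1, 0, 0, 0] ![1, 0, 1, 0, 0] (by decide +kernel)
    (by decide +kernel) (by decide +kernel) (by decide +kernel) (by decide +kernel) ?_ ?_).flip 0 0 ![1, 0, 0, 0, 0] ![1, 1, 1, 0, 0]
    ![-1, 0, 0, 0, 0] ![-1, -1, -1, 0, 0] (by decide +kernel)
    (by decide +kernel) (by decide +kernel) (by decide +kernel) (by decide +kernel) ?_ ?_).flip 4 0 ![0, 1, 0, 0, 0] ![1, 1, 1, 0, 0]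
    ![0, -1, 0, 0, 0] ![-1, -1, -1, 0, 0] (by decide +kernel)
    (by decide +kernel) (by decide +kernel) (by decide +kernel) (by decide +kernel) ?_ ?_).equivalent_model
    ![![1, 0, 0, 0, 0], ![0, 1, 0, 0, 0], ![1, 1, 1, 0, 0], ![0, 0, 0, 1, 0], ![0, 0, 0, 0, 1]]
    ![0, 1, 2, 3, 4, 5, 6, 7] ![0, 1, 2, 3, 4, 5, 6, 7] ![2, 2, 0, 0, 2, 2, 0, 0]
    (by decide) (by decide) (by decide +kernel) (by decide +kernel) (fun t => ?_) (by decide)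
    (corner_model_three_zero _)
  on_goal -1 => fin_cases t <;> simp [lin, Fin.sum_univ_five] <;> ring
  all_goals
    simp [lin, Fin.sum_univ_five, cross_neg_right, cross_neg_left, cross_add_right]
    linarith [cross_comm a c, cross_comm a e, cross_comm c e, cross_comm a b, cross_comm b c,
      cross_self a, cross_self b, cross_self c, cross_self e]

end GluedTriangles
end TranslationSurface

/-! ### Coordinates in the four parallelograms of a model surface. -/

namespace TranslationSurface
namespace GluedTriangles

/-- The parallelogram that contains a triangle of a model surface. -/
def par : Fin 8 → Fin 4 := ![0, 0, 1, 1, 2, 2, 3, 3]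

/-- The lower triangle of a parallelogram of a model surface. -/
def lower : Fin 4 → Fin 8 := ![0, 2, 4, 6]

/-- The upper triangle of a parallelogram of a model surface. -/
def upper : Fin 4 → Fin 8 := ![1, 3, 5, 7]

/-- The base points of the parallelograms of a model surface. -/
def parBase (x : Fin 5 → ℂ) : Fin 4 → ℂ := ![0, x 2, 0, x 2]

/-- The horizontal sides of the parallelograms of a model surface. -/
def parHor (x : Fin 5 → ℂ) : Fin 4 → ℂ := ![x 0, x 0, x 1, x 1]

/-- The transversal sides of the parallelograms of a model surface. -/
def parTrans (x : Fin 5 → ℂ) : Fin 4 → ℂ := ![x 2, x 3, x 2, x 4]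

/-- The parallelogram to the right of a parallelogram. -/
def parRight : Fin 4 → Fin 4 := ![2, 1, 0, 3]

/-- The parallelogram above a parallelogram. -/
def parAbove : Fin 4 → Fin 4 := ![1, 0, 3, 2]

/-- The point with given coordinates in a parallelogram of a model surface. -/
noncomputable def parPoint (x : Fin 5 → ℂ) (j : Fin 4) (s t : ℝ) : ℂ :=
  parBase x j + s * parHor x j + t * parTrans x j

variable {x : Fin 5 → ℂ}

theorem ModelDomain.cross_pos (hx : ModelDomain x) (j : Fin 4) :
    0 < cross (parHor x j) (parTrans x j) := by
  obtain ⟨h1, h2, h3, h4⟩ := hx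
  fin_cases j <;> simpa [parHor, parTrans]

theorem vert_lower (x : Fin 5 → ℂ) (j : Fin 4) :
    (model x).vert (lower j) 0 = parPoint x j 0 0 ∧ (model x).vert (lower j) 1 = parPoint x j 1 0 ∧
    (model x).vert (lower j) 2 = parPoint x j 1 1 := by
  fin_cases j <;> simp [model, lower, parPoint, parBase, parHor, parTrans]

theorem vert_upper (x : Fin 5 → ℂ) (j : Fin 4) :
    (model x).vert (upper j) 0 = parPoint x j 1 1 ∧ (model x).vert (upper j) 1 = parPoint x j 0 1 ∧
    (model x).vert (upper j) 2 = parPoint x j 0 0 := by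
  fin_cases j <;> simp [model, upper, parPoint, parBase, parHor, parTrans]

theorem eq_lower_or_upper : ∀ i, i = lower (par i) ∨ i = upper (par i) := by decide

theorem exists_coords_lower {j : Fin 4} {z : ℂ} :
    z ∈ (model x).triangle (lower j) ↔ ∃ s t : ℝ, 0 ≤ t ∧ t ≤ s ∧ s ≤ 1 ∧ z = parPoint x j s t := by
  obtain ⟨h0, h1, h2⟩ := vert_lower x j
  rw [mem_triangle_iff_weights _ _ 0, zero_add, zero_add, h0, h1, h2]
  simp only [parPoint]
  constructor
  · rintro ⟨p, q, r, hp, hq, hr, h, rfl⟩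
    refine ⟨q + r, r, hr, by linarith, by linarith, ?_⟩
    have h' : (p + q + r : ℂ) = 1 := by exact_mod_cast h
    push_cast
    linear_combination (parBase x j) * h'
  · rintro ⟨s, t, h3, h4, h5, rfl⟩
    refine ⟨1 - s, s - t, t, by linarith, by linarith, h3, by ring, ?_⟩
    push_cast
    ring

theorem exists_coords_upper {j : Fin 4} {z : ℂ} :
    z ∈ (model x).triangle (upper j) ↔ ∃ s t : ℝ, 0 ≤ s ∧ s ≤ t ∧ t ≤ 1 ∧ z = parPoint x j s t := by
  obtain ⟨h0, h1, h2⟩ := vert_upper x j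
  rw [mem_triangle_iff_weights _ _ 0, zero_add, zero_add, h0, h1, h2]
  simp only [parPoint]
  constructor
  · rintro ⟨p, q, r, hp, hq, hr, h, rfl⟩
    refine ⟨p, p + q, hp, by linarith, by linarith, ?_⟩
    have h' : (p + q + r : ℂ) = 1 := by exact_mod_cast h
    push_cast
    linear_combination (parBase x j) * h'
  · rintro ⟨s, t, h3, h4, h5, rfl⟩
    refine ⟨s, t - s, 1 - t, h3, by linarith, by linarith, by ring, ?_⟩
    push_cast
    ring

/-- The point `z` of a model surface has the coordinates `s`, `t` in the parallelogram `j`. -/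
def IsParPoint (x : Fin 5 → ℂ) (j : Fin 4) (s t : ℝ) (z : (model x).Surface) : Prop :=
  ∃ p : (model x).Points, par p.1.1 = j ∧ p.coord = parPoint x j s t ∧ (model x).proj p = z

theorem coords_of_point (hx : ModelDomain x) (p : (model x).Points) {j : Fin 4} {s t : ℝ}
    (hj : par p.1.1 = j) (hp : p.coord = parPoint x j s t) :
    (p.1.1 = lower j ∧ 0 ≤ t ∧ t ≤ s ∧ s ≤ 1) ∨ (p.1.1 = upper j ∧ 0 ≤ s ∧ s ≤ t ∧ t ≤ 1) := by
  have hmem := p.2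
  have huniq : ∀ s' t' : ℝ, p.coord = parPoint x j s' t' → s' = s ∧ t' = t := by
    intro s' t' h
    apply eq_and_eq_of_cross (hx.cross_pos j).ne'
    rw [hp] at h
    simp only [parPoint] at h
    linear_combination -h
  rcases eq_lower_or_upper p.1.1 with h | h <;> rw [hj] at h <;> rw [h] at hmem
  · obtain ⟨s', t', h1, h2, h3, h4⟩ := exists_coords_lower.1 hmem
    obtain ⟨rfl, rfl⟩ := huniq s' t' h4
    exact Or.inl ⟨h, h1, h2, h3⟩
  · obtain ⟨s', t', h1, h2, h3, h4⟩ := exists_coords_upper.1 hmem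
    obtain ⟨rfl, rfl⟩ := huniq s' t' h4
    exact Or.inr ⟨h, h1, h2, h3⟩

theorem glue_diag : ∀ j, modelGlue (lower j, 2) = (upper j, 2) := by decide
theorem glue_right : ∀ j, modelGlue (lower j, 1) = (upper (parRight j), 1) := by decide
theorem glue_above : ∀ j, modelGlue (upper j, 0) = (lower (parAbove j), 0) := by decide
theorem glue_left : ∀ j, modelGlue (upper j, 1) = (lower (parRight j), 1) := by decide
theorem glue_below : ∀ j, modelGlue (lower j, 0) = (upper (parAbove j), 0) := by decide
theorem glue_diag' : ∀ j, modelGlue (upper j, 2) = (lower j, 2) := by decide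
theorem par_lower : ∀ j, par (lower j) = j := by decide
theorem par_upper : ∀ j, par (upper j) = j := by decide

theorem sidePoint_lower (x : Fin 5 → ℂ) (j : Fin 4) (r : ℝ) :
    (model x).sidePoint (lower j, 0) r = parPoint x j r 0 ∧
    (model x).sidePoint (lower j, 1) r = parPoint x j 1 r ∧
    (model x).sidePoint (lower j, 2) r = parPoint x j (1 - r) (1 - r) := by
  obtain ⟨h0, h1, h2⟩ := vert_lower x j
  simp only [sidePoint, zero_add, show (1 : Fin 3) + 1 = 2 from rfl, show (2 : Fin 3) + 1 = 0 from rfl,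
    h0, h1, h2, parPoint]
  push_cast
  refine ⟨?_, ?_, ?_⟩ <;> ring

theorem sidePoint_upper (x : Fin 5 → ℂ) (j : Fin 4) (r : ℝ) :
    (model x).sidePoint (upper j, 0) r = parPoint x j (1 - r) 1 ∧
    (model x).sidePoint (upper j, 1) r = parPoint x j 0 (1 - r) ∧
    (model x).sidePoint (upper j, 2) r = parPoint x j r r := by
  obtain ⟨h0, h1, h2⟩ := vert_upper x j
  simp only [sidePoint, zero_add, show (1 : Fin 3) + 1 = 2 from rfl, show (2 : Fin 3) + 1 = 0 from rfl,
    h0, h1, h2, parPoint]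
  push_cast
  refine ⟨?_, ?_, ?_⟩ <;> ring

/-- A point with given coordinates is represented twice only on the diagonal `s = t`, and there the
two triangles are glued. -/
theorem IsParPoint.unique (hx : ModelDomain x) {j : Fin 4} {s t : ℝ} {z z' : (model x).Surface}
    (h : IsParPoint x j s t z) (h' : IsParPoint x j s t z') : z = z' := by
  have key : ∀ p q : (model x).Points, p.1.1 = lower j → q.1.1 = upper j →
      p.coord = parPoint x j s t → q.coord = parPoint x j s t →
      (model x).proj p = (model x).proj q := by
    intro p q hp hq hp' hq'
    have a1 := coords_of_point hx p (by rw [hp, par_lower]) hp'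
    have a2 := coords_of_point hx q (by rw [hq, par_upper]) hq'
    have hne : ∀ j, lower j ≠ upper j := by decide
    rw [hp] at a1
    rw [hq] at a2
    simp only [hne, (hne _).symm, false_and, true_and, false_or, or_false] at a1 a2
    obtain rfl : t = s := le_antisymm a1.2.1 a2.2.1
    apply proj_eq_of_glued
    refine ⟨(lower j, 2), 1 - t, ⟨by linarith [a1.2.2], by linarith [a1.1]⟩, Prod.ext hp ?_, ?_⟩
    · rw [(sidePoint_lower x j _).2.2, sub_sub_cancel]; exact hp'
    · change q.1 = ((modelGlue (lower j, 2)).1, (model x).sidePoint (modelGlue (lower j, 2)) _)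
      rw [glue_diag, (sidePoint_upper x j _).2.2, sub_sub_cancel]
      exact Prod.ext hq hq'
  obtain ⟨p, h1, h2, rfl⟩ := h
  obtain ⟨q, h3, h4, rfl⟩ := h'
  rcases eq_lower_or_upper p.1.1 with a1 | a1 <;> rcases eq_lower_or_upper q.1.1 with a2 | a2 <;>
    rw [h1] at a1 <;> rw [h3] at a2
  · rw [Points.ext' (a1.trans a2.symm) (h2.trans h4.symm)]
  · exact key p q a1 a2 h2 h4
  · exact (key q p a2 a1 h4 h2).symm
  · rw [Points.ext' (a1.trans a2.symm) (h2.trans h4.symm)]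

theorem exists_isParPoint (x : Fin 5 → ℂ) (j : Fin 4) {s t : ℝ} (hs : s ∈ Icc (0 : ℝ) 1)
    (ht : t ∈ Icc (0 : ℝ) 1) : ∃ z, IsParPoint x j s t z := by
  rcases le_total t s with h | h
  · exact ⟨_, ⟨(lower j, _), exists_coords_lower.2 ⟨s, t, ht.1, h, hs.2, rfl⟩⟩, par_lower j, rfl, rfl⟩
  · exact ⟨_, ⟨(upper j, _), exists_coords_upper.2 ⟨s, t, hs.1, h, ht.2, rfl⟩⟩, par_upper j, rfl, rfl⟩

theorem IsParPoint.right (hx : ModelDomain x) {j : Fin 4} {t : ℝ} {z : (model x).Surface}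
    (h : IsParPoint x j 1 t z) (ht : t ∈ Icc (0 : ℝ) 1) : IsParPoint x (parRight j) 0 t z := by
  have h1 : IsParPoint x j 1 t ((model x).proj ((model x).sidePt (lower j, 1) ⟨t, ht⟩)) :=
    ⟨(model x).sidePt (lower j, 1) ⟨t, ht⟩, par_lower j, (sidePoint_lower x j t).2.1, rfl⟩
  rw [h.unique hx h1]
  have ht' : 1 - t ∈ Icc (0 : ℝ) 1 := ⟨by linarith [ht.2], by linarith [ht.1]⟩
  refine ⟨(model x).sidePt (upper (parRight j), 1) ⟨1 - t, ht'⟩, par_upper _, ?_, ?_⟩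
  · exact ((sidePoint_upper x _ _).2.1).trans (by rw [sub_sub_cancel])
  · refine (proj_eq_of_glued ⟨(lower j, 1), t, ht, rfl, ?_⟩).symm
    change _ = ((modelGlue (lower j, 1)).1, (model x).sidePoint (modelGlue (lower j, 1)) _)
    rw [glue_right]
    rfl

theorem IsParPoint.above (hx : ModelDomain x) {j : Fin 4} {s : ℝ} {z : (model x).Surface}
    (h : IsParPoint x j s 1 z) (hs : s ∈ Icc (0 : ℝ) 1) : IsParPoint x (parAbove j) s 0 z := by
  have hs' : 1 - s ∈ Icc (0 : ℝ) 1 := ⟨by linarith [hs.2], by linarith [hs.1]⟩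
  have h1 : IsParPoint x j s 1 ((model x).proj ((model x).sidePt (upper j, 0) ⟨1 - s, hs'⟩)) :=
    ⟨(model x).sidePt (upper j, 0) ⟨1 - s, hs'⟩, par_upper j,
      ((sidePoint_upper x j _).1).trans (by rw [sub_sub_cancel]), rfl⟩
  rw [h.unique hx h1]
  refine ⟨(model x).sidePt (lower (parAbove j), 0) ⟨s, hs⟩, par_lower _, (sidePoint_lower x _ _).1, ?_⟩
  refine (proj_eq_of_glued ⟨(upper j, 0), 1 - s, hs', rfl, ?_⟩).symm
  change _ = ((modelGlue (upper j, 0)).1, (model x).sidePoint (modelGlue (upper j, 0)) _)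
  rw [glue_above, sub_sub_cancel]
  rfl

theorem exists_isParPoint_of_point (hx : ModelDomain x) (z : (model x).Surface) :
    ∃ j, ∃ s ∈ Ico (0 : ℝ) 1, ∃ t ∈ Ico (0 : ℝ) 1, IsParPoint x j s t z := by
  obtain ⟨p, rfl⟩ := (model x).proj_surjective z
  have h0 : ∃ j, ∃ s ∈ Icc (0 : ℝ) 1, ∃ t ∈ Icc (0 : ℝ) 1, IsParPoint x j s t ((model x).proj p) := by
    have hmem := p.2
    refine ⟨par p.1.1, ?_⟩
    rcases eq_lower_or_upper p.1.1 with h | h <;> rw [h] at hmem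
    · obtain ⟨s, t, h1, h2, h3, h4⟩ := exists_coords_lower.1 hmem
      exact ⟨s, ⟨h1.trans h2, h3⟩, t, ⟨h1, h2.trans h3⟩, p, rfl, h4, rfl⟩
    · obtain ⟨s, t, h1, h2, h3, h4⟩ := exists_coords_upper.1 hmem
      exact ⟨s, ⟨h1, h2.trans h3⟩, t, ⟨h1.trans h2, h3⟩, p, rfl, h4, rfl⟩
  obtain ⟨j, s, hs, t, ht, h⟩ := h0
  have h1 : ∃ j, ∃ s ∈ Ico (0 : ℝ) 1, IsParPoint x j s t ((model x).proj p) := by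
    rcases hs.2.lt_or_eq with h1 | rfl
    · exact ⟨j, s, ⟨hs.1, h1⟩, h⟩
    · exact ⟨_, 0, by simp, h.right hx ht⟩
  obtain ⟨j, s, hs, h⟩ := h1
  rcases ht.2.lt_or_eq with h1 | rfl
  · exact ⟨j, s, hs, t, ⟨ht.1, h1⟩, h⟩
  · exact ⟨_, s, hs, 0, by simp, h.above hx ⟨hs.1, hs.2.le⟩⟩

/-- A point that is no vertex has at most two representatives, glued along one pair of sides. Across
an edge of a parallelogram one of the two has a coordinate equal to one, which is excluded; across a
diagonal the coordinates agree. -/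
theorem IsParPoint.coords_eq (hx : ModelDomain x) {j j' : Fin 4} {s t s' t' : ℝ}
    {z : (model x).Surface} (h : IsParPoint x j s t z) (h' : IsParPoint x j' s' t' z)
    (hz : z ∉ (model x).vertices) (hs : s < 1) (ht : t < 1) (hs' : s' < 1) (ht' : t' < 1) :
    j = j' ∧ s = s' ∧ t = t' := by
  obtain ⟨p, h1, h2, rfl⟩ := h
  obtain ⟨q, h3, h4, h5⟩ := h'
  have huniq : ∀ {j : Fin 4} {a b a' b' : ℝ}, parPoint x j a b = parPoint x j a' b' →
      a = a' ∧ b = b' := by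
    intro j a b a' b' h
    apply eq_and_eq_of_cross (hx.cross_pos j).ne'
    simp only [parPoint] at h
    linear_combination h
  rcases (admissible_model hx).eq_or_glued_of_proj_eq h5.symm
    (fun c hc => hz (by rw [hc]; exact ⟨c, rfl⟩)) with rfl | ⟨⟨i, k⟩, r, hr, hp, hq⟩
  · obtain rfl : j = j' := h1.symm.trans h3
    exact ⟨rfl, huniq (h2.symm.trans h4)⟩
  · have hp1 : p.1.1 = i := by rw [hp]
    have hp2 : p.coord = (model x).sidePoint (i, k) r := by simp only [Points.coord, hp]
    change q.1 = ((modelGlue (i, k)).1, (model x).sidePoint (modelGlue (i, k)) _) at hq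
    have hq1 : q.1.1 = (modelGlue (i, k)).1 := by rw [hq]
    have hq2 : q.coord = (model x).sidePoint (modelGlue (i, k)) (1 - r) := by
      simp only [Points.coord, hq]
    rw [hp1] at h1
    rw [hq1] at h3
    rw [hp2] at h2
    rw [hq2] at h4
    subst h1
    have hk := fin3_cases 0 k
    simp only [zero_add] at hk
    rcases eq_lower_or_upper i with h | h <;> generalize par i = j at h h2 ⊢ <;> subst h <;>
      rcases hk with rfl | rfl | rfl
    · rw [glue_below, par_upper] at h3
      subst h3
      rw [glue_below, (sidePoint_upper x _ _).1] at h4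
      exact absurd (huniq h4).2 ht'.ne'
    · rw [(sidePoint_lower x _ _).2.1] at h2
      exact absurd (huniq h2).1 hs.ne'
    · rw [glue_diag, par_upper] at h3
      subst h3
      rw [glue_diag, (sidePoint_upper x _ _).2.2] at h4
      rw [(sidePoint_lower x _ _).2.2] at h2
      obtain ⟨rfl, rfl⟩ := huniq h2
      exact ⟨rfl, huniq h4⟩
    · rw [(sidePoint_upper x _ _).1] at h2
      exact absurd (huniq h2).2 ht.ne'
    · rw [glue_left, par_lower] at h3
      subst h3
      rw [glue_left, (sidePoint_lower x _ _).2.1] at h4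
      exact absurd (huniq h4).1 hs'.ne'
    · rw [glue_diag', par_lower] at h3
      subst h3
      rw [glue_diag', (sidePoint_lower x _ _).2.2, sub_sub_cancel] at h4
      rw [(sidePoint_upper x _ _).2.2] at h2
      obtain ⟨rfl, rfl⟩ := huniq h2
      exact ⟨rfl, huniq h4⟩

end GluedTriangles
end TranslationSurface

/-! ### Fundamental domains and indices of plane lattices. -/

namespace TranslationSurface

theorem mem_span_two {a w z : ℂ} :
    z ∈ Submodule.span ℤ ({a, w} : Set ℂ) ↔ ∃ m n : ℤ, (m : ℂ) * a + n * w = z := by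
  simp [Submodule.mem_span_pair]

/-- A strip of two parallelograms is a fundamental domain of a lattice. -/
theorem existsUnique_strip {a c e : ℂ} (hc : 0 < cross a c) (he : 0 < cross a e) (z : ℂ) :
    ∃! i : Bool × ℝ × ℝ, (i.2.1 ∈ Ico (0 : ℝ) 1 ∧ i.2.2 ∈ Ico (0 : ℝ) 1) ∧
      z - (bif i.1 then c + i.2.1 * a + i.2.2 * e else i.2.1 * a + i.2.2 * c) ∈
        Submodule.span ℤ ({a, c + e} : Set ℂ) := by
  have ha : a ≠ 0 := by rintro rfl; simp [cross_zero_left] at hc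
  have hpar : ∀ z : ℂ, cross a z = 0 → ∃ r : ℝ, z = r * a := by
    intro z hz
    have h := eq_of_cross_ne_zero hc.ne' z
    rw [hz] at h
    exact ⟨cross z c / cross a c, by simpa using h⟩
  have hH : 0 < cross a c + cross a e := by linarith
  have hex : ∀ (b : ℂ) (t : ℝ) (y : ℂ) (n : ℤ), cross a (z - n * (c + e) - b - t * y) = 0 →
      ∃ s ∈ Ico (0 : ℝ) 1, z - (b + s * a + t * y) ∈ Submodule.span ℤ ({a, c + e} : Set ℂ) := by
    intro b t y n h
    obtain ⟨r, hr⟩ := hpar _ h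
    refine ⟨Int.fract r, ⟨Int.fract_nonneg r, Int.fract_lt_one r⟩, mem_span_two.2 ⟨⌊r⌋, n, ?_⟩⟩
    have : (r : ℂ) = ((Int.fract r : ℝ) : ℂ) + (⌊r⌋ : ℂ) := by
      exact_mod_cast (Int.fract_add_floor r).symm
    rw [this] at hr
    linear_combination -hr
  -- The height `cross a` of the lattice takes the multiples of the height of the whole strip. `n`
  -- counts the strips below `z`, and the remaining height `q` decides which of the two
  -- parallelograms is met, and at which `t`.
  set n := ⌊cross a z / (cross a c + cross a e)⌋ with hn
  set q := cross a z - n * (cross a c + cross a e) with hq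
  have hq0 : 0 ≤ q := by
    have := Int.floor_le (cross a z / (cross a c + cross a e))
    rw [le_div_iff₀ hH] at this
    linarith
  have hq1 : q < cross a c + cross a e := by
    have := Int.lt_floor_add_one (cross a z / (cross a c + cross a e))
    rw [div_lt_iff₀ hH] at this
    linarith
  have hcr : ∀ (m : ℤ) (w : ℂ), cross a (m * w) = m * cross a w := by
    intro m w
    have := cross_smul_right m a w
    push_cast at this
    exact this
  apply existsUnique_of_exists_of_unique
  · by_cases h : q < cross a c
    · obtain ⟨s, hs, hm⟩ := hex 0 (q / cross a c) c n (by
        rw [cross_sub_right, cross_sub_right, cross_sub_right, hcr, cross_smul_right, cross_zero_right,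
          cross_add_right]
        field_simp
        linarith)
      exact ⟨(false, s, q / cross a c), ⟨hs, div_nonneg hq0 hc.le, (div_lt_one hc).2 h⟩,
        by simpa using hm⟩
    · push Not at h
      obtain ⟨s, hs, hm⟩ := hex c ((q - cross a c) / cross a e) e n (by
        rw [cross_sub_right, cross_sub_right, cross_sub_right, hcr, cross_smul_right,
          cross_add_right]
        field_simp
        linarith)
      exact ⟨(true, s, (q - cross a c) / cross a e), ⟨hs, div_nonneg (by linarith) he.le,
        (div_lt_one he).2 (by linarith)⟩, by simpa using hm⟩
  · have key : ∀ b s t, s ∈ Ico (0 : ℝ) 1 → t ∈ Ico (0 : ℝ) 1 →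
        z - (bif b then c + s * a + t * e else s * a + t * c) ∈
          Submodule.span ℤ ({a, c + e} : Set ℂ) →
        (bif b then cross a c + t * cross a e else t * cross a c) = q ∧
        (b = true ↔ cross a c ≤ q) := by
      intro b s t hs ht h
      obtain ⟨m, l, h⟩ := mem_span_two.1 h
      have h1 := congrArg (cross a) h
      rw [cross_sub_right, cross_add_right, hcr, hcr, cross_self, cross_add_right] at h1
      have e1 : cross a (bif b then c + s * a + t * e else s * a + t * c) =
          bif b then cross a c + t * cross a e else t * cross a c := by
        cases b <;> simp [cross_add_right, cross_smul_right, cross_self]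
      rw [e1] at h1
      set X := bif b then cross a c + t * cross a e else t * cross a c with hX
      have hX0 : 0 ≤ X := by
        cases b <;> simp [hX] <;> nlinarith [ht.1]
      have hX1 : X < cross a c + cross a e := by
        cases b <;> simp [hX] <;> nlinarith [ht.2]
      have hl : l = n := by
        rw [hn, eq_comm, Int.floor_eq_iff, le_div_iff₀ hH, div_lt_iff₀ hH]
        constructor <;> linarith
      have hXq : X = q := by rw [hq, ← hl]; linarith
      refine ⟨hXq, ?_⟩
      rw [← hXq, hX]
      cases b
      · simp only [cond_false, Bool.false_eq_true, false_iff, not_le]; nlinarith [ht.2]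
      · simp only [cond_true, true_iff]; nlinarith [ht.1]
    rintro ⟨b, s, t⟩ ⟨b', s', t'⟩ ⟨⟨hs, ht⟩, h⟩ ⟨⟨hs', ht'⟩, h'⟩
    simp only at *
    obtain ⟨k1, k2⟩ := key b s t hs ht h
    obtain ⟨k3, k4⟩ := key b' s' t' hs' ht' h'
    obtain rfl : b = b' := by
      rw [Bool.eq_iff_iff, k2, k4]
    have htt : t = t' := by
      rw [← k3] at k1
      cases b
      · exact mul_right_cancel₀ hc.ne' k1
      · exact mul_right_cancel₀ he.ne' (add_left_cancel k1)
    subst htt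
    have h2 := Submodule.sub_mem _ h' h
    have h3 : ((s - s' : ℝ) : ℂ) * a ∈ Submodule.span ℤ ({a, c + e} : Set ℂ) := by
      convert h2 using 1
      cases b <;> simp <;> ring
    obtain ⟨m, l, h3⟩ := mem_span_two.1 h3
    have h4 := eq_and_eq_of_cross (u := a) (v := c + e) (by rw [cross_add_right]; exact hH.ne')
      (s := m) (t := l) (s' := s - s') (t' := 0) (by push_cast at h3 ⊢; rw [h3]; ring)
    have h5 : m = 0 := by
      have c1 : (-1 : ℝ) < m := by rw [h4.1]; linarith [hs.1, hs'.2]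
      have c2 : (m : ℝ) < 1 := by rw [h4.1]; linarith [hs.2, hs'.1]
      have c1' : (-1 : ℤ) < m := by exact_mod_cast c1
      have c2' : m < 1 := by exact_mod_cast c2
      omega
    rw [h5] at h4
    have : s = s' := by have := h4.1; push_cast at this; linarith
    rw [this]

/-- The number of points of a translate of `L` in a fundamental domain of `Λ` is the index of `Λ`. -/
theorem ncard_eq_relIndex {ι : Type*} {I : Set ι} {P : ι → ℂ} {L Λ : Submodule ℤ ℂ} (hΛ : Λ ≤ L)
    (hI : ∀ z, ∃! i, i ∈ I ∧ z - P i ∈ Λ) (Y : ℂ) :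
    Nat.card {i // i ∈ I ∧ P i - Y ∈ L} = Λ.toAddSubgroup.relIndex L.toAddSubgroup := by
  rw [AddSubgroup.relIndex, AddSubgroup.index]
  let f : {i // i ∈ I ∧ P i - Y ∈ L} → L.toAddSubgroup ⧸ Λ.toAddSubgroup.addSubgroupOf L.toAddSubgroup :=
    fun i => QuotientAddGroup.mk ⟨P i.1 - Y, i.2.2⟩
  apply Nat.card_congr
  apply Equiv.ofBijective f
  constructor
  · rintro ⟨i, hi, hi'⟩ ⟨j, hj, hj'⟩ h
    rw [QuotientAddGroup.eq] at h
    have h1 : P j - P i ∈ Λ := by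
      rw [AddSubgroup.mem_addSubgroupOf] at h
      simp only [AddSubgroup.coe_add, AddSubgroup.coe_neg] at h
      have h' : -(P i - Y) + (P j - Y) ∈ Λ := h
      convert h' using 1
      ring
    have := (hI (P j)).unique ⟨hi, h1⟩ ⟨hj, by simp⟩
    exact Subtype.ext this
  · intro y
    obtain ⟨⟨l, hl⟩, rfl⟩ := QuotientAddGroup.mk_surjective y
    obtain ⟨i, ⟨hi, hi'⟩, _⟩ := hI (l + Y)
    have hl' : l ∈ L := hl
    refine ⟨⟨i, hi, ?_⟩, ?_⟩
    · have := L.sub_mem hl' (hΛ hi')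
      convert this using 1
      ring
    · rw [QuotientAddGroup.eq, AddSubgroup.mem_addSubgroupOf]
      simp only [AddSubgroup.coe_add, AddSubgroup.coe_neg]
      change -(P i - Y) + l ∈ Λ
      convert hi' using 1
      ring

theorem linearIndependent_pair_of_cross {a w : ℂ} (h : cross a w ≠ 0) :
    LinearIndependent ℤ ![a, w] := by
  rw [LinearIndependent.pair_iff]
  intro s t hst
  simp only [zsmul_eq_mul] at hst
  have := eq_and_eq_of_cross h (s := s) (t := t) (s' := 0) (t' := 0) (by push_cast; rw [hst]; simp)
  exact_mod_cast this

theorem relIndex_eq_natAbs_det {E : Type*} [AddCommGroup E] {L₁ L₂ : Submodule ℤ E} (h : L₁ ≤ L₂)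
    {ι : Type*} [DecidableEq ι] [Fintype ι] (b₁ : Module.Basis ι ℤ L₁) (b₂ : Module.Basis ι ℤ L₂) :
    L₁.toAddSubgroup.relIndex L₂.toAddSubgroup =
      (b₂.det fun i ↦ (⟨b₁ i, h (SetLike.coe_mem _)⟩ : L₂)).natAbs := by
  have := AddSubgroup.index_eq_natAbs_det b₂ (L₁.toAddSubgroup.addSubgroupOf L₂.toAddSubgroup)
    (b₁.map (Submodule.submoduleOfEquivOfLe h).symm)
  exact this

/-- The index is the absolute determinant of the change of basis, by which `cross` is multiplied; as
both pairs are positively oriented, the determinant is positive. -/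
theorem relIndex_mul_cross {a w v₁ v₂ : ℂ} (h : 0 < cross a w) (hv : 0 < cross v₁ v₂)
    (hle : Submodule.span ℤ ({a, w} : Set ℂ) ≤ Submodule.span ℤ ({v₁, v₂} : Set ℂ)) :
    ((Submodule.span ℤ ({a, w} : Set ℂ)).toAddSubgroup.relIndex
      (Submodule.span ℤ ({v₁, v₂} : Set ℂ)).toAddSubgroup : ℝ) * cross v₁ v₂ = cross a w := by
  have r1 : ∀ a w : ℂ, ({a, w} : Set ℂ) = Set.range ![a, w] := fun a w => by simp [Set.pair_comm]
  rw [r1 a w, r1 v₁ v₂] at hle ⊢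
  let b₁ := Module.Basis.span (linearIndependent_pair_of_cross h.ne')
  let b₂ := Module.Basis.span (linearIndependent_pair_of_cross hv.ne')
  have hidx : (Submodule.span ℤ (Set.range ![a, w])).toAddSubgroup.relIndex
      (Submodule.span ℤ (Set.range ![v₁, v₂])).toAddSubgroup =
      (b₂.det fun i ↦ (⟨b₁ i, hle (SetLike.coe_mem _)⟩ :
        Submodule.span ℤ (Set.range ![v₁, v₂]))).natAbs :=
    relIndex_eq_natAbs_det hle b₁ b₂
  rw [hidx, Module.Basis.det_apply, Matrix.det_fin_two]
  set A := b₂.toMatrix fun i ↦ (⟨b₁ i, hle (SetLike.coe_mem _)⟩ :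
    Submodule.span ℤ (Set.range ![v₁, v₂]))
  have hA : ∀ j, ![a, w] j = (A 0 j : ℂ) * v₁ + A 1 j * v₂ := by
    intro j
    have := congrArg Subtype.val (b₂.sum_toMatrix_smul_self (fun i ↦ (⟨b₁ i, hle (SetLike.coe_mem _)⟩ :
      Submodule.span ℤ (Set.range ![v₁, v₂]))) j)
    simp only [Fin.sum_univ_two, Submodule.coe_add, Submodule.coe_smul, zsmul_eq_mul] at this
    have e0 : ((b₂ 0 : Submodule.span ℤ (Set.range ![v₁, v₂])) : ℂ) = v₁ := by
      simp [b₂, Module.Basis.span_apply]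
    have e1 : ((b₂ 1 : Submodule.span ℤ (Set.range ![v₁, v₂])) : ℂ) = v₂ := by
      simp [b₂, Module.Basis.span_apply]
    have e2 : ((b₁ j : Submodule.span ℤ (Set.range ![a, w])) : ℂ) = ![a, w] j := by
      simp [b₁, Module.Basis.span_apply]
    rw [e0, e1, e2] at this
    exact this.symm
  have h0 : a = _ := hA 0
  have h1 : w = _ := hA 1
  have hdet : cross a w = (A 0 0 * A 1 1 - A 0 1 * A 1 0 : ℤ) * cross v₁ v₂ := by
    rw [h0, h1]
    simp only [cross, Complex.add_re, Complex.add_im, Complex.mul_re, Complex.mul_im,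
      Complex.intCast_re, Complex.intCast_im]
    push_cast
    ring
  rw [hdet] at h ⊢
  have hpos : 0 < (A 0 0 * A 1 1 - A 0 1 * A 1 0 : ℤ) := by
    have := (pos_iff_pos_of_mul_pos h).2 hv
    exact_mod_cast this
  rw [Nat.cast_natAbs, abs_of_pos hpos]

end TranslationSurface

/-! ### Torus covers of model surfaces: periods and degree. -/

namespace TranslationSurface
namespace GluedTriangles

variable {x : Fin 5 → ℂ} {L : Submodule ℤ ℂ}

/-- The absolute periods of a model surface. -/
def periods (x : Fin 5 → ℂ) : Submodule ℤ ℂ :=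
  Submodule.span ℤ {x 0, x 2 + x 3} ⊔ Submodule.span ℤ {x 1, x 2 + x 4}

theorem periods_le_iff : periods x ≤ L ↔ x 0 ∈ L ∧ x 2 + x 3 ∈ L ∧ x 1 ∈ L ∧ x 2 + x 4 ∈ L := by
  simp only [periods, sup_le_iff, Submodule.span_le, Set.insert_subset_iff, Set.singleton_subset_iff,
    SetLike.mem_coe, and_assoc]

/-- Comparing the translation constants along closed chains of triangles shows that the absolute
periods lie in `L`; along the remaining gluings all constants agree modulo `L`, so one constant
suffices. -/
theorem isTorusCover_model {π : (model x).Surface → ℂ ⧸ L} (hπ : IsTorusCover (model x) L π) :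
    periods x ≤ L ∧ ∃ κ : ℂ, ∀ p : (model x).Points,
      π ((model x).proj p) = Submodule.Quotient.mk (p.coord + κ) := by
  obtain ⟨hL, k, hk⟩ := hπ
  have h := compatible_of_proj hk
  have m02 := h (0, 2)
  have m10 := h (1, 0)
  have m22 := h (2, 2)
  have m01 := h (0, 1)
  have m41 := h (4, 1)
  have m42 := h (4, 2)
  have m21 := h (2, 1)
  have m50 := h (5, 0)
  have m62 := h (6, 2)
  have m61 := h (6, 1)
  have m30 := h (3, 0)
  have m70 := h (7, 0)
  simp [model, modelGlue] at m02 m10 m22 m01 m41 m42 m21 m50 m62 m61 m30 m70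
  have ha : x 0 ∈ L := by
    have := L.sub_mem m22 m21
    convert this using 1; ring
  have hb : x 1 ∈ L := by
    have := L.sub_mem m62 m61
    convert this using 1; ring
  have d1 : k 1 - k 0 ∈ L := m02
  have d2 : k 2 - k 0 ∈ L := by convert L.add_mem d1 m10 using 1; ring
  have d3 : k 3 - k 0 ∈ L := by convert L.add_mem d2 m22 using 1; ring
  have d5 : k 5 - k 0 ∈ L := by convert L.add_mem ha m01 using 1; ring
  have d4 : k 4 - k 0 ∈ L := by convert L.sub_mem d5 m42 using 1; ring
  have d6 : k 6 - k 0 ∈ L := by convert L.add_mem d5 m50 using 1; ring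
  have d7 : k 7 - k 0 ∈ L := by convert L.add_mem d6 m62 using 1; ring
  refine ⟨periods_le_iff.2 ⟨ha, ?_, hb, ?_⟩, k 0, fun p => ?_⟩
  · convert L.neg_mem (L.add_mem m30 d3) using 1; ring
  · convert L.neg_mem (L.add_mem m70 (L.sub_mem d7 d4)) using 1; ring
  · rw [hk, Submodule.Quotient.eq]
    have : ∀ i, k i - k 0 ∈ L := by
      intro i
      fin_cases i
      · simp
      all_goals assumption
    convert this p.1.1 using 1; ring

theorem compatible_model (h : periods x ≤ L) (κ : ℂ) : (model x).Compatible L fun _ => κ := by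
  obtain ⟨h1, h2, h3, h4⟩ := periods_le_iff.1 h
  rintro ⟨i, k⟩
  have key : ∀ z w : ℂ, z - w = 0 ∨ z - w = x 0 ∨ z - w = -x 0 ∨ z - w = x 1 ∨ z - w = -x 1 ∨
      z - w = x 2 + x 3 ∨ z - w = -(x 2 + x 3) ∨ z - w = x 2 + x 4 ∨ z - w = -(x 2 + x 4) →
      (z + κ) - (w + κ) ∈ L := by
    intro z w h
    rw [add_sub_add_right_eq_sub]
    rcases h with h | h | h | h | h | h | h | h | h <;> rw [h]
    exacts [L.zero_mem, h1, L.neg_mem h1, h3, L.neg_mem h3, h2, L.neg_mem h2, h4, L.neg_mem h4]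
  apply key
  fin_cases i <;> fin_cases k <;>
    simp [model, modelGlue, show (2 : Fin 3) + 1 = 0 from rfl, show (1 : Fin 3) + 1 = 2 from rfl] <;>
    ring_nf <;> simp

/-- The parallelograms of the two tori. -/
def quad (τ b : Bool) : Fin 4 := bif τ then (bif b then 3 else 2) else (bif b then 1 else 0)

theorem exists_quad : ∀ j, ∃ τ b, quad τ b = j := by decide

theorem quad_injective : ∀ τ b τ' b', quad τ b = quad τ' b' → τ = τ' ∧ b = b' := by decide

/-- The periods of the two tori. -/
def torusPeriods (x : Fin 5 → ℂ) (τ : Bool) : Submodule ℤ ℂ :=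
  bif τ then Submodule.span ℤ {x 1, x 2 + x 4} else Submodule.span ℤ {x 0, x 2 + x 3}

theorem torusPeriods_le (x : Fin 5 → ℂ) (τ : Bool) : torusPeriods x τ ≤ periods x := by
  cases τ
  · exact le_sup_left
  · exact le_sup_right

theorem existsUnique_quad (hx : ModelDomain x) (τ : Bool) (z : ℂ) :
    ∃! i : Bool × ℝ × ℝ, i ∈ {i : Bool × ℝ × ℝ | i.2.1 ∈ Ico (0 : ℝ) 1 ∧ i.2.2 ∈ Ico (0 : ℝ) 1} ∧
      z - parPoint x (quad τ i.1) i.2.1 i.2.2 ∈ torusPeriods x τ := by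
  cases τ
  · have h : ∀ i : Bool × ℝ × ℝ, parPoint x (quad false i.1) i.2.1 i.2.2 =
        bif i.1 then x 2 + i.2.1 * x 0 + i.2.2 * x 3 else i.2.1 * x 0 + i.2.2 * x 2 := by
      rintro ⟨_ | _, s, t⟩ <;> simp [quad, parPoint, parBase, parHor, parTrans]
    simp only [h, torusPeriods, cond_false]
    exact existsUnique_strip hx.ac hx.ae z
  · have h : ∀ i : Bool × ℝ × ℝ, parPoint x (quad true i.1) i.2.1 i.2.2 =
        bif i.1 then x 2 + i.2.1 * x 1 + i.2.2 * x 4 else i.2.1 * x 1 + i.2.2 * x 2 := by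
      rintro ⟨_ | _, s, t⟩ <;> simp [quad, parPoint, parBase, parHor, parTrans]
    simp only [h, torusPeriods, cond_true]
    exact existsUnique_strip hx.bc hx.bf z

/-- The half-open parallelograms of one torus are a fundamental domain of its lattice. Preimages in
them therefore correspond to points of a translate of `L` in the domain, and an index counts these.
-/
theorem card_fibre_model (hx : ModelDomain x) (hL : periods x ≤ L) {π : (model x).Surface → ℂ ⧸ L}
    {κ : ℂ} (hπ : ∀ p : (model x).Points,
      π ((model x).proj p) = Submodule.Quotient.mk (p.coord + κ)) (Y : ℂ)
    (hY : (Submodule.Quotient.mk (Y + κ) : ℂ ⧸ L) ∉ π '' (model x).vertices) (τ : Bool) :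
    Nat.card {z // π z = Submodule.Quotient.mk (Y + κ) ∧ ∃ b, ∃ s ∈ Ico (0 : ℝ) 1,
      ∃ t ∈ Ico (0 : ℝ) 1, IsParPoint x (quad τ b) s t z} =
      (torusPeriods x τ).toAddSubgroup.relIndex L.toAddSubgroup := by
  rw [← ncard_eq_relIndex ((torusPeriods_le x τ).trans hL) (existsUnique_quad hx τ) Y]
  have hpt : ∀ {j s t z}, IsParPoint x j s t z →
      (π z = Submodule.Quotient.mk (Y + κ) ↔ parPoint x j s t - Y ∈ L) := by
    rintro j s t _ ⟨p, -, hp, rfl⟩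
    rw [hπ, hp, Submodule.Quotient.eq]
    ring_nf
  have hex : ∀ i : {i : Bool × ℝ × ℝ // i ∈ {i : Bool × ℝ × ℝ | i.2.1 ∈ Ico (0 : ℝ) 1 ∧
      i.2.2 ∈ Ico (0 : ℝ) 1} ∧ parPoint x (quad τ i.1) i.2.1 i.2.2 - Y ∈ L},
      ∃ z, IsParPoint x (quad τ i.1.1) i.1.2.1 i.1.2.2 z := fun i =>
    exists_isParPoint x _ ⟨i.2.1.1.1, i.2.1.1.2.le⟩ ⟨i.2.1.2.1, i.2.1.2.2.le⟩
  choose g hg using hex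
  symm
  refine Nat.card_congr (Equiv.ofBijective (fun i => ⟨g i, (hpt (hg i)).2 i.2.2, i.1.1, i.1.2.1,
    i.2.1.1, i.1.2.2, i.2.1.2, hg i⟩) ⟨?_, ?_⟩)
  · intro i i' h
    have h1 : g i = g i' := congrArg Subtype.val h
    have hv : g i ∉ (model x).vertices := fun hv => hY ⟨g i, hv, (hpt (hg i)).2 i.2.2⟩
    obtain ⟨e1, e2, e3⟩ := (hg i).coords_eq hx (h1 ▸ hg i') hv i.2.1.1.2 i.2.1.2.2 i'.2.1.1.2 i'.2.1.2.2
    exact Subtype.ext (Prod.ext (quad_injective _ _ _ _ e1).2 (Prod.ext e2 e3))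
  · rintro ⟨z, hz, b, s, hs, t, ht, h⟩
    have hv : z ∉ (model x).vertices := fun hv => hY ⟨z, hv, hz⟩
    refine ⟨⟨(b, s, t), ⟨hs, ht⟩, (hpt h).1 hz⟩, Subtype.ext ?_⟩
    exact (hg _).unique hx h

/-- The fibre splits into its parts in the two tori. Each has as many points as the area of the
torus divided by the covolume, so that the degree is total area over covolume. -/
theorem hasDegree_model (hx : ModelDomain x) {v₁ v₂ : ℂ} (hv : 0 < cross v₁ v₂)
    (hL : periods x ≤ Submodule.span ℤ {v₁, v₂})
    {π : (model x).Surface → ℂ ⧸ Submodule.span ℤ ({v₁, v₂} : Set ℂ)} {κ : ℂ}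
    (hπ : ∀ p : (model x).Points, π ((model x).proj p) = Submodule.Quotient.mk (p.coord + κ))
    {N : ℕ} (hN : N * cross v₁ v₂ = cross (x 0) (x 2 + x 3) + cross (x 1) (x 2 + x 4)) :
    HasDegree π N := by
  intro y hy
  obtain ⟨Y', rfl⟩ := Submodule.Quotient.mk_surjective _ y
  obtain ⟨Y, rfl⟩ : ∃ Y, Y' = Y + κ := ⟨Y' - κ, by ring⟩
  have hc := card_fibre_model hx hL hπ Y hy
  have c0 := hc false
  have c1 := hc true
  have p0 : 0 < cross (x 0) (x 2 + x 3) := by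
    rw [cross_add_right]; exact add_pos hx.ac hx.ae
  have p1 : 0 < cross (x 1) (x 2 + x 4) := by
    rw [cross_add_right]; exact add_pos hx.bc hx.bf
  have r0 := relIndex_mul_cross p0 hv ((torusPeriods_le x false).trans hL)
  have r1 := relIndex_mul_cross p1 hv ((torusPeriods_le x true).trans hL)
  simp only [torusPeriods, cond_true, cond_false] at c0 c1
  set F : Bool → Set (model x).Surface := fun τ => {z | π z = Submodule.Quotient.mk (Y + κ) ∧ ∃ b,
    ∃ s ∈ Ico (0 : ℝ) 1, ∃ t ∈ Ico (0 : ℝ) 1, IsParPoint x (quad τ b) s t z} with hF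
  -- `ncard` is zero for infinite sets; a nonzero value therefore also proves finiteness.
  have n0 : (F false).ncard ≠ 0 := by
    intro h
    rw [← Nat.card_coe_set_eq] at h
    change Nat.card {z // z ∈ F false} = 0 at h
    simp only [hF, mem_ofPred_eq] at h
    rw [c0] at h
    rw [h] at r0
    simp at r0
    exact p0.ne r0
  have n1 : (F true).ncard ≠ 0 := by
    intro h
    rw [← Nat.card_coe_set_eq] at h
    change Nat.card {z // z ∈ F true} = 0 at h
    simp only [hF, mem_ofPred_eq] at h
    rw [c1] at h
    rw [h] at r1
    simp at r1
    exact p1.ne r1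
  have hU : π ⁻¹' {Submodule.Quotient.mk (Y + κ)} = F false ∪ F true := by
    ext z
    constructor
    · intro hz
      obtain ⟨j, s, hs, t, ht, h⟩ := exists_isParPoint_of_point hx z
      obtain ⟨τ, b, rfl⟩ := exists_quad j
      cases τ
      · exact Or.inl ⟨hz, b, s, hs, t, ht, h⟩
      · exact Or.inr ⟨hz, b, s, hs, t, ht, h⟩
    · rintro (h | h) <;> exact h.1
  have hD : Disjoint (F false) (F true) := by
    rw [Set.disjoint_left]
    rintro z ⟨hz, b, s, hs, t, ht, h⟩ ⟨-, b', s', hs', t', ht', h'⟩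
    have := (h.coords_eq hx h' (fun hv => hy ⟨z, hv, hz⟩) hs.2 ht.2 hs'.2 ht'.2).1
    simpa using (quad_injective _ _ _ _ this).1
  have f0 := Set.finite_of_ncard_ne_zero n0
  have f1 := Set.finite_of_ncard_ne_zero n1
  rw [hU]
  refine ⟨f0.union f1, ?_⟩
  rw [Set.ncard_union_eq hD f0 f1]
  have e0 : (F false).ncard = (Submodule.span ℤ {x 0, x 2 + x 3}).toAddSubgroup.relIndex
      (Submodule.span ℤ ({v₁, v₂} : Set ℂ)).toAddSubgroup := c0
  have e1 : (F true).ncard = (Submodule.span ℤ {x 1, x 2 + x 4}).toAddSubgroup.relIndex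
      (Submodule.span ℤ ({v₁, v₂} : Set ℂ)).toAddSubgroup := c1
  rw [← e0] at r0
  rw [← e1] at r1
  have : (((F false).ncard + (F true).ncard : ℕ) : ℝ) * cross v₁ v₂ = N * cross v₁ v₂ := by
    push_cast
    linarith
  exact_mod_cast mul_right_cancel₀ hv.ne' this

theorem area_model (x : Fin 5 → ℂ) :
    (model x).area = cross (x 0) (x 2 + x 3) + cross (x 1) (x 2 + x 4) := by
  have ht := hasTable_model x
  have h : ∀ i, signedArea ((model x).vert i 0) ((model x).vert i 1) ((model x).vert i 2) =
      cross (lin (modelVec (i, 0)) x) (lin (modelVec (i, 1)) x) / 2 := by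
    intro i
    have h1 := (model x).cross_side_side i 0
    rw [ht.2, ht.2, zero_add] at h1
    linarith
  simp only [area, h, fun i => (lin_modelVec x i).1, fun i => (lin_modelVec x i).2,
    Fin.sum_univ_eight, Matrix.cons_val, cross_neg_left, cross_neg_right, cross_add_right]
  ring

end GluedTriangles
end TranslationSurface

/-! ### Lattices, coverings of tori, and primitivity. -/

namespace TranslationSurface

theorem isLattice_span_pair {v₁ v₂ : ℂ} (h : cross v₁ v₂ ≠ 0) :
    IsLattice (Submodule.span ℤ {v₁, v₂}) := by
  have hl : LinearIndependent ℝ ![v₁, v₂] := by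
    rw [LinearIndependent.pair_iff]
    intro s t hst
    exact eq_and_eq_of_cross h (s' := 0) (t' := 0) (by simpa using hst)
  let b : Module.Basis (Fin 2) ℝ ℂ := basisOfLinearIndependentOfCardEqFinrank hl (by simp)
  have hb : Set.range b = {v₁, v₂} := by
    rw [coe_basisOfLinearIndependentOfCardEqFinrank]
    simp [Set.pair_comm]
  rw [← hb]
  refine ⟨inferInstance, ?_⟩
  rw [eq_top_iff, ← b.span_eq]
  exact Submodule.span_mono Submodule.subset_span

/-- A lattice has an oriented basis. -/
theorem IsLattice.exists_basis {L : Submodule ℤ ℂ} (hL : IsLattice L) :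
    ∃ v₁ v₂, 0 < cross v₁ v₂ ∧ L = Submodule.span ℤ {v₁, v₂} := by
  have := hL.discrete
  have : IsZLattice ℝ L := ⟨hL.span_top⟩
  have hfree := ZLattice.module_free ℝ L
  have hfin := ZLattice.module_finite ℝ L
  have hr : Module.finrank ℤ L = 2 := by
    rw [ZLattice.rank ℝ L]; simp
  let b : Module.Basis (Fin 2) ℤ L := Module.finBasisOfFinrankEq ℤ L hr
  have hspan : L = Submodule.span ℤ {(b 0 : ℂ), (b 1 : ℂ)} := by
    have h1 := congrArg (Submodule.map L.subtype) b.span_eq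
    rw [Submodule.map_span, Submodule.map_top, Submodule.range_subtype, ← Set.range_comp] at h1
    refine h1.symm.trans (congrArg _ ?_)
    ext z
    simp [eq_comm]
  have hne : cross (b 0 : ℂ) (b 1) ≠ 0 := by
    intro h0
    have h1 := hL.span_top
    have hfr : Module.finrank ℝ (Submodule.span ℝ (L : Set ℂ)) = 2 := by rw [h1]; simp
    have h2 : Submodule.span ℝ (L : Set ℂ) = Submodule.span ℝ (Set.range ![(b 0 : ℂ), (b 1 : ℂ)]) := by
      conv_lhs => rw [hspan]
      rw [Submodule.span_span_of_tower]
      simp [Set.pair_comm]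
    rw [h2] at hfr
    have h3 : LinearIndependent ℝ ![(b 0 : ℂ), (b 1 : ℂ)] :=
      linearIndependent_iff_card_eq_finrank_span.2 (by rw [Set.finrank, hfr]; simp)
    rw [LinearIndependent.pair_iff] at h3
    simp only [cross] at h0
    have e1 := h3 (b 1 : ℂ).re (-(b 0 : ℂ).re) (by
      apply Complex.ext <;> simp <;> linarith)
    have e2 := h3 (b 1 : ℂ).im (-(b 0 : ℂ).im) (by
      apply Complex.ext <;> simp <;> linarith)
    have : (b 0 : ℂ) = 0 := by apply Complex.ext <;> simp <;> linarith [e1.2, e2.2]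
    exact b.ne_zero 0 (by simpa using this)
  rcases lt_or_gt_of_ne hne with h | h
  · refine ⟨b 1, b 0, ?_, hspan.trans (by rw [Set.pair_comm])⟩
    rw [cross_comm] at h
    linarith
  · exact ⟨b 0, b 1, h, hspan⟩

/-- The projection of tori followed by a translation is a covering. -/
theorem isCoveringMap_mapQ {L₁ L : Submodule ℤ ℂ} (hL : IsLattice L) (h : L₁ ≤ L) (κ : ℂ) :
    IsCoveringMap fun y : ℂ ⧸ L₁ =>
      Submodule.mapQ L₁ L LinearMap.id h y + (Submodule.Quotient.mk κ : ℂ ⧸ L) := by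
  have hd := hL.discrete
  let f : (ℂ ⧸ L₁) →+ (ℂ ⧸ L) := (Submodule.mapQ L₁ L LinearMap.id h).toAddMonoidHom
  have hcomp : (f : ℂ ⧸ L₁ → ℂ ⧸ L) ∘ (Submodule.Quotient.mk : ℂ → ℂ ⧸ L₁) = Submodule.Quotient.mk := rfl
  have hq₁ : IsQuotientMap (Submodule.Quotient.mk : ℂ → ℂ ⧸ L₁) := isQuotientMap_quot_mk
  have hq : IsQuotientMap (Submodule.Quotient.mk : ℂ → ℂ ⧸ L) := isQuotientMap_quot_mk
  have hf : Continuous f := by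
    rw [hq₁.continuous_iff, hcomp]
    exact hq.continuous
  have hfq : IsQuotientMap f := IsQuotientMap.of_comp hq₁.continuous hf (hcomp ▸ hq)
  -- A neighbourhood of zero that meets `L` in zero only has an open image in `ℂ ⧸ L₁`, and this
  -- isolates zero in the kernel `L / L₁`.
  have hdisc : IsDiscrete (f.ker : Set (ℂ ⧸ L₁)) := by
    obtain ⟨U, hU, hUL⟩ : ∃ U : Set ℂ, IsOpen U ∧ ∀ z : L, (z : ℂ) ∈ U ↔ z = 0 := by
      have := isOpen_discrete ({0} : Set L)
      obtain ⟨U, hU, he⟩ := isOpen_induced_iff.1 this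
      exact ⟨U, hU, fun z => by rw [← Set.mem_singleton_iff, ← he]; rfl⟩
    have hopen : IsOpen ((Submodule.Quotient.mk : ℂ → ℂ ⧸ L₁) '' U) :=
      QuotientAddGroup.isOpenMap_coe (N := L₁.toAddSubgroup) U hU
    constructor
    apply discreteTopology_of_isOpen_singleton_zero
    rw [isOpen_induced_iff]
    refine ⟨_, hopen, ?_⟩
    ext ⟨y, hy⟩
    simp only [Set.mem_preimage, Set.mem_image, Set.mem_singleton_iff]
    constructor
    · rintro ⟨u, hu, rfl⟩
      have hu' : (Submodule.Quotient.mk u : ℂ ⧸ L) = 0 := hy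
      rw [Submodule.Quotient.mk_eq_zero] at hu'
      have h0 := (hUL ⟨u, hu'⟩).1 hu
      have h0 : u = 0 := congrArg Subtype.val h0
      subst h0
      rfl
    · intro h0
      refine ⟨0, by simpa using (hUL 0).2 rfl, ?_⟩
      exact (congrArg Subtype.val h0).symm
  have := (hfq.isAddQuotientCoveringMap_of_isDiscrete_ker_addMonoidHom hdisc).isCoveringMap
  exact this.homeomorph_comp (Homeomorph.addRight (Submodule.Quotient.mk κ))

namespace GluedTriangles

variable {x : Fin 5 → ℂ}

/-- A model surface is a primitive torus cover for the lattice of its periods. -/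
theorem isPrimitiveTorusCover_model (hx : ModelDomain x) {v₁ v₂ : ℂ} (hv : 0 < cross v₁ v₂)
    (hL : periods x = Submodule.span ℤ {v₁, v₂}) {d : ℕ} (hd : d * cross v₁ v₂ = 1)
    (ha : cross (x 0) (x 2 + x 3) + cross (x 1) (x 2 + x 4) = 1) :
    IsPrimitiveTorusCover (model x) d := by
  have hA := admissible_model hx
  have hc := compatible_model hL.le 0
  refine ⟨by rw [area_model, ha], Submodule.span ℤ {v₁, v₂}, torusMap hA hc,
    ⟨isTorusCover_torusMap hA (isLattice_span_pair hv.ne') hc, ?_⟩,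
    hasDegree_model hx hv hL.le (κ := 0) (fun p => rfl) (by rw [ha, hd])⟩
  intro L₁ π₁ q hπ₁ hq he
  obtain ⟨hle, κ, hκ⟩ := isTorusCover_model hπ₁
  rw [hL] at hle
  -- Modulo the periods every complex number is the coordinate of a point of the surface, so `q` is
  -- forced to be a translation. It is injective because the periods already lie in `L₁`.
  have key : ∀ Y : ℂ, q (Submodule.Quotient.mk Y) = Submodule.Quotient.mk (Y - κ) := by
    intro Y
    obtain ⟨⟨b, s, t⟩, ⟨⟨hs, ht⟩, hm⟩, -⟩ := existsUnique_quad hx false (Y - κ)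
    obtain ⟨z, p, -, hp, rfl⟩ := exists_isParPoint x (quad false b) ⟨hs.1, hs.2.le⟩ ⟨ht.1, ht.2.le⟩
    have hm' : Y - κ - p.coord ∈ Submodule.span ℤ {v₁, v₂} := by
      rw [hp, ← hL]
      exact torusPeriods_le x false hm
    have e1 : (Submodule.Quotient.mk Y : ℂ ⧸ L₁) = π₁ ((model x).proj p) := by
      rw [hκ, Submodule.Quotient.eq]
      convert hle hm' using 1
      ring
    have e2 := congrFun he ((model x).proj p)
    rw [e1, ← Function.comp_apply (f := q), ← e2]
    change Submodule.Quotient.mk (p.coord + 0) = _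
    rw [Submodule.Quotient.eq]
    convert Submodule.neg_mem _ hm' using 1
    ring
  intro y y' h
  obtain ⟨Y, rfl⟩ := Submodule.Quotient.mk_surjective _ y
  obtain ⟨Y', rfl⟩ := Submodule.Quotient.mk_surjective _ y'
  rw [key, key, Submodule.Quotient.eq] at h
  rw [Submodule.Quotient.eq]
  convert hle h using 1
  ring

/-- The lattice of a primitive torus cover is contained in every lattice of a torus cover that it
contains. -/
theorem IsPrimitiveCover.eq_of_le {n : ℕ} {S : GluedTriangles n} [ConnectedSpace S.Surface]
    {L L₁ : Submodule ℤ ℂ} {π : S.Surface → ℂ ⧸ L} (hπ : IsPrimitiveCover S L π)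
    {π₁ : S.Surface → ℂ ⧸ L₁} (hπ₁ : IsTorusCover S L₁ π₁) (h : L₁ ≤ L) : L₁ = L := by
  obtain ⟨⟨hL, c, hc⟩, hp⟩ := hπ
  have hπ₁' := hπ₁
  obtain ⟨hL₁, c₁, hc₁⟩ := hπ₁
  have k := compatible_of_proj hc
  have k₁ := compatible_of_proj hc₁
  obtain ⟨x₀⟩ := (inferInstance : Nonempty S.Surface)
  obtain ⟨p₀, rfl⟩ := S.proj_surjective x₀
  -- The two covers have the same differential, so modulo `L` they differ by a constant: the value
  -- `κ` at one triangle spreads over the connected surface. Primitivity is then applied to the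
  -- projection of tori followed by translation by `κ`.
  set κ := c p₀.1.1 - c₁ p₀.1.1 with hκ
  have hconst : ∀ i, (c i - c₁ i) - κ ∈ L := by
    intro i
    refine S.forall_mem_of_connected {i | (c i - c₁ i) - κ ∈ L} (fun e => ?_) (i := p₀.1.1) (by simp [hκ]) i
    have h2 := L.sub_mem (k e) (h (k₁ e))
    constructor
    · intro h3
      have := L.add_mem h2 h3
      change _ ∈ L
      convert this using 1
      ring
    · intro h3
      have := L.sub_mem h3 h2
      change _ ∈ L
      convert this using 1
      ring
  have hinj := hp L₁ π₁ _ hπ₁' (isCoveringMap_mapQ hL h κ) (by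
    funext x
    obtain ⟨p, rfl⟩ := S.proj_surjective x
    simp only [Function.comp, hc, hc₁]
    change _ = (Submodule.Quotient.mk (p.coord + c₁ p.1.1) : ℂ ⧸ L) + Submodule.Quotient.mk κ
    rw [← Submodule.Quotient.mk_add, Submodule.Quotient.eq]
    convert hconst p.1.1 using 1
    ring)
  refine le_antisymm h fun z hz => ?_
  have := @hinj (Submodule.Quotient.mk z) 0 (by
    change (Submodule.Quotient.mk z : ℂ ⧸ L) + Submodule.Quotient.mk κ = Submodule.Quotient.mk 0 +
      Submodule.Quotient.mk κ
    rw [(Submodule.Quotient.mk_eq_zero L).2 hz, Submodule.Quotient.mk_zero])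
  exact (Submodule.Quotient.mk_eq_zero L₁).1 this

end GluedTriangles
end TranslationSurface

/-! ### Linked surfaces, and deformations of split surfaces. -/

namespace TranslationSurface
open GluedTriangles

/-- The point of the stratum given by a triangulated surface with a chosen corner. -/
def labelledPoint (S : GluedTriangles 8) (h : S.IsH11) (c : Fin 8 × Fin 3) : LabelledH11 :=
  Quotient.mk labelledIsoSetoid (⟨S, h⟩, c)

/-- Two surfaces, each with a chosen corner, lie in a connected set of primitive torus covers. -/
def Linked (d : ℕ) (S : GluedTriangles 8) (c : Fin 8 × Fin 3) (S' : GluedTriangles 8)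
    (c' : Fin 8 × Fin 3) : Prop :=
  ∃ (h : S.IsH11) (h' : S'.IsH11), ∃ T ⊆ labelledPrimitiveCovers d, IsPreconnected T ∧
    labelledPoint S h c ∈ T ∧ labelledPoint S' h' c' ∈ T

theorem Linked.symm {d : ℕ} {S S' : GluedTriangles 8} {c c' : Fin 8 × Fin 3}
    (h : Linked d S c S' c') : Linked d S' c' S c := by
  obtain ⟨h, h', T, hT, hc, h1, h2⟩ := h
  exact ⟨h', h, T, hT, hc, h2, h1⟩

theorem Linked.trans {d : ℕ} {S S' S'' : GluedTriangles 8} {c c' c'' : Fin 8 × Fin 3}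
    (h : Linked d S c S' c') (h' : Linked d S' c' S'' c'') : Linked d S c S'' c'' := by
  obtain ⟨h, h1, T, hT, hc, h2, h3⟩ := h
  obtain ⟨g, g1, T', hT', hc', h2', h3'⟩ := h'
  exact ⟨h, g1, T ∪ T', union_subset hT hT', hc.union _ h3 h2' hc', Or.inl h2, Or.inr h3'⟩

theorem Linked.of_equivalent {d : ℕ} {S S' : GluedTriangles 8} {c c' : Fin 8 × Fin 3}
    (h : S.IsH11) (h' : S'.IsH11) (he : Equivalent S c S' c') (hd : IsPrimitiveTorusCover S d) :
    Linked d S c S' c' := by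
  have heq : labelledPoint S h c = labelledPoint S' h' c' := by
    obtain ⟨f, h1, h2, -⟩ := he
    exact Quotient.sound ⟨f, h1, h2⟩
  refine ⟨h, h', {labelledPoint S h c}, ?_, isPreconnected_singleton, rfl, heq.symm⟩
  rintro _ rfl
  exact ⟨(⟨S, h⟩, c), hd, rfl⟩

/-- A continuous family of primitive torus covers with a fixed gluing is contained in a connected
set of them. -/
theorem Linked.of_continuous {d : ℕ} {X : Type*} [TopologicalSpace X] [PreconnectedSpace X]
    {F : X → GluedTriangles 8} {c : Fin 8 × Fin 3} (h : ∀ q, (F q).IsH11)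
    (hd : ∀ q, IsPrimitiveTorusCover (F q) d) (hF : Continuous F) (q q' : X) :
    Linked d (F q) c (F q') c := by
  refine ⟨h q, h q', range fun q => labelledPoint (F q) (h q) c, ?_, isPreconnected_range ?_,
    mem_range_self _, mem_range_self _⟩
  · rintro _ ⟨q, rfl⟩
    exact ⟨(⟨F q, h q⟩, c), hd q, rfl⟩
  · have h1 : Continuous fun q => (⟨F q, h q⟩ : TriangulatedH11) := Continuous.subtype_mk hF h
    have h2 : Continuous fun q => ((⟨F q, h q⟩, c) : LabelledTriangulatedH11) :=
      Continuous.prodMk h1 continuous_const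
    exact continuous_quotient_mk'.comp h2

theorem continuous_gluedTriangles {n : ℕ} {X : Type*} [TopologicalSpace X]
    {F : X → GluedTriangles n} (g : Fin n × Fin 3 → Fin n × Fin 3) (hg : ∀ q, (F q).glue = g)
    (hv : ∀ i k, Continuous fun q => (F q).vert i k) : Continuous F := by
  rw [continuous_induced_rng]
  refine Continuous.prodMk ?_ (continuous_pi fun i => continuous_pi fun k => hv i k)
  simp only [hg]
  exact continuous_const

namespace GluedTriangles

theorem continuous_model {X : Type*} [TopologicalSpace X] {f : X → Fin 5 → ℂ} (hf : Continuous f) :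
    Continuous fun q => model (f q) := by
  have h : ∀ r, Continuous fun q => f q r := fun r => (continuous_apply r).comp hf
  have h0 := h 0; have h1 := h 1; have h2 := h 2; have h3 := h 3; have h4 := h 4
  apply continuous_gluedTriangles modelGlue fun q => rfl
  intro i k
  fin_cases i <;> fin_cases k <;> simp [model] <;> fun_prop

/-- The parameters of the model surface with the periods `β 0, β 1` and `β 2, β 3` of the two tori
that are slit along `c`. -/
def params (β : Fin 4 → ℂ) (c : ℂ) : Fin 5 → ℂ := ![β 0, β 2, c, β 1 - c, β 3 - c]

/-- The segment `c` is embedded transversally in the tori with the periods `β`. -/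
def IsSlit (β : Fin 4 → ℂ) (c : ℂ) : Prop :=
  0 < cross (β 0) c ∧ cross (β 0) c < cross (β 0) (β 1) ∧
    0 < cross (β 2) c ∧ cross (β 2) c < cross (β 2) (β 3)

theorem IsSlit.modelDomain {β : Fin 4 → ℂ} {c : ℂ} (h : IsSlit β c) : ModelDomain (params β c) := by
  obtain ⟨h1, h2, h3, h4⟩ := h
  refine ⟨h1, ?_, h3, ?_⟩
  · change 0 < cross (β 0) (β 1 - c)
    rw [cross_sub_right]; linarith
  · change 0 < cross (β 2) (β 3 - c)
    rw [cross_sub_right]; linarith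

theorem isSlit_iff {a w b z c : ℂ} : IsSlit ![a, w, b, z] c ↔
    0 < cross a c ∧ cross a c < cross a w ∧ 0 < cross b c ∧ cross b c < cross b z := Iff.rfl

/-- The periods `β` generate a lattice of covolume `1 / d`, and the areas of the tori add up to
one. -/
def IsGood (d : ℕ) (β : Fin 4 → ℂ) : Prop :=
  (∃ v₁ v₂, 0 < cross v₁ v₂ ∧ d * cross v₁ v₂ = 1 ∧
    Submodule.span ℤ {β 0, β 1} ⊔ Submodule.span ℤ {β 2, β 3} = Submodule.span ℤ {v₁, v₂}) ∧
  cross (β 0) (β 1) + cross (β 2) (β 3) = 1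

variable {d : ℕ} {β : Fin 4 → ℂ} {c : ℂ}

theorem IsGood.isPrimitiveTorusCover (h : IsGood d β) (hc : IsSlit β c) :
    IsPrimitiveTorusCover (model (params β c)) d := by
  obtain ⟨⟨v₁, v₂, hv, hd, hs⟩, ha⟩ := h
  refine isPrimitiveTorusCover_model hc.modelDomain hv ?_ hd ?_
  · rw [← hs]
    simp [periods, params]
  · simpa [params] using ha

/-- Model surfaces with the periods `β` and `β'` lie in a connected set of primitive torus
covers. -/
def Deformable (d : ℕ) (β β' : Fin 4 → ℂ) : Prop :=
  IsGood d β ∧ IsGood d β' ∧ ∃ c c', IsSlit β c ∧ IsSlit β' c' ∧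
    Linked d (model (params β c)) (0, 0) (model (params β' c')) (0, 0)

/-- The conditions on the slit are four strict linear inequalities. Hence the choice of the slit
never matters for the connected component. -/
theorem convex_isSlit (β : Fin 4 → ℂ) : Convex ℝ {c | IsSlit β c} := by
  intro c h c' h' s t hs ht hst
  obtain ⟨h1, h2, h3, h4⟩ := h
  obtain ⟨g1, g2, g3, g4⟩ := h'
  have e : ∀ u, cross u (s • c + t • c') = s * cross u c + t * cross u c' := by
    intro u
    simp only [Complex.real_smul, cross_add_right, cross_smul_right]
  refine ⟨?_, ?_, ?_, ?_⟩ <;> rw [e]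
  · rcases hs.lt_or_eq with h | h
    · nlinarith [mul_pos h h1, mul_nonneg ht g1.le]
    · obtain rfl : t = 1 := by linarith
      rw [← h]; linarith
  · obtain rfl : t = 1 - s := by linarith
    rcases hs.lt_or_eq with h | h
    · nlinarith [mul_pos h (sub_pos.2 h2), mul_nonneg ht (sub_pos.2 g2).le]
    · rw [← h]; linarith
  · rcases hs.lt_or_eq with h | h
    · nlinarith [mul_pos h h3, mul_nonneg ht g3.le]
    · obtain rfl : t = 1 := by linarith
      rw [← h]; linarith
  · obtain rfl : t = 1 - s := by linarith
    rcases hs.lt_or_eq with h | h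
    · nlinarith [mul_pos h (sub_pos.2 h4), mul_nonneg ht (sub_pos.2 g4).le]
    · rw [← h]; linarith

theorem linked_of_isSlit (h : IsGood d β) {c' : ℂ} (hc : IsSlit β c) (hc' : IsSlit β c') :
    Linked d (model (params β c)) (0, 0) (model (params β c')) (0, 0) := by
  have : PreconnectedSpace {c | IsSlit β c} :=
    isPreconnected_iff_preconnectedSpace.1 (convex_isSlit β).isPreconnected
  refine Linked.of_continuous (X := {c | IsSlit β c}) (F := fun c => model (params β c.1))
    (fun c => isH11_model c.2.modelDomain) (fun c => h.isPrimitiveTorusCover c.2)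
    (continuous_model (continuous_pi fun r => ?_)) ⟨c, hc⟩ ⟨c', hc'⟩
  fin_cases r <;> simp [params] <;> fun_prop

theorem Deformable.linked {β' : Fin 4 → ℂ} (h : Deformable d β β') {c c' : ℂ} (hc : IsSlit β c)
    (hc' : IsSlit β' c') :
    Linked d (model (params β c)) (0, 0) (model (params β' c')) (0, 0) := by
  obtain ⟨h1, h2, c₁, c₁', h3, h4, h5⟩ := h
  exact ((linked_of_isSlit h1 hc h3).trans h5).trans (linked_of_isSlit h2 h4 hc')

theorem Deformable.refl (h : IsGood d β) (hc : IsSlit β c) : Deformable d β β :=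
  ⟨h, h, c, c, hc, hc, linked_of_isSlit h hc hc⟩

theorem Deformable.symm {β' : Fin 4 → ℂ} (h : Deformable d β β') : Deformable d β' β := by
  obtain ⟨h1, h2, c₁, c₁', h3, h4, h5⟩ := h
  exact ⟨h2, h1, c₁', c₁, h4, h3, h5.symm⟩

theorem Deformable.trans {β' β'' : Fin 4 → ℂ} (h : Deformable d β β') (h' : Deformable d β' β'') :
    Deformable d β β'' := by
  obtain ⟨h1, h2, c₁, c₁', h3, h4, h5⟩ := h
  have h'' := h'
  obtain ⟨-, g2, e, e', -, g4, -⟩ := h'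
  exact ⟨h1, g2, c₁, e', h3, g4, h5.trans (h''.linked h4 g4)⟩

theorem Deformable.of_equivalent {β' : Fin 4 → ℂ} (h : IsGood d β) (h' : IsGood d β') {c' : ℂ}
    (hc : IsSlit β c) (hc' : IsSlit β' c')
    (he : Equivalent (model (params β c)) (0, 0) (model (params β' c')) (0, 0)) :
    Deformable d β β' :=
  ⟨h, h', c, c', hc, hc', Linked.of_equivalent (isH11_model hc.modelDomain)
    (isH11_model hc'.modelDomain) he (h.isPrimitiveTorusCover hc)⟩

variable {a w b z : ℂ}

theorem span_pair_change {a w : ℂ} {p q r s : ℤ} (h : p * s - q * r = 1) :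
    Submodule.span ℤ {p * a + q * w, r * a + s * w} = Submodule.span ℤ {a, w} := by
  have h' : (p * s - q * r : ℂ) = 1 := by exact_mod_cast h
  apply le_antisymm <;> rw [Submodule.span_le] <;> rintro y (rfl | rfl)
  · exact mem_span_two.2 ⟨p, q, rfl⟩
  · exact mem_span_two.2 ⟨r, s, rfl⟩
  · refine mem_span_two.2 ⟨s, -q, ?_⟩
    push_cast
    linear_combination y * h'
  · refine mem_span_two.2 ⟨-r, p, ?_⟩
    push_cast
    linear_combination y * h'

theorem cross_int_combination (a w : ℂ) (p q r s : ℤ) :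
    cross (p * a + q * w) (r * a + s * w) = (p * s - q * r) * cross a w := by
  simp only [cross, Complex.add_re, Complex.add_im, Complex.mul_re, Complex.mul_im,
    Complex.intCast_re, Complex.intCast_im]
  ring

theorem IsGood.change (h : IsGood d ![a, w, b, z]) {p q r s : ℤ} (hdet : p * s - q * r = 1) :
    IsGood d ![p * a + q * w, r * a + s * w, b, z] := by
  obtain ⟨⟨v₁, v₂, hv, hd, hs⟩, ha⟩ := h
  refine ⟨⟨v₁, v₂, hv, hd, ?_⟩, ?_⟩
  · rw [← hs]
    change Submodule.span ℤ {p * a + q * w, r * a + s * w} ⊔ _ = _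
    rw [span_pair_change hdet]
    rfl
  · change cross (p * a + q * w) (r * a + s * w) + cross b z = 1
    rw [cross_int_combination, show (p * s - q * r : ℝ) = 1 by exact_mod_cast hdet, one_mul]
    exact ha

theorem IsGood.swap (h : IsGood d ![a, w, b, z]) : IsGood d ![b, z, a, w] := by
  obtain ⟨⟨v₁, v₂, hv, hd, hs⟩, ha⟩ := h
  exact ⟨⟨v₁, v₂, hv, hd, (sup_comm _ _).trans hs⟩, (add_comm _ _).trans ha⟩

theorem Deformable.swap (h : IsGood d ![a, w, b, z]) (hc : IsSlit ![a, w, b, z] c) :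
    Deformable d ![a, w, b, z] ![b, z, a, w] :=
  Deformable.of_equivalent h h.swap hc ⟨hc.2.2.1, hc.2.2.2, hc.1, hc.2.1⟩
    (equivalent_model_swap hc.modelDomain)

theorem Deformable.swap_swap {a' w' b' z' : ℂ} (h : Deformable d ![a, w, b, z] ![a', w', b', z']) :
    Deformable d ![b, z, a, w] ![b', z', a', w'] := by
  have h' := h
  obtain ⟨h1, h2, c, c', h3, h4, -⟩ := h
  exact ((Deformable.swap h1 h3).symm.trans h').trans (Deformable.swap h2 h4)

theorem Deformable.shear (h : IsGood d ![a, w, b, z]) (hc : IsSlit ![a, w, b, z] c) :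
    Deformable d ![a, w, b, z] ![a, w - a, b, z] := by
  have h' := h.change (p := 1) (q := 0) (r := -1) (s := 1) (by norm_num)
  have e : (![((1 : ℤ) : ℂ) * a + ((0 : ℤ) : ℂ) * w, ((-1 : ℤ) : ℂ) * a + ((1 : ℤ) : ℂ) * w, b, z] :
      Fin 4 → ℂ) = ![a, w - a, b, z] := by
    congr 1
    · simp
    · congr 1; push_cast; ring
  rw [e] at h'
  rw [isSlit_iff] at hc
  have hc' : IsSlit ![a, w - a, b, z] c := by
    rw [isSlit_iff, cross_sub_right, cross_self, sub_zero]; exact hc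
  refine Deformable.of_equivalent h h' (isSlit_iff.2 hc) hc' ?_
  have := equivalent_model_shear (IsSlit.modelDomain (isSlit_iff.2 hc))
  have e : params ![a, w - a, b, z] c = ![a, b, c, w - c - a, z - c] := by
    simp [params]
    ring
  rw [e]
  exact this

theorem Deformable.shear_int (h : IsGood d ![a, w, b, z]) (hc : IsSlit ![a, w, b, z] c) (k : ℤ) :
    Deformable d ![a, w, b, z] ![a, w + k * a, b, z] := by
  have hc' : ∀ k : ℤ, IsSlit ![a, w + k * a, b, z] c := by
    intro k
    have := cross_smul_right k a a
    push_cast at this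
    rw [isSlit_iff, cross_add_right, this, cross_self, mul_zero, add_zero]
    exact hc
  induction k using Int.induction_on with
  | zero => simpa using Deformable.refl h hc
  | succ k ih =>
    have h2 : IsGood d ![a, w + ((k + 1 : ℤ) : ℂ) * a, b, z] := by
      have := h.change (p := 1) (q := 0) (r := k + 1) (s := 1) (by norm_num)
      convert this using 2
      · simp
      · congr 1; push_cast; ring
    have h3 := Deformable.shear h2 (hc' _)
    rw [show w + ((k + 1 : ℤ) : ℂ) * a - a = w + ((k : ℤ) : ℂ) * a by push_cast; ring] at h3
    exact ih.trans h3.symm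
  | pred k ih =>
    have h3 := Deformable.shear ih.2.1 (hc' _)
    rw [show w + ((-k : ℤ) : ℂ) * a - a = w + ((-k - 1 : ℤ) : ℂ) * a by push_cast; ring] at h3
    exact ih.trans h3

/-- With `e = w - c`, the two convexity conditions of `equivalent_model_shear'` say exactly that `c`
is a slit for the first torus with its new basis. -/
theorem Deformable.shear' (h : IsGood d ![a, w, b, z]) (hc : IsSlit ![a, w, b, z] c)
    (hc' : IsSlit ![a + w, w, b, z] c) : Deformable d ![a, w, b, z] ![a + w, w, b, z] := by
  have h' := h.change (p := 1) (q := 1) (r := 0) (s := 1) (by norm_num)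
  have e : (![((1 : ℤ) : ℂ) * a + ((1 : ℤ) : ℂ) * w, ((0 : ℤ) : ℂ) * a + ((1 : ℤ) : ℂ) * w, b, z] :
      Fin 4 → ℂ) = ![a + w, w, b, z] := by simp
  rw [e] at h'
  refine Deformable.of_equivalent h h' hc hc' ?_
  rw [isSlit_iff] at hc'
  simp only [cross_add_left, cross_self, add_zero] at hc'
  have := equivalent_model_shear' hc.modelDomain (by
    change 0 < cross (a + c) (w - c)
    rw [cross_add_left, cross_sub_right, cross_sub_right, cross_self, cross_comm c w]
    linarith) (by
    change 0 < cross (a + (w - c)) c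
    rw [cross_add_left, cross_sub_left, cross_self]
    linarith)
  have e : params ![a + w, w, b, z] c = ![a + c + (w - c), b, c, w - c, z - c] := by
    simp [params]
  rw [e]
  exact this

/-- The isomorphism `equivalent_model_twist` adds `a + b` to the slit and so to both `w` and `z`. A
shear of each torus then removes `a` from the first and `b` from the second. -/
theorem Deformable.twist (h : IsGood d ![a, w, b, z]) (hc : IsSlit ![a, w, b, z] c)
    (h1 : 0 < cross a (b + c)) (h2 : 0 < cross b (a + c)) :
    Deformable d ![a, w, b, z] ![a, w + b, b, z + a] := by
  rw [isSlit_iff] at hc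
  obtain ⟨⟨v₁, v₂, hv, hd, hs⟩, ha⟩ := h
  have hs' : Submodule.span ℤ {a, w} ⊔ Submodule.span ℤ {b, z} = Submodule.span ℤ {v₁, v₂} := hs
  have ha' : cross a w + cross b z = 1 := ha
  rw [← Submodule.span_union] at hs'
  have hg : IsGood d ![a, w + a + b, b, z + a + b] := by
    refine ⟨⟨v₁, v₂, hv, hd, ?_⟩, ?_⟩
    · rw [← hs', ← Submodule.span_union]
      change Submodule.span ℤ ({a, w + a + b} ∪ {b, z + a + b}) = _
      have m : ∀ y ∈ ({a, w} ∪ {b, z} : Set ℂ), y ∈ Submodule.span ℤ ({a, w} ∪ {b, z} : Set ℂ) :=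
        fun y hy => Submodule.subset_span hy
      have m' : ∀ y ∈ ({a, w + a + b} ∪ {b, z + a + b} : Set ℂ),
          y ∈ Submodule.span ℤ ({a, w + a + b} ∪ {b, z + a + b} : Set ℂ) :=
        fun y hy => Submodule.subset_span hy
      have ma := m a (by simp)
      have mb := m b (by simp)
      have mw := m w (by simp)
      have mz := m z (by simp)
      have ma' := m' a (by simp)
      have mb' := m' b (by simp)
      have mw' := m' (w + a + b) (by simp)
      have mz' := m' (z + a + b) (by simp)
      apply le_antisymm <;> rw [Submodule.span_le] <;> rintro y ((rfl | rfl) | (rfl | rfl))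
      · exact ma
      · exact add_mem (add_mem mw ma) mb
      · exact mb
      · exact add_mem (add_mem mz ma) mb
      · exact ma'
      · have := sub_mem (sub_mem mw' ma') mb'
        rwa [show y + a + b - a - b = y by ring] at this
      · exact mb'
      · have := sub_mem (sub_mem mz' ma') mb'
        rwa [show y + a + b - a - b = y by ring] at this
    · change cross a (w + a + b) + cross b (z + a + b) = 1
      simp only [cross_add_right, cross_self]
      linarith [cross_comm a b]
  have hc' : IsSlit ![a, w + a + b, b, z + a + b] (c + a + b) := by
    rw [isSlit_iff]
    simp only [cross_add_right, cross_self] at h1 h2 ⊢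
    refine ⟨?_, ?_, ?_, ?_⟩ <;> linarith
  have h3 : Deformable d ![a, w, b, z] ![a, w + a + b, b, z + a + b] := by
    refine Deformable.of_equivalent ⟨⟨v₁, v₂, hv, hd, hs⟩, ha⟩ hg (isSlit_iff.2 hc) hc' ?_
    have := equivalent_model_twist (IsSlit.modelDomain (isSlit_iff.2 hc)) h1 h2
    have e : params ![a, w + a + b, b, z + a + b] (c + a + b) =
        ![a, b, c + a + b, w - c, z - c] := by
      simp [params]
    rw [e]
    exact this
  have h4 := Deformable.shear hg hc'
  rw [show w + a + b - a = w + b by ring] at h4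
  have hc4 := (h4.2.2.choose_spec.choose_spec).2.1
  have h5 := (Deformable.shear h4.2.1.swap ((Deformable.swap h4.2.1 hc4).2.2.choose_spec.choose_spec).2.1).swap_swap
  rw [show z + a + b - b = z + a by ring] at h5
  exact (h3.trans h4).trans h5

end GluedTriangles
end TranslationSurface

/-! ### Changing the basis of one torus: the Euclidean algorithm. -/

namespace TranslationSurface
namespace GluedTriangles

variable {d : ℕ} {a w b z u : ℂ}

/-- A small positive multiple of `u` is a slit for both: positivity is preserved by scaling, and the
upper bounds hold for short vectors. -/
theorem exists_isSlit {β β' : Fin 4 → ℂ} {u : ℂ} (h : 0 < cross (β 0) (β 1) ∧ 0 < cross (β 2) (β 3))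
    (h' : 0 < cross (β' 0) (β' 1) ∧ 0 < cross (β' 2) (β' 3))
    (hu : 0 < cross (β 0) u ∧ 0 < cross (β 2) u) (hu' : 0 < cross (β' 0) u ∧ 0 < cross (β' 2) u) :
    ∃ c, IsSlit β c ∧ IsSlit β' c := by
  have key : ∀ x y : ℝ, 0 < x → 0 < y → ∀ᶠ ε : ℝ in 𝓝[>] 0, ε * x < y := by
    intro x y hx hy
    have : Tendsto (fun ε : ℝ => ε * x) (𝓝[>] 0) (𝓝 (0 * x)) :=
      (tendsto_id.mul_const x).mono_left nhdsWithin_le_nhds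
    rw [zero_mul] at this
    exact this.eventually_lt_const hy
  have hev := (((key _ _ hu.1 h.1).and (key _ _ hu.2 h.2)).and
    ((key _ _ hu'.1 h'.1).and (key _ _ hu'.2 h'.2))).and self_mem_nhdsWithin
  obtain ⟨ε, ⟨⟨h1, h2⟩, h3, h4⟩, h5⟩ := hev.exists
  have h5 : 0 < ε := h5
  refine ⟨(ε : ℂ) * u, ⟨?_, ?_, ?_, ?_⟩, ?_, ?_, ?_, ?_⟩ <;> rw [cross_smul_right]
  exacts [mul_pos h5 hu.1, h1, mul_pos h5 hu.2, h2, mul_pos h5 hu'.1, h3, mul_pos h5 hu'.2, h4]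

/-- The Euclidean algorithm on `(p, q)`, by induction on `|q|`. All first basis vectors occurring
are kept in the half-plane of vectors positive against the fixed `u`; then short slits along `u`
exist for every basis, as the shears require. -/
theorem Deformable.of_direction (n : ℕ) : ∀ {a w : ℂ} {p q r s : ℤ}, q.natAbs ≤ n →
    IsGood d ![a, w, b, z] → 0 < cross a w → 0 < cross b z → 0 < cross a u → 0 < cross b u →
    p * s - q * r = 1 → 0 < cross (p * a + q * w) u →
    Deformable d ![a, w, b, z] ![p * a + q * w, r * a + s * w, b, z] := by
  induction n with
  | zero =>
    intro a w p q r s hq hg haw hbz hau hbu hdet ha'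
    obtain rfl : q = 0 := by omega
    have hps : p * s = 1 := by linarith
    have hp : p = 1 := by
      rcases Int.isUnit_iff.1 (IsUnit.of_mul_eq_one s hps) with h | h
      · exact h
      · subst h
        simp [cross_neg_left] at ha'
        linarith
    subst hp
    obtain rfl : s = 1 := by linarith
    obtain ⟨c, hc, -⟩ := exists_isSlit (β := ![a, w, b, z]) (β' := ![a, w, b, z]) ⟨haw, hbz⟩
      ⟨haw, hbz⟩ ⟨hau, hbu⟩ ⟨hau, hbu⟩
    have := Deformable.shear_int hg hc r
    rw [show ((1 : ℤ) : ℂ) * a + ((0 : ℤ) : ℂ) * w = a by simp,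
      show (r : ℂ) * a + ((1 : ℤ) : ℂ) * w = w + r * a by push_cast; ring]
    exact this
  | succ n ih =>
    intro a w p q r s hq hg haw hbz hau hbu hdet ha'
    by_cases hq0 : q = 0
    · exact ih (by simp [hq0]) hg haw hbz hau hbu hdet ha'
    -- `p` is reduced modulo `q` to the range from `1` to `|q|` instead of `0` to `|q| - 1`: the
    -- next coefficient has absolute value `|q| - p'`, which must drop.
    obtain ⟨k, p', hp, hp1, hp2⟩ : ∃ k p' : ℤ, p' = p - q * k ∧ 1 ≤ p' ∧ p' ≤ |q| := by
      refine ⟨(p - 1) / q, 1 + (p - 1) % q, ?_, ?_, ?_⟩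
      · have := Int.emod_add_mul_ediv (p - 1) q; linarith
      · have := Int.emod_nonneg (p - 1) hq0; linarith
      · have := Int.emod_lt_abs (p - 1) hq0; linarith
    obtain ⟨σ, hσ, hσq⟩ : ∃ σ : ℤ, σ * σ = 1 ∧ |q| = σ * q := by
      rcases le_total 0 q with h | h
      · exact ⟨1, by norm_num, by rw [abs_of_nonneg h, one_mul]⟩
      · exact ⟨-1, by norm_num, by rw [abs_of_nonpos h]; ring⟩
    have hq' : q = σ * |q| := by rw [hσq, ← mul_assoc, hσ, one_mul]
    have hqpos : 0 < |q| := abs_pos.2 hq0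
    obtain ⟨c, hc, -⟩ := exists_isSlit (β := ![a, w, b, z]) (β' := ![a, w, b, z]) ⟨haw, hbz⟩
      ⟨haw, hbz⟩ ⟨hau, hbu⟩ ⟨hau, hbu⟩
    have h1 := Deformable.shear_int hg hc k
    set w₁ := w + k * a with hw₁
    have haw₁ : cross a w₁ = cross a w := by
      have := cross_smul_right k a a
      push_cast at this
      rw [hw₁, cross_add_right, this, cross_self]; ring
    set A := a + σ * w₁ with hA
    have hAw : cross A w₁ = cross a w := by
      have := cross_smul_left σ w₁ w₁
      push_cast at this
      rw [hA, cross_add_left, this, cross_self, haw₁]; ring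
    have hσ' : (σ * σ : ℂ) = 1 := by exact_mod_cast hσ
    have hAu : 0 < cross A u := by
      -- A positive multiple of `A` is a nonnegative multiple of `a` plus the target vector, and
      -- both of these are on the right side of `u`.
      have e : ((|q| : ℤ) : ℂ) * A = ((|q| - p' : ℤ) : ℂ) * a + (p * a + q * w) := by
        have e1 : (q : ℂ) = σ * ((|q| : ℤ) : ℂ) := by exact_mod_cast hq'
        have e2 : (p : ℂ) = p' + q * k := by rw [hp]; push_cast; ring
        rw [hA, hw₁, e2]
        push_cast
        rw [show ((|q| : ℤ) : ℂ) = σ * q by exact_mod_cast hσq]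
        linear_combination (q * (w + k * a)) * hσ'
      generalize |q| = m at e hqpos hp2
      have e3 := congrArg (fun y => cross y u) e
      have e4 := cross_smul_left (m : ℝ) A u
      have e5 := cross_smul_left ((m - p' : ℤ) : ℝ) a u
      push_cast at e3 e4 e5
      rw [cross_add_left, e4, e5] at e3
      have c1 : (0 : ℝ) < m := by exact_mod_cast hqpos
      have c2 : (0 : ℝ) ≤ (m : ℝ) - p' := by
        have : (0 : ℤ) ≤ m - p' := by linarith
        exact_mod_cast this
      have : 0 < (m : ℝ) * cross A u := by
        rw [e3]
        exact add_pos_of_nonneg_of_pos (mul_nonneg c2 hau.le) ha'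
      exact (pos_iff_pos_of_mul_pos this).1 c1
    have h2 : Deformable d ![a, w₁, b, z] ![A, w₁, b, z] := by
      have hgA : IsGood d ![A, w₁, b, z] := by
        have := h1.2.1.change (p := 1) (q := σ) (r := 0) (s := 1) (by ring)
        convert this using 2
        · rw [hA]; push_cast; ring
        · congr 1; push_cast; ring
      obtain ⟨c, c1, c2⟩ := exists_isSlit (β := ![a, w₁, b, z]) (β' := ![A, w₁, b, z])
        ⟨haw₁ ▸ haw, hbz⟩ ⟨hAw ▸ haw, hbz⟩ ⟨hau, hbu⟩ ⟨hAu, hbu⟩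
      -- For `σ = -1` the shear is applied from `A` to `a = A + w₁` and reversed.
      have hσ2 : σ = 1 ∨ σ = -1 := Int.isUnit_iff.1 (IsUnit.of_mul_eq_one σ hσ)
      rcases hσ2 with rfl | rfl
      · have hA' : A = a + w₁ := by rw [hA]; simp
        rw [hA'] at c2 ⊢
        exact Deformable.shear' h1.2.1 c1 c2
      · have hA' : a = A + w₁ := by rw [hA]; simp
        have c1' : IsSlit ![A + w₁, w₁, b, z] c := by rw [← hA']; exact c1
        have := Deformable.shear' hgA c2 c1'
        rw [← hA'] at this
        exact this.symm
    have e1 : (p * a + q * w : ℂ) = (p' : ℤ) * A + ((q - σ * p' : ℤ) : ℂ) * w₁ := by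
      rw [hA, hw₁, hp]; push_cast; ring
    have e2 : (r * a + s * w : ℂ) = ((r - s * k : ℤ) : ℂ) * A + ((s - σ * (r - s * k) : ℤ) : ℂ) * w₁ := by
      rw [hA, hw₁]; push_cast; ring
    rw [e1] at ha' ⊢
    rw [e2]
    refine (h1.trans h2).trans (ih ?_ h2.2.1 (hAw ▸ haw) hbz hAu hbu ?_ ha')
    · have e3 : q - σ * p' = σ * (|q| - p') := by
        conv_lhs => rw [hq']
        ring
      have e4 : σ.natAbs = 1 := by
        rcases Int.isUnit_iff.1 (IsUnit.of_mul_eq_one σ hσ) with h | h <;> simp [h]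
      rw [e3, Int.natAbs_mul, e4, one_mul]
      have := Int.natCast_natAbs q
      omega
    · rw [hp]; linear_combination hdet

/-- A lattice contains a primitive vector in every open cone. -/
theorem exists_primitive_in_cone (ha : cross a w ≠ 0) {u u' : ℂ} (hu : cross u u' ≠ 0) :
    ∃ p q r s : ℤ, p * s - q * r = 1 ∧ 0 < cross (p * a + q * w) u ∧ 0 < cross (p * a + q * w) u' := by
  have hci : ∀ (p q : ℤ) (v : ℂ), cross (p * a + q * w) v = p * cross a v + q * cross w v := by
    intro p q v
    have e4 := cross_smul_left p a v
    have e5 := cross_smul_left q w v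
    push_cast at e4 e5
    rw [cross_add_left, e4, e5]
  -- The real vector `ξ a + η w` has determinant one with both `u` and `u'`. It is scaled by `N`,
  -- which exceeds the error caused by rounding the coefficients down.
  obtain ⟨ξ, η, h1, h2⟩ : ∃ ξ η : ℝ, ξ * cross a u + η * cross w u = 1 ∧
      ξ * cross a u' + η * cross w u' = 1 := by
    have hD : cross a u * cross w u' - cross w u * cross a u' ≠ 0 := by
      have : cross a u * cross w u' - cross w u * cross a u' = cross a w * cross u u' := by
        simp only [cross]; ring
      rw [this]
      exact mul_ne_zero ha hu
    refine ⟨(cross w u' - cross w u) / (cross a u * cross w u' - cross w u * cross a u'),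
      (cross a u - cross a u') / (cross a u * cross w u' - cross w u * cross a u'), ?_, ?_⟩ <;>
    · rw [div_mul_eq_mul_div, div_mul_eq_mul_div, ← add_div, div_eq_one_iff_eq hD]
      ring
  set C := |cross a u| + |cross w u| + |cross a u'| + |cross w u'| with hC
  set N := C + 1 with hN
  have hC0 : 0 ≤ C := by positivity
  have hbound : ∀ v, |cross a v| + |cross w v| ≤ C → ξ * cross a v + η * cross w v = 1 →
      0 < cross (((⌊N * ξ⌋ : ℤ) : ℂ) * a + ((⌊N * η⌋ : ℤ) : ℂ) * w) v := by
    intro v hv h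
    rw [hci]
    have f1 := Int.fract_add_floor (N * ξ)
    have f2 := Int.fract_add_floor (N * η)
    have g1 : Int.fract (N * ξ) * cross a v ≤ |cross a v| := by
      have := Int.fract_nonneg (N * ξ); have := Int.fract_lt_one (N * ξ)
      nlinarith [le_abs_self (cross a v), abs_nonneg (cross a v)]
    have g2 : Int.fract (N * η) * cross w v ≤ |cross w v| := by
      have := Int.fract_nonneg (N * η); have := Int.fract_lt_one (N * η)
      nlinarith [le_abs_self (cross w v), abs_nonneg (cross w v)]
    have : (⌊N * ξ⌋ : ℝ) * cross a v + ⌊N * η⌋ * cross w v =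
        N - Int.fract (N * ξ) * cross a v - Int.fract (N * η) * cross w v := by
      rw [show (⌊N * ξ⌋ : ℝ) = N * ξ - Int.fract (N * ξ) by linarith,
        show (⌊N * η⌋ : ℝ) = N * η - Int.fract (N * η) by linarith]
      linear_combination N * h
    rw [this]
    linarith
  have b1 := hbound u (by rw [hC]; linarith [abs_nonneg (cross a u'), abs_nonneg (cross w u')]) h1
  have b2 := hbound u' (by rw [hC]; linarith [abs_nonneg (cross a u), abs_nonneg (cross w u)]) h2
  generalize ⌊N * ξ⌋ = P at b1 b2
  generalize ⌊N * η⌋ = Q at b1 b2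
  have hg : 0 < Int.gcd P Q := by
    rw [Int.gcd_pos_iff]
    by_contra! h
    rw [h.1, h.2] at b1
    simp [cross_zero_left] at b1
  -- Division by the greatest common divisor makes the vector primitive and keeps its direction.
  obtain ⟨p, q, hpq, hP, hQ⟩ := Int.exists_gcd_one hg
  obtain ⟨s, r, hsr⟩ := Int.isCoprime_iff_gcd_eq_one.2 hpq
  have hsc : ∀ v, cross (P * a + Q * w) v = (Int.gcd P Q : ℝ) * cross (p * a + q * w) v := by
    intro v
    rw [hci, hci]
    have hP' : (P : ℝ) = p * (Int.gcd P Q : ℝ) := by exact_mod_cast hP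
    have hQ' : (Q : ℝ) = q * (Int.gcd P Q : ℝ) := by exact_mod_cast hQ
    rw [hP', hQ']
    ring
  have hg' : (0 : ℝ) < Int.gcd P Q := by exact_mod_cast hg
  rw [hsc] at b1 b2
  exact ⟨p, q, -r, s, by linarith, (pos_iff_pos_of_mul_pos b1).1 hg', (pos_iff_pos_of_mul_pos b2).1 hg'⟩

end GluedTriangles
end TranslationSurface

/-! ### Smith normal form, and independence of the bases of the tori. -/

namespace TranslationSurface

/-- The integral matrix `E` can be brought to the form `diag(e₁, e₂)` with `e₁ ∣ e₂`. -/
def HasDiagonalForm (E : Matrix (Fin 2) (Fin 2) ℤ) : Prop :=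
  ∃ P Q : Matrix (Fin 2) (Fin 2) ℤ, P.det = 1 ∧ Q.det = 1 ∧ ∃ e f : ℤ,
    P * E * Q = !![e, 0; 0, e * f]

theorem HasDiagonalForm.of_mul {E P Q : Matrix (Fin 2) (Fin 2) ℤ} (hP : P.det = 1) (hQ : Q.det = 1)
    (h : HasDiagonalForm (P * E * Q)) : HasDiagonalForm E := by
  obtain ⟨P', Q', h1, h2, e, f, h3⟩ := h
  refine ⟨P' * P, Q * Q', by rw [Matrix.det_mul, h1, hP, one_mul],
    by rw [Matrix.det_mul, h2, hQ, one_mul], e, f, ?_⟩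
  rw [← h3]
  simp only [Matrix.mul_assoc]

theorem HasDiagonalForm.transpose {E : Matrix (Fin 2) (Fin 2) ℤ} (h : HasDiagonalForm E.transpose) :
    HasDiagonalForm E := by
  obtain ⟨P, Q, h1, h2, e, f, h3⟩ := h
  refine ⟨Q.transpose, P.transpose, by rwa [Matrix.det_transpose], by rwa [Matrix.det_transpose], e, f, ?_⟩
  have := congrArg Matrix.transpose h3
  rw [Matrix.transpose_mul, Matrix.transpose_mul, Matrix.transpose_transpose, ← Matrix.mul_assoc] at this
  rw [this]
  ext i j
  fin_cases i <;> fin_cases j <;> simp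

/-- Descent on `|a|`: an entry beside or below `a` that `a` does not divide yields a smaller nonzero
corner entry. The transformations have determinant one, not merely `±1`, so that bases stay
oriented; the sign is absorbed by the diagonal. -/
theorem hasDiagonalForm_aux (n : ℕ) : ∀ a b c d : ℤ, a ≠ 0 → a.natAbs ≤ n →
    HasDiagonalForm !![a, b; c, d] := by
  induction n with
  | zero => intro a b c d ha h; omega
  | succ n ih =>
    have step : ∀ a b c d : ℤ, a ≠ 0 → a.natAbs ≤ n + 1 → ¬ a ∣ b → HasDiagonalForm !![a, b; c, d] := by
      intro a b c d ha h hab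
      have hr : b % a ≠ 0 := fun h => hab (Int.dvd_of_emod_eq_zero h)
      have hlt : (b % a).natAbs ≤ n := by
        have h1 := Int.emod_lt_abs b ha
        have h2 := Int.emod_nonneg b ha
        have h3 := Int.natCast_natAbs a
        omega
      -- This column operation puts the remainder `b % a` into the corner.
      refine HasDiagonalForm.of_mul (P := 1) (Q := !![-(b / a), -1; 1, 0]) (by simp)
        (by simp [Matrix.det_fin_two]) ?_
      have := ih (b % a) (-a) (d - c * (b / a)) (-c) hr hlt
      convert this using 1
      have e := Int.emod_add_mul_ediv b a
      rw [one_mul]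
      ext i j
      fin_cases i <;> fin_cases j <;> simp [Matrix.mul_apply, Fin.sum_univ_two] <;> linarith
    intro a b c d ha h
    by_cases hb : a ∣ b
    · by_cases hc : a ∣ c
      · obtain ⟨b, rfl⟩ := hb
        obtain ⟨c, rfl⟩ := hc
        refine HasDiagonalForm.of_mul (P := !![1, 0; -c, 1]) (Q := !![1, -b; 0, 1])
          (by simp [Matrix.det_fin_two]) (by simp [Matrix.det_fin_two]) ?_
        have he : (!![1, 0; -c, 1] * !![a, a * b; a * c, d] * !![1, -b; 0, 1] :
            Matrix (Fin 2) (Fin 2) ℤ) = !![a, 0; 0, d - a * b * c] := by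
          ext i j
          fin_cases i <;> fin_cases j <;> simp [Matrix.mul_apply, Fin.sum_univ_two] <;> ring
        rw [he]
        by_cases hd : a ∣ d - a * b * c
        · obtain ⟨f, hf⟩ := hd
          exact ⟨1, 1, by simp, by simp, a, f, by rw [hf]; simp⟩
        -- Adding the second row to the first puts the entry that `a` does not divide beside `a`,
        -- where `step` applies.
        · refine HasDiagonalForm.of_mul (P := !![1, 1; 0, 1]) (Q := 1)
            (by simp [Matrix.det_fin_two]) (by simp) ?_
          have := step a (d - a * b * c) 0 (d - a * b * c) ha h hd
          convert this using 1
          ext i j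
          fin_cases i <;> fin_cases j <;> simp [Matrix.mul_apply, Fin.sum_univ_two]
      · apply HasDiagonalForm.transpose
        have := step a c b d ha h hc
        convert this using 1
        ext i j
        fin_cases i <;> fin_cases j <;> simp
    · exact step a b c d ha h hb

theorem hasDiagonalForm (a b c d : ℤ) (h : a * d - b * c ≠ 0) : HasDiagonalForm !![a, b; c, d] := by
  by_cases ha : a = 0
  · have hb : b ≠ 0 := by rintro rfl; simp [ha] at h
    refine HasDiagonalForm.of_mul (P := 1) (Q := !![0, -1; 1, 0]) (by simp)
      (by simp [Matrix.det_fin_two]) ?_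
    have := hasDiagonalForm_aux b.natAbs b (-a) d (-c) hb le_rfl
    convert this using 1
    rw [one_mul]
    ext i j
    fin_cases i <;> fin_cases j <;> simp [Matrix.mul_apply, Fin.sum_univ_two]
  · exact hasDiagonalForm_aux _ a b c d ha le_rfl

/-- The pairs `(a, w)` and `(a', w')` are oriented bases of the same lattice. -/
def IsBaseChange (a w a' w' : ℂ) : Prop :=
  ∃ p q r s : ℤ, p * s - q * r = 1 ∧ a' = p * a + q * w ∧ w' = r * a + s * w

theorem IsBaseChange.symm {a w a' w' : ℂ} (h : IsBaseChange a w a' w') : IsBaseChange a' w' a w := by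
  obtain ⟨p, q, r, s, h, rfl, rfl⟩ := h
  have h' : (p * s - q * r : ℂ) = 1 := by exact_mod_cast h
  refine ⟨s, -q, -r, p, by linarith, ?_, ?_⟩
  · push_cast; linear_combination (-a) * h'
  · push_cast; linear_combination (-w) * h'

theorem IsBaseChange.trans {a w a' w' a'' w'' : ℂ} (h : IsBaseChange a w a' w')
    (h' : IsBaseChange a' w' a'' w'') : IsBaseChange a w a'' w'' := by
  obtain ⟨p, q, r, s, h, rfl, rfl⟩ := h
  obtain ⟨p', q', r', s', h', rfl, rfl⟩ := h'
  refine ⟨p' * p + q' * r, p' * q + q' * s, r' * p + s' * r, r' * q + s' * s, ?_, ?_, ?_⟩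
  · linear_combination (p' * s' - q' * r') * h + h'
  · push_cast; ring
  · push_cast; ring

theorem IsBaseChange.cross_eq {a w a' w' : ℂ} (h : IsBaseChange a w a' w') :
    cross a' w' = cross a w := by
  obtain ⟨p, q, r, s, h, rfl, rfl⟩ := h
  have h' : (p * s - q * r : ℝ) = 1 := by exact_mod_cast h
  simp only [cross, Complex.add_re, Complex.add_im, Complex.mul_re, Complex.mul_im,
    Complex.intCast_re, Complex.intCast_im]
  linear_combination (a.re * w.im - a.im * w.re) * h'

namespace GluedTriangles

variable {d : ℕ} {a w b z a' w' b' z' u : ℂ}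

theorem IsGood.of_isBaseChange (h : IsGood d ![a, w, b, z]) (h1 : IsBaseChange a w a' w')
    (h2 : IsBaseChange b z b' z') : IsGood d ![a', w', b', z'] := by
  obtain ⟨p, q, r, s, h1, rfl, rfl⟩ := h1
  obtain ⟨p', q', r', s', h2, rfl, rfl⟩ := h2
  exact ((h.change h1).swap.change h2).swap

theorem Deformable.of_direction₂ (h : IsGood d ![a, w, b, z]) (haw : 0 < cross a w)
    (hbz : 0 < cross b z) (hau : 0 < cross a u) (hbu : 0 < cross b u) (h1 : IsBaseChange a w a' w')
    (h2 : IsBaseChange b z b' z') (hau' : 0 < cross a' u) (hbu' : 0 < cross b' u) :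
    Deformable d ![a, w, b, z] ![a', w', b', z'] := by
  have haw' : 0 < cross a' w' := by rw [h1.cross_eq]; exact haw
  obtain ⟨p, q, r, s, h1, rfl, rfl⟩ := h1
  obtain ⟨p', q', r', s', h2, rfl, rfl⟩ := h2
  have d1 := Deformable.of_direction _ le_rfl h haw hbz hau hbu h1 hau'
  have d2 := Deformable.of_direction _ le_rfl d1.2.1.swap hbz haw' hbu hau' h2 hbu'
  exact d1.trans d2.swap_swap

/-- The deformation class depends only on the lattices of the two tori. -/
theorem Deformable.of_isBaseChange {c c' : ℂ} (h : IsGood d ![a, w, b, z])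
    (hc : IsSlit ![a, w, b, z] c) (hc' : IsSlit ![a', w', b', z'] c') (h1 : IsBaseChange a w a' w')
    (h2 : IsBaseChange b z b' z') : Deformable d ![a, w, b, z] ![a', w', b', z'] := by
  rw [isSlit_iff] at hc hc'
  have haw : 0 < cross a w := by linarith
  have hbz : 0 < cross b z := by linarith
  have hc0 : c ≠ 0 := by rintro rfl; simp [cross_zero_right] at hc
  -- `u` is a direction that admits the new basis and is not parallel to the slit `c` of the old
  -- one: `c'` itself, or `c'` turned slightly if it is parallel to `c`.
  obtain ⟨u, hu0, hu1, hu2⟩ : ∃ u, cross c u ≠ 0 ∧ 0 < cross a' u ∧ 0 < cross b' u := by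
    by_cases h0 : cross c c' = 0
    · have hlim : ∀ v, 0 < cross v c' → ∀ᶠ ε : ℝ in 𝓝[>] 0, 0 < cross v (c' + ε * (Complex.I * c)) := by
        intro v hv
        have hcont : Continuous fun ε : ℝ => cross v (c' + ε * (Complex.I * c)) :=
          Continuous.cross continuous_const (by fun_prop)
        have := (hcont.tendsto 0).mono_left (nhdsWithin_le_nhds (s := Ioi 0))
        simp only [Complex.ofReal_zero, zero_mul, add_zero] at this
        exact this.eventually_const_lt hv
      obtain ⟨ε, ⟨h3, h4⟩, h5⟩ := (((hlim a' hc'.1).and (hlim b' hc'.2.2.1)).and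
        self_mem_nhdsWithin).exists
      refine ⟨_, ?_, h3, h4⟩
      rw [cross_add_right, h0, cross_smul_right, zero_add]
      have h5 : 0 < ε := h5
      have : cross c (Complex.I * c) = Complex.normSq c := by simp [cross, Complex.normSq_apply]
      rw [this]
      exact mul_ne_zero h5.ne' (Complex.normSq_pos.2 hc0).ne'
    · exact ⟨c', h0, hc'.1, hc'.2.2.1⟩
  -- An intermediate basis positive against both `c` and `u` exists since these are not parallel.
  -- The old basis is joined to it along `c`, and it is joined to the new basis along `u`.
  obtain ⟨p, q, r, s, hdet, k1, k2⟩ := exists_primitive_in_cone haw.ne' hu0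
  obtain ⟨p', q', r', s', hdet', k1', k2'⟩ := exists_primitive_in_cone hbz.ne' hu0
  have g1 : IsBaseChange a w (p * a + q * w) (r * a + s * w) := ⟨p, q, r, s, hdet, rfl, rfl⟩
  have g2 : IsBaseChange b z (p' * b + q' * z) (r' * b + s' * z) := ⟨p', q', r', s', hdet', rfl, rfl⟩
  have d1 := Deformable.of_direction₂ h haw hbz hc.1 hc.2.2.1 g1 g2 k1 k1'
  have d2 := Deformable.of_direction₂ d1.2.1 (by rw [g1.cross_eq]; exact haw)
    (by rw [g2.cross_eq]; exact hbz) k2 k2' (g1.symm.trans h1) (g2.symm.trans h2) hu1 hu2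
  exact d1.trans d2

theorem exists_cross_eq {a b : ℂ} (h : cross a b ≠ 0) (X Y : ℝ) :
    ∃ c, cross a c = X ∧ cross b c = Y := by
  refine ⟨((-Y / cross a b : ℝ) : ℂ) * a + ((X / cross a b : ℝ) : ℂ) * b, ?_, ?_⟩ <;>
    rw [cross_add_right, cross_smul_right, cross_smul_right, cross_self]
  · field_simp
    ring
  · have h' : cross b a ≠ 0 := by rw [cross_comm]; exact neg_ne_zero.2 h
    rw [cross_comm a b]; field_simp
    ring

theorem exists_isSlit_of_cross (haw : 0 < cross a w) (hbz : 0 < cross b z) (h : cross a b ≠ 0) :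
    ∃ c, IsSlit ![a, w, b, z] c := by
  obtain ⟨c, h1, h2⟩ := exists_cross_eq h (cross a w / 2) (cross b z / 2)
  refine ⟨c, isSlit_iff.2 ⟨?_, ?_, ?_, ?_⟩⟩ <;> linarith

/-- When `a` and `b` are not parallel, the heights `X` and `Y` of the slit over them can be
prescribed independently. The conditions of the twist become `X > -cross a b` and `Y > cross a b`,
compatible with the upper bounds by hypothesis. -/
theorem Deformable.twist_of_cross (h : IsGood d ![a, w, b, z]) (haw : 0 < cross a w)
    (hbz : 0 < cross b z) (h0 : cross a b ≠ 0) (h1 : -cross a w < cross a b)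
    (h2 : cross a b < cross b z) : Deformable d ![a, w, b, z] ![a, w + b, b, z + a] := by
  obtain ⟨X, hX1, hX2⟩ := exists_between (show max 0 (-cross a b) < cross a w from
    max_lt haw (by linarith))
  obtain ⟨Y, hY1, hY2⟩ := exists_between (show max 0 (cross a b) < cross b z from max_lt hbz h2)
  rw [max_lt_iff] at hX1 hY1
  obtain ⟨c, e1, e2⟩ := exists_cross_eq h0 X Y
  refine Deformable.twist h (c := c) (isSlit_iff.2 ⟨?_, ?_, ?_, ?_⟩) ?_ ?_
  · rw [e1]; exact hX1.1
  · rw [e1]; exact hX2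
  · rw [e2]; exact hY1.1
  · rw [e2]; exact hY2
  · rw [cross_add_right, e1]; linarith
  · rw [cross_add_right, e2, cross_comm]; linarith

/-- If `b` is a positive multiple of `a`, the conditions of the twist are those of a slit, and every
slit will do. -/
theorem Deformable.twist_of_parallel (h : IsGood d ![a, w, b, z]) (haw : 0 < cross a w)
    (hbz : 0 < cross b z) {t : ℝ} (ht : 0 < t) (hb : b = t * a) :
    Deformable d ![a, w, b, z] ![a, w + b, b, z + a] ∧ ∃ c, IsSlit ![a, w, b, z] c := by
  have hbw : cross b w = t * cross a w := by rw [hb, cross_smul_left]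
  have hab : cross a b = 0 := by rw [hb, cross_smul_right, cross_self, mul_zero]
  have hba : cross b a = 0 := by rw [cross_comm, hab, neg_zero]
  have hbw' : 0 < cross b w := by rw [hbw]; exact mul_pos ht haw
  obtain ⟨c, hc, -⟩ := exists_isSlit (β := ![a, w, b, z]) (β' := ![a, w, b, z]) ⟨haw, hbz⟩
      ⟨haw, hbz⟩ ⟨haw, hbw'⟩ ⟨haw, hbw'⟩
  refine ⟨Deformable.twist h hc ?_ ?_, c, hc⟩
  · rw [cross_add_right, hab, zero_add]; exact hc.1
  · rw [cross_add_right, hba, zero_add]; exact hc.2.2.1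

end GluedTriangles
end TranslationSurface

/-! ### The pairing of the two lattices, and periods in normal form. -/

namespace TranslationSurface

/-- The additive map `x ↦ cross x y`. -/
noncomputable def crossHom (y : ℂ) : ℂ →+ ℝ where
  toFun x := cross x y
  map_zero' := cross_zero_left y
  map_add' x x' := cross_add_left x x' y

theorem cross_mem_of_span {K : AddSubgroup ℝ} {s t : Set ℂ} (h : ∀ x ∈ s, ∀ y ∈ t, cross x y ∈ K)
    {x y : ℂ} (hx : x ∈ Submodule.span ℤ s) (hy : y ∈ Submodule.span ℤ t) : cross x y ∈ K := by
  have h1 : ∀ y ∈ t, ∀ x ∈ Submodule.span ℤ s, cross x y ∈ K := by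
    intro y hy x hx
    have : Submodule.span ℤ s ≤ AddSubgroup.toIntSubmodule (K.comap (crossHom y)) :=
      Submodule.span_le.2 fun x hx => h x hx y hy
    exact this hx
  have : Submodule.span ℤ t ≤ AddSubgroup.toIntSubmodule (K.comap (crossHom x)) := by
    refine Submodule.span_le.2 fun y hy => ?_
    change cross y x ∈ K
    rw [cross_comm y x]
    exact K.neg_mem (h1 y hy x hx)
  have h2 : cross y x ∈ K := this hy
  rw [cross_comm x y]
  exact K.neg_mem h2

/-- The integral multiples of a real number. -/
theorem mem_zmultiples_real {κ r : ℝ} : r ∈ AddSubgroup.zmultiples κ ↔ ∃ k : ℤ, r = k * κ := by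
  rw [AddSubgroup.mem_zmultiples_iff]
  simp [eq_comm]

theorem cross_combination (p q r s : ℤ) (a w b z : ℂ) :
    cross (p * a + q * w) (r * b + s * z) =
      p * r * cross a b + p * s * cross a z + q * r * cross w b + q * s * cross w z := by
  simp only [cross, Complex.add_re, Complex.add_im, Complex.mul_re, Complex.mul_im,
    Complex.intCast_re, Complex.intCast_im]
  ring

/-- The determinant of the pairing between the two lattices is the product of the areas of the tori;
in particular the pairing is nondegenerate. -/
theorem cross_mul_cross (a w b z : ℂ) :
    cross a b * cross w z - cross a z * cross w b = cross a w * cross b z := by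
  simp only [cross]; ring

/-- Two lattices with integral pairing have bases for which the pairing is diagonal. -/
theorem exists_diagonal_bases {a w b z : ℂ} {κ : ℝ} (haw : cross a w ≠ 0) (hbz : cross b z ≠ 0)
    {e₁₁ e₁₂ e₂₁ e₂₂ : ℤ} (h₁₁ : cross a b = e₁₁ * κ) (h₁₂ : cross a z = e₁₂ * κ)
    (h₂₁ : cross w b = e₂₁ * κ) (h₂₂ : cross w z = e₂₂ * κ) :
    ∃ u₁ u₂ t₁ t₂ : ℂ, ∃ e f : ℤ, IsBaseChange a w u₁ u₂ ∧ IsBaseChange b z t₁ t₂ ∧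
      cross u₁ t₁ = e * κ ∧ cross u₁ t₂ = 0 ∧ cross u₂ t₁ = 0 ∧ cross u₂ t₂ = e * f * κ := by
  have hdet : e₁₁ * e₂₂ - e₁₂ * e₂₁ ≠ 0 := by
    intro h
    have h' : (e₁₁ * e₂₂ - e₁₂ * e₂₁ : ℝ) = 0 := by exact_mod_cast h
    have := cross_mul_cross a w b z
    rw [h₁₁, h₁₂, h₂₁, h₂₂] at this
    have h3 : cross a w * cross b z = 0 := by rw [← this]; linear_combination κ * κ * h'
    exact mul_ne_zero haw hbz h3
  obtain ⟨P, Q, hP, hQ, e, f, h⟩ := hasDiagonalForm _ _ _ _ hdet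
  rw [Matrix.det_fin_two] at hP hQ
  have h00 := congrFun (congrFun h 0) 0
  have h01 := congrFun (congrFun h 0) 1
  have h10 := congrFun (congrFun h 1) 0
  have h11 := congrFun (congrFun h 1) 1
  simp [Matrix.mul_apply, Fin.sum_univ_two] at h00 h01 h10 h11
  refine ⟨P 0 0 * a + P 0 1 * w, P 1 0 * a + P 1 1 * w, Q 0 0 * b + Q 1 0 * z, Q 0 1 * b + Q 1 1 * z,
    e, f, ⟨_, _, _, _, hP, rfl, rfl⟩, ⟨_, _, _, _, by linarith, rfl, rfl⟩, ?_, ?_, ?_, ?_⟩ <;>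
    rw [cross_combination, h₁₁, h₁₂, h₂₁, h₂₂]
  · rw [← h00]; push_cast; ring
  · have h' : (((P 0 0 * e₁₁ + P 0 1 * e₂₁) * Q 0 1 + (P 0 0 * e₁₂ + P 0 1 * e₂₂) * Q 1 1 : ℤ) : ℝ) = 0 := by
      exact_mod_cast h01
    push_cast at h'
    linear_combination κ * h'
  · have h' : (((P 1 0 * e₁₁ + P 1 1 * e₂₁) * Q 0 0 + (P 1 0 * e₁₂ + P 1 1 * e₂₂) * Q 1 0 : ℤ) : ℝ) = 0 := by
      exact_mod_cast h10
    push_cast at h'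
    linear_combination κ * h'
  · have h' : (((P 1 0 * e₁₁ + P 1 1 * e₂₁) * Q 0 1 + (P 1 0 * e₁₂ + P 1 1 * e₂₂) * Q 1 1 : ℤ) : ℝ) =
        (e * f : ℤ) := by exact_mod_cast h11
    push_cast at h'
    linear_combination κ * h'

theorem IsBaseChange.mem_span {a w u₁ u₂ : ℂ} (h : IsBaseChange a w u₁ u₂) :
    a ∈ Submodule.span ℤ ({u₁, u₂} : Set ℂ) ∧ w ∈ Submodule.span ℤ ({u₁, u₂} : Set ℂ) := by
  obtain ⟨p, q, r, s, -, h1, h2⟩ := h.symm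
  exact ⟨mem_span_two.2 ⟨p, q, h1.symm⟩, mem_span_two.2 ⟨r, s, h2.symm⟩⟩

namespace GluedTriangles

variable {d : ℕ} {a w b z : ℂ}

theorem IsGood.d_pos (h : IsGood d ![a, w, b, z]) : 0 < d := by
  obtain ⟨⟨v₁, v₂, hv, hd, -⟩, -⟩ := h
  rcases Nat.eq_zero_or_pos d with rfl | h
  · simp at hd
  · exact h

theorem IsGood.cross_mem (h : IsGood d ![a, w, b, z]) {x y : ℂ} (hx : x ∈ ({a, w, b, z} : Set ℂ))
    (hy : y ∈ ({a, w, b, z} : Set ℂ)) : ∃ k : ℤ, cross x y = k * (1 / d) := by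
  have hdp := h.d_pos
  obtain ⟨⟨v₁, v₂, hv, hd, hs⟩, -⟩ := h
  have hκ : cross v₁ v₂ = 1 / d := by field_simp; linarith
  have hm : ∀ x ∈ ({a, w, b, z} : Set ℂ), x ∈ Submodule.span ℤ {v₁, v₂} := by
    intro x hx
    rw [← hs]
    rcases hx with rfl | rfl | rfl | rfl
    · exact Submodule.mem_sup_left (Submodule.subset_span (Or.inl rfl))
    · exact Submodule.mem_sup_left (Submodule.subset_span (Or.inr rfl))
    · exact Submodule.mem_sup_right (Submodule.subset_span (Or.inl rfl))
    · exact Submodule.mem_sup_right (Submodule.subset_span (Or.inr rfl))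
  rw [← mem_zmultiples_real]
  refine cross_mem_of_span ?_ (hm x hx) (hm y hy)
  have h0 : (0 : ℝ) ∈ AddSubgroup.zmultiples (1 / (d : ℝ)) := zero_mem _
  have h1 : (1 / (d : ℝ)) ∈ AddSubgroup.zmultiples (1 / (d : ℝ)) := AddSubgroup.mem_zmultiples _
  rintro _ (rfl | rfl) _ (rfl | rfl)
  · rwa [cross_self]
  · rwa [hκ]
  · rw [cross_comm, hκ]; exact neg_mem h1
  · rwa [cross_self]

/-- The pairings of the generators of the period lattice have no common divisor. -/
theorem IsGood.isUnit_of_dvd (h : IsGood d ![a, w, b, z]) (p : ℤ)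
    (hp : ∀ x ∈ ({a, w, b, z} : Set ℂ), ∀ y ∈ ({a, w, b, z} : Set ℂ),
      ∃ k : ℤ, cross x y = k * (p * (1 / d))) : IsUnit p := by
  have hdp := h.d_pos
  obtain ⟨⟨v₁, v₂, hv, hd, hs⟩, -⟩ := h
  have hκ : cross v₁ v₂ = 1 / d := by field_simp; linarith
  have hs' : Submodule.span ℤ ({a, w, b, z} : Set ℂ) = Submodule.span ℤ {v₁, v₂} := by
    rw [← hs, ← Submodule.span_union]
    congr 1
    ext y
    simp only [Set.mem_union, Set.mem_insert_iff, Set.mem_singleton_iff, Matrix.cons_val]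
    tauto
  have hm1 : v₁ ∈ Submodule.span ℤ ({a, w, b, z} : Set ℂ) := by
    rw [hs']; exact Submodule.subset_span (Or.inl rfl)
  have hm2 : v₂ ∈ Submodule.span ℤ ({a, w, b, z} : Set ℂ) := by
    rw [hs']; exact Submodule.subset_span (Or.inr rfl)
  have := cross_mem_of_span (K := AddSubgroup.zmultiples ((p : ℝ) * (1 / d)))
    (fun x hx y hy => mem_zmultiples_real.2 (hp x hx y hy)) hm1 hm2
  obtain ⟨k, hk⟩ := mem_zmultiples_real.1 this
  rw [hκ] at hk
  have hd' : (0 : ℝ) < d := by exact_mod_cast hdp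
  field_simp at hk
  have hk' : k * p = 1 := by exact_mod_cast hk.symm
  exact IsUnit.of_mul_eq_one k (by linarith)

/-- Every model surface can be deformed to one for which the pairing of the periods of the tori is
diagonal with first entry one. -/
theorem IsGood.exists_unimodular {c : ℂ} (h : IsGood d ![a, w, b, z]) (hc : IsSlit ![a, w, b, z] c) :
    ∃ u₁ u₂ t₁ t₂ : ℂ, Deformable d ![a, w, b, z] ![u₁, u₂, t₁, t₂] ∧ cross u₁ u₂ = cross a w ∧
      cross t₁ t₂ = cross b z ∧ cross u₁ t₁ = 1 / d ∧ cross u₁ t₂ = 0 ∧ cross u₂ t₁ = 0 := by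
  have hdp : (0 : ℝ) < d := by exact_mod_cast h.d_pos
  have hκ : (0 : ℝ) < 1 / d := by positivity
  set κ : ℝ := 1 / d with hκd
  have haw : 0 < cross a w := by rw [isSlit_iff] at hc; linarith
  have hbz : 0 < cross b z := by rw [isSlit_iff] at hc; linarith
  obtain ⟨_, g1⟩ := h.cross_mem (x := a) (y := b) (by simp) (by simp)
  obtain ⟨_, g2⟩ := h.cross_mem (x := a) (y := z) (by simp) (by simp)
  obtain ⟨_, g3⟩ := h.cross_mem (x := w) (y := b) (by simp) (by simp)
  obtain ⟨_, g4⟩ := h.cross_mem (x := w) (y := z) (by simp) (by simp)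
  obtain ⟨u₁, u₂, t₁, t₂, e, f, hu, ht, k1, k2, k3, k4⟩ := exists_diagonal_bases haw.ne' hbz.ne' g1 g2 g3 g4
  rw [← hκd] at k1 k4
  have hG := h.of_isBaseChange hu ht
  obtain ⟨m, hm⟩ := hG.cross_mem (x := u₁) (y := u₂) (by simp) (by simp)
  obtain ⟨n, hn⟩ := hG.cross_mem (x := t₁) (y := t₂) (by simp) (by simp)
  rw [← hκd] at hm hn
  have hu12 : 0 < cross u₁ u₂ := by rw [hu.cross_eq]; exact haw
  have ht12 : 0 < cross t₁ t₂ := by rw [ht.cross_eq]; exact hbz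
  have hmul := cross_mul_cross u₁ u₂ t₁ t₂
  rw [k1, k2, k4, k3, hm, hn] at hmul
  have hmn : e * (e * f) = m * n := by
    have : ((e * (e * f) : ℤ) : ℝ) * (κ * κ) = ((m * n : ℤ) : ℝ) * (κ * κ) := by
      push_cast; linarith
    exact_mod_cast mul_right_cancel₀ (mul_pos hκ hκ).ne' this
  have hm0 : 0 < m := by
    rw [hm] at hu12
    exact_mod_cast (pos_iff_pos_of_mul_pos hu12).2 hκ
  have hn0 : 0 < n := by
    rw [hn] at ht12
    exact_mod_cast (pos_iff_pos_of_mul_pos ht12).2 hκ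
  have he0 : e ≠ 0 := by
    rintro rfl
    have := mul_pos hm0 hn0
    rw [← hmn] at this
    simp at this
  have hut : cross u₁ t₁ ≠ 0 := by
    rw [k1]
    exact mul_ne_zero (by exact_mod_cast he0) hκ.ne'
  obtain ⟨c₁, hc₁⟩ := exists_isSlit_of_cross hu12 ht12 hut
  have D1 := Deformable.of_isBaseChange h hc hc₁ hu ht
  -- The zero off the diagonal of the pairing says that `t₂` is parallel to `u₁`. With the sign `σ`
  -- it points in the same direction, which is what the parallel twist needs.
  obtain ⟨μ, hμ⟩ : ∃ μ : ℝ, t₂ = μ * u₁ := by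
    have := eq_of_cross_ne_zero hu12.ne' t₂
    rw [k2] at this
    exact ⟨cross t₂ u₂ / cross u₁ u₂, by simpa using this⟩
  have hμ0 : μ ≠ 0 := by
    rintro rfl
    rw [hμ] at ht12
    simp [cross_zero_right] at ht12
  obtain ⟨σ, hσ, hσμ⟩ : ∃ σ : ℤ, σ * σ = 1 ∧ 0 < σ * μ := by
    rcases lt_or_gt_of_ne hμ0 with h | h
    · exact ⟨-1, by norm_num, by push_cast; linarith⟩
    · exact ⟨1, by norm_num, by push_cast; linarith⟩
  have hσ' : (σ * σ : ℝ) = 1 := by exact_mod_cast hσ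
  set b₀ : ℂ := σ * t₂ with hb₀
  set z₀ : ℂ := -(σ * t₁) with hz₀
  have hbc : IsBaseChange t₁ t₂ b₀ z₀ := ⟨0, σ, -σ, 0, by linarith, by simp [hb₀], by simp [hz₀]⟩
  have hrefl : ∀ x y : ℂ, IsBaseChange x y x y := fun x y => ⟨1, 0, 0, 1, by norm_num, by simp, by simp⟩
  obtain ⟨D3, c₂, hc₂⟩ := Deformable.twist_of_parallel (hG.of_isBaseChange (hrefl u₁ u₂) hbc) hu12
    (by rw [hbc.cross_eq]; exact ht12) hσμ (by rw [hb₀, hμ]; push_cast; ring)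
  have D2 := Deformable.of_isBaseChange hG hc₁ hc₂ (hrefl u₁ u₂) hbc
  have hcσ : ∀ x y : ℂ, cross x (σ * y) = σ * cross x y := by
    intro x y
    have := cross_smul_right σ x y
    push_cast at this
    exact this
  have hcσ' : ∀ x y : ℂ, cross (σ * x) y = σ * cross x y := by
    intro x y
    rw [cross_comm, hcσ, cross_comm x y]; ring
  -- In units of `κ`, the pairing after the twist has the entries `0`, `-σ e`, `σ e f` and `n - m`,
  -- where `m` and `n` measure the areas and `e² f = m n`.
  have q1 : cross u₁ b₀ = (0 : ℤ) * κ := by rw [hb₀, hcσ, k2]; simp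
  have q2 : cross u₁ (z₀ + u₁) = (-σ * e : ℤ) * κ := by
    rw [hz₀, cross_add_right, cross_neg_right, hcσ, k1, cross_self]; push_cast; ring
  have q3 : cross (u₂ + b₀) b₀ = (σ * (e * f) : ℤ) * κ := by
    rw [cross_add_left, cross_self, hb₀, hcσ, k4]; push_cast; ring
  have q4 : cross (u₂ + b₀) (z₀ + u₁) = (n - m : ℤ) * κ := by
    rw [hz₀, hb₀]
    simp only [cross_add_left, cross_add_right, cross_neg_right, hcσ, hcσ']
    rw [cross_comm u₂ u₁, cross_comm t₂ t₁, cross_comm t₂ u₁, k2, hm, hn]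
    push_cast
    linear_combination (n * κ) * hσ' - σ * k3
  have hG3 := D3.2.1
  have hc₃ := D3.2.2.choose_spec.choose_spec.2.1
  have p1 : 0 < cross u₁ (u₂ + b₀) := by rw [cross_add_right, q1]; simpa using hu12
  have p2 : cross b₀ (z₀ + u₁) = cross t₁ t₂ := by
    rw [cross_add_right, hbc.cross_eq, cross_comm b₀ u₁, q1]; simp
  have p2' : 0 < cross b₀ (z₀ + u₁) := by rw [p2]; exact ht12
  obtain ⟨x₁, x₂, y₁, y₂, e', f', hx, hy, j1, j2, j3, j4⟩ := exists_diagonal_bases p1.ne' p2'.ne' q1 q2 q3 q4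
  -- A prime that divides the new pairing divides `e` and `n - m`, hence `m n = e² f`, hence `m` and
  -- `n`. It would then divide all pairings of the old periods, which generate a lattice of covolume
  -- `κ`.
  have hunit : IsUnit e' := by
    by_contra hne
    have hne' : e'.natAbs ≠ 1 := fun h => hne (Int.isUnit_iff_natAbs_eq.2 h)
    obtain ⟨p, hp, hpe⟩ := Nat.exists_prime_and_dvd hne'
    have hpe' : (p : ℤ) ∣ e' := Int.natCast_dvd.2 hpe
    have hpp : Prime (p : ℤ) := Nat.prime_iff_prime_int.1 hp
    have hdiv : ∀ x ∈ Submodule.span ℤ ({x₁, x₂} : Set ℂ), ∀ y ∈ Submodule.span ℤ ({y₁, y₂} : Set ℂ),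
        ∀ k : ℤ, cross x y = k * κ → (p : ℤ) ∣ k := by
      intro x hx y hy k hk
      have : cross x y ∈ AddSubgroup.zmultiples ((e' : ℝ) * κ) := by
        refine cross_mem_of_span ?_ hx hy
        rintro _ (rfl | rfl) _ (rfl | rfl)
        · rw [j1]; exact AddSubgroup.mem_zmultiples _
        · rw [j2]; exact zero_mem _
        · rw [j3]; exact zero_mem _
        · rw [j4]; exact mem_zmultiples_real.2 ⟨f', by ring⟩
      obtain ⟨l, hl⟩ := mem_zmultiples_real.1 this
      rw [hk, ← mul_assoc] at hl
      have := mul_right_cancel₀ hκ.ne' hl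
      have : k = l * e' := by exact_mod_cast this
      rw [this]
      exact hpe'.mul_left l
    have i1 := hdiv _ hx.mem_span.1 _ hy.mem_span.2 _ q2
    have i3 := hdiv _ hx.mem_span.2 _ hy.mem_span.1 _ q3
    have i4 := hdiv _ hx.mem_span.2 _ hy.mem_span.2 _ q4
    have hpσ : IsUnit σ := IsUnit.of_mul_eq_one σ hσ
    have ie : (p : ℤ) ∣ e := by
      rw [neg_mul, dvd_neg] at i1
      exact (hpσ.dvd_mul_left).1 i1
    have ief : (p : ℤ) ∣ e * f := ie.mul_right f
    have imn : (p : ℤ) ∣ m * n := by rw [← hmn]; exact ie.mul_right _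
    have imn' : (p : ℤ) ∣ m ∧ (p : ℤ) ∣ n := by
      rcases hpp.dvd_or_dvd imn with h | h
      · exact ⟨h, by have := dvd_add i4 h; simpa using this⟩
      · exact ⟨by have := dvd_sub h i4; simpa using this, h⟩
    have hk : ∀ x y : ℂ, (∃ k : ℤ, (p : ℤ) ∣ k ∧ cross x y = k * κ) →
        ∃ k : ℤ, cross x y = k * (((p : ℤ) : ℝ) * (1 / d)) := by
      rintro x y ⟨_, ⟨k, rfl⟩, hk⟩
      exact ⟨k, by rw [hk]; push_cast; ring⟩
    have z0 : (p : ℤ) ∣ 0 := dvd_zero _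
    have := hG.isUnit_of_dvd p (by
      intro x hx y hy
      apply hk
      rcases hx with rfl | rfl | rfl | rfl <;> rcases hy with rfl | rfl | rfl | rfl
      · exact ⟨0, z0, by rw [cross_self]; simp⟩
      · exact ⟨m, imn'.1, hm⟩
      · exact ⟨e, ie, k1⟩
      · exact ⟨0, z0, by rw [k2]; simp⟩
      · exact ⟨-m, imn'.1.neg_right, by rw [cross_comm, hm]; push_cast; ring⟩
      · exact ⟨0, z0, by rw [cross_self]; simp⟩
      · exact ⟨0, z0, by rw [k3]; simp⟩
      · exact ⟨e * f, ief, by rw [k4]; push_cast; ring⟩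
      · exact ⟨-e, ie.neg_right, by rw [cross_comm, k1]; push_cast; ring⟩
      · exact ⟨0, z0, by rw [cross_comm, k3]; simp⟩
      · exact ⟨0, z0, by rw [cross_self]; simp⟩
      · exact ⟨n, imn'.2, hn⟩
      · exact ⟨0, z0, by rw [cross_comm, k2]; simp⟩
      · exact ⟨-(e * f), ief.neg_right, by rw [cross_comm, k4]; push_cast; ring⟩
      · exact ⟨-n, imn'.2.neg_right, by rw [cross_comm, hn]; push_cast; ring⟩
      · exact ⟨0, z0, by rw [cross_self]; simp⟩)
    exact hpp.not_isUnit this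
  have hfin : ∀ x₁ x₂ : ℂ, IsBaseChange u₁ (u₂ + b₀) x₁ x₂ → cross x₁ y₁ = κ → cross x₁ y₂ = 0 →
      cross x₂ y₁ = 0 →
    ∃ u₁ u₂ t₁ t₂ : ℂ, Deformable d ![a, w, b, z] ![u₁, u₂, t₁, t₂] ∧ cross u₁ u₂ = cross a w ∧
      cross t₁ t₂ = cross b z ∧ cross u₁ t₁ = κ ∧ cross u₁ t₂ = 0 ∧ cross u₂ t₁ = 0 := by
    intro x₁ x₂ hx i1 i2 i3
    have e1 : cross x₁ x₂ = cross a w := by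
      rw [hx.cross_eq, cross_add_right, q1, hu.cross_eq]; simp
    have e2 : cross y₁ y₂ = cross b z := by rw [hy.cross_eq, p2, ht.cross_eq]
    obtain ⟨c₄, hc₄⟩ := exists_isSlit_of_cross (e1 ▸ haw) (e2 ▸ hbz) (by rw [i1]; exact hκ.ne')
    exact ⟨x₁, x₂, y₁, y₂, ((D1.trans D2).trans D3).trans (Deformable.of_isBaseChange hG3 hc₃ hc₄ hx hy),
      e1, e2, i1, i2, i3⟩
  -- A negative unit is removed by changing the sign of both vectors of the first basis, which
  -- preserves its orientation.
  rcases Int.isUnit_iff.1 hunit with rfl | rfl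
  · exact hfin x₁ x₂ hx (by rw [j1]; simp) j2 j3
  · refine hfin (-x₁) (-x₂) (hx.trans ⟨-1, 0, 0, -1, by norm_num, by simp, by simp⟩) ?_ ?_ ?_
    · rw [cross_neg_left, j1]; simp
    · rw [cross_neg_left, j2]; simp
    · rw [cross_neg_left, j3]; simp

/-- Every model surface can be deformed to one with periods in normal form. -/
theorem IsGood.exists_normal_form {c : ℂ} (h : IsGood d ![a, w, b, z]) (hc : IsSlit ![a, w, b, z] c) :
    ∃ u₁ u₂ : ℂ, cross u₁ u₂ = 1 / d ∧
      Deformable d ![a, w, b, z] ![u₁, u₂, u₂, -((d - 1 : ℂ) * u₁)] := by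
  have hdp : (0 : ℝ) < d := by exact_mod_cast h.d_pos
  have hκ : (0 : ℝ) < 1 / d := by positivity
  obtain ⟨u₁, u₂, t₁, t₂, D1, -, -, k1, k2, k3⟩ := h.exists_unimodular hc
  have hG := D1.2.1
  obtain ⟨c₁, hc₁⟩ : ∃ c, IsSlit ![u₁, u₂, t₁, t₂] c := by
    obtain ⟨-, -, -, c₁, -, h, -⟩ := D1
    exact ⟨c₁, h⟩
  have hu : 0 < cross u₁ u₂ := by rw [isSlit_iff] at hc₁; linarith
  have ht : 0 < cross t₁ t₂ := by rw [isSlit_iff] at hc₁; linarith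
  have hsum : cross u₁ u₂ + cross t₁ t₂ = 1 := hG.2
  obtain ⟨m, hm⟩ := hG.cross_mem (x := u₁) (y := u₂) (by simp) (by simp)
  obtain ⟨n, hn⟩ := hG.cross_mem (x := t₁) (y := t₂) (by simp) (by simp)
  obtain ⟨l, hl⟩ := hG.cross_mem (x := u₂) (y := t₂) (by simp) (by simp)
  set κ : ℝ := 1 / d with hκd
  have hm0 : 0 < m := by
    rw [hm] at hu
    exact_mod_cast (pos_iff_pos_of_mul_pos hu).2 hκ
  have hn0 : 0 < n := by
    rw [hn] at ht
    exact_mod_cast (pos_iff_pos_of_mul_pos ht).2 hκ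
  have hl' : (l : ℝ) = m * n := by
    have hmul := cross_mul_cross u₁ u₂ t₁ t₂
    rw [k1, k2, k3, hl, hm, hn] at hmul
    have : (l : ℝ) * (κ * κ) = (m * n) * (κ * κ) := by linarith
    exact mul_right_cancel₀ (mul_pos hκ hκ).ne' this
  obtain ⟨a', w', b', z', D2, hA, hB, hslit⟩ : ∃ a' w' b' z' : ℂ,
      Deformable d ![u₁, u₂, t₁, t₂] ![a', w', b', z'] ∧ cross a' w' = κ ∧ cross b' z' = 1 - κ ∧
        ∃ c, IsSlit ![a', w', b', z'] c := by
    by_cases hm1 : m = 1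
    · refine ⟨u₁, u₂, t₁, t₂, Deformable.refl hG hc₁, by rw [hm, hm1]; simp, ?_, c₁, hc₁⟩
      rw [hm, hm1] at hsum
      push_cast at hsum
      linarith
    -- The pairing of `u₁ + u₂` with `r t₁ + t₂` is `(r + m n) κ`, and this `r` makes it `(1 - m)
    -- κ`. The twist adds it to the area `m κ` of the first torus and leaves `κ`.
    · set r : ℤ := 1 - m - m * n with hr
      have b1 : IsBaseChange u₁ u₂ (u₁ + u₂) u₂ := ⟨1, 1, 0, 1, by norm_num, by simp, by simp⟩
      have b2 : IsBaseChange t₁ t₂ (r * t₁ + t₂) (-t₁) := ⟨r, 1, -1, 0, by ring, by simp, by simp⟩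
      have hcr : cross (u₁ + u₂) (r * t₁ + t₂) = (1 - m) * κ := by
        have := cross_combination 1 1 r 1 u₁ u₂ t₁ t₂
        push_cast at this
        rw [one_mul, one_mul, one_mul] at this
        rw [this, k1, k2, k3, hl, hl', hr]
        push_cast
        ring
      have hm1' : (1 - m : ℝ) < 0 := by
        have : 1 < m := lt_of_le_of_ne hm0 (Ne.symm hm1)
        have : (1 : ℝ) < m := by exact_mod_cast this
        linarith
      have g1 : 0 < cross (u₁ + u₂) u₂ := by rw [b1.cross_eq]; exact hu
      have g2 : 0 < cross (r * t₁ + t₂) (-t₁) := by rw [b2.cross_eq]; exact ht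
      have hne : cross (u₁ + u₂) (r * t₁ + t₂) ≠ 0 := by
        rw [hcr]; exact mul_ne_zero hm1'.ne hκ.ne'
      have hneg : cross (u₁ + u₂) (r * t₁ + t₂) < 0 := by
        rw [hcr]; exact mul_neg_of_neg_of_pos hm1' hκ
      obtain ⟨c₂, hc₂⟩ := exists_isSlit_of_cross g1 g2 hne
      have E1 := Deformable.of_isBaseChange hG hc₁ hc₂ b1 b2
      have E2 := Deformable.twist_of_cross E1.2.1 g1 g2 hne (by
        rw [b1.cross_eq, hcr, hm]; nlinarith) (by linarith)
      have hA : cross (u₁ + u₂) (u₂ + (r * t₁ + t₂)) = κ := by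
        rw [cross_add_right, b1.cross_eq, hcr, hm]; ring
      refine ⟨_, _, _, _, E1.trans E2, hA, ?_, ?_⟩
      · have : cross (u₁ + u₂) (u₂ + (r * t₁ + t₂)) + cross (r * t₁ + t₂) (-t₁ + (u₁ + u₂)) = 1 := E2.2.1.2
        linarith
      · obtain ⟨-, -, -, c₃, -, h, -⟩ := E2
        exact ⟨c₃, h⟩
  obtain ⟨c₂, hc₂⟩ := hslit
  obtain ⟨x₁, x₂, y₁, y₂, D3, i0, i00, i1, i2, i3⟩ := D2.2.1.exists_unimodular hc₂
  rw [hA] at i0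
  rw [hB] at i00
  rw [← hκd] at i1
  have hx0 : cross x₁ x₂ ≠ 0 := by rw [i0]; exact hκ.ne'
  -- Now the area of the first torus and the first entry of the pairing are both `κ`, so the
  -- determinants with `x₁` and `x₂` identify the second basis.
  have hy1 : y₁ = x₂ := by
    have := eq_of_cross_ne_zero hx0 y₁
    rw [i1, i0, cross_comm, i3] at this
    rw [this, div_self hκ.ne']
    simp
  have hy2 : y₂ = -((d - 1 : ℂ) * x₁) := by
    have h1 := cross_mul_cross x₁ x₂ y₁ y₂
    rw [i1, i2, i3, i0, i00] at h1
    have h2 : cross x₂ y₂ = 1 - κ := by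
      have : κ * cross x₂ y₂ = κ * (1 - κ) := by linarith
      exact mul_left_cancel₀ hκ.ne' this
    have := eq_of_cross_ne_zero hx0 y₂
    rw [i2, i0, cross_comm, h2] at this
    rw [this, hκd]
    push_cast
    have : (d : ℂ) ≠ 0 := by exact_mod_cast hdp.ne'
    field_simp
    ring
  rw [hy1, hy2] at D3
  exact ⟨x₁, x₂, i0, (D1.trans D2).trans D3⟩

end GluedTriangles
end TranslationSurface

/-! ### Connectedness of the surfaces in normal form. -/

namespace TranslationSurface
namespace GluedTriangles

variable {d : ℕ}

/-- The periods of the two tori in normal form. -/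
def normalPeriods (d : ℕ) (u₁ u₂ : ℂ) : Fin 4 → ℂ := ![u₁, u₂, u₂, -((d - 1) * u₁)]

theorem cross_normalPeriods (u₁ u₂ : ℂ) : cross u₂ (-((d - 1 : ℂ) * u₁)) = (d - 1) * cross u₁ u₂ := by
  simp [cross]
  ring

/-- Half the difference of the basis vectors has determinant half the covolume with each of them.
This is below the area of the second torus, `d - 1` times the covolume, because `d ≥ 2`. -/
theorem isSlit_normalPeriods (hd : 2 ≤ d) {u₁ u₂ : ℂ} (h : 0 < cross u₁ u₂) :
    IsSlit (normalPeriods d u₁ u₂) ((u₂ - u₁) / 2) := by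
  have hd' : (2 : ℝ) ≤ d := by exact_mod_cast hd
  have h1 : cross u₁ ((u₂ - u₁) / 2) = cross u₁ u₂ / 2 := by
    simp [cross]; ring
  have h2 : cross u₂ ((u₂ - u₁) / 2) = cross u₁ u₂ / 2 := by
    simp [cross]; ring
  refine ⟨?_, ?_, ?_, ?_⟩
  · change 0 < cross u₁ _
    rw [h1]; linarith
  · change cross u₁ _ < cross u₁ u₂
    rw [h1]; linarith
  · change 0 < cross u₂ _
    rw [h2]; linarith
  · change cross u₂ _ < cross u₂ (-((d - 1 : ℂ) * u₁))
    rw [h2, cross_normalPeriods]; nlinarith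

theorem isGood_normalPeriods (hd : 2 ≤ d) {u₁ u₂ : ℂ} (h : cross u₁ u₂ = 1 / d) :
    IsGood d (normalPeriods d u₁ u₂) := by
  have hd' : (0 : ℝ) < d := by exact_mod_cast (by omega : 0 < d)
  refine ⟨⟨u₁, u₂, by rw [h]; positivity, by rw [h]; field_simp, ?_⟩, ?_⟩
  · change Submodule.span ℤ {u₁, u₂} ⊔ Submodule.span ℤ {u₂, -((d - 1 : ℂ) * u₁)} = _
    refine sup_eq_left.2 (Submodule.span_le.2 ?_)
    rintro _ (rfl | rfl)
    · exact Submodule.subset_span (Or.inr rfl)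
    · exact mem_span_two.2 ⟨-(d - 1), 0, by push_cast; ring⟩
  · change cross u₁ u₂ + cross u₂ (-((d - 1 : ℂ) * u₁)) = 1
    rw [cross_normalPeriods, h]
    field_simp
    ring

theorem preconnectedSpace_compl_zero : PreconnectedSpace {v : ℂ // v ≠ 0} := by
  have : IsPreconnected ({0}ᶜ : Set ℂ) :=
    (isConnected_compl_singleton_of_one_lt_rank (by rw [Complex.rank_real_complex]; norm_num)
      0).isPreconnected
  exact Subtype.preconnectedSpace this

/-- A second basis vector for a lattice of covolume `κ`. -/
noncomputable def complement (κ : ℝ) (q : {v : ℂ // v ≠ 0} × ℝ) : ℂ :=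
  (q.2 + κ / Complex.normSq q.1.1 * Complex.I) * q.1.1

theorem continuous_complement (κ : ℝ) : Continuous (complement κ) := by
  unfold complement
  have h : ∀ q : {v : ℂ // v ≠ 0} × ℝ, (Complex.normSq q.1.1 : ℂ) ≠ 0 := fun q => by
    simpa using q.1.2
  have h1 : Continuous fun q : {v : ℂ // v ≠ 0} × ℝ => (Complex.normSq q.1.1 : ℂ) :=
    Complex.continuous_ofReal.comp (Complex.continuous_normSq.comp (by fun_prop))
  have h2 : Continuous fun q : {v : ℂ // v ≠ 0} × ℝ => (κ : ℂ) / (Complex.normSq q.1.1 : ℂ) :=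
    continuous_const.div h1 h
  fun_prop

theorem cross_mul_self (v : ℂ) (x y : ℝ) : cross v ((x + y * Complex.I) * v) = y * Complex.normSq v := by
  simp [cross, Complex.normSq_apply]
  ring

theorem cross_complement (κ : ℝ) (q : {v : ℂ // v ≠ 0} × ℝ) : cross q.1.1 (complement κ q) = κ := by
  have h : Complex.normSq q.1.1 ≠ 0 := by simpa using q.1.2
  have := cross_mul_self q.1.1 q.2 (κ / Complex.normSq q.1.1)
  rw [div_mul_cancel₀ _ h] at this
  rw [complement]
  push_cast at this
  exact this

theorem exists_eq_complement {κ : ℝ} {u₁ u₂ : ℂ} (h0 : u₁ ≠ 0) (h : cross u₁ u₂ = κ) :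
    ∃ s, complement κ (⟨u₁, h0⟩, s) = u₂ := by
  have hn : Complex.normSq u₁ ≠ 0 := by simpa using h0
  refine ⟨(u₂ / u₁).re, ?_⟩
  have h1 := cross_mul_self u₁ (u₂ / u₁).re (u₂ / u₁).im
  rw [Complex.re_add_im, div_mul_cancel₀ _ h0, h] at h1
  have h2 : κ / Complex.normSq u₁ = (u₂ / u₁).im := by rw [h1]; field_simp
  simp only [complement]
  rw [← Complex.ofReal_div, h2, Complex.re_add_im, div_mul_cancel₀ _ h0]

/-- An oriented basis of given covolume is a nonzero vector together with a real shear parameter, so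
that these bases form a connected space, over which the standard slit varies continuously. -/
theorem linked_normalPeriods (hd : 2 ≤ d) {u₁ u₂ v₁ v₂ : ℂ} (hu : cross u₁ u₂ = 1 / d)
    (hv : cross v₁ v₂ = 1 / d) :
    Linked d (model (params (normalPeriods d u₁ u₂) ((u₂ - u₁) / 2))) (0, 0)
      (model (params (normalPeriods d v₁ v₂) ((v₂ - v₁) / 2))) (0, 0) := by
  have hκ : (0 : ℝ) < 1 / d := by
    have : (0 : ℝ) < d := by exact_mod_cast (by omega : 0 < d)
    positivity
  have h0 : ∀ {u₁ u₂ : ℂ}, cross u₁ u₂ = 1 / d → u₁ ≠ 0 := by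
    rintro _ u₂ h rfl
    rw [cross_zero_left] at h
    exact hκ.ne h
  obtain ⟨s, hs⟩ := exists_eq_complement (h0 hu) hu
  obtain ⟨s', hs'⟩ := exists_eq_complement (h0 hv) hv
  have := preconnectedSpace_compl_zero
  have hc := continuous_complement (1 / d)
  have hcr := fun q => cross_complement (1 / d) q
  set g := complement (1 / d) with hg
  have hF : Continuous fun q : {v : ℂ // v ≠ 0} × ℝ =>
      model (params (normalPeriods d q.1.1 (g q)) ((g q - q.1.1) / 2)) := by
    apply continuous_model
    refine continuous_pi fun i => ?_
    fin_cases i <;> simp [params, normalPeriods] <;> fun_prop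
  have := Linked.of_continuous (c := (0, 0))
    (fun q => isH11_model (isSlit_normalPeriods hd (by rw [hcr]; exact hκ)).modelDomain)
    (fun q => (isGood_normalPeriods hd (hcr q)).isPrimitiveTorusCover
      (isSlit_normalPeriods hd (by rw [hcr]; exact hκ))) hF (⟨u₁, h0 hu⟩, s) (⟨v₁, h0 hv⟩, s')
  simpa only [hs, hs'] using this

/-- Any two surfaces that consist of two tori slit along the same segment are linked. -/
theorem linked_of_isGood (hd : 2 ≤ d) {β β' : Fin 4 → ℂ} {c c' : ℂ} (h : IsGood d β) (hc : IsSlit β c)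
    (h' : IsGood d β') (hc' : IsSlit β' c') :
    Linked d (model (params β c)) (0, 0) (model (params β' c')) (0, 0) := by
  have key : ∀ {β : Fin 4 → ℂ} {c : ℂ}, IsGood d β → IsSlit β c → ∃ u₁ u₂, cross u₁ u₂ = 1 / d ∧
      Linked d (model (params β c)) (0, 0)
        (model (params (normalPeriods d u₁ u₂) ((u₂ - u₁) / 2))) (0, 0) := by
    intro β c h hc
    have hβ : β = ![β 0, β 1, β 2, β 3] := by
      ext i; fin_cases i <;> rfl
    rw [hβ] at h hc ⊢
    obtain ⟨u₁, u₂, hu, hD⟩ := h.exists_normal_form hc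
    refine ⟨u₁, u₂, hu, hD.linked hc (isSlit_normalPeriods hd ?_)⟩
    rw [hu]
    have : (0 : ℝ) < d := by exact_mod_cast (by omega : 0 < d)
    positivity
  obtain ⟨u₁, u₂, hu, h1⟩ := key h hc
  obtain ⟨v₁, v₂, hv, h2⟩ := key h' hc'
  exact (h1.trans (linked_normalPeriods hd hu hv)).trans h2.symm

end GluedTriangles
end TranslationSurface

/-! ### The angle at a vertex, counted in one direction. -/

namespace TranslationSurface

/-- The angle is the difference of the arguments, up to a jump by `2π` when the sector crosses the
branch cut of `Complex.arg`. -/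
theorem exists_arg_sub_arg {u v : ℂ} (h : 0 < cross u v) :
    InnerProductGeometry.angle u v =
      v.arg - u.arg + if v.arg < u.arg then 2 * Real.pi else 0 := by
  have hu : u ≠ 0 := by rintro rfl; simp [cross_zero_left] at h
  have hv : v ≠ 0 := by rintro rfl; simp [cross_zero_right] at h
  obtain ⟨e, h1, h2⟩ := angle_eq_arg h
  rw [e]
  have hc := Complex.arg_div_coe_angle hv hu
  rw [← Real.Angle.coe_sub, Real.Angle.angle_eq_iff_two_pi_dvd_sub] at hc
  obtain ⟨k, hk⟩ := hc
  have a1 := Complex.neg_pi_lt_arg u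
  have a2 := Complex.arg_le_pi u
  have b1 := Complex.neg_pi_lt_arg v
  have b2 := Complex.arg_le_pi v
  have hpi := Real.pi_pos
  have k1 : (-1 : ℝ) < k := by nlinarith
  have k2 : (k : ℝ) < 2 := by nlinarith
  have k1' : -1 < k := by exact_mod_cast k1
  have k2' : k < 2 := by exact_mod_cast k2
  have hk' : k = 0 ∨ k = 1 := by omega
  rcases hk' with rfl | rfl
  · rw [if_neg (by push_cast at hk; linarith)]
    push_cast at hk; linarith
  · rw [if_pos (by push_cast at hk; linarith)]
    push_cast at hk; linarith

/-- The sector from `u` to `v` contains the direction of the negative real axis. -/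
theorem arg_lt_arg_iff {u v : ℂ} (h : 0 < cross u v) :
    v.arg < u.arg ↔ v.im < 0 ∧ 0 ≤ u.im := by
  have key := exists_arg_sub_arg h
  obtain ⟨e, h1, h2⟩ := angle_eq_arg h
  rw [e] at key
  have a1 := Complex.neg_pi_lt_arg u
  have a2 := Complex.arg_le_pi u
  have b1 := Complex.neg_pi_lt_arg v
  have b2 := Complex.arg_le_pi v
  have hv := Complex.arg_neg_iff (z := v)
  have hu := Complex.arg_neg_iff (z := u)
  constructor
  · intro hlt
    rw [if_pos hlt] at key
    constructor
    · rw [← hv]; by_contra hh; linarith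
    · by_contra hh
      have := hu.2 (not_le.1 hh)
      linarith
  · rintro ⟨g1, g2⟩
    have := hv.2 g1
    have : ¬ u.arg < 0 := fun hh => absurd (hu.1 hh) (not_lt.2 g2)
    linarith

theorem cross_div (u v w : ℂ) : cross (u / w) (v / w) = cross u v / Complex.normSq w := by
  rcases eq_or_ne w 0 with rfl | hw
  · simp [cross]
  have hn : Complex.normSq w ≠ 0 := by simpa using hw
  simp only [cross, Complex.div_re, Complex.div_im]
  field_simp
  rw [Complex.normSq_apply]
  ring

theorem im_div_eq_cross (u w : ℂ) : (u / w).im = cross w u / Complex.normSq w := by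
  simp only [cross, Complex.div_im]
  ring

namespace GluedTriangles

variable {n : ℕ} {S : GluedTriangles n}

theorem turn_glue (hS : S.Admissible) (c : Fin n × Fin 3) :
    S.turn (S.glue (c.1, c.2 + 2)) = c := by
  simp [turn, hS.glue_glue]

theorem glue_turn (hS : S.Admissible) (c : Fin n × Fin 3) :
    S.glue ((S.turn c).1, (S.turn c).2 + 2) = c := by
  simp [turn, hS.glue_glue]

theorem corner_turn (S : GluedTriangles n) (c : Fin n × Fin 3) : S.corner (S.turn c) = S.corner c :=
  (S.corner_glue c).symm

/-- The permutation of the corners that runs around the vertices. -/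
def turnEquiv (hS : S.Admissible) : Fin n × Fin 3 ≃ Fin n × Fin 3 where
  toFun := S.turn
  invFun c := S.glue (c.1, c.2 + 2)
  left_inv := glue_turn hS
  right_inv := turn_glue hS

/-- A sum over the corners at a vertex that telescopes around the vertex. -/
theorem sum_turn (hS : S.Admissible) (z : S.Surface) (g : Fin n × Fin 3 → ℝ) [∀ c, Decidable (S.corner c = z)] :
    ∑ c, (if S.corner c = z then g (S.glue (c.1, c.2 + 2)) else 0) =
      ∑ c, if S.corner c = z then g c else 0 := by
  rw [← (turnEquiv hS).sum_comp]
  refine Finset.sum_congr rfl fun c _ => ?_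
  change (if S.corner (S.turn c) = z then g (S.glue ((S.turn c).1, (S.turn c).2 + 2)) else 0) = _
  simp only [glue_turn hS, corner_turn]

open Classical in
/-- The total angle at a vertex is `2π` times the number of the triangles at the vertex that
contain a given direction `-v`. -/
theorem Admissible.totalAngle_eq_card (hS : S.Admissible) {v : ℂ} (hv : v ≠ 0) (z : S.Surface) :
    S.totalAngle z = 2 * Real.pi * (Finset.univ.filter fun c : Fin n × Fin 3 =>
      S.corner c = z ∧ 0 ≤ cross v (S.side c) ∧ 0 < cross v (S.side (c.1, c.2 + 2))).card := by
  have hn : 0 < Complex.normSq v := Complex.normSq_pos.2 hv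
  -- Division by `v` turns the direction `-v` into the branch cut. The differences of arguments
  -- cancel around the vertex by `sum_turn`, and only the jumps remain.
  have key : ∀ c, S.cornerAngle c =
      (S.side (S.glue (c.1, c.2 + 2)) / v).arg - (S.side c / v).arg +
        if 0 ≤ cross v (S.side c) ∧ 0 < cross v (S.side (c.1, c.2 + 2)) then 2 * Real.pi else 0 := by
    intro c
    have h1 := hS.cross_corner c
    rw [hS.side_glue]
    have h2 : 0 < cross (S.side c / v) (-S.side (c.1, c.2 + 2) / v) := by
      rw [cross_div]; exact div_pos h1 hn
    have h3 : S.cornerAngle c = InnerProductGeometry.angle (S.side c / v) (-S.side (c.1, c.2 + 2) / v) := by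
      rw [cornerAngle, (angle_eq_arg h1).1, (angle_eq_arg h2).1, div_div_div_cancel_right₀ hv]
    have h4 : (-S.side (c.1, c.2 + 2) / v).arg < (S.side c / v).arg ↔
        0 ≤ cross v (S.side c) ∧ 0 < cross v (S.side (c.1, c.2 + 2)) := by
      rw [arg_lt_arg_iff h2, im_div_eq_cross, im_div_eq_cross, cross_neg_right, neg_div, neg_lt_zero,
        le_div_iff₀ hn, lt_div_iff₀ hn, zero_mul, and_comm]
    rw [h3, exists_arg_sub_arg h2]
    simp only [h4]
  rw [totalAngle_eq]
  simp only [key]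
  have hs := sum_turn hS z fun c => (S.side c / v).arg
  calc ∑ c, (if S.corner c = z then (S.side (S.glue (c.1, c.2 + 2)) / v).arg - (S.side c / v).arg +
        (if 0 ≤ cross v (S.side c) ∧ 0 < cross v (S.side (c.1, c.2 + 2)) then 2 * Real.pi else 0)
        else 0)
      = ∑ c, (((if S.corner c = z then (S.side (S.glue (c.1, c.2 + 2)) / v).arg else 0) -
          if S.corner c = z then (S.side c / v).arg else 0) +
          if S.corner c = z ∧ 0 ≤ cross v (S.side c) ∧ 0 < cross v (S.side (c.1, c.2 + 2))
            then 2 * Real.pi else 0) := by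
        refine Finset.sum_congr rfl fun c _ => ?_
        by_cases hc : S.corner c = z <;> simp [hc]
    _ = _ := by
        rw [Finset.sum_add_distrib, Finset.sum_sub_distrib, hs, sub_self, zero_add,
          ← Finset.sum_filter, Finset.sum_const, nsmul_eq_mul, mul_comm]

end GluedTriangles
end TranslationSurface

/-! ### Surfaces with the same gluing, and the displacement of a zero. -/

namespace TranslationSurface
namespace GluedTriangles

section SameGluing

variable {n : ℕ} {S S' : GluedTriangles n}

/-- Which corners form a vertex depends on the gluing alone. -/
theorem corner_eq_of_glue_eq (hS : S.Admissible) (h : S'.glue = S.glue) {c c' : Fin n × Fin 3}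
    (hc : S.corner c = S.corner c') : S'.corner c = S'.corner c' :=
  hS.eq_of_corner_eq S'.corner (fun e => by rw [← h]; exact S'.corner_glue e) hc

theorem corner_eq_iff_of_glue_eq (hS : S.Admissible) (hS' : S'.Admissible) (h : S'.glue = S.glue)
    (c c' : Fin n × Fin 3) : S'.corner c = S'.corner c' ↔ S.corner c = S.corner c' :=
  ⟨corner_eq_of_glue_eq hS' h.symm, corner_eq_of_glue_eq hS h⟩

/-- A surface in the stratum has two vertices. -/
theorem IsH11.exists_corners (hS : S.IsH11) : ∃ c₁ c₂, S.corner c₁ ≠ S.corner c₂ ∧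
    ∀ c, S.corner c = S.corner c₁ ∨ S.corner c = S.corner c₂ := by
  obtain ⟨x, y, hxy, hv⟩ := Set.ncard_eq_two.1 hS.two_vertices
  obtain ⟨c₁, rfl⟩ : x ∈ S.vertices := by rw [hv]; exact Or.inl rfl
  obtain ⟨c₂, rfl⟩ : y ∈ S.vertices := by rw [hv]; exact Or.inr rfl
  refine ⟨c₁, c₂, hxy, fun c => ?_⟩
  have : S.corner c ∈ S.vertices := mem_range_self c
  rw [hv] at this
  exact this

theorem connectedSpace_of_glue_eq (hS : S.Admissible) [ConnectedSpace S.Surface]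
    (h : S'.glue = S.glue) : ConnectedSpace S'.Surface := by
  obtain ⟨x⟩ : Nonempty S.Surface := inferInstance
  obtain ⟨p, -⟩ := Quot.exists_rep x
  refine connectedSpace_of_forall S' p.1.1 fun P hP hcl j => ?_
  rw [h] at hcl
  refine S.forall_mem_of_connected P (fun e => ⟨hcl e, fun he => ?_⟩) hP j
  have := hcl _ he
  rwa [hS.glue_glue] at this

/-- If the sides of a surface in the stratum are changed so little that they do not cross a given
direction, the surface remains in the stratum. -/
theorem IsH11.of_glue_eq (hS : S.IsH11) (hS' : S'.Admissible) (h : S'.glue = S.glue) {v : ℂ}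
    (hv : v ≠ 0) (h0 : ∀ e, cross v (S.side e) ≠ 0) (h0' : ∀ e, cross v (S'.side e) ≠ 0)
    (hsign : ∀ e, 0 < cross v (S'.side e) ↔ 0 < cross v (S.side e)) : S'.IsH11 := by
  have hA := hS.admissible
  have hcon := hS.connected
  have hc := corner_eq_iff_of_glue_eq hA hS' h
  refine ⟨hS'.signedArea_pos, hS'.glue_glue, hS'.side_glue, connectedSpace_of_glue_eq hA h, ?_, ?_⟩
  · obtain ⟨c₁, c₂, h1, h2⟩ := hS.exists_corners
    rw [Set.ncard_eq_two]
    refine ⟨S'.corner c₁, S'.corner c₂, by rwa [Ne, hc], ?_⟩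
    ext z
    constructor
    · rintro ⟨c, rfl⟩
      simpa [hc] using h2 c
    · rintro (rfl | rfl) <;> exact mem_range_self _
  · rintro _ ⟨c, rfl⟩
    -- Both angles are `2π` times a number of corners that depends only on the gluing and on the
    -- signs of the sides against `v`.
    rw [← hS.simple_zero _ (mem_range_self c), hS'.totalAngle_eq_card hv, hA.totalAngle_eq_card hv]
    refine congrArg (fun s : Finset (Fin n × Fin 3) => 2 * Real.pi * (s.card : ℝ)) (Finset.ext fun e => ?_)
    simp only [Finset.mem_filter, Finset.mem_univ, true_and, (h0 _).symm.le_iff_lt, (h0' _).symm.le_iff_lt, hsign, hc]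

end SameGluing

section Displacement

variable {n : ℕ}

open Classical in
/-- The surface in which the vertex `z` is moved by `w`. -/
noncomputable def displace (S : GluedTriangles n) (z : S.Surface) (w : ℂ) : GluedTriangles n where
  glue := S.glue
  vert i k := S.vert i k + if S.corner (i, k) = z then w else 0

variable {S : GluedTriangles n} {z : S.Surface} {w : ℂ}

open Classical in
theorem vert_displace (i : Fin n) (k : Fin 3) :
    (S.displace z w).vert i k = S.vert i k + if S.corner (i, k) = z then w else 0 := rfl

open Classical in
theorem side_displace (e : Fin n × Fin 3) : (S.displace z w).side e =
    S.side e + ((if S.corner (e.1, e.2 + 1) = z then w else 0) - if S.corner e = z then w else 0) := by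
  simp only [side, vert_displace]
  ring

theorem corner_glue_eq (hS : S.Admissible) (e : Fin n × Fin 3) :
    S.corner (S.glue e) = S.corner (e.1, e.2 + 1) := by
  rw [S.corner_glue, hS.glue_glue]

theorem admissible_displace (hS : S.Admissible)
    (h : ∀ i, 0 < signedArea ((S.displace z w).vert i 0) ((S.displace z w).vert i 1)
      ((S.displace z w).vert i 2)) : (S.displace z w).Admissible := by
  refine ⟨h, hS.glue_glue, fun e => ?_⟩
  change (S.displace z w).side (S.glue e) = _
  rw [side_displace, side_displace, hS.side_glue, ← S.corner_glue, corner_glue_eq hS]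
  ring

/-- Corners that are glued belong to the same vertex and move together, so the absolute periods do
not change. -/
theorem compatible_displace {L : Submodule ℤ ℂ} {c : Fin n → ℂ} :
    (S.displace z w).Compatible L c ↔ S.Compatible L c := by
  refine forall_congr' fun e => ?_
  change (S.displace z w).vert (S.glue e).1 ((S.glue e).2 + 1) + c (S.glue e).1 -
    ((S.displace z w).vert e.1 e.2 + c e.1) ∈ L ↔ _
  rw [vert_displace, vert_displace, ← S.corner_glue]
  refine iff_of_eq (congrArg (· ∈ L) ?_)
  ring

theorem two_mul_area (S : GluedTriangles n) :
    2 * S.area = ∑ e : Fin n × Fin 3, cross (S.vert e.1 e.2) (S.side e) := by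
  rw [area, Finset.mul_sum, Fintype.sum_prod_type]
  refine Finset.sum_congr rfl fun i _ => ?_
  rw [Fin.sum_univ_three, signedArea_eq]
  simp only [side, TranslationSurface.cross, zero_add, show (1 : Fin 3) + 1 = 2 from rfl,
    show (2 : Fin 3) + 1 = 0 from rfl, Complex.sub_re, Complex.sub_im]
  ring

theorem sum_side_add_one (f : Fin n × Fin 3 → ℝ) :
    ∑ e : Fin n × Fin 3, f (e.1, e.2 + 1) = ∑ e, f e := by
  simp only [Fintype.sum_prod_type]
  refine Finset.sum_congr rfl fun i _ => ?_
  exact Equiv.sum_comp (Equiv.addRight (1 : Fin 3)) fun k => f (i, k)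

/-- In the boundary form `two_mul_area` the quadratic terms vanish, all displacements being `0` or
`w`. The linear terms cancel by summation by parts in each triangle, followed by pairing the glued
sides. -/
theorem area_displace (hS : S.Admissible) : (S.displace z w).area = S.area := by
  classical
  set s : Fin n × Fin 3 → ℂ := fun e => if S.corner e = z then w else 0 with hs
  have hss : ∀ e e', cross (s e) (s e') = 0 := by
    intro e e'
    simp only [hs]
    split_ifs <;> simp [cross_self, cross_zero_left, cross_zero_right]
  have h1 : ∀ e, cross ((S.displace z w).vert e.1 e.2) ((S.displace z w).side e) =
      cross (S.vert e.1 e.2) (S.side e) + (cross (s e) (S.side e) +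
        (cross (S.vert e.1 e.2) (s (e.1, e.2 + 1)) - cross (S.vert e.1 e.2) (s e))) := by
    intro e
    have hv : (S.displace z w).vert e.1 e.2 = S.vert e.1 e.2 + s e := vert_displace _ _
    have hd : (S.displace z w).side e = S.side e + (s (e.1, e.2 + 1) - s e) := side_displace e
    rw [hv, hd]
    simp only [cross_add_left, cross_add_right, cross_sub_right, hss]
    ring
  have h2 : ∑ e : Fin n × Fin 3, cross (S.vert e.1 e.2) (s e) =
      ∑ e : Fin n × Fin 3, cross (S.vert e.1 (e.2 + 1)) (s (e.1, e.2 + 1)) :=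
    (sum_side_add_one fun e => cross (S.vert e.1 e.2) (s e)).symm
  have h3 : ∑ e : Fin n × Fin 3, cross (S.side e) (s (e.1, e.2 + 1)) =
      ∑ e : Fin n × Fin 3, cross (s e) (S.side e) := by
    have g : ∀ e, cross (S.side e) (s (e.1, e.2 + 1)) = cross (s (S.glue e)) (S.side (S.glue e)) := by
      intro e
      have : s (S.glue e) = s (e.1, e.2 + 1) := by simp only [hs, corner_glue_eq hS]
      rw [this, hS.side_glue, cross_neg_right, cross_comm]
    simp only [g]
    exact Equiv.sum_comp (Function.Involutive.toPerm S.glue hS.glue_glue) fun e => cross (s e) (S.side e)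
  have h4 : ∀ e : Fin n × Fin 3, cross (S.vert e.1 (e.2 + 1)) (s (e.1, e.2 + 1)) =
      cross (S.vert e.1 e.2) (s (e.1, e.2 + 1)) + cross (S.side e) (s (e.1, e.2 + 1)) := by
    intro e
    rw [← cross_add_left]
    congr 1
    simp [side]
  have h5 : 2 * (S.displace z w).area = 2 * S.area := by
    rw [two_mul_area, two_mul_area]
    simp only [h1, Finset.sum_add_distrib, Finset.sum_sub_distrib]
    simp only [h4, Finset.sum_add_distrib] at h2
    rw [h3] at h2
    linarith
  linarith

end Displacement

end GluedTriangles
end TranslationSurface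

/-! ### Small displacements preserve the stratum and the degree. -/

namespace TranslationSurface
namespace GluedTriangles

variable {n : ℕ} {S : GluedTriangles n}

/-- There is a direction that is not parallel to any of the sides. -/
theorem exists_transverse (hS : S.Admissible) : ∃ v, v ≠ 0 ∧ ∀ e, cross v (S.side e) ≠ 0 := by
  obtain ⟨s, hs⟩ := Set.Infinite.exists_notMem_finite (Set.infinite_univ (α := ℝ))
    (Set.finite_range fun e => (S.side e).im / (S.side e).re)
  refine ⟨1 + s * Complex.I, fun h => ?_, fun e he => ?_⟩
  · simpa using congrArg Complex.re h
  · have h1 : (S.side e).im = s * (S.side e).re := by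
      simp [cross] at he
      linarith
    have h0 := hS.side_ne_zero e
    by_cases hr : (S.side e).re = 0
    · exact h0 (Complex.ext hr (by rw [h1, hr]; simp))
    · exact hs.2 ⟨e, by simp only [h1]; field_simp⟩

theorem displace_zero (S : GluedTriangles n) (z : S.Surface) : S.displace z 0 = S := by
  classical
  cases S
  simp only [displace, ite_self, add_zero]

theorem continuous_vert_displace (z : S.Surface) (τ : ℂ) (i : Fin n) (k : Fin 3) :
    Continuous fun t : ℝ => (S.displace z (t * τ)).vert i k := by
  simp only [vert_displace]
  split_ifs <;> fun_prop

theorem continuous_side_displace (z : S.Surface) (τ : ℂ) (e : Fin n × Fin 3) :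
    Continuous fun t : ℝ => (S.displace z (t * τ)).side e :=
  (continuous_vert_displace z τ _ _).sub (continuous_vert_displace z τ _ _)

theorem eventually_admissible_displace (hS : S.Admissible) (z : S.Surface) (τ : ℂ) :
    ∀ᶠ t : ℝ in 𝓝 0, (S.displace z (t * τ)).Admissible := by
  have h : ∀ i, ∀ᶠ t : ℝ in 𝓝 0, 0 < signedArea ((S.displace z (t * τ)).vert i 0)
      ((S.displace z (t * τ)).vert i 1) ((S.displace z (t * τ)).vert i 2) := by
    intro i
    have hc : Continuous fun t : ℝ => signedArea ((S.displace z (t * τ)).vert i 0)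
        ((S.displace z (t * τ)).vert i 1) ((S.displace z (t * τ)).vert i 2) := by
      simp only [signedArea_eq]
      have h0 := continuous_vert_displace z τ i 0
      have h1 := continuous_vert_displace z τ i 1
      have h2 := continuous_vert_displace z τ i 2
      exact (Continuous.cross (h1.sub h0) (h2.sub h0)).div_const 2
    refine hc.continuousAt.eventually (lt_mem_nhds ?_)
    simp only [Complex.ofReal_zero, zero_mul, displace_zero]
    exact hS.signedArea_pos i
  filter_upwards [eventually_all.2 h] with t ht
  exact admissible_displace hS ht

theorem eventually_isH11_displace (hS : S.IsH11) (z : S.Surface) (τ : ℂ) :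
    ∀ᶠ t : ℝ in 𝓝 0, (S.displace z (t * τ)).IsH11 := by
  obtain ⟨v, hv, h0⟩ := exists_transverse hS.admissible
  have h : ∀ e, ∀ᶠ t : ℝ in 𝓝 0, cross v ((S.displace z (t * τ)).side e) ≠ 0 ∧
      (0 < cross v ((S.displace z (t * τ)).side e) ↔ 0 < cross v (S.side e)) := by
    intro e
    have hc : Continuous fun t : ℝ => cross v ((S.displace z (t * τ)).side e) :=
      Continuous.cross continuous_const (continuous_side_displace z τ e)
    have e0 : cross v ((S.displace z ((0 : ℝ) * τ)).side e) = cross v (S.side e) := by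
      simp only [Complex.ofReal_zero, zero_mul, displace_zero]
    rcases lt_or_gt_of_ne (h0 e) with hlt | hgt
    · filter_upwards [hc.continuousAt.eventually (gt_mem_nhds (e0.trans_lt hlt))] with t ht
      exact ⟨ht.ne, iff_of_false ht.not_gt hlt.not_gt⟩
    · filter_upwards [hc.continuousAt.eventually (lt_mem_nhds (hgt.trans_eq e0.symm))] with t ht
      exact ⟨ht.ne', iff_of_true ht hgt⟩
  filter_upwards [eventually_admissible_displace hS.admissible z τ, eventually_all.2 h] with t h1 h2
  exact hS.of_glue_eq h1 rfl hv h0 (fun e => (h2 e).1) fun e => (h2 e).2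

/-- The points of the triangles that are mapped to `y` by the translations `c`. -/
def preimages (S : GluedTriangles n) {L : Submodule ℤ ℂ} (c : Fin n → ℂ) (y : ℂ ⧸ L) :
    Set (Fin n × ℂ) :=
  {x | x.2 ∈ S.triangle x.1 ∧ Submodule.Quotient.mk (x.2 + c x.1) = y}

/-- The fibre of a torus cover over a point that does not lie on the image of a side. -/
theorem ncard_fibre (hS : S.Admissible) {L : Submodule ℤ ℂ} {c : Fin n → ℂ} {π : S.Surface → ℂ ⧸ L}
    (hπ : ∀ p : S.Points, π (S.proj p) = Submodule.Quotient.mk (p.coord + c p.1.1)) {y : ℂ ⧸ L}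
    (hy : ∀ x ∈ S.preimages c y, ∀ k, cross (S.side (x.1, k)) (x.2 - S.vert x.1 k) ≠ 0) :
    y ∉ π '' S.vertices ∧ (π ⁻¹' {y}).ncard = (S.preimages c y).ncard := by
  have hcor : ∀ p : S.Points, p.1 ∈ S.preimages c y → ∀ e, p ≠ S.cornerPt e := by
    rintro _ hp e rfl
    refine hy _ hp e.2 ?_
    simp [cornerPt, cross_zero_right]
  have hmem : ∀ p : S.Points, π (S.proj p) = y ↔ p.1 ∈ S.preimages c y := by
    intro p
    rw [hπ]
    exact ⟨fun h => ⟨p.2, h⟩, fun h => h.2⟩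
  constructor
  · rintro ⟨_, ⟨e, rfl⟩, he⟩
    rw [← proj_cornerPt] at he
    exact hcor _ ((hmem _).1 he) e rfl
  · have h1 : π ⁻¹' {y} = S.proj '' {p | p.1 ∈ S.preimages c y} := by
      ext x
      obtain ⟨p, rfl⟩ := Quot.exists_rep x
      constructor
      · intro h
        exact ⟨p, (hmem p).1 h, rfl⟩
      · rintro ⟨q, hq, h⟩
        change π (Quot.mk _ p) = y
        rw [← h]
        exact (hmem q).2 hq
    have h2 : InjOn S.proj {p | p.1 ∈ S.preimages c y} := by
      intro p hp q hq hpq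
      rcases hS.eq_or_glued_of_proj_eq hpq (hcor p hp) with h | ⟨e, t, ht, h, -⟩
      · exact h.symm
      · exfalso
        have := hy _ hp
        rw [h] at this
        refine this e.2 ?_
        rw [sidePoint_eq, add_sub_cancel_left, cross_smul_right, cross_self, mul_zero]
    have h3 : S.preimages c y = Subtype.val '' {p : S.Points | p.1 ∈ S.preimages c y} := by
      ext x
      constructor
      · intro hx
        exact ⟨⟨x, hx.1⟩, hx, rfl⟩
      · rintro ⟨p, hp, rfl⟩
        exact hp
    rw [h1, h2.ncard_image]
    conv_rhs => rw [h3, Subtype.val_injective.injOn.ncard_image]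
    rfl

/-- A bounded region contains finitely many candidates for preimages, so that finitely many sign
conditions decide which triangles contain them. -/
theorem finite_preimages {L : Submodule ℤ ℂ} (hL : IsLattice L) (a : ℂ) (y : ℂ ⧸ L) (R : ℝ) :
    {q : ℂ | ‖q‖ ≤ R ∧ (Submodule.Quotient.mk (q + a) : ℂ ⧸ L) = y}.Finite := by
  obtain ⟨Y, rfl⟩ := Submodule.Quotient.mk_surjective _ y
  have hd := hL.discrete
  have hd' : DiscreteTopology (L.toAddSubgroup : Set ℂ) := hd
  have hc : IsClosed (L.toAddSubgroup : Set ℂ) := AddSubgroup.isClosed_of_discrete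
  have hf := Metric.finite_isBounded_inter_isClosed (K := Metric.closedBall (0 : ℂ) (R + ‖a - Y‖))
    ⟨hd'⟩ Metric.isBounded_closedBall hc
  refine (hf.preimage (add_left_injective (a - Y)).injOn).subset ?_
  rintro q ⟨h1, h2⟩
  rw [Submodule.Quotient.eq] at h2
  refine ⟨?_, ?_⟩
  · rw [mem_closedBall_zero_iff]
    exact (norm_add_le _ _).trans (by linarith)
  · change q + (a - Y) ∈ L
    rwa [← add_sub_assoc]

/-- The number of preimages of a generic point does not change under small displacements. -/
theorem eventually_preimages_displace (hS : S.Admissible) (z : S.Surface) (τ : ℂ)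
    {L : Submodule ℤ ℂ} (hL : IsLattice L) {c : Fin n → ℂ} {y : ℂ ⧸ L}
    (hy : ∀ i q, Submodule.Quotient.mk (q + c i) = y →
      ∀ k, cross (S.side (i, k)) (q - S.vert i k) ≠ 0) :
    ∀ᶠ t : ℝ in 𝓝 0, (S.displace z (t * τ)).preimages c y = S.preimages c y ∧
      ∀ x ∈ (S.displace z (t * τ)).preimages c y, ∀ k,
        cross ((S.displace z (t * τ)).side (x.1, k)) (x.2 - (S.displace z (t * τ)).vert x.1 k) ≠ 0 := by
  -- `R` bounds all triangles, with room for small displacements; preimages need to be sought only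
  -- in this disc.
  set R : ℝ := ∑ e : Fin n × Fin 3, (‖S.vert e.1 e.2‖ + 1) with hR
  have hR1 : ∀ i k, ‖S.vert i k‖ + 1 ≤ R := fun i k =>
    Finset.single_le_sum (f := fun e : Fin n × Fin 3 => ‖S.vert e.1 e.2‖ + 1)
      (fun _ _ => by positivity) (Finset.mem_univ (i, k))
  have e0 : S.displace z ((0 : ℝ) * τ) = S := by
    rw [Complex.ofReal_zero, zero_mul, displace_zero]
  have hbd : ∀ᶠ t : ℝ in 𝓝 0, ∀ i, (S.displace z (t * τ)).triangle i ⊆ Metric.closedBall 0 R := by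
    have : ∀ᶠ t : ℝ in 𝓝 0, ∀ i k, ‖(S.displace z (t * τ)).vert i k‖ < R := by
      refine eventually_all.2 fun i => eventually_all.2 fun k => ?_
      refine (continuous_vert_displace z τ i k).norm.continuousAt.eventually (gt_mem_nhds ?_)
      simp only [e0]
      linarith [hR1 i k]
    filter_upwards [this] with t ht i
    refine convexHull_min ?_ (convex_closedBall 0 R)
    rintro _ ⟨k, rfl⟩
    exact mem_closedBall_zero_iff.2 (ht i k).le
  -- None of the finitely many candidates lies on the line through a side, so their positions with
  -- respect to the sides persist for small `t`.
  have hsign : ∀ᶠ t : ℝ in 𝓝 0, ∀ i, ∀ q ∈ {q : ℂ | ‖q‖ ≤ R ∧ (Submodule.Quotient.mk (q + c i) : ℂ ⧸ L) = y},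
      ∀ k, cross ((S.displace z (t * τ)).side (i, k)) (q - (S.displace z (t * τ)).vert i k) ≠ 0 ∧
        (0 ≤ cross ((S.displace z (t * τ)).side (i, k)) (q - (S.displace z (t * τ)).vert i k) ↔
          0 ≤ cross (S.side (i, k)) (q - S.vert i k)) := by
    refine eventually_all.2 fun i => ?_
    rw [(finite_preimages hL (c i) y R).eventually_all]
    rintro q ⟨-, hq⟩
    refine eventually_all.2 fun k => ?_
    have h0 := hy i q hq k
    have hc : Continuous fun t : ℝ =>
        cross ((S.displace z (t * τ)).side (i, k)) (q - (S.displace z (t * τ)).vert i k) :=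
      Continuous.cross (continuous_side_displace z τ _)
        (continuous_const.sub (continuous_vert_displace z τ i k))
    have h1 := hc.tendsto 0
    rw [e0] at h1
    rcases lt_or_gt_of_ne h0 with hlt | hgt
    · filter_upwards [h1.eventually (gt_mem_nhds hlt)] with t ht
      exact ⟨ht.ne, iff_of_false ht.not_ge hlt.not_ge⟩
    · filter_upwards [h1.eventually (lt_mem_nhds hgt)] with t ht
      exact ⟨ht.ne', iff_of_true ht.le hgt.le⟩
  have hbd0 := hbd.self_of_nhds
  rw [e0] at hbd0
  filter_upwards [hbd, hsign, eventually_admissible_displace hS z τ] with t h1 h2 h4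
  have hiff : ∀ i q, Submodule.Quotient.mk (q + c i) = y →
      (q ∈ (S.displace z (t * τ)).triangle i ↔ q ∈ S.triangle i) := by
    intro i q hq
    by_cases hqR : ‖q‖ ≤ R
    · have := h2 i q ⟨hqR, hq⟩
      rw [h4.mem_triangle_iff i 0, hS.mem_triangle_iff i 0, (this _).2, (this _).2, (this _).2]
    · exact iff_of_false (fun h => hqR (mem_closedBall_zero_iff.1 (h1 i h)))
        fun h => hqR (mem_closedBall_zero_iff.1 (hbd0 i h))
  refine ⟨Set.ext fun x => ⟨fun h => ⟨(hiff _ _ h.2).1 h.1, h.2⟩, fun h => ⟨(hiff _ _ h.2).2 h.1, h.2⟩⟩, ?_⟩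
  intro x hx k
  exact (h2 x.1 x.2 ⟨mem_closedBall_zero_iff.1 (h1 _ hx.1), hx.2⟩ k).1

/-- There is a point of the torus that does not lie on the image of a side. -/
theorem exists_generic (hS : S.Admissible) {L : Submodule ℤ ℂ} (hL : IsLattice L) (c : Fin n → ℂ) :
    ∃ y : ℂ ⧸ L, ∀ i q, Submodule.Quotient.mk (q + c i) = y →
      ∀ k, cross (S.side (i, k)) (q - S.vert i k) ≠ 0 := by
  obtain ⟨v, hv, h0⟩ := exists_transverse hS
  have hd := hL.discrete
  have : Countable L := TopologicalSpace.separableSpace_iff_countable.1 inferInstance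
  let f : (Fin n × Fin 3) × L → ℝ := fun x =>
    cross (S.side x.1) (S.vert x.1.1 x.1.2 + c x.1.1 + x.2) / cross (S.side x.1) v
  -- The line in the direction `v`, transversal to all sides, meets the countably many translates of
  -- lines through sides in countably many points, and some point avoids them.
  obtain ⟨s, hs⟩ := ((Set.countable_range f).dense_compl ℝ).nonempty
  refine ⟨Submodule.Quotient.mk (s * v), fun i q hq k h => hs ?_⟩
  rw [eq_comm, Submodule.Quotient.eq] at hq
  refine ⟨((i, k), ⟨_, hq⟩), ?_⟩
  have hne : cross (S.side (i, k)) v ≠ 0 := by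
    rw [cross_comm]
    exact neg_ne_zero.2 (h0 _)
  simp only [f]
  rw [div_eq_iff hne, ← cross_smul_right]
  rw [← sub_eq_zero, ← cross_sub_right]
  rw [← neg_eq_zero, ← cross_neg_right, ← h]
  congr 1
  ring

/-- The degree of a torus cover does not change under small displacements. -/
theorem degree_eq_of_displace (hS : S.Admissible) (z : S.Surface) (τ : ℂ) {L : Submodule ℤ ℂ}
    (hL : IsLattice L) {c : Fin n → ℂ} (h : S.Compatible L c) {d N : ℕ}
    (hd : HasDegree (torusMap hS h) d)
    (hN : ∃ᶠ t : ℝ in 𝓝 0, ∀ h' : (S.displace z (t * τ)).Admissible,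
      HasDegree (torusMap h' (compatible_displace.2 h)) N) : d = N := by
  obtain ⟨y, hy⟩ := exists_generic hS hL c
  obtain ⟨t, h1, ⟨h2, h3⟩, h4⟩ := (hN.and_eventually ((eventually_preimages_displace hS z τ hL hy).and
    (eventually_admissible_displace hS z τ))).exists
  obtain ⟨a1, a2⟩ := ncard_fibre hS (π := torusMap hS h) (fun _ => rfl) (y := y)
    fun x hx k => hy x.1 x.2 hx.2 k
  obtain ⟨b1, b2⟩ := ncard_fibre h4 (π := torusMap h4 (compatible_displace.2 h)) (fun _ => rfl) h3
  rw [← (hd y a1).2, ← (h1 h4 y b1).2, a2, b2, h2]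

end GluedTriangles
end TranslationSurface

/-! ### Heights of sides, and triangulations with horizontal sides. -/

namespace TranslationSurface

/-- An integer-valued function that is strictly increasing on `κℤ ∪ (κℤ + δ) ∪ (κℤ - δ)`. -/
noncomputable def heightRank (κ δ r : ℝ) : ℤ := ⌊r / κ⌋ + ⌊(r - δ) / κ⌋ + ⌊(r + δ) / κ⌋

theorem heightRank_mono {κ δ r r' : ℝ} (hκ : 0 < κ) (h : r ≤ r') :
    heightRank κ δ r ≤ heightRank κ δ r' := by
  have h1 : ⌊r / κ⌋ ≤ ⌊r' / κ⌋ := Int.floor_mono (by gcongr)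
  have h2 : ⌊(r - δ) / κ⌋ ≤ ⌊(r' - δ) / κ⌋ := Int.floor_mono (by gcongr)
  have h3 : ⌊(r + δ) / κ⌋ ≤ ⌊(r' + δ) / κ⌋ := Int.floor_mono (by gcongr)
  unfold heightRank
  omega

theorem floor_div_lt {κ x y : ℝ} {m : ℤ} (hκ : 0 < κ) (hxy : x < y) (hy : y = m * κ) :
    ⌊x / κ⌋ < ⌊y / κ⌋ := by
  have h1 : y / κ = m := by rw [hy]; field_simp
  rw [h1, Int.floor_intCast, Int.floor_lt, ← h1]
  gcongr

/-- `r'` belongs to one of the three progressions, and the corresponding floor jumps on reaching it.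
-/
theorem heightRank_lt {κ δ r r' : ℝ} (hκ : 0 < κ) (h : r < r') {m j : ℤ}
    (hj : j = -1 ∨ j = 0 ∨ j = 1) (hr : r' = m * κ + j * δ) :
    heightRank κ δ r < heightRank κ δ r' := by
  have h1 : ⌊r / κ⌋ ≤ ⌊r' / κ⌋ := Int.floor_mono (by gcongr)
  have h2 : ⌊(r - δ) / κ⌋ ≤ ⌊(r' - δ) / κ⌋ := Int.floor_mono (by gcongr)
  have h3 : ⌊(r + δ) / κ⌋ ≤ ⌊(r' + δ) / κ⌋ := Int.floor_mono (by gcongr)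
  unfold heightRank
  rcases hj with rfl | rfl | rfl
  · have := floor_div_lt hκ (x := r + δ) (y := r' + δ) (m := m) (by linarith)
      (by rw [hr]; push_cast; ring)
    omega
  · have := floor_div_lt hκ (x := r) (y := r') (m := m) h (by rw [hr]; push_cast; ring)
    omega
  · have := floor_div_lt hκ (x := r - δ) (y := r' - δ) (m := m) (by linarith)
      (by rw [hr]; push_cast; ring)
    omega

theorem cross_plucker (a b c v : ℂ) :
    cross a b * cross v c + cross b c * cross v a + cross c a * cross v b = 0 := by
  simp only [cross]; ring

namespace GluedTriangles

variable {n : ℕ} {S : GluedTriangles n}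

/-- The heights of the vertices with respect to the direction `v` are multiples of `κ`, up to the
height `δ` of one of them. -/
def IsGraded (S : GluedTriangles n) (L : Submodule ℤ ℂ) (v : ℂ) (δ : ℝ) : Prop :=
  ∃ π : S.Surface → ℂ ⧸ L, IsTorusCover S L π ∧ ∃ z,
    (∀ x ∈ S.vertices, ∀ y ∈ S.vertices, x ≠ z → y ≠ z → x = y) ∧
    ∀ x ∈ S.vertices, ∃ Y : ℂ,
      π x = Submodule.Quotient.mk Y ∧ (x = z → cross v Y = δ) ∧ (x ≠ z → cross v Y = 0)

theorem IsGraded.of_equivalent {m : ℕ} {S' : GluedTriangles m} {c : Fin n × Fin 3}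
    {c' : Fin m × Fin 3} {L : Submodule ℤ ℂ} {v : ℂ} {δ : ℝ} (h : S.IsGraded L v δ)
    (he : Equivalent S c S' c') : S'.IsGraded L v δ := by
  obtain ⟨π, hπ, z, hu, hz⟩ := h
  obtain ⟨f, -, -, h3, h4, -, -⟩ := he
  have hv : ∀ x ∈ S'.vertices, f.symm x ∈ S.vertices := fun x hx => by
    rw [← h3]; simpa using hx
  refine ⟨π ∘ f.symm, h4 L π hπ, f z, fun x hx y hy h h' => ?_, fun x hx => ?_⟩
  · exact f.symm.injective (hu _ (hv x hx) _ (hv y hy) (fun h1 => h (by rw [← h1]; simp))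
      fun h1 => h' (by rw [← h1]; simp))
  obtain ⟨Y, h1, h2, h5⟩ := hz (f.symm x) (hv x hx)
  refine ⟨Y, h1, fun h => h2 ?_, fun h => h5 fun h' => h ?_⟩
  · rw [h]; simp
  · rw [← h']; simp

/-- The height of a side is the difference of the heights of its ends, each being `0` or `δ` up to
the height of a lattice vector; `j` vanishes only if both ends are the same vertex. -/
theorem IsGraded.height {L : Submodule ℤ ℂ} {v : ℂ} {δ κ : ℝ} (h : S.IsGraded L v δ)
    (hL : ∀ l ∈ L, ∃ m : ℤ, cross v l = m * κ) (e : Fin n × Fin 3) :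
    ∃ m j : ℤ, (j = -1 ∨ j = 0 ∨ j = 1) ∧ cross v (S.side e) = m * κ + j * δ ∧
      (j = 0 → S.corner e = S.corner (e.1, e.2 + 1)) := by
  obtain ⟨π, ⟨-, c, hc⟩, z, hu, hz⟩ := h
  obtain ⟨Y, h1, h2, h3⟩ := hz (S.corner e) (mem_range_self _)
  obtain ⟨Y', h1', h2', h3'⟩ := hz (S.corner (e.1, e.2 + 1)) (mem_range_self _)
  rw [← proj_cornerPt, hc, Submodule.Quotient.eq] at h1 h1'
  obtain ⟨m, hm⟩ := hL _ (L.sub_mem h1' h1)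
  have hs : cross v (S.side e) = m * κ + (cross v Y' - cross v Y) := by
    rw [← hm, ← cross_sub_right, ← cross_add_right]
    congr 1
    simp only [side, Points.coord, cornerPt]
    ring
  by_cases hx : S.corner e = z <;> by_cases hx' : S.corner (e.1, e.2 + 1) = z
  · exact ⟨m, 0, by simp, by rw [hs, h2 hx, h2' hx']; simp, fun _ => hx.trans hx'.symm⟩
  · exact ⟨m, -1, by simp, by rw [hs, h2 hx, h3' hx']; push_cast; ring, fun h => by omega⟩
  · exact ⟨m, 1, by simp, by rw [hs, h3 hx, h2' hx']; push_cast; ring, fun h => by omega⟩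
  · refine ⟨m, 0, by simp, by rw [hs, h3 hx, h3' hx']; simp, fun _ => ?_⟩
    exact hu _ (mem_range_self _) _ (mem_range_self _) hx hx'

/-- The quadrilateral formed by two triangles is convex, and the other diagonal is less high, if
their common side is the highest side of both. -/
theorem Admissible.canFlip_of_height (hS : S.Admissible) {v : ℂ} {i : Fin n} {k : Fin 3}
    (hne : ∀ k', cross v (S.side (i, k')) ≠ 0)
    (h1 : ∀ k', |cross v (S.side (i, k'))| ≤ |cross v (S.side (i, k))|)
    (h2 : ∀ k', |cross v (S.side ((S.glue (i, k)).1, k'))| ≤ |cross v (S.side (i, k))|) :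
    S.CanFlip i k ∧ |cross v (S.side (i, k + 2) + S.side ((S.glue (i, k)).1, (S.glue (i, k)).2 + 1))| <
      |cross v (S.side (i, k))| := by
  wlog H : 0 < cross v (S.side (i, k)) generalizing v
  · have hneg : ∀ w, |cross (-v) w| = |cross v w| := fun w => by rw [cross_neg_left, abs_neg]
    have := this (v := -v) (fun k' => by rw [cross_neg_left]; exact neg_ne_zero.2 (hne k'))
      (by simpa only [hneg] using h1) (by simpa only [hneg] using h2)
      (by rw [cross_neg_left]; have := lt_of_le_of_ne (not_lt.1 H) (hne k); linarith)
    simpa only [hneg] using this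
  have hs := hS.side_glue (i, k)
  rcases hg : S.glue (i, k) with ⟨j, l⟩
  rw [hg] at hs h2
  simp only [CanFlip, hg]
  have t1 := S.side_add_side_add_side i k
  have t2 := S.side_add_side_add_side j l
  have p1 := hS.cross_pos i k
  have p3 := hS.cross_pos i (k + 2)
  have q1 := hS.cross_pos j l
  have q3 := hS.cross_pos j (l + 2)
  rw [fin3_add_two_add_one] at p3 q3
  have n1 := hne (k + 1)
  have n2 := hne (k + 2)
  have a1 := h1 (k + 1)
  have a2 := h1 (k + 2)
  have b1 := h2 (l + 1)
  have b2 := h2 (l + 2)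
  rw [hs] at t2 q1 q3
  generalize S.side (i, k) = s at *
  generalize S.side (i, k + 1) = A at *
  generalize S.side (i, k + 2) = B at *
  generalize S.side (j, l + 1) = A' at *
  generalize S.side (j, l + 2) = B' at *
  rw [abs_of_pos H] at *
  have u1 := congrArg (cross v) t1
  have u2 := congrArg (cross v) t2
  simp only [cross_add_right, cross_neg_right, cross_zero_right] at u1 u2
  rw [abs_le] at a1 a2 b1 b2
  -- The heights in a triangle add up to zero and the common side is the highest, so the two other
  -- sides have the opposite sign. This is strict in the triangle `i`, which has no horizontal side;
  -- the neighbour may have one.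
  have B0 : cross v B < 0 := lt_of_le_of_ne (by linarith) n2
  have A0 : cross v A < 0 := lt_of_le_of_ne (by linarith) n1
  have A'0 : 0 ≤ cross v A' := by linarith
  have B'0 : 0 ≤ cross v B' := by linarith
  rw [cross_neg_left] at q1
  rw [cross_neg_right] at q3
  refine ⟨⟨?_, ?_⟩, ?_⟩
  -- The Plücker relation writes the determinant at a new corner, times the height of the common
  -- side, as a sum of products of known sign.
  · have e := cross_plucker B A' s v
    rw [cross_comm A' s, cross_comm s B] at e
    have : 0 < cross B A' * cross v s := by nlinarith [mul_nonneg p3.le A'0, mul_pos q1 (neg_pos.2 B0)]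
    exact (mul_pos_iff_of_pos_right H).1 this
  · have e := cross_plucker B' A s v
    rw [cross_comm A s, cross_comm s B'] at e
    have : 0 < cross B' A * cross v s := by nlinarith [mul_nonneg p1.le B'0, mul_pos q3 (neg_pos.2 A0)]
    exact (mul_pos_iff_of_pos_right H).1 this
  · rw [cross_add_right, abs_lt]
    constructor <;> linarith

/-- Only the diagonal changes, and it is counted once in each of its two triangles, with opposite
directions. -/
theorem sum_side_flip (hS : S.Admissible) (i : Fin n) (k : Fin 3) (f : ℂ → ℝ) (hf : ∀ w, f (-w) = f w) :
    ∑ e, f ((S.flip i k).side e) = ∑ e, f (S.side e) + 2 *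
      (f (S.side (i, k + 2) + S.side ((S.glue (i, k)).1, (S.glue (i, k)).2 + 1)) - f (S.side (i, k))) := by
  classical
  have hs := hS.side_glue (i, k)
  rcases hg : S.glue (i, k) with ⟨j, l⟩
  rw [hg] at hs
  have h := hS.flipRel_flip hg
  have a1 := fin3_add_one_ne
  have a2 := fin3_add_two_ne
  obtain ⟨d1, d2⟩ := h.side_diag
  have e1 := h.side_flipSide (e := (i, k + 1)) (by simp [a1]) (by simp [h.ne])
  have e2 := h.side_flipSide (e := (i, k + 2)) (by simp [a2]) (by simp [h.ne])
  have e3 := h.side_flipSide (e := (j, l + 1)) (by simp [h.ne.symm]) (by simp [a1])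
  have e4 := h.side_flipSide (e := (j, l + 2)) (by simp [h.ne.symm]) (by simp [a2])
  rw [flipSide_one] at e1
  rw [flipSide_two] at e2
  rw [flipSide_three h.ne] at e3
  rw [flipSide_four h.ne] at e4
  simp only [Fintype.sum_prod_type]
  set D := f (S.side (i, k + 2) + S.side (j, l + 1)) with hD
  have key := sum_eq_of_pair h.ne (fun a => ∑ b, f ((S.flip i k).side (a, b)))
    (fun a => ∑ b, f (S.side (a, b)) + if a = i then 2 * (D - f (S.side (i, k))) else 0) ?_ ?_
  · rw [key, Finset.sum_add_distrib]
    simp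
  · intro a ha hb
    simp only [if_neg ha, add_zero]
    refine Finset.sum_congr rfl fun b _ => ?_
    have e5 := h.side_flipSide (e := (a, b)) (by simp [ha]) (by simp [hb])
    rw [flipSide_of_ne (by simpa using ha) (by simpa using hb)] at e5
    rw [e5]
  · simp only [if_neg h.ne.symm, if_true]
    rw [sum_fin_three _ k, sum_fin_three _ l, sum_fin_three _ k, sum_fin_three _ l, d1, d2, e1, e2, e3,
      e4, hf, hs, hf, ← hD]
    ring

end GluedTriangles
end TranslationSurface

namespace TranslationSurface
namespace GluedTriangles

variable {n : ℕ} {S : GluedTriangles n}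

/-- The sum of the ranks of the heights of the sides. -/
noncomputable def totalRank (S : GluedTriangles n) (v : ℂ) (κ δ : ℝ) : ℝ :=
  ∑ e, (heightRank κ δ |cross v (S.side e)| : ℝ)

/-- Among the triangles without horizontal side choose one with the highest side. The neighbour
across it has no higher side: by maximality, or because a horizontal side forces its two other sides
to have equal heights. The new diagonal is lower, its integral rank drops, and the diagonal counts
twice. -/
theorem exists_flip_of_height (hS : S.IsH11) {L : Submodule ℤ ℂ} {v : ℂ} {κ δ : ℝ} (hκ : 0 < κ)
    (hL : ∀ l ∈ L, ∃ m : ℤ, cross v l = m * κ) (hg : S.IsGraded L v δ) {i₀ : Fin n}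
    (h0 : ∀ k, cross v (S.side (i₀, k)) ≠ 0) : ∃ i k, S.CanFlip i k ∧
      (S.flip i k).totalRank v κ δ + 2 ≤ S.totalRank v κ δ := by
  classical
  have hA := hS.admissible
  obtain ⟨⟨i, k⟩, hik, hmax⟩ := Finset.exists_max_image
    (Finset.univ.filter fun e : Fin n × Fin 3 => ∀ k, cross v (S.side (e.1, k)) ≠ 0)
    (fun e => |cross v (S.side e)|) ⟨(i₀, 0), by simpa using h0⟩
  simp only [Finset.mem_filter, Finset.mem_univ, true_and] at hik hmax
  have h1 : ∀ k', |cross v (S.side (i, k'))| ≤ |cross v (S.side (i, k))| := fun k' => hmax (i, k') hik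
  have h2 : ∀ k', |cross v (S.side ((S.glue (i, k)).1, k'))| ≤ |cross v (S.side (i, k))| := by
    have hs := hA.side_glue (i, k)
    rcases hgl : S.glue (i, k) with ⟨j, l⟩
    rw [hgl] at hs
    by_cases hj : ∀ k', cross v (S.side (j, k')) ≠ 0
    · exact fun k' => hmax (j, k') hj
    · push Not at hj
      obtain ⟨q, hq⟩ := hj
      have hl : |cross v (S.side (j, l))| = |cross v (S.side (i, k))| := by
        rw [hs, cross_neg_right, abs_neg]
      have hql : q ≠ l := by
        rintro rfl
        rw [hq, abs_zero, eq_comm, abs_eq_zero] at hl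
        exact hik k hl
      have t := congrArg (cross v) (S.side_add_side_add_side j q)
      simp only [cross_add_right, cross_zero_right, hq, zero_add] at t
      have hs' : |cross v (S.side (j, q + 2))| = |cross v (S.side (j, q + 1))| := by
        rw [eq_neg_of_add_eq_zero_right t, abs_neg]
      have hpos := abs_nonneg (cross v (S.side (i, k)))
      intro k'
      rcases fin3_cases q l with rfl | rfl | rfl
      · exact absurd rfl hql
      · rcases fin3_cases q k' with rfl | rfl | rfl
        · rw [hq, abs_zero]; exact hpos
        · exact hl.le
        · rw [hs']; exact hl.le
      · rcases fin3_cases q k' with rfl | rfl | rfl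
        · rw [hq, abs_zero]; exact hpos
        · rw [← hs']; exact hl.le
        · exact hl.le
  obtain ⟨hc, hlt⟩ := hA.canFlip_of_height hik h1 h2
  refine ⟨i, k, hc, ?_⟩
  have hsum := sum_side_flip hA i k (fun w => (heightRank κ δ |cross v w| : ℝ))
    fun w => by rw [cross_neg_right, abs_neg]
  obtain ⟨m, j, hj, hm, -⟩ := hg.height hL (i, k)
  obtain ⟨m', j', hj', hm'⟩ : ∃ m' j' : ℤ, (j' = -1 ∨ j' = 0 ∨ j' = 1) ∧
      |cross v (S.side (i, k))| = m' * κ + j' * δ := by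
    rcases abs_choice (cross v (S.side (i, k))) with h | h
    · exact ⟨m, j, hj, by rw [h, hm]⟩
    · exact ⟨-m, -j, by omega, by rw [h, hm]; push_cast; ring⟩
  have hr := heightRank_lt hκ hlt hj' hm'
  have hr' : (heightRank κ δ |cross v (S.side (i, k + 2) +
      S.side ((S.glue (i, k)).1, (S.glue (i, k)).2 + 1))| : ℝ) + 1 ≤
      heightRank κ δ |cross v (S.side (i, k))| := by exact_mod_cast hr
  simp only [totalRank]
  rw [hsum]
  linarith

/-- Every graded surface has a triangulation in which every triangle has a horizontal side. -/
theorem exists_horizontal (hS : S.IsH11) (c : Fin n × Fin 3) {L : Submodule ℤ ℂ} {v : ℂ} {κ δ : ℝ}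
    (hκ : 0 < κ) (hL : ∀ l ∈ L, ∃ m : ℤ, cross v l = m * κ) (hg : S.IsGraded L v δ) :
    ∃ (S' : GluedTriangles n) (c' : Fin n × Fin 3), Equivalent S c S' c' ∧ S'.IsH11 ∧
      ∀ i, ∃ k, cross v (S'.side (i, k)) = 0 := by
  have hbd : ∀ S : GluedTriangles n, ∑ _e : Fin n × Fin 3, (heightRank κ δ 0 : ℝ) ≤
      S.totalRank v κ δ := fun S =>
    Finset.sum_le_sum fun e _ => by exact_mod_cast heightRank_mono hκ (abs_nonneg _)
  -- The total rank is bounded below by its value at height zero, and each flip lowers it by at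
  -- least two; `N` bounds the remaining number of flips.
  obtain ⟨N, hN⟩ := exists_nat_ge (S.totalRank v κ δ - ∑ _e : Fin n × Fin 3, (heightRank κ δ 0 : ℝ))
  induction N generalizing S c with
  | zero =>
    refine ⟨S, c, Equivalent.refl _ _, hS, ?_⟩
    by_contra! h
    obtain ⟨i₀, h0⟩ := h
    obtain ⟨i, k, -, h1⟩ := exists_flip_of_height hS hκ hL hg h0
    have := hbd (S.flip i k)
    push_cast at hN
    linarith
  | succ N ih =>
    by_cases h : ∀ i, ∃ k, cross v (S.side (i, k)) = 0
    · exact ⟨S, c, Equivalent.refl _ _, hS, h⟩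
    push Not at h
    obtain ⟨i₀, h0⟩ := h
    obtain ⟨i, k, hc, h1⟩ := exists_flip_of_height hS hκ hL hg h0
    obtain ⟨c', hc'⟩ := hS.admissible.equivalent_flip hc c
    push_cast at hN
    obtain ⟨S', c'', h2, h3⟩ := ih (hS.flip hc) c' (hg.of_equivalent hc') (by linarith)
    exact ⟨S', c'', hc'.trans h2, h3⟩

end GluedTriangles
end TranslationSurface

/-! ### Parallel vectors, and renumbering the triangles of a surface. -/

namespace TranslationSurface

theorem exists_eq_mul_of_cross {v a : ℂ} (hv : v ≠ 0) (h : cross v a = 0) : ∃ r : ℝ, a = r * v := by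
  have him : (a / v).im = 0 := by rw [im_div_eq_cross, h, zero_div]
  refine ⟨(a / v).re, ?_⟩
  have : ((a / v).re : ℂ) = a / v := Complex.ext rfl (by simp [him])
  rw [this, div_mul_cancel₀ _ hv]

namespace GluedTriangles

theorem IsH11.of_relabelling {n : ℕ} {S S' : GluedTriangles n} {σ : Fin n × Fin 3 ≃ Fin n × Fin 3}
    (hS : S.IsH11) (hσ : IsRelabelling σ) (hglue : ∀ e, S'.glue (σ e) = σ (S.glue e))
    (hside : ∀ e, S'.side (σ e) = S.side e) : S'.IsH11 ∧
      ∀ c c', S'.corner (σ c) = S'.corner (σ c') ↔ S.corner c = S.corner c' := by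
  have hA := hS.admissible
  have hA' := hA.of_relabelling hσ hglue hside
  have hc : ∀ c c', S'.corner (σ c) = S'.corner (σ c') ↔ S.corner c = S.corner c' := by
    intro c c'
    constructor
    · intro h
      have := hA'.eq_of_corner_eq (fun e => S.corner (σ.symm e)) (fun e => ?_) h
      · simpa using this
      · obtain ⟨e, rfl⟩ := σ.surjective e
        rw [hglue, ← hσ]
        simpa using S.corner_glue e
    · refine hA.eq_of_corner_eq (fun e => S'.corner (σ e)) fun e => ?_
      rw [hσ, ← hglue]
      exact S'.corner_glue (σ e)
  refine ⟨⟨hA'.signedArea_pos, hA'.glue_glue, hA'.side_glue, ?_, ?_, ?_⟩, hc⟩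
  · obtain ⟨c, -, -, -⟩ := hS.exists_corners
    obtain ⟨f, -⟩ := equivalent_of_relabelling hσ hglue hside c
    have := hS.connected
    exact f.surjective.connectedSpace f.continuous
  · obtain ⟨c₁, c₂, h1, h2⟩ := hS.exists_corners
    rw [Set.ncard_eq_two]
    refine ⟨S'.corner (σ c₁), S'.corner (σ c₂), by rwa [Ne, hc], ?_⟩
    ext z
    constructor
    · rintro ⟨c, rfl⟩
      obtain ⟨c, rfl⟩ := σ.surjective c
      simpa [hc] using h2 c
    · rintro (rfl | rfl) <;> exact mem_range_self _
  · rintro _ ⟨c, rfl⟩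
    obtain ⟨c, rfl⟩ := σ.surjective c
    rw [← hS.simple_zero _ (mem_range_self c), totalAngle_eq, totalAngle_eq]
    classical
    rw [← σ.sum_comp]
    refine Finset.sum_congr rfl fun e _ => ?_
    have h3 : S'.cornerAngle (σ e) = S.cornerAngle e := by
      simp only [cornerAngle, hside]
      rw [← hσ.apply_add e.1 e.2 2, hside]
    simp only [hc, h3]

section relabelled

variable (S : GluedTriangles 8) {p q : Fin 8 → Fin 8} (r : Fin 8 → Fin 3) (h1 : ∀ i, q (p i) = i)
  (h2 : ∀ i, p (q i) = i)

/-- The surface in which the triangle `p i`, rotated by `r i`, has the number `i`. -/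
noncomputable def relabelled : GluedTriangles 8 where
  glue e := (relabel p q r h1 h2).symm (S.glue (relabel p q r h1 h2 e))
  vert i k := S.vert (p i) (k + r i)

theorem side_relabelled (e : Fin 8 × Fin 3) :
    (S.relabelled r h1 h2).side e = S.side (p e.1, e.2 + r e.1) := by
  simp only [side, relabelled]
  rw [add_right_comm]

variable {S} in
theorem IsH11.relabelled (hS : S.IsH11) : (S.relabelled r h1 h2).IsH11 ∧
    (∀ c c', (S.relabelled r h1 h2).corner c = (S.relabelled r h1 h2).corner c' ↔
      S.corner (p c.1, c.2 + r c.1) = S.corner (p c'.1, c'.2 + r c'.1)) ∧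
    ∀ c, Equivalent S (p c.1, c.2 + r c.1) (S.relabelled r h1 h2) c := by
  set σ := relabel p q r h1 h2 with hσ
  have hr : IsRelabelling σ.symm := (isRelabelling_relabel h1 h2).symm
  have hglue : ∀ e, (S.relabelled r h1 h2).glue (σ.symm e) = σ.symm (S.glue e) := fun e => by
    simp [GluedTriangles.relabelled, ← hσ]
  have hside : ∀ e, (S.relabelled r h1 h2).side (σ.symm e) = S.side e := fun e => by
    rw [side_relabelled]
    exact congrArg S.side (σ.apply_symm_apply e)
  obtain ⟨a, b⟩ := hS.of_relabelling hr hglue hside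
  refine ⟨a, fun c c' => ?_, fun c => ?_⟩
  · have := b (σ c) (σ c')
    rw [Equiv.symm_apply_apply, Equiv.symm_apply_apply] at this
    exact this
  · have := equivalent_of_relabelling hr hglue hside (σ c)
    rwa [Equiv.symm_apply_apply] at this

end relabelled

theorem Equivalent.exists_corner {n m : ℕ} {S : GluedTriangles n} {S' : GluedTriangles m}
    {c : Fin n × Fin 3} {c' : Fin m × Fin 3} (h : Equivalent S c S' c') (d : Fin n × Fin 3) :
    ∃ d', Equivalent S d S' d' := by
  obtain ⟨f, h1, h2, h3, r⟩ := h
  obtain ⟨d', hd'⟩ := (h3 (S.corner d)).2 (mem_range_self d)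
  exact ⟨d', f, h1, hd'.symm, h3, r⟩

end GluedTriangles
end TranslationSurface

/-! ### Triangulations arranged in horizontal rows. -/

namespace TranslationSurface
namespace GluedTriangles

/-- A triangulation in which every triangle has a side in the direction `v`: the triangles `i` with
`i < 4` lie above this side, the side of `i` is glued to that of `i + 4`, and the sides of the first
two and of the last two of these pairs are loops at different vertices. -/
structure IsRowed (S : GluedTriangles 8) (v : ℂ) : Prop where
  isH11 : S.IsH11
  ne_zero : v ≠ 0
  hor : ∀ i, cross v (S.side (i, 0)) = 0
  up : ∀ i, i < 4 → 0 < cross v (S.side (i, 1))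
  down : ∀ i, 4 ≤ i → cross v (S.side (i, 1)) < 0
  glue_hor : ∀ i, S.glue (i, 0) = (i + 4, 0)
  loop : ∀ i, S.corner (i, 0) = S.corner (i, 1)
  first : S.corner (4, 0) = S.corner (5, 0)
  last : S.corner (6, 0) = S.corner (7, 0)
  ne : S.corner (4, 0) ≠ S.corner (6, 0)

variable {S : GluedTriangles 8}

section

variable {n : ℕ} {S : GluedTriangles n} {v : ℂ}

theorem cross_side_ne_zero (hS : S.Admissible) (hv : v ≠ 0) {i : Fin n} {k k' : Fin 3}
    (h : cross v (S.side (i, k)) = 0) (hk : k' ≠ k) : cross v (S.side (i, k')) ≠ 0 := by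
  intro h'
  obtain ⟨r, hr⟩ := exists_eq_mul_of_cross hv h
  obtain ⟨r', hr'⟩ := exists_eq_mul_of_cross hv h'
  have h0 : cross (S.side (i, k)) (S.side (i, k')) = 0 := by
    rw [hr, hr', cross_smul_right, cross_comm, cross_smul_right, cross_self]; simp
  have c1 := hS.cross_pos i k
  have c3 := hS.cross_pos i (k + 2)
  rw [fin3_add_two_add_one] at c3
  rcases fin3_cases k k' with rfl | rfl | rfl
  · exact hk rfl
  · exact c1.ne' h0
  · rw [cross_comm] at h0; linarith

open Classical in
/-- Around every vertex there are exactly two triangles below a horizontal side. -/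
theorem card_down (hS : S.IsH11) (hv : v ≠ 0) {k : Fin n → Fin 3}
    (hk : ∀ i, cross v (S.side (i, k i)) = 0) {z : S.Surface} (hz : z ∈ S.vertices) :
    (Finset.univ.filter fun i => S.corner (i, k i) = z ∧ cross v (S.side (i, k i + 1)) < 0).card = 2 := by
  have hA := hS.admissible
  have h1 := hA.totalAngle_eq_card hv z
  rw [hS.simple_zero z hz] at h1
  have h2 : ((Finset.univ.filter fun c : Fin n × Fin 3 => S.corner c = z ∧
      0 ≤ cross v (S.side c) ∧ 0 < cross v (S.side (c.1, c.2 + 2))).card : ℝ) = 2 := by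
    have := Real.pi_pos
    have : 2 * Real.pi * _ = 2 * Real.pi * 2 := h1.symm.trans (by ring)
    exact mul_left_cancel₀ (by positivity) this
  -- In each triangle only the initial corner of the horizontal side can be counted, and it is
  -- exactly when the triangle lies below that side. The angle `4π` therefore means two such
  -- triangles.
  have h3 : (Finset.univ.filter fun c : Fin n × Fin 3 => S.corner c = z ∧
      0 ≤ cross v (S.side c) ∧ 0 < cross v (S.side (c.1, c.2 + 2))) =
      (Finset.univ.filter fun i => S.corner (i, k i) = z ∧ cross v (S.side (i, k i + 1)) < 0).image
        fun i => (i, k i) := by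
    ext ⟨i, l⟩
    simp only [Finset.mem_filter, Finset.mem_univ, true_and, Finset.mem_image, Prod.mk.injEq]
    have t := congrArg (cross v) (S.side_add_side_add_side i (k i))
    simp only [cross_add_right, cross_zero_right, hk, zero_add] at t
    constructor
    · rintro ⟨a, b, c⟩
      have hl : l = k i := by
        rcases fin3_cases (k i) l with h | h | h
        · exact h
        · rw [h, fin3_add_one_add_two, hk] at c; exact absurd c (lt_irrefl _)
        · rw [h] at b c; rw [fin3_add_two_add_two] at c; linarith
      subst hl
      exact ⟨i, ⟨a, by linarith⟩, rfl, rfl⟩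
    · rintro ⟨j, ⟨a, b⟩, rfl, rfl⟩
      exact ⟨a, (hk j).ge, by linarith⟩
  rw [h3, Finset.card_image_of_injective _ fun i j h => congrArg Prod.fst h] at h2
  exact_mod_cast h2

end

/-- A surface all whose triangles have horizontal sides, which are loops, can be brought into rowed
form. -/
theorem exists_isRowed (hS : S.IsH11) {v : ℂ} (hv : v ≠ 0)
    (hh : ∀ i, ∃ k, cross v (S.side (i, k)) = 0)
    (hl : ∀ e, cross v (S.side e) = 0 → S.corner e = S.corner (e.1, e.2 + 1))
    (c : Fin 8 × Fin 3) : ∃ S' c', Equivalent S c S' c' ∧ S'.IsRowed v := by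
  classical
  have hA := hS.admissible
  choose k hk using hh
  have huniq : ∀ e, cross v (S.side e) = 0 → e.2 = k e.1 := by
    rintro ⟨i, l⟩ he
    by_contra h
    exact cross_side_ne_zero hA hv (hk i) h he
  obtain ⟨c₁, c₂, hc, -⟩ := hS.exists_corners
  obtain ⟨i₀, i₁, h01, hs1⟩ := Finset.card_eq_two.1 (card_down hS hv hk (mem_range_self c₁))
  obtain ⟨i₂, i₃, h23, hs2⟩ := Finset.card_eq_two.1 (card_down hS hv hk (mem_range_self c₂))
  have m1 : ∀ i ∈ ({i₀, i₁} : Finset (Fin 8)), S.corner (i, k i) = S.corner c₁ ∧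
      cross v (S.side (i, k i + 1)) < 0 := fun i hi => by
    rw [← hs1] at hi; simpa using hi
  have m2 : ∀ i ∈ ({i₂, i₃} : Finset (Fin 8)), S.corner (i, k i) = S.corner c₂ ∧
      cross v (S.side (i, k i + 1)) < 0 := fun i hi => by
    rw [← hs2] at hi; simpa using hi
  obtain ⟨z0, d0⟩ := m1 i₀ (by simp)
  obtain ⟨z1, d1⟩ := m1 i₁ (by simp)
  obtain ⟨z2, d2⟩ := m2 i₂ (by simp)
  obtain ⟨z3, d3⟩ := m2 i₃ (by simp)
  have h02 : i₀ ≠ i₂ := by rintro rfl; exact hc (z0.symm.trans z2)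
  have h03 : i₀ ≠ i₃ := by rintro rfl; exact hc (z0.symm.trans z3)
  have h12 : i₁ ≠ i₂ := by rintro rfl; exact hc (z1.symm.trans z2)
  have h13 : i₁ ≠ i₃ := by rintro rfl; exact hc (z1.symm.trans z3)
  -- `τ` passes to the triangle across the horizontal side; it exchanges triangles above and below
  -- such a side.
  set τ : Fin 8 → Fin 8 := fun i => (S.glue (i, k i)).1 with hτ
  have hτg : ∀ i, S.glue (i, k i) = (τ i, k (τ i)) := by
    intro i
    refine Prod.ext rfl (huniq _ ?_)
    rw [hA.side_glue, cross_neg_right, hk, neg_zero]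
  have hττ : ∀ i, τ (τ i) = i := by
    intro i
    have := hA.glue_glue (i, k i)
    rw [hτg, hτg] at this
    exact congrArg Prod.fst this
  have hτs : ∀ i, cross v (S.side (i, k i + 1)) < 0 → 0 < cross v (S.side (τ i, k (τ i) + 1)) := by
    intro i hi
    obtain ⟨r, hr⟩ := exists_eq_mul_of_cross hv (hk i)
    have hr' : S.side (τ i, k (τ i)) = (-r : ℝ) * v := by
      rw [← hτg, hA.side_glue, hr]; push_cast; ring
    have p1 := hA.cross_pos i (k i)
    have p2 := hA.cross_pos (τ i) (k (τ i))
    have e : ∀ (r : ℝ) w, cross (r * v) w = r * cross v w := fun r w => by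
      rw [cross_comm, cross_smul_right, cross_comm w v]; ring
    rw [hr, e] at p1
    rw [hr', e] at p2
    have hr0 : r < 0 := by
      by_contra h
      nlinarith [not_lt.1 h]
    by_contra h
    nlinarith [not_lt.1 h]
  -- The last four are the triangles below the loops, two for each vertex, and the first four are
  -- their partners above.
  set p : Fin 8 → Fin 8 := ![τ i₀, τ i₁, τ i₂, τ i₃, i₀, i₁, i₂, i₃] with hp
  have hτne : ∀ i j, cross v (S.side (i, k i + 1)) < 0 → cross v (S.side (j, k j + 1)) < 0 → τ i ≠ j := by
    rintro i _ hi hj rfl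
    exact absurd (hτs i hi) hj.not_gt
  have hτinj : ∀ i j, i ≠ j → τ i ≠ τ j := fun i j hij h => hij (by rw [← hττ i, h, hττ])
  have hinj : Function.Injective p := by
    intro a b hab
    by_contra hne
    have sy : ∀ {i j : Fin 8}, i ≠ j → j ≠ i := Ne.symm
    have T01 := hτinj _ _ h01; have T02 := hτinj _ _ h02; have T03 := hτinj _ _ h03
    have T12 := hτinj _ _ h12; have T13 := hτinj _ _ h13; have T23 := hτinj _ _ h23
    have A0 := fun j hj => hτne i₀ j d0 hj; have A1 := fun j hj => hτne i₁ j d1 hj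
    have A2 := fun j hj => hτne i₂ j d2 hj; have A3 := fun j hj => hτne i₃ j d3 hj
    have A00 := A0 _ d0; have A01 := A0 _ d1; have A02 := A0 _ d2; have A03 := A0 _ d3
    have A10 := A1 _ d0; have A11 := A1 _ d1; have A12 := A1 _ d2; have A13 := A1 _ d3
    have A20 := A2 _ d0; have A21 := A2 _ d1; have A22 := A2 _ d2; have A23 := A2 _ d3
    have A30 := A3 _ d0; have A31 := A3 _ d1; have A32 := A3 _ d2; have A33 := A3 _ d3
    clear_value τ
    clear A0 A1 A2 A3 hτne hτinj
    fin_cases a <;> fin_cases b <;> first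
      | exact hne rfl
      | (simp only [hp, Fin.reduceFinMk, Fin.zero_eta, Fin.mk_one, Matrix.cons_val] at hab
         first
          | exact absurd hab ‹_›
          | exact absurd hab.symm ‹_›)
  have hbij : Function.Bijective p := Finite.injective_iff_bijective.1 hinj
  set e := Equiv.ofBijective p hbij with he
  have q1 : ∀ i, e.symm (p i) = i := e.symm_apply_apply
  have q2 : ∀ i, p (e.symm i) = i := e.apply_symm_apply
  set r : Fin 8 → Fin 3 := fun i => k (p i) with hr
  obtain ⟨hS', hcor, heq⟩ := hS.relabelled r q1 q2
  have hside := S.side_relabelled r q1 q2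
  have hpτ : ∀ i, τ (p i) = p (i + 4) := by
    intro i
    fin_cases i
    · exact hττ _
    · exact hττ _
    · exact hττ _
    · exact hττ _
    all_goals rfl
  have hglue : ∀ i, (S.relabelled r q1 q2).glue (i, 0) = (i + 4, 0) := by
    intro i
    change (relabel p e.symm r q1 q2).symm (S.glue (p i, 0 + r i)) = _
    rw [Equiv.symm_apply_eq, zero_add, hr, hτg, hpτ]
    simp [relabel]
  obtain ⟨c', hc'⟩ := (heq (0, 0)).exists_corner c
  refine ⟨_, c', hc', hS', hv, fun i => ?_, fun i hi => ?_, fun i hi => ?_, hglue, fun i => ?_, ?_, ?_, ?_⟩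
  · rw [hside, zero_add]; exact hk _
  · rw [hside, add_comm]
    have hi' : i = 0 ∨ i = 1 ∨ i = 2 ∨ i = 3 := by revert i; decide
    rcases hi' with rfl | rfl | rfl | rfl
    · exact hτs _ d0
    · exact hτs _ d1
    · exact hτs _ d2
    · exact hτs _ d3
  · rw [hside, add_comm]
    have hi' : i = 4 ∨ i = 5 ∨ i = 6 ∨ i = 7 := by revert i; decide
    rcases hi' with rfl | rfl | rfl | rfl
    · exact d0
    · exact d1
    · exact d2
    · exact d3
  · rw [hcor]
    have := hl (p i, r i) (hk _)
    rw [zero_add, add_comm 1]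
    exact this
  · rw [hcor, zero_add, zero_add]
    exact z0.trans z1.symm
  · rw [hcor, zero_add, zero_add]
    exact z2.trans z3.symm
  · rw [Ne, hcor, zero_add, zero_add]
    intro h
    exact hc (z0.symm.trans (h.trans z2))

end GluedTriangles
end TranslationSurface

/-! ### The cyclic rows of a rowed surface and their boundaries. -/

namespace TranslationSurface
namespace GluedTriangles

/-- The side by which a triangle of a rowed surface meets its right neighbour. -/
def rightSide (i : Fin 8) : Fin 3 := if i < 4 then 1 else 2

/-- The side by which a triangle of a rowed surface meets its left neighbour. -/
def leftSide (i : Fin 8) : Fin 3 := if i < 4 then 2 else 1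

/-- The gluing of a rowed surface in which `ρ` and `ρ'` send a triangle to its right and its left
neighbour. -/
def rowGlue (ρ ρ' : Fin 8 → Fin 8) (e : Fin 8 × Fin 3) : Fin 8 × Fin 3 :=
  if e.2 = 0 then (e.1 + 4, 0) else if e.2 = rightSide e.1 then (ρ e.1, leftSide (ρ e.1))
  else (ρ' e.1, rightSide (ρ' e.1))

/-- The right neighbour of a triangle. -/
def right (S : GluedTriangles 8) (i : Fin 8) : Fin 8 := (S.glue (i, rightSide i)).1

/-- The left neighbour of a triangle. -/
def left (S : GluedTriangles 8) (i : Fin 8) : Fin 8 := (S.glue (i, leftSide i)).1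

theorem side_cases_row (i : Fin 8) (k : Fin 3) : k = 0 ∨ k = rightSide i ∨ k = leftSide i := by
  revert i k; decide

theorem rightSide_ne_zero (i : Fin 8) : rightSide i ≠ 0 := by revert i; decide
theorem leftSide_ne_zero (i : Fin 8) : leftSide i ≠ 0 := by revert i; decide
theorem leftSide_ne_rightSide (i : Fin 8) : leftSide i ≠ rightSide i := by revert i; decide

theorem side_sum_row (S : GluedTriangles 8) (i : Fin 8) :
    S.side (i, 0) = -S.side (i, rightSide i) - S.side (i, leftSide i) := by
  have t := S.side_add_side_add_side i 0
  rw [zero_add, zero_add] at t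
  by_cases hi : i < 4
  · simp only [rightSide, leftSide, hi, if_true]; linear_combination t
  · simp only [rightSide, leftSide, hi, if_false]; linear_combination t

namespace IsRowed

variable {S : GluedTriangles 8} {v : ℂ}

theorem height_right (h : S.IsRowed v) (i : Fin 8) : 0 < cross v (S.side (i, rightSide i)) := by
  have t := congrArg (cross v) (S.side_add_side_add_side i 0)
  simp only [zero_add, cross_add_right, h.hor, cross_zero_right] at t
  by_cases hi : i < 4
  · simp only [rightSide, hi, if_true]; exact h.up i hi
  · simp only [rightSide, hi, if_false]; linarith [h.down i (not_lt.1 hi)]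

theorem height_left (h : S.IsRowed v) (i : Fin 8) : cross v (S.side (i, leftSide i)) < 0 := by
  have t := congrArg (cross v) (S.side_sum_row i)
  rw [h.hor, cross_sub_right, cross_neg_right] at t
  linarith [h.height_right i]

theorem glue_right (h : S.IsRowed v) (i : Fin 8) : S.glue (i, rightSide i) = (S.right i, leftSide (S.right i)) := by
  have hs := congrArg (cross v) (h.isH11.admissible.side_glue (i, rightSide i))
  rw [cross_neg_right] at hs
  have h1 := h.height_right i
  refine Prod.ext rfl ?_
  have e : S.glue (i, rightSide i) = (S.right i, (S.glue (i, rightSide i)).2) := rfl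
  rcases side_cases_row (S.right i) (S.glue (i, rightSide i)).2 with h0 | h0 | h0
  · rw [e, h0, h.hor] at hs; linarith
  · rw [e, h0] at hs; linarith [h.height_right (S.right i)]
  · exact h0

theorem glue_left (h : S.IsRowed v) (i : Fin 8) : S.glue (i, leftSide i) = (S.left i, rightSide (S.left i)) := by
  have hs := congrArg (cross v) (h.isH11.admissible.side_glue (i, leftSide i))
  rw [cross_neg_right] at hs
  have h1 := h.height_left i
  refine Prod.ext rfl ?_
  have e : S.glue (i, leftSide i) = (S.left i, (S.glue (i, leftSide i)).2) := rfl
  rcases side_cases_row (S.left i) (S.glue (i, leftSide i)).2 with h0 | h0 | h0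
  · rw [e, h0, h.hor] at hs; linarith
  · exact h0
  · rw [e, h0] at hs; linarith [h.height_left (S.left i)]

theorem left_right (h : S.IsRowed v) (i : Fin 8) : S.left (S.right i) = i := by
  have := h.isH11.admissible.glue_glue (i, rightSide i)
  rw [h.glue_right] at this
  exact congrArg Prod.fst this

theorem right_left (h : S.IsRowed v) (i : Fin 8) : S.right (S.left i) = i := by
  have := h.isH11.admissible.glue_glue (i, leftSide i)
  rw [h.glue_left] at this
  exact congrArg Prod.fst this

theorem glue_eq (h : S.IsRowed v) : S.glue = rowGlue S.right S.left := by
  funext ⟨i, k⟩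
  rcases side_cases_row i k with rfl | rfl | rfl
  · simp [rowGlue, h.glue_hor]
  · simp [rowGlue, rightSide_ne_zero, h.glue_right]
  · simp [rowGlue, leftSide_ne_zero, leftSide_ne_rightSide, h.glue_left]

theorem exists_length (h : S.IsRowed v) : ∃ m : Fin 8 → ℝ, (∀ i, S.side (i, 0) = m i * v) ∧
    (∀ i, i < 4 → 0 < m i) ∧ ∀ i, m (i + 4) = -m i := by
  choose m hm using fun i => exists_eq_mul_of_cross h.ne_zero (h.hor i)
  refine ⟨m, hm, fun i hi => ?_, fun i => ?_⟩
  · have p := h.isH11.admissible.cross_pos i 0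
    rw [hm, zero_add, cross_comm, cross_smul_right, cross_comm] at p
    have u := h.up i hi
    by_contra hh
    nlinarith [not_lt.1 hh]
  · have := h.isH11.admissible.side_glue (i, 0)
    rw [h.glue_hor, hm, hm, ← neg_mul] at this
    have := mul_right_cancel₀ h.ne_zero this
    exact_mod_cast this

/-- The horizontal sides at the bottom and at the top of a union of rows have the same length. -/
theorem sum_length (h : S.IsRowed v) {m : Fin 8 → ℝ} (hm : ∀ i, S.side (i, 0) = m i * v) {B : Fin 8 → Bool}
    (hB : ∀ i, B (S.right i) = B i) : ∑ i, (if B i then m i else 0) = 0 := by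
  -- Within a union of rows each right side is glued to a left side, so the transversal sides cancel
  -- and the horizontal ones add up to zero.
  have h1 : ∑ i, (if B i then S.side (i, leftSide i) else 0) =
      -∑ i, (if B i then S.side (i, rightSide i) else 0) := by
    let e : Fin 8 ≃ Fin 8 := ⟨S.right, S.left, h.left_right, h.right_left⟩
    rw [← e.sum_comp, ← Finset.sum_neg_distrib]
    refine Finset.sum_congr rfl fun i _ => ?_
    change (if B (S.right i) then S.side (S.right i, leftSide (S.right i)) else 0) = _
    rw [hB, ← h.glue_right, h.isH11.admissible.side_glue]
    split_ifs <;> simp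
  have h2 : ((∑ i, (if B i then m i else 0) : ℝ) : ℂ) * v = 0 := by
    push_cast
    rw [Finset.sum_mul]
    have : ∀ i, ((if B i then m i else 0 : ℝ) : ℂ) * v =
        -(if B i then S.side (i, rightSide i) else 0) - if B i then S.side (i, leftSide i) else 0 := by
      intro i
      split_ifs
      · rw [← hm, S.side_sum_row]
      · simp
    simp only [this, Finset.sum_sub_distrib, Finset.sum_neg_distrib, h1]
    ring
  have := (mul_eq_zero.1 h2).resolve_right h.ne_zero
  exact_mod_cast this

/-- Functions on the rows that agree along the horizontal sides are functions of the vertices. -/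
theorem eq_of_rows (h : S.IsRowed v) {B T : Fin 8 → Bool} (hB : ∀ i, B (S.right i) = B i) (hT : ∀ i, T (S.right i) = T i)
    (hBT : ∀ i, i < 4 → B i = T (i + 4)) : B 0 = B 1 ∧ B 2 = B 3 := by
  -- The corners `0, 1` of an upper triangle lie at the bottom of its row and the corner `2` at the
  -- top; in a lower triangle it is the reverse. This colours all corners compatibly with the
  -- gluing.
  let κ : Fin 8 × Fin 3 → Bool := fun e =>
    if e.1 < 4 then (if e.2 = 2 then T e.1 else B e.1) else if e.2 = 2 then B e.1 else T e.1
  have hκ : ∀ e, κ e = κ ((S.glue e).1, (S.glue e).2 + 1) := by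
    rintro ⟨i, k⟩
    have hr : ∀ i, κ (i, rightSide i) = B i ∧ κ (i, rightSide i + 1) = T i ∧ κ (i, leftSide i) = T i ∧
        κ (i, leftSide i + 1) = B i := by
      intro i
      by_cases hi : i < 4 <;> simp [κ, rightSide, leftSide, hi]
    rcases side_cases_row i k with rfl | rfl | rfl
    · rw [h.glue_hor]
      by_cases hi : i < 4
      · have : ¬ i + 4 < 4 := by revert hi; revert i; decide
        simp [κ, hi, this, hBT i hi]
      · have h4 : i + 4 < 4 := by revert hi; revert i; decide
        have h8 : i + 4 + 4 = i := by revert i; decide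
        simp [κ, hi, h4, hBT _ h4, h8]
    · rw [h.glue_right, (hr _).1, (hr _).2.2.2, hB]
    · rw [h.glue_left, (hr _).2.2.1, (hr _).2.1]
      conv_lhs => rw [← h.right_left i, hT]
  have hz : ∀ i, i < 4 → S.corner (i, 0) = S.corner (i + 4, 0) := by
    intro i _
    rw [S.corner_glue (i, 0), h.glue_hor]
    exact (h.loop _).symm
  have A := h.isH11.admissible
  exact ⟨A.eq_of_corner_eq κ hκ ((hz 0 (by decide)).trans (h.first.trans (hz 1 (by decide)).symm)),
    A.eq_of_corner_eq κ hκ ((hz 2 (by decide)).trans (h.last.trans (hz 3 (by decide)).symm))⟩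

/-- The rows cannot be divided into two parts. -/
theorem eq_of_connected (h : S.IsRowed v) {B : Fin 8 → Bool} (hB : ∀ i, B (S.right i) = B i)
    (hB' : ∀ i, B (i + 4) = B i) (i j : Fin 8) : B i = B j := by
  have := h.isH11.connected
  have key : ∀ e, B (S.glue e).1 = B e.1 := by
    rintro ⟨i, k⟩
    rcases side_cases_row i k with rfl | rfl | rfl
    · rw [h.glue_hor]; exact hB' i
    · exact hB i
    · change B (S.left i) = B i
      conv_rhs => rw [← h.right_left i, hB]
  exact (S.forall_mem_of_connected {l | B l = B i} (fun e => by simp [key]) rfl j).symm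

end IsRowed
end GluedTriangles
end TranslationSurface

namespace TranslationSurface
namespace GluedTriangles
namespace IsRowed

variable {S : GluedTriangles 8} {v : ℂ}

/-- The vertex at the bottom of a row does not depend on the triangle. -/
theorem corner_bottom (h : S.IsRowed v) (i : Fin 8) :
    S.corner (S.right i, rightSide (S.right i)) = S.corner (i, rightSide i) := by
  rw [S.corner_glue (i, rightSide i), h.glue_right]
  generalize S.right i = j
  by_cases hj : j < 4
  · simp only [rightSide, leftSide, hj, if_true]; exact (h.loop j).symm
  · simp only [rightSide, leftSide, hj, if_false]; rfl

/-- The vertex at the top of a row does not depend on the triangle. -/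
theorem corner_top (h : S.IsRowed v) (i : Fin 8) :
    S.corner (S.right i, rightSide (S.right i) + 1) = S.corner (i, rightSide i + 1) := by
  rw [← corner_glue_eq h.isH11.admissible (i, rightSide i), h.glue_right]
  generalize S.right i = j
  by_cases hj : j < 4
  · simp only [rightSide, leftSide, hj, if_true]; rfl
  · simp only [rightSide, leftSide, hj, if_false]; exact h.loop j

theorem corner_hor (h : S.IsRowed v) (i : Fin 8) : S.corner (i, 0) = S.corner (i + 4, 0) := by
  rw [S.corner_glue (i, 0), h.glue_hor]
  exact (h.loop _).symm

/-- The bottoms of the rows of the triangles `0`, `1`, `6`, `7` are at one vertex, their tops at the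
other. -/
theorem classes (h : S.IsRowed v) (i : Fin 8) :
    (![true, true, false, false, false, false, true, true] : Fin 8 → Bool) (S.right i) =
      (![true, true, false, false, false, false, true, true] : Fin 8 → Bool) i := by
  classical
  set b : Fin 8 → Bool := fun i => decide (S.corner (i, rightSide i) = S.corner (4, 0)) with hb
  set t : Fin 8 → Bool := fun i => decide (S.corner (i, rightSide i + 1) = S.corner (4, 0)) with ht
  have bρ : ∀ i, b (S.right i) = b i := fun i => by simp only [hb, h.corner_bottom]
  have tρ : ∀ i, t (S.right i) = t i := fun i => by simp only [ht, h.corner_top]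
  have b0 : b 0 = true := by
    simp only [hb]; exact decide_eq_true ((h.loop 0).symm.trans (h.corner_hor 0))
  have b1 : b 1 = true := by
    simp only [hb]
    exact decide_eq_true ((h.loop 1).symm.trans ((h.corner_hor 1).trans h.first.symm))
  have b2 : b 2 = false := by
    simp only [hb]
    exact decide_eq_false fun e => h.ne (e.symm.trans ((h.loop 2).symm.trans (h.corner_hor 2)))
  have b3 : b 3 = false := by
    simp only [hb]
    exact decide_eq_false fun e => h.ne (e.symm.trans ((h.loop 3).symm.trans ((h.corner_hor 3).trans
      h.last.symm)))
  have t4 : t 4 = true := by simp only [ht]; exact decide_eq_true rfl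
  have t5 : t 5 = true := by simp only [ht]; exact decide_eq_true h.first.symm
  have t6 : t 6 = false := by simp only [ht]; exact decide_eq_false fun e => h.ne e.symm
  have t7 : t 7 = false := by simp only [ht]; exact decide_eq_false fun e => h.ne (h.last.trans e).symm
  obtain ⟨m, hm, hpos, hneg⟩ := h.exists_length
  have m0 := hpos 0 (by decide)
  have m1 := hpos 1 (by decide)
  have m2 := hpos 2 (by decide)
  have m3 := hpos 3 (by decide)
  have n4 : m 4 = -m 0 := hneg 0
  have n5 : m 5 = -m 1 := hneg 1
  have n6 : m 6 = -m 2 := hneg 2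
  have n7 : m 7 = -m 3 := hneg 3
  have len := fun {B} => h.sum_length hm (B := B)
  have h4 : ∀ i : Fin 8, i < 4 → i = 0 ∨ i = 1 ∨ i = 2 ∨ i = 3 := by decide
  have col : ∀ {B T : Fin 8 → Bool}, (∀ i, B (S.right i) = B i) → (∀ i, T (S.right i) = T i) →
      B 0 = T 4 → B 1 = T 5 → B 2 = T 6 → B 3 = T 7 → B 0 = B 1 ∧ B 2 = B 3 := by
    intro B T hB hT e0 e1 e2 e3
    refine h.eq_of_rows hB hT fun i hi => ?_
    rcases h4 i hi with rfl | rfl | rfl | rfl <;> assumption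
  have con : ∀ {B : Fin 8 → Bool}, (∀ i, B (S.right i) = B i) →
      B 0 = B 4 → B 1 = B 5 → B 2 = B 6 → B 3 = B 7 → B 0 = B 2 ∧ B 1 = B 3 := by
    intro B hB e0 e1 e2 e3
    have := h.eq_of_connected hB (fun i => by
      fin_cases i
      · exact e0.symm
      · exact e1.symm
      · exact e2.symm
      · exact e3.symm
      · exact e0
      · exact e1
      · exact e2
      · exact e3)
    exact ⟨this _ _, this _ _⟩
  have bt : ∀ i, (b (S.right i) && t (S.right i)) = (b i && t i) := fun i => by rw [bρ, tρ]
  have bt' : ∀ i, (!b (S.right i) && !t (S.right i)) = (!b i && !t i) := fun i => by rw [bρ, tρ]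
  have tb : ∀ i, (t (S.right i) && !b (S.right i)) = (t i && !b i) := fun i => by rw [bρ, tρ]
  -- `b && t` marks the rows with both boundaries at the first vertex, `!b && !t` those with both at
  -- the second. The constraints come from the lengths of bottoms and tops (`L`), from the two loops
  -- meeting at one vertex (`C`) and from connectedness (`K`).
  have L1 := len (B := fun i => b i && t i) bt
  have L2 := len (B := fun i => !b i && !t i) bt'
  have C1 := col (B := fun i => b i && t i) (T := fun i => b i && t i) bt bt
  have C2 := col (B := fun i => b i && t i) (T := fun i => t i && !b i) bt tb
  have C1' := col (B := fun i => !b i && !t i) (T := fun i => !b i && !t i) bt' bt'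
  have tb' : ∀ i, (b (S.right i) && !t (S.right i)) = (b i && !t i) := fun i => by rw [bρ, tρ]
  have C2' := col (B := fun i => !b i && !t i) (T := fun i => b i && !t i) bt' tb'
  have K1 := con (B := fun i => b i && t i) bt
  have K2 := con (B := fun i => !b i && !t i) bt'
  simp only [Fin.sum_univ_eight, b0, b1, b2, b3, t4, t5, t6, t7, n4, n5, n6, n7, Bool.true_and,
    Bool.false_and, Bool.and_true, Bool.and_false, Bool.not_true, Bool.not_false]
    at L1 L2 C1 C2 C1' C2' K1 K2
  -- The tops of the rows of `4` and `5` lie at the first vertex. In every case with a bottom there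
  -- as well, one of the constraints fails.
  have s1 : b 4 = false ∧ b 5 = false := by
    clear L2 C1' C2' K2
    revert L1 C1 C2 K1
    cases t 0 <;> cases t 1 <;> cases b 4 <;> cases b 5 <;> simp <;> intro hL <;> linarith
  have s2 : b 6 = true ∧ b 7 = true := by
    clear L1 C1 C2 K1
    revert L2 C1' C2' K2
    cases t 2 <;> cases t 3 <;> cases b 6 <;> cases b 7 <;> simp <;> intro hL <;> linarith
  have hbX : ∀ i, b i = (![true, true, false, false, false, false, true, true] : Fin 8 → Bool) i := by
    intro i
    fin_cases i
    · exact b0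
    · exact b1
    · exact b2
    · exact b3
    · exact s1.1
    · exact s1.2
    · exact s2.1
    · exact s2.2
  rw [← hbX, ← hbX, bρ]

end IsRowed
end GluedTriangles
end TranslationSurface

/-! ### The possible cyclic orders of the triangles in the rows. -/

namespace TranslationSurface
namespace GluedTriangles

/-- The cyclic orders in the rows with bottom at the first and top at the second vertex: the images
of `0`, `1`, `6`, `7`. -/
def firstRows : Fin 8 → Fin 4 → Fin 8 :=
  ![![1, 6, 7, 0], ![1, 7, 0, 6], ![6, 7, 1, 0], ![6, 0, 7, 1], ![7, 6, 0, 1], ![7, 0, 1, 6],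
    ![6, 7, 0, 1], ![7, 6, 1, 0]]

/-- The cyclic orders in the rows with bottom at the second and top at the first vertex: the images
of `2`, `3`, `4`, `5`. -/
def secondRows : Fin 8 → Fin 4 → Fin 8 :=
  ![![3, 4, 5, 2], ![3, 5, 2, 4], ![4, 5, 3, 2], ![4, 2, 5, 3], ![5, 4, 2, 3], ![5, 2, 3, 4],
    ![4, 5, 2, 3], ![5, 4, 3, 2]]

/-- The right neighbours of the triangles of a rowed surface. -/
def rowPerm (a b : Fin 8) : Fin 8 → Fin 8 :=
  ![firstRows a 0, firstRows a 1, secondRows b 0, secondRows b 1, secondRows b 2, secondRows b 3,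
    firstRows a 2, firstRows a 3]

/-- The gluing of a rowed surface with the given cyclic orders. -/
def rowPermGlue (a b : Fin 8) : Fin 8 × Fin 3 → Fin 8 × Fin 3 :=
  rowGlue (rowPerm a b) ((rowPerm a b)^[3])

/-- Of the nine permutations of four triangles without fixed point, the one that pairs `0` with `1`
is excluded: a row needs horizontal sides both at the bottom and at the top. In the list the first
six are cycles of length four, a single row, and the last two are pairs of rows. -/
theorem exists_firstRows : ∀ x y z w : Fin 8,
    (![true, true, false, false, false, false, true, true] : Fin 8 → Bool) x = true →
    (![true, true, false, false, false, false, true, true] : Fin 8 → Bool) y = true →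
    (![true, true, false, false, false, false, true, true] : Fin 8 → Bool) z = true →
    (![true, true, false, false, false, false, true, true] : Fin 8 → Bool) w = true →
    x ≠ 0 → y ≠ 1 → z ≠ 6 → w ≠ 7 → x ≠ y → x ≠ z → x ≠ w → y ≠ z → y ≠ w → z ≠ w →
    ¬(x = 1 ∧ y = 0) →
    ∃ a, x = firstRows a 0 ∧ y = firstRows a 1 ∧ z = firstRows a 2 ∧ w = firstRows a 3 := by
  decide +kernel

theorem exists_secondRows : ∀ x y z w : Fin 8,
    (![true, true, false, false, false, false, true, true] : Fin 8 → Bool) x = false →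
    (![true, true, false, false, false, false, true, true] : Fin 8 → Bool) y = false →
    (![true, true, false, false, false, false, true, true] : Fin 8 → Bool) z = false →
    (![true, true, false, false, false, false, true, true] : Fin 8 → Bool) w = false →
    x ≠ 2 → y ≠ 3 → z ≠ 4 → w ≠ 5 → x ≠ y → x ≠ z → x ≠ w → y ≠ z → y ≠ w → z ≠ w →
    ¬(x = 3 ∧ y = 2) →
    ∃ a, x = secondRows a 0 ∧ y = secondRows a 1 ∧ z = secondRows a 2 ∧ w = secondRows a 3 := by
  decide +kernel

/-- The corners that are met when one runs around a vertex from the corner `(0, 0)`. -/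
def orbit (g : Fin 8 × Fin 3 → Fin 8 × Fin 3) : List (Fin 8 × Fin 3) :=
  List.iterate (fun c => ((g c).1, (g c).2 + 1)) (0, 0) 12

/-- If both families are single rows, or both are pairs of rows, the corners `(0, 0)` and `(1, 0)`
lie at different vertices. In a rowed surface they are the same vertex, so exactly one family is a
single row and there are three cylinders. -/
theorem orbit_rowPermGlue : ∀ a b : Fin 8, (a < 6 ↔ b < 6) →
    (∀ e, e ∈ orbit (rowPermGlue a b) ↔
      ((rowPermGlue a b e).1, (rowPermGlue a b e).2 + 1) ∈ orbit (rowPermGlue a b)) ∧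
    (0, 0) ∈ orbit (rowPermGlue a b) ∧ (1, 0) ∉ orbit (rowPermGlue a b) := by
  decide +kernel

theorem IsRowed.exists_rowPerm {S : GluedTriangles 8} {v : ℂ} (h : S.IsRowed v) :
    ∃ a b : Fin 8, ¬(a < 6 ↔ b < 6) ∧ S.glue = rowPermGlue a b := by
  have hX := h.classes
  have hinj : ∀ {i j}, i ≠ j → S.right i ≠ S.right j := fun hij he =>
    hij (by
      have := congrArg S.left he
      rwa [h.left_right, h.left_right] at this)
  obtain ⟨m, hm, hpos, hneg⟩ := h.exists_length
  have hm0 : ∀ i, (i < 4 → 0 < m i) ∧ (¬i < 4 → m i < 0) := by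
    intro i
    refine ⟨hpos i, fun hi => ?_⟩
    have h1 : i + 4 < 4 := by revert i; decide
    have h2 := hneg (i + 4)
    have h3 : ∀ i : Fin 8, i + 4 + 4 = i := by decide
    rw [h3] at h2
    linarith [hpos _ h1]
  have hfix : ∀ i, S.right i ≠ i := by
    intro i hi
    -- A triangle alone in its row would have a horizontal side of length zero.
    have := h.sum_length hm (B := fun j => decide (j = i)) fun j => by
      refine decide_eq_decide.2 ⟨fun hj => ?_, fun hj => by rw [hj, hi]⟩
      rw [← h.left_right j, hj, ← hi, h.left_right, hi]
    simp only [decide_eq_true_eq, Finset.sum_ite_eq', Finset.mem_univ, if_true] at this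
    rcases lt_or_ge i 4 with h4 | h4
    · exact ((hm0 i).1 h4).ne' this
    · exact ((hm0 i).2 h4.not_gt).ne this
  have hswap : ∀ i j, i < 4 → j < 4 → i ≠ j → ¬(S.right i = j ∧ S.right j = i) := by
    rintro i j hi hj hij ⟨h1, h2⟩
    have := h.sum_length hm (B := fun l => decide (l = i) || decide (l = j)) fun l => by
      rw [Bool.eq_iff_iff]
      simp only [Bool.or_eq_true, decide_eq_true_eq]
      constructor
      · rintro (h3 | h3)
        · right; rw [← h.left_right l, h3]; conv_lhs => rw [← h2, h.left_right]
        · left; rw [← h.left_right l, h3]; conv_lhs => rw [← h1, h.left_right]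
      · rintro (rfl | rfl)
        · exact Or.inr h1
        · exact Or.inl h2
    have e : ∀ l, (if (decide (l = i) || decide (l = j)) = true then m l else 0) =
        (if l = i then m l else 0) + if l = j then m l else 0 := by
      intro l
      by_cases h3 : l = i
      · subst h3; simp [hij]
      · simp [h3]
    simp only [e, Finset.sum_add_distrib, Finset.sum_ite_eq', Finset.mem_univ, if_true] at this
    linarith [hpos i hi, hpos j hj]
  obtain ⟨a, a0, a1, a6, a7⟩ := exists_firstRows _ _ _ _ (hX 0) (hX 1) (hX 6) (hX 7) (hfix 0) (hfix 1)
    (hfix 6) (hfix 7) (hinj (by decide)) (hinj (by decide)) (hinj (by decide)) (hinj (by decide))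
    (hinj (by decide)) (hinj (by decide)) (hswap 0 1 (by decide) (by decide) (by decide))
  obtain ⟨b, b2, b3, b4, b5⟩ := exists_secondRows _ _ _ _ (hX 2) (hX 3) (hX 4) (hX 5) (hfix 2) (hfix 3)
    (hfix 4) (hfix 5) (hinj (by decide)) (hinj (by decide)) (hinj (by decide)) (hinj (by decide))
    (hinj (by decide)) (hinj (by decide)) (hswap 2 3 (by decide) (by decide) (by decide))
  have hr : S.right = rowPerm a b := by
    funext i
    fin_cases i
    · exact a0
    · exact a1
    · exact b2
    · exact b3
    · exact b4
    · exact b5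
    · exact a6
    · exact a7
  -- All listed permutations have order dividing four, so that the third power is the inverse.
  have hl : S.left = (rowPerm a b)^[3] := by
    have h4 : ∀ a b i : Fin 8, rowPerm a b ((rowPerm a b)^[3] i) = i := by decide +kernel
    funext i
    conv_lhs => rw [← h4 a b i]
    rw [← hr, h.left_right]
  have hg : S.glue = rowPermGlue a b := by rw [h.glue_eq, hr, hl]; rfl
  refine ⟨a, b, fun hab => ?_, hg⟩
  obtain ⟨h1, h2, h3⟩ := orbit_rowPermGlue a b hab
  have hc : S.corner (0, 0) = S.corner (1, 0) :=
    (h.corner_hor 0).trans (h.first.trans (h.corner_hor 1).symm)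
  have := h.isH11.admissible.eq_of_corner_eq (fun e => e ∈ orbit (rowPermGlue a b))
    (fun e => by rw [hg]; exact propext (h1 e)) hc
  exact h3 (this ▸ h2)

end GluedTriangles
end TranslationSurface

/-! ### From rows to model surfaces. -/

namespace TranslationSurface
namespace GluedTriangles

/-- The sides of a rowed surface in terms of five periods. -/
def rowVec (x y z : Fin 5 → ℤ) (e : Fin 8 × Fin 3) : Fin 5 → ℤ :=
  let u : Fin 8 → Fin 5 → ℤ := ![![1, 0, 0, 0, 0], ![0, 1, 0, 0, 0], ![1, 0, 0, 0, 0], ![0, 1, 0, 0, 0],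
    ![-1, 0, 0, 0, 0], ![0, -1, 0, 0, 0], ![-1, 0, 0, 0, 0], ![0, -1, 0, 0, 0]]
  let t : Fin 8 → Fin 5 → ℤ := ![![0, 0, 1, 0, 0], x, ![0, 0, 0, 1, 0], ![0, 0, 0, 0, 1],
    ![0, 0, 0, -1, 0], ![0, 0, 0, 0, -1], y, z]
  (![u e.1, t e.1, -(u e.1 + t e.1)] : Fin 3 → Fin 5 → ℤ) e.2

/-- The sides that are determined by the given ones, in one step. -/
def determined (g : Fin 8 × Fin 3 → Fin 8 × Fin 3) (A : Finset (Fin 8 × Fin 3)) :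
    Finset (Fin 8 × Fin 3) :=
  Finset.univ.filter fun e => e ∈ A ∨ g e ∈ A ∨ (e.1, e.2 + 1) ∈ A ∧ (e.1, e.2 + 2) ∈ A

/-- For the difference between the actual sides and a table: it vanishes on seven known sides, and
gluing and closing of triangles propagate this to all sides. -/
theorem eq_zero_of_determined {g : Fin 8 × Fin 3 → Fin 8 × Fin 3} {s : Fin 8 × Fin 3 → ℂ}
    (h1 : ∀ e, s (g e) = -s e) (h2 : ∀ i k, s (i, k) + s (i, k + 1) + s (i, k + 2) = 0)
    {A : Finset (Fin 8 × Fin 3)} (hA : ∀ e ∈ A, s e = 0) (m : ℕ) :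
    ∀ e ∈ (determined g)^[m] A, s e = 0 := by
  induction m generalizing A with
  | zero => exact hA
  | succ m ih =>
    rw [Function.iterate_succ_apply]
    refine ih fun e he => ?_
    rcases (Finset.mem_filter.1 he).2 with h | h | ⟨h, h'⟩
    · exact hA e h
    · rw [← neg_eq_zero, ← h1]; exact hA _ h
    · have := h2 e.1 e.2
      rw [hA _ h, hA _ h'] at this
      simpa using this

theorem determined_rowPermGlue : ∀ w : Fin 8, w = 0 ∨ w = 1 ∨ w = 2 ∨ w = 4 → ∀ e,
    e ∈ (determined (rowPermGlue w 6))^[6]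
      {(0, 0), (1, 0), (0, 1), (2, 1), (3, 1), (2, 0), (3, 0)} := by
  decide +kernel

variable {S : GluedTriangles 8} {v : ℂ}

theorem hasTable_rowVec (hS : S.Admissible) {w : Fin 8} (hw : w = 0 ∨ w = 1 ∨ w = 2 ∨ w = 4)
    (hg : S.glue = rowPermGlue w 6) (x y z : Fin 5 → ℤ)
    (hV : ∀ e, rowVec x y z (rowPermGlue w 6 e) = -rowVec x y z e) :
    HasTable S (rowPermGlue w 6) (rowVec x y z)
      ![S.side (0, 0), S.side (1, 0), S.side (0, 1), S.side (2, 1), S.side (3, 1)] := by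
  refine ⟨hg, fun e => sub_eq_zero.1 ?_⟩
  set X := ![S.side (0, 0), S.side (1, 0), S.side (0, 1), S.side (2, 1), S.side (3, 1)]
  have hs : ∀ e, S.side (rowPermGlue w 6 e) = -S.side e := fun e => by
    rw [← hg, hS.side_glue]
  -- The triangles `2` and `4` form a row by themselves, a parallelogram, and the horizontal side of
  -- `4` is glued to that of `0`; likewise for `3`, `5` and `1`.
  have hpar : S.side (2, 0) = S.side (0, 0) ∧ S.side (3, 0) = S.side (1, 0) := by
    have hc : ∀ w : Fin 8, rowPermGlue w 6 (2, 1) = (4, 1) ∧ rowPermGlue w 6 (2, 2) = (4, 2) ∧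
        rowPermGlue w 6 (0, 0) = (4, 0) ∧ rowPermGlue w 6 (3, 1) = (5, 1) ∧
        rowPermGlue w 6 (3, 2) = (5, 2) ∧ rowPermGlue w 6 (1, 0) = (5, 0) := by decide +kernel
    obtain ⟨c1, c2, c3, c4, c5, c6⟩ := hc w
    have e1 := hs (2, 1); have e2 := hs (2, 2); have e3 := hs (0, 0)
    have e4 := hs (3, 1); have e5 := hs (3, 2); have e6 := hs (1, 0)
    rw [c1] at e1; rw [c2] at e2; rw [c3] at e3; rw [c4] at e4; rw [c5] at e5; rw [c6] at e6
    have t2 := S.side_add_side_add_side 2 0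
    have t3 := S.side_add_side_add_side 3 0
    have t4 := S.side_add_side_add_side 4 0
    have t5 := S.side_add_side_add_side 5 0
    simp only [zero_add] at t2 t3 t4 t5
    exact ⟨by linear_combination t2 + t4 - e1 - e2 - e3, by linear_combination t3 + t5 - e4 - e5 - e6⟩
  refine eq_zero_of_determined (g := rowPermGlue w 6) (s := fun e => S.side e - lin (rowVec x y z e) X)
    (fun e => ?_) (fun i k => ?_) (fun e he => ?_) 6 e (determined_rowPermGlue w hw e)
  · simp only [hs, hV, lin_neg]; ring
  · have h1 := S.side_add_side_add_side i k
    have h2 : rowVec x y z (i, k) + rowVec x y z (i, k + 1) + rowVec x y z (i, k + 2) = 0 := by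
      fin_cases k <;> simp [rowVec]
    have h3 := congrArg (fun V => lin V X) h2
    simp only [lin_add] at h3
    have h4 : lin 0 X = 0 := by simp [lin]
    linear_combination h1 - h3 - h4
  · simp only [Finset.mem_insert, Finset.mem_singleton] at he
    rcases he with rfl | rfl | rfl | rfl | rfl | rfl | rfl <;>
      simp [rowVec, lin, X, Fin.sum_univ_five, hpar.1, hpar.2]

/-- The relabellings of a rowed surface that change the order in its rows. -/
def rowRelabel : Fin 8 → Fin 8 → Fin 8 :=
  ![![0, 1, 2, 3, 4, 5, 6, 7], ![0, 1, 3, 2, 4, 5, 7, 6], ![1, 0, 2, 3, 5, 4, 6, 7],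
    ![1, 0, 3, 2, 5, 4, 7, 6], ![2, 3, 0, 1, 6, 7, 4, 5], ![2, 3, 1, 0, 6, 7, 5, 4],
    ![3, 2, 0, 1, 7, 6, 4, 5], ![3, 2, 1, 0, 7, 6, 5, 4]]

/-- Renumbering the loops at each zero, or exchanging the zeros, makes the second family the pair of
rows in standard order. Up to this, four orders of the single row remain. -/
theorem exists_rowRelabel : ∀ a b : Fin 8, ¬(a < 6 ↔ b < 6) → ∃ s s' w : Fin 8,
    (w = 0 ∨ w = 1 ∨ w = 2 ∨ w = 4) ∧ (∀ i, rowRelabel s' (rowRelabel s i) = i) ∧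
    (∀ i, rowRelabel s (rowRelabel s' i) = i) ∧ ∀ e : Fin 8 × Fin 3,
    (rowRelabel s' (rowPermGlue a b (rowRelabel s e.1, e.2)).1,
      (rowPermGlue a b (rowRelabel s e.1, e.2)).2) = rowPermGlue w 6 e := by
  decide +kernel

theorem rowRelabel_lt : ∀ s i, i < 4 → rowRelabel s i < 4 := by decide +kernel

/-- A surface whose rows are ordered in one of four ways is a model surface. -/
theorem exists_model_of_rowPermGlue (hS : S.IsH11) (hv : v ≠ 0)
    (hh : ∀ i, cross v (S.side (i, 0)) = 0) (hu : ∀ i, i < 4 → 0 < cross v (S.side (i, 1)))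
    {w : Fin 8} (hw : w = 0 ∨ w = 1 ∨ w = 2 ∨ w = 4) (hg : S.glue = rowPermGlue w 6) :
    ∃ x, ModelDomain x ∧ Equivalent S (2, 0) (model x) (2, 0) := by
  have hA := hS.admissible
  have hpos : ∀ i, i < 4 → ∃ m : ℝ, 0 < m ∧ S.side (i, 0) = m * v := fun i hi => by
    obtain ⟨r, hr⟩ := exists_eq_mul_of_cross hv (hh i)
    refine ⟨r, ?_, hr⟩
    have := hA.cross_pos i 0
    rw [hr, cross_comm, cross_smul_right, zero_add, cross_comm] at this
    nlinarith [hu i hi]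
  have hcr : ∀ i j, i < 4 → j < 4 → 0 < cross (S.side (i, 0)) (S.side (j, 1)) := fun i j hi hj => by
    obtain ⟨r, h0, hr⟩ := hpos i hi
    rw [hr, cross_comm, cross_smul_right, cross_comm]
    nlinarith [mul_pos h0 (hu j hj)]
  have hab : cross (S.side (0, 0)) (S.side (1, 0)) = 0 := by
    obtain ⟨r, h0, hr⟩ := hpos 0 (by decide)
    rw [hr, cross_comm, cross_smul_right, cross_comm, hh]; simp
  have hac := hcr 0 0 (by decide) (by decide)
  have hbc := hcr 1 0 (by decide) (by decide)
  have hae := hcr 0 2 (by decide) (by decide)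
  have hbf := hcr 1 3 (by decide) (by decide)
  have hR : ∀ x y z, (∀ e, rowVec x y z (rowPermGlue w 6 e) = -rowVec x y z e) →
      Reaches S (2, 0) (rowPermGlue w 6) (rowVec x y z)
        ![S.side (0, 0), S.side (1, 0), S.side (0, 1), S.side (2, 1), S.side (3, 1)] :=
    fun x y z h => ⟨S, hA, hasTable_rowVec hA hw hg x y z h, Equivalent.refl _ _⟩
  generalize S.side (0, 0) = a at *
  generalize S.side (1, 0) = b at *
  generalize S.side (0, 1) = c at *
  generalize S.side (2, 1) = e at *
  generalize S.side (3, 1) = f at *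
  have hba := cross_comm a b
  have hca := cross_comm a c
  have hcb := cross_comm b c
  have hd : ∀ c', 0 < cross a c' → 0 < cross b c' → ModelDomain ![a, b, c', e, f] := fun c' h h' =>
    modelDomain_iff.2 ⟨h, hae, h', hbf⟩
  -- The triangles `0, 1, 6, 7` form the long cylinder. At most two flips inside it cut it into
  -- parallelograms with sides `a, c'` and `b, c'` and the diagonals of the model; the last order
  -- needs none.
  rcases hw with rfl | rfl | rfl | rfl
  · refine ⟨![a, b, c - b, e, f], hd _ ?_ ?_, ((hR ![0, -1, 1, 0, 0] ![0, 1, -1, 0, 0]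
      ![-1, 1, -1, 0, 0] (by decide +kernel)).flip 0 2 ![0, 0, 1, 0, 0] ![0, -1, 0, 0, 0]
      ![-1, 1, -1, 0, 0] ![1, 0, 0, 0, 0] (by decide +kernel) (by decide +kernel) (by decide +kernel)
      (by decide +kernel) (by decide +kernel) ?_ ?_).equivalent_model
      ![![1, 0, 0, 0, 0], ![0, 1, 0, 0, 0], ![0, -1, 1, 0, 0], ![0, 0, 0, 1, 0], ![0, 0, 0, 0, 1]]
      ![5, 4, 2, 6, 3, 7, 1, 0] ![7, 6, 2, 4, 1, 0, 3, 5] ![2, 0, 0, 0, 0, 0, 0, 2]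
      (by decide) (by decide) (by decide +kernel) (by decide +kernel) (fun t => ?_) (by decide) rfl⟩
    on_goal -1 => fin_cases t <;> (simp [lin, Fin.sum_univ_five]; try ring)
    all_goals
      simp [lin, Fin.sum_univ_five, cross_neg_right, cross_neg_left, cross_add_left, cross_sub_right,
        cross_self]
      try linarith
  · refine ⟨![a, b, c, e, f], hd _ hac hbc, ((hR ![0, -1, 1, 0, 0] ![0, 0, -1, 0, 0]
      ![0, 1, -1, 0, 0] (by decide +kernel)).flip 1 1 ![0, 1, 0, 0, 0] ![0, 0, 1, 0, 0]
      ![0, -1, 0, 0, 0] ![0, 0, -1, 0, 0] (by decide +kernel) (by decide +kernel) (by decide +kernel)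
      (by decide +kernel) (by decide +kernel) ?_ ?_).equivalent_model
      ![![1, 0, 0, 0, 0], ![0, 1, 0, 0, 0], ![0, 0, 1, 0, 0], ![0, 0, 0, 1, 0], ![0, 0, 0, 0, 1]]
      ![0, 4, 2, 6, 3, 7, 1, 5] ![0, 6, 2, 4, 1, 7, 3, 5] ![0, 1, 0, 0, 0, 0, 0, 1]
      (by decide) (by decide) (by decide +kernel) (by decide +kernel) (fun t => ?_) (by decide) rfl⟩
    on_goal -1 => fin_cases t <;> simp [lin, Fin.sum_univ_five]
    all_goals
      simp [lin, Fin.sum_univ_five, cross_neg_right, cross_neg_left]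
      try linarith
  · refine ⟨![a, b, a + c, e, f], hd _ ?_ ?_, (((hR ![1, -1, 1, 0, 0] ![0, 0, -1, 0, 0]
      ![-1, 1, -1, 0, 0] (by decide +kernel)).flip 0 1 ![1, 0, 0, 0, 0] ![1, 0, 1, 0, 0]
      ![-1, 0, 0, 0, 0] ![-1, 0, -1, 0, 0] (by decide +kernel) (by decide +kernel) (by decide +kernel)
      (by decide +kernel) (by decide +kernel) ?_ ?_).flip 1 1 ![0, 1, 0, 0, 0] ![1, 0, 1, 0, 0]
      ![0, -1, 0, 0, 0] ![-1, 0, -1, 0, 0] (by decide +kernel) (by decide +kernel) (by decide +kernel)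
      (by decide +kernel) (by decide +kernel) ?_ ?_).equivalent_model
      ![![1, 0, 0, 0, 0], ![0, 1, 0, 0, 0], ![1, 0, 1, 0, 0], ![0, 0, 0, 1, 0], ![0, 0, 0, 0, 1]]
      ![0, 4, 2, 6, 3, 7, 1, 5] ![0, 6, 2, 4, 1, 7, 3, 5] ![1, 1, 0, 0, 0, 0, 1, 1]
      (by decide) (by decide) (by decide +kernel) (by decide +kernel) (fun t => ?_) (by decide) rfl⟩
    on_goal -1 => fin_cases t <;> simp [lin, Fin.sum_univ_five]
    all_goals
      simp [lin, Fin.sum_univ_five, cross_neg_right, cross_neg_left, cross_add_right, cross_self]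
      try linarith
  · refine ⟨![a, b, c, e, f], hd _ hac hbc, (hR ![0, 0, 1, 0, 0] ![0, 0, -1, 0, 0]
      ![0, 0, -1, 0, 0] (by decide +kernel)).equivalent_model
      ![![1, 0, 0, 0, 0], ![0, 1, 0, 0, 0], ![0, 0, 1, 0, 0], ![0, 0, 0, 1, 0], ![0, 0, 0, 0, 1]]
      ![0, 4, 2, 6, 3, 7, 1, 5] ![0, 6, 2, 4, 1, 7, 3, 5] ![0, 0, 0, 0, 0, 0, 0, 0]
      (by decide) (by decide) (by decide +kernel) (by decide +kernel) (fun t => ?_) (by decide) rfl⟩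
    fin_cases t <;> simp [lin, Fin.sum_univ_five]

/-- A rowed surface is a model surface with the first zero as the labelled one. -/
theorem IsRowed.exists_model (h : S.IsRowed v) (c : Fin 8 × Fin 3) :
    ∃ x, ModelDomain x ∧ Equivalent S c (model x) (0, 0) := by
  obtain ⟨a, b, hab, hg⟩ := h.exists_rowPerm
  obtain ⟨s, s', w, hw, h1, h2, hr⟩ := exists_rowRelabel a b hab
  obtain ⟨h3, -, h4⟩ := h.isH11.relabelled (p := rowRelabel s) (q := rowRelabel s') (fun _ => 0) h1 h2
  obtain ⟨x, hx, h5⟩ := exists_model_of_rowPermGlue h3 h.ne_zero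
    (fun i => by rw [side_relabelled]; exact h.hor _)
    (fun i hi => by rw [side_relabelled]; exact h.up _ (rowRelabel_lt s i hi)) hw
    (funext fun e => by
      rw [← hr e]
      simp [relabelled, relabel, hg])
  obtain ⟨c', hc'⟩ := ((h4 (2, 0)).trans h5).exists_corner c
  -- If the label is at the second zero, the half-turn brings it to the first.
  cases hd : modelColour c'
  · obtain ⟨x0, x1, x2, x3, x4, rfl⟩ : ∃ x0 x1 x2 x3 x4, x = ![x0, x1, x2, x3, x4] :=
      ⟨_, _, _, _, _, by ext i; fin_cases i <;> rfl⟩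
    refine ⟨_, ?_, hc'.trans (equivalent_model_rotate hx hd)⟩
    have := modelDomain_iff.1 hx
    refine modelDomain_iff.2 ?_
    simpa [cross_neg_left, cross_neg_right] using this
  · refine ⟨x, hx, hc'.of_corner_eq rfl ?_⟩
    rw [corner_model_eq, hd]; rfl

end GluedTriangles
end TranslationSurface

/-! ### Every primitive cover is linked to a split surface. -/

namespace TranslationSurface
namespace GluedTriangles

variable {S : GluedTriangles 8} {L : Submodule ℤ ℂ} {v : ℂ} {κ δ : ℝ}

/-- A graded surface for which the zeros lie at different heights is a model surface. -/
theorem IsGraded.exists_model (hg : S.IsGraded L v δ) (hS : S.IsH11) (hv : v ≠ 0) (hκ : 0 < κ)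
    (hL : ∀ l ∈ L, ∃ m : ℤ, cross v l = m * κ) (hδ : ∀ m : ℤ, δ ≠ m * κ) (c : Fin 8 × Fin 3) :
    ∃ x, ModelDomain x ∧ Equivalent S c (model x) (0, 0) := by
  obtain ⟨S', c', he, hS', hh⟩ := exists_horizontal hS c hκ hL hg
  have hg' := hg.of_equivalent he
  obtain ⟨S'', c'', he', hr⟩ := exists_isRowed hS' hv hh (fun e h0 => by
    obtain ⟨m, j, hj, h1, h2⟩ := hg'.height hL e
    rw [h0] at h1
    rcases hj with rfl | rfl | rfl
    · exact absurd (by push_cast at h1; linarith) (hδ m)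
    · exact h2 rfl
    · exact absurd (by push_cast at h1 ⊢; linarith) (hδ (-m))) c'
  obtain ⟨x, hx, h⟩ := hr.exists_model c''
  exact ⟨x, hx, (he.trans he').trans h⟩

theorem HasDegree.of_homeomorph {n m : ℕ} {S : GluedTriangles n} {S' : GluedTriangles m}
    (f : S.Surface ≃ₜ S'.Surface) (hf : ∀ x, f x ∈ S'.vertices ↔ x ∈ S.vertices)
    {π : S'.Surface → ℂ ⧸ L} {d : ℕ} (h : HasDegree π d) : HasDegree (S := S) (π ∘ f) d := by
  intro y hy
  obtain ⟨h1, h2⟩ := h y fun ⟨x, hx, hxy⟩ =>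
    hy ⟨f.symm x, (hf _).1 (by simpa using hx), by simpa using hxy⟩
  have he : (π ∘ f) ⁻¹' {y} = f.symm '' (π ⁻¹' {y}) := by
    rw [Homeomorph.image_eq_preimage_symm]; rfl
  rw [he]
  exact ⟨h1.image _, by rw [Set.ncard_image_of_injective _ f.symm.injective, h2]⟩

/-- The degree and the period lattice of a torus cover of a model surface. -/
theorem Equivalent.degree_and_periods {c : Fin 8 × Fin 3} {c' : Fin 8 × Fin 3} {x : Fin 5 → ℂ}
    (h : Equivalent S c (model x) c') (hx : ModelDomain x) {v₁ v₂ : ℂ} (hv : 0 < cross v₁ v₂)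
    (ha : S.area = 1) {π : S.Surface → ℂ ⧸ Submodule.span ℤ ({v₁, v₂} : Set ℂ)}
    (hπ : IsTorusCover S _ π) : periods x ≤ Submodule.span ℤ {v₁, v₂} ∧
    cross (x 0) (x 2 + x 3) + cross (x 1) (x 2 + x 4) = 1 ∧
    ∃ N : ℕ, N * cross v₁ v₂ = 1 ∧ HasDegree π N := by
  obtain ⟨f, -, -, hf, h1, -, hA⟩ := h
  obtain ⟨hle, κ, hκ⟩ := isTorusCover_model (h1 _ π hπ)
  have hA1 := (area_model x).symm.trans (hA.symm.trans ha)
  obtain ⟨p0, p1, p2, p3⟩ := periods_le_iff.1 hle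
  have hK : ∀ a ∈ Submodule.span ℤ ({v₁, v₂} : Set ℂ), ∀ b ∈ Submodule.span ℤ ({v₁, v₂} : Set ℂ),
      cross a b ∈ AddSubgroup.zmultiples (cross v₁ v₂) := fun a hm b hb => by
    refine cross_mem_of_span ?_ hm hb
    have h1 := AddSubgroup.mem_zmultiples (cross v₁ v₂)
    have h2 := neg_mem h1
    rw [← cross_comm] at h2
    rintro _ (rfl | rfl) _ (rfl | rfl)
    · rw [cross_self]; exact zero_mem _
    · exact h1
    · exact h2
    · rw [cross_self]; exact zero_mem _
  -- The periods lie in the lattice, so both areas are integral multiples of the covolume; the total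
  -- area one gives the degree as a natural number.
  have h3 := add_mem (hK _ p0 _ p1) (hK _ p2 _ p3)
  rw [hA1] at h3
  obtain ⟨k, hk⟩ := mem_zmultiples_real.1 h3
  have hk0 : 0 ≤ k := by
    by_contra! hneg
    have : (k : ℝ) < 0 := by exact_mod_cast hneg
    nlinarith
  lift k to ℕ using hk0
  have hN : (k : ℝ) * cross v₁ v₂ = 1 := by rw [hk]; push_cast; ring
  refine ⟨hle, hA1, k, hN, ?_⟩
  have := HasDegree.of_homeomorph f hf (hasDegree_model hx hv hle hκ (hN.trans hA1.symm))
  have he : (π ∘ f.symm) ∘ f = π := by ext x; simp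
  rwa [he] at this

/-- The period lattice of a model surface is a lattice if it is contained in one. -/
theorem isLattice_periods {x : Fin 5 → ℂ} (hx : ModelDomain x) (hL : IsLattice L)
    (h : periods x ≤ L) : IsLattice (periods x) := by
  have := hL.discrete
  refine ⟨DiscreteTopology.of_subset (s := (L : Set ℂ)) this h, ?_⟩
  have h1 : (0 : ℝ) < cross (x 0) (x 2 + x 3) := by
    rw [cross_add_right]; exact add_pos hx.1 hx.2
  rw [eq_top_iff, ← (isLattice_span_pair h1.ne').span_top]
  exact Submodule.span_mono (show Submodule.span ℤ {x 0, x 2 + x 3} ≤ periods x from le_sup_left)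

end GluedTriangles
end TranslationSurface

namespace TranslationSurface
namespace GluedTriangles

variable {S : GluedTriangles 8}

/-- For small `t > 0` the number `r + t κ` lies strictly between consecutive multiples of `κ`, even
if `r` is itself a multiple. This separates the heights of the zeros. -/
theorem eventually_ne_int_mul {κ : ℝ} (hκ : 0 < κ) (r : ℝ) :
    ∀ᶠ t : ℝ in 𝓝[>] 0, ∀ m : ℤ, r + t * κ ≠ m * κ := by
  have h : 0 < (⌊r / κ⌋ + 1 - r / κ : ℝ) := by linarith [Int.lt_floor_add_one (r / κ)]
  filter_upwards [Ioo_mem_nhdsGT h] with t ht m hm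
  have h1 : r / κ + t = m := by field_simp; linarith
  have h2 : (⌊r / κ⌋ : ℝ) < m := by linarith [Int.floor_le (r / κ), ht.1]
  have h3 : (m : ℝ) < ⌊r / κ⌋ + 1 := by linarith [ht.2]
  have h4 : ⌊r / κ⌋ < m := by exact_mod_cast h2
  have h5 : m < ⌊r / κ⌋ + 1 := by exact_mod_cast h3
  omega

/-- The surfaces near a torus cover in which one zero is moved in a direction transversal to `v` are
graded. -/
theorem isGraded_displace (hS : S.Admissible) {L : Submodule ℤ ℂ} (hL : IsLattice L) {k : Fin 8 → ℂ}
    (hk : S.Compatible L k) {c₁ c₂ : Fin 8 × Fin 3}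
    (hc : ∀ c, S.corner c = S.corner c₁ ∨ S.corner c = S.corner c₂) (hne : S.corner c₁ ≠ S.corner c₂)
    (v w : ℂ) (hT : (S.displace (S.corner c₂) w).Admissible) :
    (S.displace (S.corner c₂) w).IsGraded L v
      (cross v (S.vert c₂.1 c₂.2 + k c₂.1 - (S.vert c₁.1 c₁.2 + k c₁.1)) + cross v w) := by
  set T := S.displace (S.corner c₂) w with hTdef
  have hcor : ∀ c c', T.corner c = T.corner c' ↔ S.corner c = S.corner c' :=
    corner_eq_iff_of_glue_eq hS hT rfl
  set Y₁ := S.vert c₁.1 c₁.2 + k c₁.1 with hY₁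
  -- The cover is translated so that the first zero goes to the origin, at height zero.
  have hk' : T.Compatible L fun i => k i - Y₁ := by
    intro e
    convert (compatible_displace (z := S.corner c₂) (w := w)).2 hk e using 1
    ring
  refine ⟨torusMap hT hk', isTorusCover_torusMap hT hL hk', T.corner c₂, ?_, ?_⟩
  · rintro _ ⟨c, rfl⟩ _ ⟨c', rfl⟩ h h'
    rw [Ne, hcor] at h h'
    rw [hcor, (hc c).resolve_right h, (hc c').resolve_right h']
  · have hmap : ∀ c, torusMap hT hk' (T.corner c) =
        Submodule.Quotient.mk (T.vert c.1 c.2 + (k c.1 - Y₁)) := fun c => rfl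
    rintro _ ⟨c, rfl⟩
    by_cases h : S.corner c = S.corner c₂
    · refine ⟨_, by rw [(hcor _ _).2 h]; exact hmap c₂, fun _ => ?_, fun h' => absurd ((hcor _ _).2 h) h'⟩
      rw [hTdef, vert_displace, if_pos rfl, ← cross_add_right]
      congr 1
      ring
    · refine ⟨_, by rw [(hcor _ _).2 ((hc c).resolve_right h)]; exact hmap c₁,
        fun h' => absurd ((hcor _ _).1 h') h, fun _ => ?_⟩
      rw [hTdef, vert_displace, if_neg hne, hY₁]
      convert cross_zero_right v using 2
      ring

/-- A torus cover of a displaced surface is one of the surface itself. -/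
theorem isTorusCover_of_displace (hS : S.Admissible) {z : S.Surface} {w : ℂ} {L : Submodule ℤ ℂ}
    {π : (S.displace z w).Surface → ℂ ⧸ L} (hπ : IsTorusCover _ L π) : ∃ π', IsTorusCover S L π' := by
  obtain ⟨hL, c, hc⟩ := hπ
  have h := compatible_displace.1 (compatible_of_proj hc)
  exact ⟨_, isTorusCover_torusMap hS hL h⟩

theorem params_eq (x : Fin 5 → ℂ) : params ![x 0, x 2 + x 3, x 1, x 2 + x 4] (x 2) = x := by
  ext i
  fin_cases i <;> simp [params]

/-- Every primitive torus cover is linked to one that consists of two tori slit along a segment. -/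
theorem exists_linked_params {d : ℕ} (hS : S.IsH11) (hd : IsPrimitiveTorusCover S d)
    (c : Fin 8 × Fin 3) :
    ∃ β s, IsGood d β ∧ IsSlit β s ∧ Linked d S c (model (params β s)) (0, 0) := by
  have hA := hS.admissible
  have := hS.connected
  have hd' := hd
  obtain ⟨ha, L, π, hπ, hdeg⟩ := hd'
  obtain ⟨hL, k, hk⟩ := hπ.1
  obtain ⟨v₁, v₂, hv, rfl⟩ := hL.exists_basis
  have hk' := compatible_of_proj hk
  have hdeg' : HasDegree (torusMap hA hk') d := by
    convert hdeg
    ext x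
    obtain ⟨p, rfl⟩ := S.proj_surjective x
    exact (hk p).symm
  obtain ⟨c₁, c₂, hne, hc⟩ := hS.exists_corners
  set z := S.corner c₂
  set r := cross v₁ (S.vert c₂.1 c₂.2 + k c₂.1 - (S.vert c₁.1 c₁.2 + k c₁.1))
  set T : ℝ → GluedTriangles 8 := fun t => S.displace z (t * v₂) with hT
  have hv₁ : v₁ ≠ 0 := by rintro rfl; simp [cross_zero_left] at hv
  have hLv : ∀ l ∈ Submodule.span ℤ ({v₁, v₂} : Set ℂ), ∃ m : ℤ, cross v₁ l = m * cross v₁ v₂ := by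
    intro l hl
    obtain ⟨p, q, rfl⟩ := mem_span_two.1 hl
    exact ⟨q, by simp [cross]; ring⟩
  have hev : ∀ᶠ t : ℝ in 𝓝[>] 0, (T t).IsH11 ∧ ∃ x, ModelDomain x ∧ Equivalent (T t) c (model x) (0, 0) := by
    filter_upwards [(eventually_isH11_displace hS z v₂).filter_mono nhdsWithin_le_nhds,
      eventually_ne_int_mul hv r] with t h1 h2
    refine ⟨h1, ?_⟩
    have hg := isGraded_displace hA hL hk' hc hne v₁ (t * v₂) h1.admissible
    rw [cross_smul_right] at hg
    exact hg.exists_model h1 hv₁ hv hLv h2 c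
  obtain ⟨t₀, ht₀, hsub⟩ := mem_nhdsGT_iff_exists_Ioc_subset.1 hev
  have ht₀ : 0 < t₀ := ht₀
  -- The periods of the model generate a sublattice that also gives a torus cover of the displaced
  -- surface, hence of `S`. Primitivity of the original cover makes it equal to the full lattice.
  have hper : ∀ t ∈ Ioc 0 t₀, ∀ x, ModelDomain x → Equivalent (T t) c (model x) (0, 0) →
      ∃ h' : (T t).Admissible, periods x = Submodule.span ℤ {v₁, v₂} ∧
      cross (x 0) (x 2 + x 3) + cross (x 1) (x 2 + x 4) = 1 ∧
      ∃ N : ℕ, N * cross v₁ v₂ = 1 ∧ HasDegree (torusMap h' (compatible_displace.2 hk')) N := by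
    intro t ht x hx he
    have hTt := (hsub ht).1.admissible
    obtain ⟨h1, h2, h3⟩ := he.degree_and_periods hx hv ((area_displace hA).trans ha)
      (isTorusCover_torusMap hTt hL (compatible_displace.2 hk'))
    refine ⟨hTt, ?_, h2, h3⟩
    obtain ⟨f, -, -, -, -, h4, -⟩ := he
    have h5 := h4 _ _ (isTorusCover_torusMap (admissible_model hx) (isLattice_periods hx hL h1)
      (compatible_model le_rfl 0))
    obtain ⟨π₁, hπ₁⟩ := isTorusCover_of_displace hA h5
    exact IsPrimitiveCover.eq_of_le hπ hπ₁ h1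
  -- For a model the degree is area over covolume. The degree of the original cover is the same,
  -- since it is constant under small displacements.
  have hdκ : d * cross v₁ v₂ = 1 := by
    obtain ⟨-, x, hx, he⟩ := hsub ⟨ht₀, le_rfl⟩
    obtain ⟨-, -, -, N, hN, -⟩ := hper t₀ ⟨ht₀, le_rfl⟩ x hx he
    have : ∀ᶠ t : ℝ in 𝓝[>] 0, ∀ h' : (T t).Admissible,
        HasDegree (torusMap h' (compatible_displace.2 hk')) N := by
      filter_upwards [Ioc_mem_nhdsGT ht₀] with t ht h'
      obtain ⟨-, x, hx, he⟩ := hsub ht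
      obtain ⟨_, -, -, N', hN', h⟩ := hper t ht x hx he
      have : (N' : ℝ) = N := mul_right_cancel₀ hv.ne' (hN'.trans hN.symm)
      have : N' = N := by exact_mod_cast this
      exact this ▸ h
    rw [degree_eq_of_displace hA z v₂ hL hk' hdeg' (this.frequently.filter_mono nhdsWithin_le_nhds)]
    exact hN
  have hgood : ∀ t ∈ Ioc 0 t₀, ∃ β s, IsGood d β ∧ IsSlit β s ∧
      Equivalent (T t) c (model (params β s)) (0, 0) := by
    intro t ht
    obtain ⟨-, x, hx, he⟩ := hsub ht
    obtain ⟨_, hp, h1, -⟩ := hper t ht x hx he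
    refine ⟨![x 0, x 2 + x 3, x 1, x 2 + x 4], x 2, ⟨⟨v₁, v₂, hv, hdκ, hp⟩, h1⟩, ?_, by rwa [params_eq]⟩
    obtain ⟨h2, h3, h4, h5⟩ := hx
    refine ⟨h2, ?_, h4, ?_⟩
    · change cross (x 0) (x 2) < cross (x 0) (x 2 + x 3)
      rw [cross_add_right]; linarith
    · change cross (x 1) (x 2) < cross (x 1) (x 2 + x 4)
      rw [cross_add_right]; linarith
  have hT0 : T 0 = S := by
    rw [hT]; simpa using displace_zero S z
  -- The path of displacements lies in the space up to and including `t = 0`, where it is the given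
  -- surface; for `t > 0` the surfaces are isomorphic to good models.
  have hprim : ∀ t : Icc 0 t₀, (T t).IsH11 ∧ IsPrimitiveTorusCover (T t) d := by
    rintro ⟨t, h0, h1⟩
    rcases h0.eq_or_lt with rfl | h0
    · change (T 0).IsH11 ∧ IsPrimitiveTorusCover (T 0) d
      rw [hT0]; exact ⟨hS, hd⟩
    · obtain ⟨β, s, hβ, hs, he⟩ := hgood t ⟨h0, h1⟩
      exact ⟨(hsub ⟨h0, h1⟩).1, he.symm.isPrimitiveTorusCover (hβ.isPrimitiveTorusCover hs)⟩
  have hconn : PreconnectedSpace (Icc 0 t₀) := Subtype.preconnectedSpace isPreconnected_Icc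
  have hlink := Linked.of_continuous (F := fun t : Icc 0 t₀ => T t) (c := c) (fun t => (hprim t).1)
    (fun t => (hprim t).2) (continuous_gluedTriangles S.glue (fun _ => rfl) fun i k =>
      (continuous_vert_displace z v₂ i k).comp continuous_subtype_val)
    ⟨0, le_rfl, ht₀.le⟩ ⟨t₀, ht₀.le, le_rfl⟩
  obtain ⟨β, s, hβ, hs, he⟩ := hgood t₀ ⟨ht₀, le_rfl⟩
  refine ⟨β, s, hβ, hs, ?_⟩
  have h1 := hlink.trans (Linked.of_equivalent (hprim ⟨t₀, ht₀.le, le_rfl⟩).1 (isH11_model hs.modelDomain)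
    he (hprim ⟨t₀, ht₀.le, le_rfl⟩).2)
  simpa only [hT0] using h1

end GluedTriangles
end TranslationSurface

/-! ### Conclusion: the labelled space, and the image that forgets the labels. -/

namespace TranslationSurface
open GluedTriangles

theorem labelledPrimitiveCovers_nonempty {d : ℕ} (hd : 2 ≤ d) : (labelledPrimitiveCovers d).Nonempty := by
  have hd' : (0 : ℝ) < d := by exact_mod_cast (by omega : 0 < d)
  -- The basis `1`, `i / d` of a rectangular lattice yields a surface in normal form.
  have h : cross 1 (((1 / d : ℝ) : ℂ) * Complex.I) = 1 / d := by simp [cross]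
  have hs := isSlit_normalPeriods hd (h.symm ▸ one_div_pos.2 hd')
  exact ⟨_, (⟨_, isH11_model hs.modelDomain⟩, (0, 0)),
    (isGood_normalPeriods hd h).isPrimitiveTorusCover hs, rfl⟩

theorem isPreconnected_labelledPrimitiveCovers {d : ℕ} (hd : 2 ≤ d) :
    IsPreconnected (labelledPrimitiveCovers d) := by
  refine isPreconnected_of_forall_pair ?_
  rintro _ ⟨⟨⟨S, hS⟩, c⟩, h, rfl⟩ _ ⟨⟨⟨S', hS'⟩, c'⟩, h', rfl⟩
  obtain ⟨β, s, hβ, hs, hl⟩ := exists_linked_params hS h c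
  obtain ⟨β', s', hβ', hs', hl'⟩ := exists_linked_params hS' h' c'
  obtain ⟨_, _, T, hT, hc, h1, h2⟩ :=
    (hl.trans (linked_of_isGood hd hβ hs hβ' hs')).trans hl'.symm
  exact ⟨T, hT, h1, h2, hc⟩

/-- The map that forgets the labels of the zeros. -/
def forget : LabelledH11 → H11 :=
  Quotient.map Prod.fst fun _ _ ⟨f, h, _⟩ => ⟨f, h⟩

theorem continuous_forget : Continuous forget :=
  Continuous.quotient_map' continuous_fst _

theorem image_forget (d : ℕ) : forget '' labelledPrimitiveCovers d = primitiveCovers d := by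
  ext x
  constructor
  · rintro ⟨_, ⟨S, h, rfl⟩, rfl⟩
    exact ⟨S.1, h, rfl⟩
  · rintro ⟨S, h, rfl⟩
    exact ⟨_, ⟨(S, (0, 0)), h, rfl⟩, rfl⟩

end TranslationSurface

theorem theorem5 (d : ℕ) (hd : 2 ≤ d) :
    IsConnected (TranslationSurface.primitiveCovers d) ∧
      IsConnected (TranslationSurface.labelledPrimitiveCovers d) := by
  have h : IsConnected (TranslationSurface.labelledPrimitiveCovers d) :=
    ⟨TranslationSurface.labelledPrimitiveCovers_nonempty hd,
      TranslationSurface.isPreconnected_labelledPrimitiveCovers hd⟩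
  refine ⟨?_, h⟩
  rw [← TranslationSurface.image_forget]
  exact h.image _ TranslationSurface.continuous_forget.continuousOn
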